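/- Let $A\to M$ be a Lie algebroid over a smooth manifold: a smooth vector bundle with a smooth anchor $\rho:A\to TM$ and a Lie bracket on $\Gamma(A)$ such that $[\alpha,f\beta]=f[\alpha,\beta]+\rho(\alpha)(f)\beta$. Let $k\ge 1$. All exterior, symmetric and tensor products are of vector bundles over $M$, and products of sections of $\Lambda A\otimes STM$ are taken as $(a\otimes s)(b\otimes t)=(a\wedge b)\otimes st$. **The representation up to homotopy $\Lambda^k\mathrm{Ad}_\nabla$.** Let $\nabla$ be a smooth connection on the vector bundle $A$. Put $$\nabla^{bas}_\alpha\beta=\nabla_{\rho(\beta)}\alpha+[\alpha,\beta],\qquad \nabla^{bas}_\alpha X=\rho(\nabla_X\alpha)+[\rho(\alpha),X],$$ $$R^{bas}(\alpha,\beta)X=\nabla_X[\alpha,\beta]-[\nabla_X\alpha,\beta]-[\alpha,\nabla_X\beta]-\nabla_{\nabla^{bas}_\beta X}\alpha+\nabla_{\nabla^{bas}_\alpha X}\beta ,$$ and let $$\Omega(A;\Lambda^k\mathrm{Ad})^p=\bigoplus_{0\le i\le k,\ i\le p}\Omega^{p-i}(A;\Lambda^{k-i}A\otimes S^iTM).$$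 Write $\eta=(\eta^q)_q$ with $\eta^q$ the component that has $q$ arguments. The structure operator $D_\nabla$ is $$(D_\nabla\eta)^q=(-1)^q\,\partial\circ\eta^q+d_{\nabla^{bas}}\eta^{q-1}+R^{bas}\wedge\eta^{q-2}.$$ Here $\partial$ extends $\rho$ to $\partial(w_1\wedge\dots\wedge w_j\otimes u)=\sum_s(-1)^{j-s}\,w_1\wedge\dots\widehat{w_s}\dots\wedge w_j\otimes\rho(w_s)u$; $d_{\nabla^{bas}}$ is the Koszul differential of the connection on $\Lambda A\otimes STM$ induced by $\nabla^{bas}$ as a derivation; and $$(R^{bas}\wedge\eta)(\alpha_1,\dots,\alpha_{q})=\sum_{i<j}(-1)^{q}(-1)^{i+j-1}R^{bas}(\alpha_i,\alpha_j)\cdot\eta^{q-2}(\dots\widehat{\alpha_i}\dots\widehat{\alpha_j}\dots),$$ where a map $\kappa:TM\to A$ acts by $\kappa\cdot(a\otimes u_1\cdots u_i)=\sum_s a\wedge\kappa(u_s)\otimes u_1\cdots\widehat{u_s}\cdots u_i$. The cohomology of $(\Omega(A;\Lambda^k\mathrm{Ad})^\bullet,D_\nabla)$, which is a complex, realizes $H^\bullet(A;\Lambda^k\mathrm{Ad})$.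 If $\nabla'$ is another connection, the realizations are identified by the map $\Phi_{\nabla,\nabla'}=\exp(N_{\nabla-\nabla'})$ (the $k$-th exterior power of $\mathrm{Id}+\Phi_1$, $\Phi_1(\alpha)X=\nabla'_X\alpha-\nabla_X\alpha$), where for $\theta=\theta(\alpha):TM\to A$ $$(N_\theta c)^{q+1}(\alpha_0,\dots,\alpha_q)=\sum_{i=0}^{q}(-1)^{i+q+1}\,\theta(\alpha_i)\cdot c^{q}(\alpha_0,\dots,\widehat{\alpha_i},\dots,\alpha_q),\qquad (N_\theta c)^0=0 .$$ **The intrinsic complex.** $C^p(A;\Lambda^k\mathrm{Ad})$ is the space of strings $c=(c_0,c_1,\dots)$ of $\mathbb R$-multilinear antisymmetric maps $$c_i:\underbrace{\Gamma(A)\times\dots\times\Gamma(A)}_{p-i}\to\Gamma(\Lambda^{k-i}A\otimes S^iTM)\qquad(0\le i\le \min(k,p))$$ with, for all $f\in C^\infty(M)$, $$c_i(\alpha_1,\dots,f\alpha_{p-i})=f\,c_i(\alpha_1,\dots,\alpha_{p-i})+i(df)\bigl(c_{i+1}(\alpha_1,\dots,\alpha_{p-i-1})\wedge\alpha_{p-i}\bigr),$$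 where $i(df):S^{i+1}TM\to S^iTM$, $u_0\cdots u_i\mapsto\sum_s df(u_s)\,u_0\cdots\widehat{u_s}\cdots u_i$, and $c_{k+1}=0$. Its differential is $$(dc)_i(\alpha_1,\dots,\alpha_{q})=\sum_{a<b}(-1)^{a+b}c_i([\alpha_a,\alpha_b],\dots\widehat{\alpha_a}\dots\widehat{\alpha_b}\dots)+\sum_a(-1)^{a+1}L_{\alpha_a}\bigl(c_i(\dots\widehat{\alpha_a}\dots)\bigr)-(-1)^{q}\,\partial\bigl(c_{i-1}(\alpha_1,\dots,\alpha_q)\bigr),$$ where $q=p+1-i$, $c_{-1}=0$, and $L_\alpha$ is the derivation with $L_\alpha f=\rho(\alpha)(f)$, $L_\alpha\beta=[\alpha,\beta]$, $L_\alpha X=[\rho(\alpha),X]$. In particular $(dc)_0$ is given by the Koszul formula. **$k$-differentials.** An almost $k$-differential on $A$ is a pair of $\mathbb R$-linear maps $\delta:C^\infty(M)\to\Gamma(\Lambda^{k-1}A)$, $\delta:\Gamma(A)\to\Gamma(\Lambda^kA)$ with $\delta(fg)=\delta(f)g+f\delta(g)$ and $\delta(f\alpha)=\delta(f)\wedge\alpha+f\delta(\alpha)$.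 It is a $k$-differential if, for the Schouten bracket, $\delta[\alpha,\beta]=[\delta(\alpha),\beta]+[\alpha,\delta(\beta)]$ for all $\alpha,\beta\in\Gamma(A)$. **Proposition.** 1. $d$ maps $C^p(A;\Lambda^k\mathrm{Ad})$ to $C^{p+1}(A;\Lambda^k\mathrm{Ad})$ and $d^2=0$; the definition of $C^\bullet(A;\Lambda^k\mathrm{Ad})$ and $d$ uses no connection. 2. For every smooth connection $\nabla$ on $A$, $D_\nabla$ maps $\Omega(A;\Lambda^k\mathrm{Ad})^p$ to $\Omega(A;\Lambda^k\mathrm{Ad})^{p+1}$ and $D_\nabla^2=0$, and the map $\Psi_\nabla$, $(\Psi_\nabla c)^q=(-1)^{p+q}(\exp(N_\nabla)c)^q$ for $c\in C^p(A;\Lambda^k\mathrm{Ad})$, where $c^q=c_{p-q}$ and $\nabla$ stands for $\theta(\alpha)X=\nabla_X\alpha$, is an isomorphism of complexes $$(C^\bullet(A;\Lambda^k\mathrm{Ad}),d)\to(\Omega(A;\Lambda^k\mathrm{Ad})^\bullet,D_\nabla).$$ It therefore induces an isomorphism $H^p(C^\bullet(A;\Lambda^k\mathrm{Ad}),d)\cong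 H^p(A;\Lambda^k\mathrm{Ad})$ for every $p$. It is natural: for two smooth connections, $\Phi_{\nabla,\nabla'}$ is an isomorphism of complexes and $\Phi_{\nabla,\nabla'}\circ\Psi_\nabla=\Psi_{\nabla'}$. 3. The map $(c_0,c_1)\mapsto\delta$, $\delta(f)=i(df)(c_1)$, $\delta(\alpha)=c_0(\alpha)$, is a bijection from $C^1(A;\Lambda^k\mathrm{Ad})$ onto the almost $k$-differentials on $A$. If $\operatorname{rank}A\ne k-1$, it restricts to a bijection from the $1$-cocycles onto the $k$-differentials. In every rank, it restricts to a bijection from the $1$-cocycles onto the $k$-differentials that also satisfy $\delta(\rho(\alpha)(f))=[\delta(\alpha),f]+[\alpha,\delta(f)]$ for all $\alpha\in\Gamma(A)$, $f\in C^\infty(M)$, where $[\alpha,f]=\rho(\alpha)(f)$ and $[w_1\wedge\dots\wedge w_j,f]=\sum_s(-1)^{j-s}\rho(w_s)(f)\,w_1\wedge\dots\widehat{w_s}\dots\wedge w_j$. -/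

import Mathlib

open Bundle Manifold Topology
open scoped ContDiff TensorProduct

noncomputable section

namespace LieAlgebroidCohomology

/-! ## Fibrewise algebra of `Λ W ⊗ S U` -/

section Fibre

variable (W U : Type*) [AddCommGroup W] [Module ℝ W] [AddCommGroup U] [Module ℝ U]

/-- The algebra `Λ W ⊗ S U`. Its product is `(a ⊗ s) (b ⊗ t) = (a ∧ b) ⊗ (s t)`. For a graded vector
space with `W` in degree `0` and `U` in degree `1`, the `k`-th (graded) exterior power has
`Λ^(k-i) W ⊗ S^i U` as its part of degree `i`. -/
abbrev ExtSym : Type _ := ExteriorAlgebra ℝ W ⊗[ℝ] SymmetricAlgebra ℝ U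

/-- The summand `Λ^j W ⊗ S^i U` of `Λ W ⊗ S U`. -/
def bidegree (j i : ℕ) : Submodule ℝ (ExtSym W U) :=
  Submodule.map₂ (TensorProduct.mk ℝ (ExteriorAlgebra ℝ W) (SymmetricAlgebra ℝ U))
    (⋀[ℝ]^j W) (LinearMap.range (SymmetricAlgebra.ι ℝ U) ^ i)

variable {W U}

/-- The inclusion of `W` in `Λ W ⊗ S U`. -/
def inclExt : W →ₗ[ℝ] ExtSym W U :=
  (Algebra.TensorProduct.includeLeft (R := ℝ) (S := ℝ)
    (A := ExteriorAlgebra ℝ W) (B := SymmetricAlgebra ℝ U)).toLinearMap ∘ₗ ExteriorAlgebra.ι ℝ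

/-- The inclusion of `U` in `Λ W ⊗ S U`. -/
def inclSym : U →ₗ[ℝ] ExtSym W U :=
  (Algebra.TensorProduct.includeRight (R := ℝ)
    (A := ExteriorAlgebra ℝ W) (B := SymmetricAlgebra ℝ U)).toLinearMap ∘ₗ SymmetricAlgebra.ι ℝ U

/-- The projection of `S U` to its summand `S¹ U = U`. -/
def symProj : SymmetricAlgebra ℝ U →ₗ[ℝ] U := by
  letI : Module ℝᵐᵒᵖ U := Module.compHom _ ((RingHom.id ℝ).fromOpposite mul_comm)
  haveI : IsCentralScalar ℝ U := ⟨fun _ _ => rfl⟩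
  exact (TrivSqZeroExt.sndHom ℝ U).comp
    (SymmetricAlgebra.lift (TrivSqZeroExt.inrHom ℝ U)).toLinearMap

/-- The polarization `u₁ ⋯ uᵢ ↦ ∑ₛ (u₁ ⋯ ûₛ ⋯ uᵢ) ⊗ uₛ`, obtained from the coproduct
`u ↦ u ⊗ 1 + 1 ⊗ u` of `S U`. -/
def polarize : SymmetricAlgebra ℝ U →ₗ[ℝ] SymmetricAlgebra ℝ U ⊗[ℝ] U :=
  (LinearMap.lTensor (SymmetricAlgebra ℝ U) (symProj (U := U))).comp
    (SymmetricAlgebra.lift (A := SymmetricAlgebra ℝ U ⊗[ℝ] SymmetricAlgebra ℝ U)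
      ((Algebra.TensorProduct.includeLeft (R := ℝ) (S := ℝ)
          (A := SymmetricAlgebra ℝ U) (B := SymmetricAlgebra ℝ U)).toLinearMap ∘ₗ
            SymmetricAlgebra.ι ℝ U +
        (Algebra.TensorProduct.includeRight (R := ℝ)
          (A := SymmetricAlgebra ℝ U) (B := SymmetricAlgebra ℝ U)).toLinearMap ∘ₗ
            SymmetricAlgebra.ι ℝ U)).toLinearMap

/-- For `φ : U → ℝ`, the contraction
`a ⊗ u₁ ⋯ uᵢ ↦ ∑ₛ φ(uₛ) a ⊗ (u₁ ⋯ ûₛ ⋯ uᵢ)`. -/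
def contract (φ : U →ₗ[ℝ] ℝ) : ExtSym W U →ₗ[ℝ] ExtSym W U :=
  LinearMap.lTensor (ExteriorAlgebra ℝ W)
    ((TensorProduct.rid ℝ (SymmetricAlgebra ℝ U)).toLinearMap ∘ₗ
      LinearMap.lTensor (SymmetricAlgebra ℝ U) φ ∘ₗ polarize)

/-- For `κ : U → W`, the extension of `κ` as a graded derivation of degree `-1`:
`a ⊗ u₁ ⋯ uᵢ ↦ ∑ₛ (a ∧ κ(uₛ)) ⊗ (u₁ ⋯ ûₛ ⋯ uᵢ)`. -/
def slide (κ : U →ₗ[ℝ] W) : ExtSym W U →ₗ[ℝ] ExtSym W U :=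
  TensorProduct.lift
    ((LinearMap.mul ℝ (ExtSym W U)).compl₁₂
      (Algebra.TensorProduct.includeLeft (R := ℝ) (S := ℝ)
        (A := ExteriorAlgebra ℝ W) (B := SymmetricAlgebra ℝ U)).toLinearMap
      (TensorProduct.map (ExteriorAlgebra.ι ℝ ∘ₗ κ) LinearMap.id ∘ₗ
        (TensorProduct.comm ℝ (SymmetricAlgebra ℝ U) U).toLinearMap ∘ₗ polarize))

/-- The recursion step `(w, (a, t)) ↦ w ∧ t + (-1)^|a| a ⊗ r(w)` of `extBoundary`. -/
def extBoundaryStep (r : W →ₗ[ℝ] U) :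
    W →ₗ[ℝ] ExteriorAlgebra ℝ W × ExtSym W U →ₗ[ℝ] ExtSym W U :=
  LinearMap.lcomp ℝ (ExtSym W U) (LinearMap.snd ℝ (ExteriorAlgebra ℝ W) (ExtSym W U)) ∘ₗ
      LinearMap.mul ℝ (ExtSym W U) ∘ₗ inclExt +
    LinearMap.lcomp ℝ (ExtSym W U)
        ((CliffordAlgebra.involute (Q := (0 : QuadraticForm ℝ W))).toLinearMap ∘ₗ
          LinearMap.fst ℝ (ExteriorAlgebra ℝ W) (ExtSym W U)) ∘ₗ
      (TensorProduct.mk ℝ (ExteriorAlgebra ℝ W) (SymmetricAlgebra ℝ U)).flip ∘ₗ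
        SymmetricAlgebra.ι ℝ U ∘ₗ r

theorem extBoundaryStep_apply (r : W →ₗ[ℝ] U) (w : W)
    (p : ExteriorAlgebra ℝ W × ExtSym W U) :
    extBoundaryStep r w p = inclExt w * p.2 +
      (CliffordAlgebra.involute (Q := (0 : QuadraticForm ℝ W)) p.1) ⊗ₜ[ℝ]
        SymmetricAlgebra.ι ℝ U (r w) := rfl

theorem extBoundaryStep_self (r : W →ₗ[ℝ] U) (w : W) (a : ExteriorAlgebra ℝ W)
    (t : ExtSym W U) :
    extBoundaryStep r w (CliffordAlgebra.ι (0 : QuadraticForm ℝ W) w * a,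
      extBoundaryStep r w (a, t)) = (0 : QuadraticForm ℝ W) w • t := by
  have h : (inclExt w : ExtSym W U) * inclExt w = 0 := by
    simp [inclExt]
  simp only [extBoundaryStep_apply, mul_add, ← mul_assoc, h, map_mul,
    CliffordAlgebra.involute_ι]
  simp [inclExt, TensorProduct.neg_tmul]

/-- The map `Λ W → Λ W ⊗ U`, `w₁ ∧ ⋯ ∧ wⱼ ↦ ∑ₛ (-1)^(j-s) (w₁ ∧ ⋯ ŵₛ ⋯ ∧ wⱼ) ⊗ r(wₛ)`, defined by
the recursion `w ∧ a ↦ w ∧ extBoundary r a + (-1)^|a| a ⊗ r(w)`. -/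
def extBoundary (r : W →ₗ[ℝ] U) : ExteriorAlgebra ℝ W →ₗ[ℝ] ExtSym W U :=
  CliffordAlgebra.foldr' (0 : QuadraticForm ℝ W) (extBoundaryStep r) (extBoundaryStep_self r) 0

/-- For `r : W → U`, the extension of `r` as a graded derivation of degree `1`:
`w₁ ∧ ⋯ ∧ wⱼ ⊗ u ↦ ∑ₛ (-1)^(j-s) (w₁ ∧ ⋯ ŵₛ ⋯ ∧ wⱼ) ⊗ (r(wₛ) u)`, `u ∈ S U`. -/
def boundary (r : W →ₗ[ℝ] U) : ExtSym W U →ₗ[ℝ] ExtSym W U :=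
  TensorProduct.lift
    ((LinearMap.mul ℝ (ExtSym W U)).compl₁₂ (extBoundary r)
      (Algebra.TensorProduct.includeRight (R := ℝ)
        (A := ExteriorAlgebra ℝ W) (B := SymmetricAlgebra ℝ U)).toLinearMap)

end Fibre

/-! ## Cohomology -/

section Cohomology

variable {N : Type*} [AddCommGroup N] [Module ℝ N]

/-- The `p`-cocycles of a sequence `C` of spaces of cochains, for the differential `D`. -/
def cocycles (C : ℕ → Submodule ℝ N) (D : N →ₗ[ℝ] N) (p : ℕ) : Submodule ℝ N :=
  C p ⊓ LinearMap.ker D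

/-- The `p`-coboundaries of a sequence `C` of spaces of cochains, for the differential `D`. -/
def coboundaries (C : ℕ → Submodule ℝ N) (D : N →ₗ[ℝ] N) : ℕ → Submodule ℝ N
  | 0 => ⊥
  | p + 1 => (C p).map D

/-- The cohomology in degree `p` of a sequence `C` of spaces of cochains with differential `D`. -/
abbrev Cohomology (C : ℕ → Submodule ℝ N) (D : N →ₗ[ℝ] N) (p : ℕ) : Type _ :=
  ↥(cocycles C D p) ⧸ (coboundaries C D p).submoduleOf (cocycles C D p)

/-- The cohomology class of a cocycle. -/
def cohomologyClass (C : ℕ → Submodule ℝ N) (D : N →ₗ[ℝ] N) (p : ℕ) (c : N)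
    (hc : c ∈ cocycles C D p) : Cohomology C D p :=
  Submodule.Quotient.mk ⟨c, hc⟩

end Cohomology

/-! ## Lie algebroids -/

section Manifold

variable {E : Type*} [NormedAddCommGroup E] [NormedSpace ℝ E] [FiniteDimensional ℝ E]
  {M : Type*} [TopologicalSpace M] [ChartedSpace E M] [IsManifold 𝓘(ℝ, E) ∞ M]
  {F : Type*} [NormedAddCommGroup F] [NormedSpace ℝ F] [FiniteDimensional ℝ F]
  {V : M → Type*} [TopologicalSpace (TotalSpace F V)]
  [∀ x, AddCommGroup (V x)] [∀ x, Module ℝ (V x)] [∀ x, TopologicalSpace (V x)]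
  [∀ x, IsTopologicalAddGroup (V x)] [∀ x, ContinuousSMul ℝ (V x)]
  [FiberBundle F V] [VectorBundle ℝ F V] [ContMDiffVectorBundle ∞ F V 𝓘(ℝ, E)]

variable (E M) in
/-- The algebra `C^∞(M)`. -/
abbrev Func : Type _ := C^∞⟮𝓘(ℝ, E), M; 𝓘(ℝ), ℝ⟯

variable (E F V) in
/-- The space `Γ(A)` of smooth sections of the vector bundle `A` with fibres `V x`. -/
abbrev Sect : Type _ := Cₛ^∞⟮𝓘(ℝ, E); F, V⟯

variable (E M) in
/-- The space `Γ(TM)` of smooth vector fields. -/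
abbrev VecField : Type _ := Cₛ^∞⟮𝓘(ℝ, E); E, (TangentSpace 𝓘(ℝ, E) : M → Type _)⟯

/-- The differential of a smooth function at a point. -/
def dAt (f : Func E M) (x : M) : TangentSpace 𝓘(ℝ, E) x →ₗ[ℝ] ℝ :=
  (mvfderiv 𝓘(ℝ, E) f x).toLinearMap

/-- The product of a smooth function and a smooth section. -/
def fsmul (f : Func E M) (α : Sect E F V) : Sect E F V :=
  ⟨fun x => f x • α x, f.contMDiff.smul_section α.contMDiff⟩

/-- The Lie bracket of vector fields. -/
def vecBracket (X Y : VecField E M) : VecField E M :=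
  ⟨VectorField.mlieBracket 𝓘(ℝ, E) X Y, fun x => by
    have : IsManifold 𝓘(ℝ, E) (minSmoothness ℝ 2) M := by
      rw [minSmoothness_of_isRCLikeNormedField]
      exact IsManifold.of_le (n := ∞) 
        (WithTop.coe_le_coe.2 (le_top : (2 : ℕ∞) ≤ ⊤))
    have : IsManifold 𝓘(ℝ, E) (((⊤ : ℕ∞) : ℕ∞ω) + 1) M := by
      exact IsManifold.of_le (n := ∞) le_rfl
    exact ContMDiffAt.mlieBracket_vectorField (m := (⊤ : ℕ∞)) (n := (⊤ : ℕ∞))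
      (X.contMDiff x) (Y.contMDiff x) (by simp)⟩

/-- The derivative `X(f)` of a smooth function along a vector field. -/
def vecDeriv (X : VecField E M) (f : Func E M) : Func E M :=
  ⟨fun x => dAt f x (X x), by
    have h := (f.contMDiff.contMDiff_tangentMap (m := ∞) (by simp)).comp X.contMDiff
    intro x
    have h2 := (contMDiffAt_totalSpace.1 (h x)).2
    simp only [Function.comp_def] at h2
    simp at h2
    exact h2⟩

variable (E F V) in
/-- A Lie algebroid structure on the vector bundle with fibres `V x`: a smooth bundle map to `TM`
(the anchor) and a Lie bracket on the space of smooth sections that satisfies the Leibniz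
identity. -/
structure LieAlgebroid where
  anchor : ∀ x, V x →ₗ[ℝ] TangentSpace 𝓘(ℝ, E) x
  contMDiff_anchor : ContMDiff (𝓘(ℝ, E).prod 𝓘(ℝ, F)) 𝓘(ℝ, E).tangent ∞
    (fun v : TotalSpace F V => (⟨v.proj, anchor v.proj v.2⟩ : TangentBundle 𝓘(ℝ, E) M))
  bracket : Sect E F V →ₗ[ℝ] Sect E F V →ₗ[ℝ] Sect E F V
  bracket_self : ∀ α, bracket α α = 0
  jacobi : ∀ α β γ, bracket α (bracket β γ) + bracket β (bracket γ α) + bracket γ (bracket α β) = 0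
  leibniz : ∀ (f : Func E M) (α β : Sect E F V) (x : M),
    bracket α (fsmul f β) x = f x • bracket α β x + dAt f x (anchor x (α x)) • β x

namespace LieAlgebroid

variable (A : LieAlgebroid E F V)

/-- The vector field `ρ(α)`. -/
def rho (α : Sect E F V) : VecField E M :=
  ⟨fun x => A.anchor x (α x), A.contMDiff_anchor.comp α.contMDiff⟩

end LieAlgebroid

/-- The section `∇_X α`, for a smooth connection `∇` on `A`. -/
def cov (nabla : CovariantDerivative 𝓘(ℝ, E) F V)
    [h : CovariantDerivative.ContMDiffCovariantDerivative nabla ∞]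
    (X : VecField E M) (α : Sect E F V) : Sect E F V :=
  ⟨fun x => nabla α x (X x), by
    have h1 := (h.contMDiff.contMDiff (σ := α) α.contMDiff.contMDiffOn)
    rw [contMDiffOn_univ] at h1
    exact h1.clm_bundle_apply X.contMDiff⟩

/-! ## Sections of `Λ A ⊗ S TM` -/

variable (E V) in
/-- All (set-theoretic) sections of the bundle with fibres `Λ A_x ⊗ S T_x M`. -/
abbrev Tensor : Type _ := ∀ x : M, ExtSym (V x) (TangentSpace 𝓘(ℝ, E) x)

/-- A function, as a section of `Λ⁰ A ⊗ S⁰ TM`. -/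
def ofFunc (f : Func E M) : Tensor E V :=
  fun x => algebraMap ℝ (ExtSym (V x) (TangentSpace 𝓘(ℝ, E) x)) (f x)

/-- A section of `A`, as a section of `Λ¹ A ⊗ S⁰ TM`. -/
def ofSect (α : Sect E F V) : Tensor E V := fun x => inclExt (α x)

/-- A vector field, as a section of `Λ⁰ A ⊗ S¹ TM`. -/
def ofVec (X : VecField E M) : Tensor E V := fun x => inclSym (X x)

variable (E F V) in
/-- The finite sums of products of smooth functions, smooth sections of `A` and smooth vector
fields. -/
def polySections : Subalgebra ℝ (Tensor E V) :=
  Algebra.adjoin ℝ (Set.range (fun f : Func E M => (ofFunc f : Tensor E V)) ∪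
    Set.range (ofSect : Sect E F V → Tensor E V) ∪
    Set.range (ofVec : VecField E M → Tensor E V))

variable (E F V) in
/-- The smooth sections of `Λ A ⊗ S TM`: those which near every point are finite sums of products
of smooth functions, smooth sections of `A` and smooth vector fields (equivalently, in smooth local
frames of `A` and `TM`, polynomials in the frame with smooth coefficients). -/
def smoothSections : Subalgebra ℝ (Tensor E V) where
  carrier := {s | ∀ x, ∃ t ∈ polySections E F V, ∀ᶠ y in 𝓝 x, s y = t y}
  mul_mem' := by
    intro s t hs ht x
    obtain ⟨s', hs', hss⟩ := hs x
    obtain ⟨t', ht', htt⟩ := ht x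
    refine ⟨s' * t', mul_mem hs' ht', ?_⟩
    filter_upwards [hss, htt] with y h1 h2
    simp [h1, h2]
  add_mem' := by
    intro s t hs ht x
    obtain ⟨s', hs', hss⟩ := hs x
    obtain ⟨t', ht', htt⟩ := ht x
    refine ⟨s' + t', add_mem hs' ht', ?_⟩
    filter_upwards [hss, htt] with y h1 h2
    simp [h1, h2]
  algebraMap_mem' := fun r _ =>
    ⟨algebraMap ℝ _ r, Subalgebra.algebraMap_mem _ r, Filter.Eventually.of_forall fun _ => rfl⟩

/-- `D` is the extension, as a derivation of the algebra of smooth sections of `Λ A ⊗ S TM`, of an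
operator `δ` on functions, `DA` on sections of `A` and `DT` on vector fields. This determines `D` on
smooth sections; its values on non-smooth sections are irrelevant. -/
structure IsDerivationExtension (δ : Func E M → Func E M) (DA : Sect E F V → Sect E F V)
    (DT : VecField E M → VecField E M) (D : Tensor E V →ₗ[ℝ] Tensor E V) : Prop where
  mem : ∀ s ∈ smoothSections E F V, D s ∈ smoothSections E F V
  mul : ∀ s ∈ smoothSections E F V, ∀ t ∈ smoothSections E F V, D (s * t) = D s * t + s * D t
  func : ∀ f, D (ofFunc f) = ofFunc (δ f)
  sect : ∀ α, D (ofSect α) = ofSect (DA α)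
  vec : ∀ X, D (ofVec X) = ofVec (DT X)

open Classical in
/-- The extension of `(δ, DA, DT)` to a derivation of the smooth sections of `Λ A ⊗ S TM`. -/
def derivationExtension (δ : Func E M → Func E M) (DA : Sect E F V → Sect E F V)
    (DT : VecField E M → VecField E M) : Tensor E V →ₗ[ℝ] Tensor E V :=
  if h : ∃ D, IsDerivationExtension δ DA DT D then h.choose else 0

open Classical in
/-- The value at `x` of a `C^∞(M)`-linear map `κ : Γ(TM) → Γ(A)`: the linear map `T_x M → A_x` that
sends `X(x)` to `κ(X)(x)`, for all vector fields `X`. -/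
def tensorAt (κ : VecField E M → Sect E F V) (x : M) : TangentSpace 𝓘(ℝ, E) x →ₗ[ℝ] V x :=
  if h : ∃ φ : TangentSpace 𝓘(ℝ, E) x →ₗ[ℝ] V x, ∀ X : VecField E M, φ (X x) = κ X x then
    h.choose else 0

namespace LieAlgebroid

variable (A : LieAlgebroid E F V)

/-- The Lie derivative `L_α` on sections of `Λ A ⊗ S TM`: the derivation with
`L_α f = ρ(α)(f)`, `L_α β = [α, β]` and `L_α X = [ρ(α), X]`. -/
def lie (α : Sect E F V) : Tensor E V →ₗ[ℝ] Tensor E V :=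
  derivationExtension (fun f => vecDeriv (A.rho α) f) (fun β => A.bracket α β)
    (fun X => vecBracket (A.rho α) X)

/-- The graded derivation `∂` of sections of `Λ A ⊗ S TM` which extends the anchor. -/
def del : Tensor E V →ₗ[ℝ] Tensor E V :=
  LinearMap.pi fun x => (boundary (A.anchor x)).comp (LinearMap.proj x)

end LieAlgebroid

/-- The contraction `i(df) : Λ A ⊗ S^{i+1} TM → Λ A ⊗ S^i TM`. -/
def contractD (f : Func E M) : Tensor E V →ₗ[ℝ] Tensor E V :=
  LinearMap.pi fun x => (contract (dAt f x)).comp (LinearMap.proj x)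

/-! ## Cochains -/

variable (E F V) in
/-- Families `c = (c^q)_q` of maps `c^q : Γ(A)^q → {sections of Λ A ⊗ S TM}`. A string
`(c₀, c₁, …)` of degree `p`, with `cᵢ` a function of `p - i` arguments, is encoded by `c^q = c_(p-q)`
for `q ≤ p`, and `c^q = 0` for `q > p`. -/
abbrev Cochain : Type _ := ∀ q : ℕ, (Fin q → Sect E F V) → Tensor E V

variable (E F V) in
/-- The families with `c^q : Γ(A)^q → Γ(Λ^(k-i) A ⊗ S^i TM)` multilinear over `ℝ` and antisymmetric
for `q + i = p`, `0 ≤ i ≤ k`, and `c^q = 0` for the other `q`. -/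
def strings (k p : ℕ) : Submodule ℝ (Cochain E F V) where
  carrier := {c | ∀ q,
    (∃ g : AlternatingMap ℝ (Sect E F V) (Tensor E V) (Fin q), ⇑g = c q) ∧
    (∀ v, c q v ∈ smoothSections E F V) ∧
    (∀ v x, c q v x ∈ ⨆ (i : ℕ) (j : ℕ) (_ : q + i = p) (_ : j + i = k),
      bidegree (V x) (TangentSpace 𝓘(ℝ, E) x) j i)}
  add_mem' := by
    rintro a b ha hb q
    obtain ⟨⟨g, hg⟩, h1, h2⟩ := ha q
    obtain ⟨⟨g', hg'⟩, h1', h2'⟩ := hb q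
    exact ⟨⟨g + g', by ext; simp [← hg, ← hg']⟩, fun v => add_mem (h1 v) (h1' v),
      fun v x => add_mem (h2 v x) (h2' v x)⟩
  zero_mem' := fun q => ⟨⟨0, rfl⟩, fun _ => zero_mem _, fun _ _ => zero_mem _⟩
  smul_mem' := by
    rintro r a ha q
    obtain ⟨⟨g, hg⟩, h1, h2⟩ := ha q
    exact ⟨⟨r • g, by ext; simp [← hg]⟩, fun v => Subalgebra.smul_mem _ (h1 v) r,
      fun v x => Submodule.smul_mem _ r (h2 v x)⟩

variable (E F V) in
/-- The space `Ω(A; Λ^k Ad)^p = ⨁ᵢ Ω^(p-i)(A; Λ^(k-i) A ⊗ S^i TM)` of forms: strings of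
`C^∞(M)`-multilinear maps. -/
def forms (k p : ℕ) : Submodule ℝ (Cochain E F V) where
  carrier := {c | c ∈ strings E F V k p ∧ ∀ q (v : Fin q → Sect E F V) (f : Func E M)
    (α : Sect E F V), c (q + 1) (Fin.snoc v (fsmul f α)) = ofFunc f * c (q + 1) (Fin.snoc v α)}
  add_mem' := by
    rintro a b ⟨ha, ha'⟩ ⟨hb, hb'⟩
    exact ⟨add_mem ha hb, fun q v f α => by simp [ha', hb', mul_add]⟩
  zero_mem' := ⟨zero_mem _, fun q v f α => by simp⟩
  smul_mem' := by
    rintro r a ⟨ha, ha'⟩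
    exact ⟨Submodule.smul_mem _ r ha, fun q v f α => by
      simp only [Pi.smul_apply, ha', mul_smul_comm]⟩

variable (E F V) in
/-- The space `C^p(A; Λ^k Ad)`: strings `(c₀, c₁, …)` with
`cᵢ(α₁, …, f α) = f cᵢ(α₁, …, α) + i(df)(c_{i+1}(α₁, …) ∧ α)`. -/
def intrinsic (k p : ℕ) : Submodule ℝ (Cochain E F V) where
  carrier := {c | c ∈ strings E F V k p ∧ ∀ q (v : Fin q → Sect E F V) (f : Func E M)
    (α : Sect E F V), c (q + 1) (Fin.snoc v (fsmul f α)) =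
      ofFunc f * c (q + 1) (Fin.snoc v α) + contractD f (c q v * ofSect α)}
  add_mem' := by
    rintro a b ⟨ha, ha'⟩ ⟨hb, hb'⟩
    exact ⟨add_mem ha hb, fun q v f α => by simp [ha', hb', mul_add, add_mul]; abel⟩
  zero_mem' := ⟨zero_mem _, fun q v f α => by simp⟩
  smul_mem' := by
    rintro r a ⟨ha, ha'⟩
    exact ⟨Submodule.smul_mem _ r ha, fun q v f α => by
      simp only [Pi.smul_apply, ha', mul_smul_comm, smul_mul_assoc, map_smul, smul_add]⟩

/-- The evaluation `c ↦ c^q(v)`. -/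
def evalAt (q : ℕ) (v : Fin q → Sect E F V) : Cochain E F V →ₗ[ℝ] Tensor E V :=
  LinearMap.proj v ∘ₗ LinearMap.proj q

/-- `v₀, …, v_{q+1}` with the entries number `i < j` omitted. -/
def omitTwo {q : ℕ} (v : Fin (q + 2) → Sect E F V) (j : Fin (q + 2)) (i : Fin (q + 1)) :
    Fin q → Sect E F V :=
  fun l => v (j.succAbove (i.succAbove l))

namespace LieAlgebroid

variable (A : LieAlgebroid E F V)

/-- The terms `∑_{i<j} (-1)^(i+j) c([vᵢ, vⱼ], v₀, …, v̂ᵢ, …, v̂ⱼ, …)` of the Koszul formula. -/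
def bracketTerms : ∀ q : ℕ, (Fin q → Sect E F V) → (Cochain E F V →ₗ[ℝ] Tensor E V)
  | 0, _ => 0
  | 1, _ => 0
  | q + 2, v => ∑ j : Fin (q + 2), ∑ i : Fin (q + 1),
      if i.castSucc < j then
        (-1 : ℝ) ^ ((i : ℕ) + (j : ℕ)) •
          evalAt (q + 1) (Fin.cons (A.bracket (v i.castSucc) (v j)) (omitTwo v j i))
      else 0

/-- The terms `∑ᵢ (-1)^i act(vᵢ)(c(v₀, …, v̂ᵢ, …))` of the Koszul formula. -/
def actionTerms (act : Sect E F V → Tensor E V →ₗ[ℝ] Tensor E V) :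
    ∀ q : ℕ, (Fin q → Sect E F V) → (Cochain E F V →ₗ[ℝ] Tensor E V)
  | 0, _ => 0
  | q + 1, v => ∑ i : Fin (q + 1),
      (-1 : ℝ) ^ (i : ℕ) • (act (v i) ∘ₗ evalAt q (i.removeNth v))

/-- The Koszul formula, for an operation `act` of `Γ(A)` on the coefficients. -/
def koszul (act : Sect E F V → Tensor E V →ₗ[ℝ] Tensor E V) :
    Cochain E F V →ₗ[ℝ] Cochain E F V :=
  LinearMap.pi fun q => LinearMap.pi fun v => A.bracketTerms q v + actionTerms act q v

/-- The operator `c^q ↦ (-1)^q ∂ ∘ c^q`. -/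
def delTerm : Cochain E F V →ₗ[ℝ] Cochain E F V :=
  LinearMap.pi fun q => LinearMap.pi fun v => (-1 : ℝ) ^ q • (A.del ∘ₗ evalAt q v)

/-- The differential of the intrinsic complex. On the leading term of a string it is the Koszul
formula with the Lie derivative; the term with `∂` makes the tail of `d c` satisfy the tail
relations whenever `c` does. -/
def d : Cochain E F V →ₗ[ℝ] Cochain E F V := A.koszul A.lie - A.delTerm

section Connection

variable (nabla : CovariantDerivative 𝓘(ℝ, E) F V) [CovariantDerivative.ContMDiffCovariantDerivative nabla ∞]

/-- The basic connection on `A`: `∇^bas_α β = ∇_{ρ(β)} α + [α, β]`. -/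
def basA (α β : Sect E F V) : Sect E F V := cov nabla (A.rho β) α + A.bracket α β

/-- The basic connection on `TM`: `∇^bas_α X = ρ(∇_X α) + [ρ(α), X]`. -/
def basT (α : Sect E F V) (X : VecField E M) : VecField E M :=
  A.rho (cov nabla X α) + vecBracket (A.rho α) X

/-- The basic curvature `R^bas(α, β)(X)`. -/
def basCurvature (α β : Sect E F V) (X : VecField E M) : Sect E F V :=
  cov nabla X (A.bracket α β) - A.bracket (cov nabla X α) β - A.bracket α (cov nabla X β) -
    cov nabla (A.basT nabla β X) α + cov nabla (A.basT nabla α X) β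

/-- The connection on sections of `Λ A ⊗ S TM` induced by the basic connections. -/
def bas (α : Sect E F V) : Tensor E V →ₗ[ℝ] Tensor E V :=
  derivationExtension (fun f => vecDeriv (A.rho α) f) (A.basA nabla α) (A.basT nabla α)

/-- The graded derivation of sections of `Λ A ⊗ S TM` which extends
`R^bas(α, β) : TM → A`. -/
def curvatureExt (α β : Sect E F V) : Tensor E V →ₗ[ℝ] Tensor E V :=
  LinearMap.pi fun x =>
    (slide (tensorAt (A.basCurvature nabla α β) x)).comp (LinearMap.proj x)

/-- The wedge product with the basic curvature, an `End`-valued `2`-form of total degree `1`: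
`(R ∧ c)(v) = ∑_{i<j} (-1)^q (-1)^(i+j-1) R(vᵢ, vⱼ)(c^q(v₀, …, v̂ᵢ, …, v̂ⱼ, …))`. -/
def curvatureTerms : ∀ q : ℕ, (Fin q → Sect E F V) → (Cochain E F V →ₗ[ℝ] Tensor E V)
  | 0, _ => 0
  | 1, _ => 0
  | q + 2, v => ∑ j : Fin (q + 2), ∑ i : Fin (q + 1),
      if i.castSucc < j then
        (-1 : ℝ) ^ (q + (i : ℕ) + (j : ℕ) + 1) •
          (A.curvatureExt nabla (v i.castSucc) (v j) ∘ₗ evalAt q (omitTwo v j i))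
      else 0

/-- The structure operator `D_∇ = ∂ + d_{∇^bas} + R^bas` of the representation up to homotopy
`Λ^k (Ad_∇)`, for all `k` at once. -/
def structureOp : Cochain E F V →ₗ[ℝ] Cochain E F V :=
  A.delTerm + A.koszul (A.bas nabla) +
    LinearMap.pi fun q => LinearMap.pi fun v => A.curvatureTerms nabla q v

end Connection

end LieAlgebroid

/-! ## The comparison of intrinsic cochains and forms -/

/-- For `θ(α)_x : T_x M → A_x`, the operator
`(N_θ c)(v₀, …, v_q) = ∑ᵢ (-1)^(i+q+1) θ(vᵢ)(c^q(v₀, …, v̂ᵢ, …, v_q))`, where `θ(vᵢ)` acts as a graded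
derivation of `Λ A ⊗ S TM`; and `(N_θ c)^0 = 0`. -/
def insertion (θ : Sect E F V → ∀ x : M, TangentSpace 𝓘(ℝ, E) x →ₗ[ℝ] V x) :
    Cochain E F V →ₗ[ℝ] Cochain E F V :=
  LinearMap.pi fun q => LinearMap.pi fun v =>
    match q, v with
    | 0, _ => 0
    | q + 1, v => ∑ i : Fin (q + 1), (-1 : ℝ) ^ ((i : ℕ) + q + 1) •
        ((LinearMap.pi fun x => (slide (θ (v i) x)).comp (LinearMap.proj x)) ∘ₗ
          evalAt q (i.removeNth v))

/-- The exponential of `N_θ`: `(exp(N_θ) c)^q = ∑_{r ≤ q} (1/r!) (N_θ^r c)^q`. The terms with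
`r > q` vanish. -/
def expInsertion (θ : Sect E F V → ∀ x : M, TangentSpace 𝓘(ℝ, E) x →ₗ[ℝ] V x) :
    Cochain E F V →ₗ[ℝ] Cochain E F V :=
  LinearMap.pi fun q => ∑ r ∈ Finset.range (q + 1),
    ((r.factorial : ℝ)⁻¹) • (LinearMap.proj q ∘ₗ (insertion θ) ^ r)

/-- The map `Ψ_∇` from intrinsic `p`-cochains to forms of total degree `p` given by a connection,
`(Ψ_∇ c)^q = (-1)^(p+q) (exp(N_∇) c)^q`. For `k = 1` it is the splitting
`(c₀, c₁) ↦ (c₀ + (-1)^p ∑ᵢ (-1)^i ∇_{c₁(…, v̂ᵢ, …)} vᵢ, -c₁)` with `i` counted from `0`. -/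
def comparison (nabla : CovariantDerivative 𝓘(ℝ, E) F V) (p : ℕ) :
    Cochain E F V →ₗ[ℝ] Cochain E F V :=
  LinearMap.pi fun q => (-1 : ℝ) ^ (p + q) •
    (LinearMap.proj q ∘ₗ expInsertion fun α x => (nabla α x).toLinearMap)

/-- The map of forms induced by the isomorphism of representations up to homotopy
`Λ^k Ad_∇ → Λ^k Ad_∇'`, which is the exterior power of `Id + Φ₁`, `Φ₁(α)(X) = ∇'_X α - ∇_X α`. -/
def transition (nabla nabla' : CovariantDerivative 𝓘(ℝ, E) F V) :
    Cochain E F V →ₗ[ℝ] Cochain E F V :=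
  expInsertion fun α x => (nabla α x - nabla' α x).toLinearMap

/-! ## `k`-differentials -/

variable (E F V) in
/-- The space `Γ(Λ^j A)`. -/
def multisections (j : ℕ) : Submodule ℝ (Tensor E V) where
  carrier := {s | s ∈ smoothSections E F V ∧
    ∀ x, s x ∈ bidegree (V x) (TangentSpace 𝓘(ℝ, E) x) j 0}
  add_mem' := fun ⟨h, h'⟩ ⟨g, g'⟩ => ⟨add_mem h g, fun x => add_mem (h' x) (g' x)⟩
  zero_mem' := ⟨zero_mem _, fun _ => zero_mem _⟩
  smul_mem' := fun r _ ⟨h, h'⟩ =>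
    ⟨Subalgebra.smul_mem _ h r, fun x => Submodule.smul_mem _ r (h' x)⟩

/-- An almost `k`-differential on `A`: linear maps `δ : C^∞(M) → Γ(Λ^(k-1) A)` and
`δ : Γ(A) → Γ(Λ^k A)` with `δ(f g) = δ(f) g + f δ(g)` and `δ(f α) = δ(f) ∧ α + f δ(α)`
(for `k ≥ 1`). -/
structure IsAlmostKDifferential (k : ℕ)
    (δ : (Func E M → Tensor E V) × (Sect E F V → Tensor E V)) : Prop where
  linear_func : IsLinearMap ℝ δ.1
  linear_sect : IsLinearMap ℝ δ.2
  mem_func : ∀ f, δ.1 f ∈ multisections E F V (k - 1)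
  mem_sect : ∀ α, δ.2 α ∈ multisections E F V k
  func_mul : ∀ f g : Func E M, δ.1 (f * g) = δ.1 f * ofFunc g + ofFunc f * δ.1 g
  sect_mul : ∀ (f : Func E M) (α : Sect E F V),
    δ.2 (fsmul f α) = δ.1 f * ofSect α + ofFunc f * δ.2 α

namespace LieAlgebroid

variable (A : LieAlgebroid E F V)

/-- A `k`-differential on `A`: an almost `k`-differential with
`δ[α, β] = [δ(α), β] + [α, δ(β)]`. Here `[α, P] = L_α P = -[P, α]` is the Schouten bracket of a
section `α` of `A` with a section `P` of `Λ A`. -/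
structure IsKDifferential (k : ℕ)
    (δ : (Func E M → Tensor E V) × (Sect E F V → Tensor E V)) : Prop
    extends IsAlmostKDifferential k δ where
  bracket : ∀ α β : Sect E F V,
    δ.2 (A.bracket α β) = -A.lie β (δ.2 α) + A.lie α (δ.2 β)

/-- The identity `δ[α, f] = [δ(α), f] + [α, δ(f)]`. Here `[α, f] = ρ(α)(f)`, and
`[w₁ ∧ ⋯ ∧ wⱼ, f] = ∑ₛ (-1)^(j-s) ρ(wₛ)(f) w₁ ∧ ⋯ ŵₛ ⋯ ∧ wⱼ` is the Schouten bracket of a section of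
`Λ^j A` with a function. -/
def FunctionBracketIdentity
    (δ : (Func E M → Tensor E V) × (Sect E F V → Tensor E V)) : Prop :=
  ∀ (α : Sect E F V) (f : Func E M),
    δ.1 (vecDeriv (A.rho α) f) = contractD f (A.del (δ.2 α)) + A.lie α (δ.1 f)

end LieAlgebroid

/-- The pair of maps given by a string `(c₀, c₁)` of degree `1`: `δ(f) = i(df) c₁` on functions and
`δ(α) = c₀(α)` on sections. -/
def toPair (c : Cochain E F V) : (Func E M → Tensor E V) × (Sect E F V → Tensor E V) :=
  (fun f => contractD f (c 0 ![]), fun α => c 1 ![α])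

end Manifold

end LieAlgebroidCohomology

end

/-! The smooth sections of `Λ A ⊗ S TM` form an algebra `Smooth`, generated near each point by
functions, sections of `A` and vector fields. All operators involved are derivations of it: `L_α`,
`∇^bas_α` and `i(df)` are even; `∂` and the slides, which extend maps `TM → A` such as `∇α`, `df ⊗
α` and `R^bas(α, β)`, are odd. (Anti)commutators of derivations are derivations, and a derivation is
determined by its values on generators (`Smooth.twistedDer_ext`). Hence every operator identity
needed reduces to the algebroid axioms on functions, sections and vector fields. That `L_α` and
`∇^bas_α` exist at all as operators is `exists_derivationExtension`, proved in local frames.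

Intrinsic complex. `d² = 0` follows formally from the Cartan relations `isCartan`. Tail relations
survive because `L_{fα} = f L_α - (K ∂ + ∂ K)`, where `K` is the slide of `df ⊗ α` (`isLeibniz`):
the defect of linearity of `L` is absorbed by the `∂` term of `d`. Identities between sums over
argument positions are proved by induction on the number of arguments, inserting one argument at a
time (`eq_zero_of_ins`).

Comparison. The rule `∇(fα) = f ∇α + df ⊗ α` has the same shape as a tail relation, so `exp(N_∇)`
turns tailed cochains into `C^∞(M)`-linear ones and `exp(-N_∇)` turns them back. To conjugate `d`,
put `θ(α) = ∇α` and `κ(α) = θ(α) ∂ + ∂ θ(α)`. Then `[N, d] = Y` contains `κ` and a two-form `ω₁`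
linear in `∇`; `[N, Y] = Z` is a two-form `ω₂` quadratic in `∇`; and `[N, Z] = 0` because slides
anticommute. Therefore `exp(N) d = (d + Y + Z/2) exp(N)` (`expC_conj`). Since `L + κ = ∇^bas`
(`basS_eq`) and `ω₁ + ω₂/2 = R^bas` (`isSlide_curvS`), the right side is `D_∇` up to the signs in
`Ψ_∇`. The facts that `D_∇` preserves forms, that `D_∇² = 0` and that the change of connection is a
chain map are then transported from the intrinsic complex. Exponents add, because the operators `N`
commute.

Degree one. By Hadamard's lemma a derivation `C^∞(M) → Γ(Λ^(k-1) A)` depends on differentials only,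
so it is the contraction with a unique section `c₁` of `Λ^(k-1) A ⊗ TM`. For a string `c` of degree
one, `d c` has three components. The one with two arguments vanishes exactly if `δ` is a derivation
of the bracket, the one with one argument exactly if `δ` satisfies the identity on functions. If a
component of `d c` vanishes, the tail relation gives `i(df)(ω) ∧ α = 0` for the next one, `ω`; as
only top forms are killed by all wedge products, `ω = 0` unless its exterior degree is the rank.
This yields the exception `rank A = k - 1`. For the component without arguments the exception would
be rank `k - 2`, but there `Λ^(k-1) A = 0`, so `c₁ = 0` already. -/

set_option linter.unusedSectionVars false

noncomputable section

namespace LieAlgebroidCohomology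

/-! ### The fibrewise operators as twisted derivations of `Λ W ⊗ S U`. -/

section Fibre

variable {W U : Type*} [AddCommGroup W] [Module ℝ W] [AddCommGroup U] [Module ℝ U]

theorem inclExt_apply (w : W) : (inclExt w : ExtSym W U) = ExteriorAlgebra.ι ℝ w ⊗ₜ 1 := rfl

theorem inclSym_apply (u : U) : (inclSym u : ExtSym W U) = 1 ⊗ₜ SymmetricAlgebra.ι ℝ U u := rfl

theorem inclExt_mul_self (w : W) : (inclExt w : ExtSym W U) * inclExt w = 0 := by
  simp [inclExt_apply]

theorem inclExt_anticomm (w w' : W) :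
    (inclExt w : ExtSym W U) * inclExt w' = -(inclExt w' * inclExt w) := by
  have h := inclExt_mul_self (U := U) (w + w')
  rw [map_add, mul_add, add_mul, add_mul, inclExt_mul_self, inclExt_mul_self, zero_add,
    add_zero] at h
  exact eq_neg_of_add_eq_zero_right h

/-- The parity automorphism of `Λ W ⊗ S U`, which is `-1` on `W` and `1` on `U`. -/
def parity : ExtSym W U →ₐ[ℝ] ExtSym W U :=
  Algebra.TensorProduct.map (CliffordAlgebra.involute (Q := (0 : QuadraticForm ℝ W)))
    (AlgHom.id ℝ (SymmetricAlgebra ℝ U))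

theorem parity_tmul (a : ExteriorAlgebra ℝ W) (s : SymmetricAlgebra ℝ U) :
    parity (a ⊗ₜ[ℝ] s) = (CliffordAlgebra.involute (Q := (0 : QuadraticForm ℝ W)) a) ⊗ₜ s := rfl

@[simp]
theorem parity_inclExt (w : W) : parity (inclExt w : ExtSym W U) = -inclExt w := by
  rw [inclExt_apply, parity_tmul]
  erw [CliffordAlgebra.involute_ι]
  rw [TensorProduct.neg_tmul]

@[simp]
theorem parity_inclSym (u : U) : parity (inclSym u : ExtSym W U) = inclSym u := by
  rw [inclSym_apply, parity_tmul, map_one]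

theorem ExtSym.induction {C : ExtSym W U → Prop} (hr : ∀ r, C (algebraMap ℝ _ r))
    (hw : ∀ w, C (inclExt w)) (hu : ∀ u, C (inclSym u)) (hmul : ∀ a b, C a → C b → C (a * b))
    (hadd : ∀ a b, C a → C b → C (a + b)) (x : ExtSym W U) : C x := by
  have h0 : C 0 := by simpa using hr 0
  induction x using TensorProduct.induction_on with
  | zero => exact h0
  | add a b ha hb => exact hadd a b ha hb
  | tmul a s =>
    rw [show a ⊗ₜ[ℝ] s = (a ⊗ₜ[ℝ] (1 : SymmetricAlgebra ℝ U)) * (1 ⊗ₜ s) by simp]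
    apply hmul
    · induction a using ExteriorAlgebra.induction with
      | algebraMap r => exact hr r
      | ι w => exact hw w
      | mul a b ha hb => simpa using hmul _ _ ha hb
      | add a b ha hb => simpa [TensorProduct.add_tmul] using hadd _ _ ha hb
    · induction s using SymmetricAlgebra.induction with
      | algebraMap r =>
        have : (1 : ExteriorAlgebra ℝ W) ⊗ₜ[ℝ] algebraMap ℝ (SymmetricAlgebra ℝ U) r =
            algebraMap ℝ _ r := by
          simp [Algebra.algebraMap_eq_smul_one, Algebra.TensorProduct.one_def]
        rw [this]; exact hr r
      | ι u => exact hu u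
      | mul a b ha hb => simpa using hmul _ _ ha hb
      | add a b ha hb => simpa [TensorProduct.tmul_add] using hadd _ _ ha hb

theorem ExtSym.algHom_ext {C : Type*} [Semiring C] [Algebra ℝ C] {f g : ExtSym W U →ₐ[ℝ] C}
    (hw : ∀ w, f (inclExt w) = g (inclExt w)) (hu : ∀ u, f (inclSym u) = g (inclSym u)) :
    f = g := by
  ext x
  · exact hw x
  · exact hu x

theorem parity_parity (x : ExtSym W U) : parity (parity x) = x := by
  have : (parity (W := W) (U := U)).comp parity = AlgHom.id ℝ _ :=
    ExtSym.algHom_ext (by simp) (by simp)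
  exact DFunLike.congr_fun this x

/-- `Q (s t) = s Q(t) + Q(s) τ(t)`. -/
def IsTwistedDer {B : Type*} [Ring B] [Algebra ℝ B] (τ : B → B) (Q : B →ₗ[ℝ] B) : Prop :=
  ∀ s t, Q (s * t) = s * Q t + Q s * τ t

theorem IsTwistedDer.map_one {B : Type*} [Ring B] [Algebra ℝ B] {τ : B → B} {Q : B →ₗ[ℝ] B}
    (h : IsTwistedDer τ Q) (hτ : τ 1 = 1) : Q 1 = 0 := by
  simpa [hτ] using h 1 1

theorem IsTwistedDer.sub {B : Type*} [Ring B] [Algebra ℝ B] {τ : B → B} {Q Q' : B →ₗ[ℝ] B}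
    (h : IsTwistedDer τ Q) (h' : IsTwistedDer τ Q') : IsTwistedDer τ (Q - Q') := fun s t => by
  simp only [LinearMap.sub_apply, h s t, h' s t, mul_sub, sub_mul]; abel

theorem IsTwistedDer.add {B : Type*} [Ring B] [Algebra ℝ B] {τ : B → B} {Q Q' : B →ₗ[ℝ] B}
    (h : IsTwistedDer τ Q) (h' : IsTwistedDer τ Q') : IsTwistedDer τ (Q + Q') := fun s t => by
  simp only [LinearMap.add_apply, h s t, h' s t, mul_add, add_mul]; abel

/-- The kernel is closed under products and contains the scalars, the latter because `τ 1 = 1`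
forces `Q 1 = 0`. -/
theorem IsTwistedDer.eq_zero {τ : ExtSym W U → ExtSym W U} {Q : ExtSym W U →ₗ[ℝ] ExtSym W U}
    (h : IsTwistedDer τ Q) (hτ : τ 1 = 1) (hw : ∀ w, Q (inclExt w) = 0)
    (hu : ∀ u, Q (inclSym u) = 0) (x : ExtSym W U) : Q x = 0 := by
  induction x using ExtSym.induction with
  | hr r => rw [Algebra.algebraMap_eq_smul_one, map_smul, h.map_one hτ, smul_zero]
  | hw w => exact hw w
  | hu u => exact hu u
  | hmul a b ha hb => rw [h, ha, hb, mul_zero, zero_mul, add_zero]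
  | hadd a b ha hb => rw [map_add, ha, hb, add_zero]

theorem IsTwistedDer.ext {τ : ExtSym W U → ExtSym W U} {Q Q' : ExtSym W U →ₗ[ℝ] ExtSym W U}
    (h : IsTwistedDer τ Q) (h' : IsTwistedDer τ Q') (hτ : τ 1 = 1)
    (hw : ∀ w, Q (inclExt w) = Q' (inclExt w))
    (hu : ∀ u, Q (inclSym u) = Q' (inclSym u)) (x : ExtSym W U) : Q x = Q' x :=
  sub_eq_zero.1 ((h.sub h').eq_zero hτ (fun w => sub_eq_zero.2 (hw w))
    (fun u => sub_eq_zero.2 (hu u)) x)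

/-- The anticommutator of odd derivations is even: the mixed terms cancel because both operators
anticommute with the parity `p`. -/
theorem IsTwistedDer.comp_add {B : Type*} [Ring B] [Algebra ℝ B] {p : B →ₐ[ℝ] B}
    (hp : ∀ x, p (p x) = x) {Q Q' : B →ₗ[ℝ] B} (h : IsTwistedDer p Q) (h' : IsTwistedDer p Q')
    (hQ : ∀ x, p (Q x) = -Q (p x)) (hQ' : ∀ x, p (Q' x) = -Q' (p x)) :
    IsTwistedDer id (Q ∘ₗ Q' + Q' ∘ₗ Q) := fun s t => by
  simp only [LinearMap.add_apply, LinearMap.comp_apply, h s t, h' s t, map_add, h _ _, h' _ _,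
    hQ, hQ', hp, id]
  noncomm_ring

/-! ### Polarization -/

/-- Read off from the product of a square-zero extension, whose scalar part is the augmentation of
`S U`. -/
theorem symProj_mul (s t : SymmetricAlgebra ℝ U) :
    symProj (s * t) = SymmetricAlgebra.algebraMapInv s • symProj t +
      SymmetricAlgebra.algebraMapInv t • symProj s := by
  -- These are the instances chosen inside the definition of `symProj`; they must be the same ones
  -- here for the terms to agree.
  let : Module ℝᵐᵒᵖ U := Module.compHom _ ((RingHom.id ℝ).fromOpposite mul_comm)
  have : IsCentralScalar ℝ U := ⟨fun _ _ => rfl⟩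
  have hfst : (TrivSqZeroExt.fstHom ℝ ℝ U).comp
      (SymmetricAlgebra.lift (TrivSqZeroExt.inrHom ℝ U)) =
      (SymmetricAlgebra.algebraMapInv : SymmetricAlgebra ℝ U →ₐ[ℝ] ℝ) := by
    apply SymmetricAlgebra.algHom_ext
    ext u
    simp [SymmetricAlgebra.algebraMapInv]
  have hfst' : ∀ s : SymmetricAlgebra ℝ U,
      (SymmetricAlgebra.lift (TrivSqZeroExt.inrHom ℝ U) s).fst =
        SymmetricAlgebra.algebraMapInv s := fun s => DFunLike.congr_fun hfst s
  change (SymmetricAlgebra.lift (TrivSqZeroExt.inrHom ℝ U) (s * t)).snd = _ • 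
    (SymmetricAlgebra.lift (TrivSqZeroExt.inrHom ℝ U) t).snd + _ • 
    (SymmetricAlgebra.lift (TrivSqZeroExt.inrHom ℝ U) s).snd
  rw [map_mul, TrivSqZeroExt.snd_mul, hfst', hfst', op_smul_eq_smul]

theorem symProj_ι (u : U) : symProj (SymmetricAlgebra.ι ℝ U u) = u := by
  let : Module ℝᵐᵒᵖ U := Module.compHom _ ((RingHom.id ℝ).fromOpposite mul_comm)
  have : IsCentralScalar ℝ U := ⟨fun _ _ => rfl⟩
  change (SymmetricAlgebra.lift (TrivSqZeroExt.inrHom ℝ U) (SymmetricAlgebra.ι ℝ U u)).snd = u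
  simp

theorem symProj_one : symProj (1 : SymmetricAlgebra ℝ U) = 0 := by
  have h := symProj_mul (1 : SymmetricAlgebra ℝ U) 1
  simpa using h

/-- The coproduct of the symmetric algebra. -/
def symCoprod : SymmetricAlgebra ℝ U →ₐ[ℝ] SymmetricAlgebra ℝ U ⊗[ℝ] SymmetricAlgebra ℝ U :=
  SymmetricAlgebra.lift (A := SymmetricAlgebra ℝ U ⊗[ℝ] SymmetricAlgebra ℝ U)
      ((Algebra.TensorProduct.includeLeft (R := ℝ) (S := ℝ)
          (A := SymmetricAlgebra ℝ U) (B := SymmetricAlgebra ℝ U)).toLinearMap ∘ₗ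
            SymmetricAlgebra.ι ℝ U +
        (Algebra.TensorProduct.includeRight (R := ℝ)
          (A := SymmetricAlgebra ℝ U) (B := SymmetricAlgebra ℝ U)).toLinearMap ∘ₗ
            SymmetricAlgebra.ι ℝ U)

theorem symCoprod_ι (u : U) : symCoprod (SymmetricAlgebra.ι ℝ U u) =
    SymmetricAlgebra.ι ℝ U u ⊗ₜ 1 + 1 ⊗ₜ SymmetricAlgebra.ι ℝ U u := by
  simp [symCoprod]

/-- The counit on the right factor. -/
def counitRight : SymmetricAlgebra ℝ U ⊗[ℝ] SymmetricAlgebra ℝ U →ₐ[ℝ] SymmetricAlgebra ℝ U :=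
  Algebra.TensorProduct.lift (AlgHom.id ℝ _)
    ((Algebra.ofId ℝ (SymmetricAlgebra ℝ U)).comp SymmetricAlgebra.algebraMapInv)
    (fun _ _ => Commute.all _ _)

theorem counitRight_symCoprod (s : SymmetricAlgebra ℝ U) : counitRight (symCoprod s) = s := by
  have : (counitRight (U := U)).comp symCoprod = AlgHom.id ℝ _ := by
    apply SymmetricAlgebra.algHom_ext
    ext u
    simp [symCoprod_ι, counitRight, SymmetricAlgebra.algebraMapInv_ι]
  exact DFunLike.congr_fun this s

theorem lTensor_symProj_mul (X Y : SymmetricAlgebra ℝ U ⊗[ℝ] SymmetricAlgebra ℝ U) :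
    LinearMap.lTensor (SymmetricAlgebra ℝ U) (symProj (U := U)) (X * Y) =
      counitRight X • LinearMap.lTensor (SymmetricAlgebra ℝ U) (symProj (U := U)) Y +
      counitRight Y • LinearMap.lTensor (SymmetricAlgebra ℝ U) (symProj (U := U)) X := by
  induction X using TensorProduct.induction_on with
  | zero => simp
  | add a b ha hb => rw [add_mul, map_add, ha, hb, map_add, map_add, smul_add, add_smul]; abel
  | tmul a b =>
    induction Y using TensorProduct.induction_on with
    | zero => simp
    | add c d hc hd => rw [mul_add, map_add, hc, hd, map_add, map_add, smul_add, add_smul]; abel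
    | tmul c d =>
      simp only [Algebra.TensorProduct.tmul_mul_tmul, LinearMap.lTensor_tmul, symProj_mul,
        TensorProduct.tmul_add, TensorProduct.tmul_smul, counitRight,
        Algebra.TensorProduct.lift_tmul, TensorProduct.smul_tmul', AlgHom.id_apply,
        AlgHom.comp_apply, Algebra.ofId_apply, smul_eq_mul]
      have key : ∀ (x y : SymmetricAlgebra ℝ U) (r : ℝ),
          x * algebraMap ℝ (SymmetricAlgebra ℝ U) r * y = r • (x * y) := fun x y r => by
        rw [Algebra.smul_def]; ring
      rw [key, key, mul_comm c a]

theorem polarize_apply (s : SymmetricAlgebra ℝ U) : polarize s =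
    LinearMap.lTensor (SymmetricAlgebra ℝ U) (symProj (U := U)) (symCoprod s) := rfl

/-- The coproduct is multiplicative and `symProj` is a derivation over the augmentation. The counit
axiom then turns the two coefficients into `s` and `t` themselves. -/
theorem polarize_mul (s t : SymmetricAlgebra ℝ U) :
    polarize (s * t) = s • polarize t + t • polarize s := by
  rw [polarize_apply, polarize_apply, polarize_apply, map_mul, lTensor_symProj_mul, counitRight_symCoprod, counitRight_symCoprod]

theorem polarize_ι (u : U) : polarize (SymmetricAlgebra.ι ℝ U u) = 1 ⊗ₜ u := by
  simp [polarize_apply, symCoprod_ι, symProj_ι, symProj_one]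

theorem polarize_one : polarize (1 : SymmetricAlgebra ℝ U) = 0 := by
  simp [polarize_apply, symProj_one, Algebra.TensorProduct.one_def]

/-! ### The operators as derivations -/

theorem contract_tmul (φ : U →ₗ[ℝ] ℝ) (a : ExteriorAlgebra ℝ W) (s : SymmetricAlgebra ℝ U) :
    contract φ (a ⊗ₜ[ℝ] s) = a ⊗ₜ (TensorProduct.rid ℝ (SymmetricAlgebra ℝ U)
      (LinearMap.lTensor (SymmetricAlgebra ℝ U) φ (polarize s))) := rfl

theorem rid_lTensor_smul (φ : U →ₗ[ℝ] ℝ) (s : SymmetricAlgebra ℝ U)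
    (z : SymmetricAlgebra ℝ U ⊗[ℝ] U) :
    TensorProduct.rid ℝ (SymmetricAlgebra ℝ U)
      (LinearMap.lTensor (SymmetricAlgebra ℝ U) φ (s • z)) =
    s * TensorProduct.rid ℝ (SymmetricAlgebra ℝ U)
      (LinearMap.lTensor (SymmetricAlgebra ℝ U) φ z) := by
  induction z using TensorProduct.induction_on with
  | zero => simp
  | add a b ha hb => rw [smul_add, map_add, map_add, ha, hb, map_add, map_add, mul_add]
  | tmul a u => simp [TensorProduct.smul_tmul']

theorem contract_isDer (φ : U →ₗ[ℝ] ℝ) : IsTwistedDer id (contract (W := W) φ) := fun x y => by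
  induction x using TensorProduct.induction_on with
  | zero => simp
  | add a b ha hb => simp only [add_mul, map_add, ha, hb]; abel
  | tmul a s =>
    induction y using TensorProduct.induction_on with
    | zero => simp
    | add c d hc hd => simp only [id, mul_add, map_add] at *; rw [hc, hd]; abel
    | tmul b t =>
      simp only [Algebra.TensorProduct.tmul_mul_tmul, contract_tmul, polarize_mul, map_add,
        rid_lTensor_smul, TensorProduct.tmul_add, id]
      rw [mul_comm t]

@[simp]
theorem contract_inclExt (φ : U →ₗ[ℝ] ℝ) (w : W) : contract φ (inclExt w : ExtSym W U) = 0 := by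
  simp [inclExt_apply, contract_tmul, polarize_one]

@[simp]
theorem contract_inclSym (φ : U →ₗ[ℝ] ℝ) (u : U) :
    contract φ (inclSym u : ExtSym W U) = algebraMap ℝ _ (φ u) := by
  simp [inclSym_apply, contract_tmul, polarize_ι, Algebra.algebraMap_eq_smul_one,
    Algebra.TensorProduct.one_def]

theorem inclExt_mul_eq (w : W) (x : ExtSym W U) : x * inclExt w = inclExt w * parity x := by
  induction x using ExtSym.induction with
  | hr r => rw [AlgHom.commutes, Algebra.commutes]
  | hw v => rw [parity_inclExt, inclExt_anticomm]; exact (mul_neg (inclExt w : ExtSym W U) (inclExt v)).symm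
  | hu u => rw [parity_inclSym]; simp [inclExt_apply, inclSym_apply]
  | hmul a b ha hb => rw [mul_assoc, hb, ← mul_assoc, ha, map_mul, mul_assoc]
  | hadd a b ha hb => rw [add_mul, ha, hb, map_add, mul_add]

theorem inclExt_mul_parity (w : W) (x : ExtSym W U) : inclExt w * x = parity x * inclExt w := by
  rw [inclExt_mul_eq, parity_parity]

theorem slide_tmul (κ : U →ₗ[ℝ] W) (a : ExteriorAlgebra ℝ W) (s : SymmetricAlgebra ℝ U) :
    slide κ (a ⊗ₜ[ℝ] s) = (a ⊗ₜ 1) * (TensorProduct.map (ExteriorAlgebra.ι ℝ ∘ₗ κ) LinearMap.id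
      (TensorProduct.comm ℝ (SymmetricAlgebra ℝ U) U (polarize s))) := rfl

theorem slideAux_smul (κ : U →ₗ[ℝ] W) (s : SymmetricAlgebra ℝ U)
    (z : SymmetricAlgebra ℝ U ⊗[ℝ] U) :
    TensorProduct.map (ExteriorAlgebra.ι ℝ ∘ₗ κ) LinearMap.id
      (TensorProduct.comm ℝ (SymmetricAlgebra ℝ U) U (s • z)) =
    ((1 : ExteriorAlgebra ℝ W) ⊗ₜ[ℝ] s) * TensorProduct.map (ExteriorAlgebra.ι ℝ ∘ₗ κ) LinearMap.id
      (TensorProduct.comm ℝ (SymmetricAlgebra ℝ U) U z) := by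
  induction z using TensorProduct.induction_on with
  | zero => simp
  | add a b ha hb => rw [smul_add, map_add, map_add, ha, hb, map_add, map_add, mul_add]
  | tmul a u => simp [TensorProduct.smul_tmul']

theorem slideAux_parity (κ : U →ₗ[ℝ] W) (b : ExteriorAlgebra ℝ W)
    (z : SymmetricAlgebra ℝ U ⊗[ℝ] U) :
    (b ⊗ₜ[ℝ] (1 : SymmetricAlgebra ℝ U)) *
      TensorProduct.map (ExteriorAlgebra.ι ℝ ∘ₗ κ) LinearMap.id
        (TensorProduct.comm ℝ (SymmetricAlgebra ℝ U) U z) =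
    TensorProduct.map (ExteriorAlgebra.ι ℝ ∘ₗ κ) LinearMap.id
      (TensorProduct.comm ℝ (SymmetricAlgebra ℝ U) U z) * parity (b ⊗ₜ[ℝ] 1) := by
  induction z using TensorProduct.induction_on with
  | zero => simp
  | add a b ha hb => rw [map_add, map_add, add_mul, mul_add, ha, hb]
  | tmul a u =>
    have e : TensorProduct.map (ExteriorAlgebra.ι ℝ ∘ₗ κ) LinearMap.id
        (TensorProduct.comm ℝ (SymmetricAlgebra ℝ U) U (a ⊗ₜ u)) =
        (inclExt (κ u) : ExtSym W U) * (1 ⊗ₜ[ℝ] a) := by simp [inclExt_apply]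
    rw [e, ← mul_assoc, inclExt_mul_eq, mul_assoc, mul_assoc]
    congr 1
    simp [parity_tmul]

/-- The vector `κ(u)` is written to the right of the exterior factor. For `u` in the left factor of
a product it must cross the exterior part of the right factor, so the parity twist falls on the
second factor. -/
theorem slide_isDer (κ : U →ₗ[ℝ] W) : IsTwistedDer parity (slide κ) := fun x y => by
  induction x using TensorProduct.induction_on with
  | zero => simp
  | add a b ha hb => simp only [add_mul, map_add, ha, hb]; abel
  | tmul a s =>
    induction y using TensorProduct.induction_on with
    | zero => simp
    | add c d hc hd => simp only [mul_add, map_add] at *; rw [hc, hd]; abel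
    | tmul b t =>
      have e1 : (a * b) ⊗ₜ[ℝ] (1 : SymmetricAlgebra ℝ U) = (a ⊗ₜ 1) * (b ⊗ₜ 1) := by simp
      have e2 : ∀ s : SymmetricAlgebra ℝ U, (b ⊗ₜ[ℝ] (1 : SymmetricAlgebra ℝ U)) * (1 ⊗ₜ s) =
        (1 ⊗ₜ s) * (b ⊗ₜ 1) := by simp
      have e3 : a ⊗ₜ[ℝ] s = (a ⊗ₜ 1) * (1 ⊗ₜ s) := by simp
      have e4 : parity (b ⊗ₜ[ℝ] t) = parity (b ⊗ₜ[ℝ] 1) * (1 ⊗ₜ t) := by simp [parity_tmul]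
      have e5 : ∀ z : ExtSym W U, ((1 : ExteriorAlgebra ℝ W) ⊗ₜ[ℝ] t) * z = z * (1 ⊗ₜ t) := by
        intro z
        induction z using TensorProduct.induction_on with
        | zero => simp
        | add c d hc hd => rw [mul_add, add_mul, hc, hd]
        | tmul c d => simp [mul_comm]
      rw [Algebra.TensorProduct.tmul_mul_tmul, slide_tmul, slide_tmul, slide_tmul, polarize_mul,
        map_add, map_add, slideAux_smul, slideAux_smul, mul_add, e1, e4, e3]
      congr 1
      · simp only [mul_assoc]; rw [← mul_assoc (b ⊗ₜ 1), e2]; simp only [mul_assoc]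
      · rw [e5]; simp only [mul_assoc]; rw [← mul_assoc (b ⊗ₜ 1), slideAux_parity]
        simp only [mul_assoc]

@[simp]
theorem slide_inclExt (κ : U →ₗ[ℝ] W) (w : W) : slide κ (inclExt w : ExtSym W U) = 0 := by
  simp [inclExt_apply, slide_tmul, polarize_one]

@[simp]
theorem slide_inclSym (κ : U →ₗ[ℝ] W) (u : U) :
    slide κ (inclSym u : ExtSym W U) = inclExt (κ u) := by
  simp [inclSym_apply, slide_tmul, polarize_ι, inclExt_apply]

theorem extBoundary_ι_mul (r : W →ₗ[ℝ] U) (w : W) (a : ExteriorAlgebra ℝ W) :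
    extBoundary r (ExteriorAlgebra.ι ℝ w * a) = inclExt w * extBoundary r a +
      (CliffordAlgebra.involute (Q := (0 : QuadraticForm ℝ W)) a) ⊗ₜ[ℝ]
        SymmetricAlgebra.ι ℝ U (r w) := by
  rw [extBoundary, ExteriorAlgebra.ι]
  erw [CliffordAlgebra.foldr'_ι_mul]
  rfl

theorem extBoundary_algebraMap (r : W →ₗ[ℝ] U) (x : ℝ) :
    extBoundary r (algebraMap ℝ (ExteriorAlgebra ℝ W) x) = 0 := by
  rw [extBoundary]
  erw [CliffordAlgebra.foldr'_algebraMap]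
  simp

/-- Left induction fits the recursion that defines `extBoundary`, which adds one vector on the left
at a time. -/
theorem extBoundary_mul (r : W →ₗ[ℝ] U) (a b : ExteriorAlgebra ℝ W) :
    extBoundary r (a * b) = (a ⊗ₜ 1) * extBoundary r b + extBoundary r a * parity (b ⊗ₜ 1) := by
  induction a using CliffordAlgebra.left_induction with
  | algebraMap x =>
    have := extBoundary_algebraMap r x
    erw [this]
    rw [zero_mul, add_zero, ← Algebra.smul_def, map_smul, Algebra.algebraMap_eq_smul_one,
      ← TensorProduct.smul_tmul', ← Algebra.TensorProduct.one_def, smul_mul_assoc, one_mul]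
  | add x y hx hy => rw [add_mul, map_add, hx, hy, map_add, TensorProduct.add_tmul]; noncomm_ring
  | ι_mul a w ha =>
    have h1 := extBoundary_ι_mul r w
    rw [ExteriorAlgebra.ι] at h1
    rw [h1, mul_assoc, h1, ha, map_mul, parity_tmul, inclExt_apply, ExteriorAlgebra.ι]
    simp only [mul_add, add_mul, ← mul_assoc, Algebra.TensorProduct.tmul_mul_tmul, mul_one]
    abel

theorem boundary_tmul (r : W →ₗ[ℝ] U) (a : ExteriorAlgebra ℝ W) (s : SymmetricAlgebra ℝ U) :
    boundary r (a ⊗ₜ[ℝ] s) = extBoundary r a * (1 ⊗ₜ s) := rfl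

theorem boundary_isDer (r : W →ₗ[ℝ] U) : IsTwistedDer parity (boundary r) := fun x y => by
  induction x using TensorProduct.induction_on with
  | zero => simp
  | add a b ha hb => simp only [add_mul, map_add, ha, hb]; abel
  | tmul a s =>
    induction y using TensorProduct.induction_on with
    | zero => simp
    | add c d hc hd => simp only [mul_add, map_add] at *; rw [hc, hd]; abel
    | tmul b t =>
      have e5 : ∀ (s : SymmetricAlgebra ℝ U) (z : ExtSym W U),
          ((1 : ExteriorAlgebra ℝ W) ⊗ₜ[ℝ] s) * z = z * (1 ⊗ₜ s) := by
        intro s z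
        induction z using TensorProduct.induction_on with
        | zero => simp
        | add c d hc hd => rw [mul_add, add_mul, hc, hd]
        | tmul c d => simp [mul_comm]
      have e3 : a ⊗ₜ[ℝ] s = (a ⊗ₜ 1) * (1 ⊗ₜ s) := by simp
      have e4 : parity (b ⊗ₜ[ℝ] t) = parity (b ⊗ₜ[ℝ] 1) * (1 ⊗ₜ t) := by simp [parity_tmul]
      have e6 : (1 : ExteriorAlgebra ℝ W) ⊗ₜ[ℝ] (s * t) = (1 ⊗ₜ s) * (1 ⊗ₜ t) := by simp
      rw [Algebra.TensorProduct.tmul_mul_tmul, boundary_tmul, boundary_tmul, boundary_tmul,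
        extBoundary_mul, e3, e4, e6, add_mul]
      congr 1
      · simp only [mul_assoc]; rw [← mul_assoc (1 ⊗ₜ s), e5 s (extBoundary r b), mul_assoc]
      · simp only [mul_assoc]
        rw [← mul_assoc (1 ⊗ₜ s) (parity (b ⊗ₜ[ℝ] 1)), e5 s (parity (b ⊗ₜ[ℝ] 1)), mul_assoc]

@[simp]
theorem boundary_inclExt (r : W →ₗ[ℝ] U) (w : W) :
    boundary r (inclExt w : ExtSym W U) = inclSym (r w) := by
  have h1 := extBoundary_ι_mul r w 1
  have h2 := extBoundary_algebraMap r 1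
  rw [map_one] at h2
  rw [h2, mul_one] at h1
  simp [inclExt_apply, boundary_tmul, h1, inclSym_apply, ← Algebra.TensorProduct.one_def]

@[simp]
theorem boundary_inclSym (r : W →ₗ[ℝ] U) (u : U) :
    boundary r (inclSym u : ExtSym W U) = 0 := by
  have h2 := extBoundary_algebraMap r 1
  rw [map_one] at h2
  simp [inclSym_apply, boundary_tmul, h2]

end Fibre

/-! ### How twisted derivations move the bidegree. -/

section Generic

theorem mul_neg_add_neg_mul {B : Type*} [Ring B] (a b c d : B) : a * -b + -c * d = -(a * b + c * d) := by
  noncomm_ring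

variable {B : Type*} [Ring B] [Algebra ℝ B] {τ : B → B} {D : B →ₗ[ℝ] B} {P Q : Submodule ℝ B}

/-- A twisted derivation that vanishes on `P` vanishes on the powers of `P`. -/
theorem IsTwistedDer.pow_eq_zero (h : IsTwistedDer τ D) (hτ : τ 1 = 1) (hP : ∀ x ∈ P, D x = 0)
    {j : ℕ} {x : B} (hx : x ∈ P ^ j) : D x = 0 := by
  refine Submodule.pow_induction_on_left P (C := fun x => D x = 0) (fun r => ?_)
    (fun x y hx hy => by rw [map_add, hx, hy, add_zero])
    (fun m hm x hx => by rw [h, hx, hP m hm, mul_zero, zero_mul, add_zero]) hx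
  rw [Algebra.algebraMap_eq_smul_one, map_smul, h.map_one hτ, smul_zero]

/-- One of the `j + 1` factors is sent to `Q`; carrying it to the front requires that `P` and `Q`
commute as submodules. -/
theorem IsTwistedDer.pow_mem (h : IsTwistedDer τ D) (hP : ∀ x ∈ P, D x ∈ Q)
    (hτP : ∀ n, ∀ x ∈ P ^ n, τ x ∈ P ^ n) (hPQ : P * Q = Q * P) (j : ℕ) :
    ∀ x ∈ P ^ (j + 1), D x ∈ Q * P ^ j := by
  induction j with
  | zero => intro x hx; simpa using hP x (by simpa using hx)
  | succ j ih =>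
    intro x hx
    rw [pow_succ'] at hx
    refine Submodule.mul_induction_on hx (fun m hm n hn => ?_)
      (fun x y hx hy => by rw [map_add]; exact add_mem hx hy)
    rw [h]
    refine add_mem ?_ (Submodule.mul_mem_mul (hP m hm) (hτP _ _ hn))
    rw [pow_succ', ← mul_assoc, ← hPQ, mul_assoc]
    exact Submodule.mul_mem_mul hm (ih n hn)

theorem IsTwistedDer.mul_mem (h : IsTwistedDer τ D) {A A' A₁ A₂ : Submodule ℝ B}
    (h1 : ∀ x ∈ A, ∀ y ∈ A', x * D y ∈ A₁ * A₂) (h2 : ∀ x ∈ A, ∀ y ∈ A', D x * τ y ∈ A₁ * A₂)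
    {x : B} (hx : x ∈ A * A') : D x ∈ A₁ * A₂ := by
  refine Submodule.mul_induction_on hx (fun m hm n hn => ?_)
      (fun x y hx hy => by rw [map_add]; exact add_mem hx hy)
  rw [h]
  exact add_mem (h1 m hm n hn) (h2 m hm n hn)

/-- With `P` spanned by `W` and `Q` by `U`, this is the behaviour of slides; `lower`, `reduce` and
`preserve` below are for the boundary, the contractions and the even derivations induced by
endomorphisms. -/
theorem IsTwistedDer.raise (h : IsTwistedDer τ D) (hτ : τ 1 = 1) (hPQ : P * Q = Q * P)
    (hP : ∀ x ∈ P, D x = 0) (hQ : ∀ x ∈ Q, D x ∈ P) (hτQ : ∀ n, ∀ x ∈ Q ^ n, τ x ∈ Q ^ n)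
    {j i : ℕ} {x : B} (hx : x ∈ P ^ j * Q ^ (i + 1)) : D x ∈ P ^ (j + 1) * Q ^ i := by
  refine h.mul_mem (fun x hx y hy => ?_) (fun x hx y hy => ?_) hx
  · rw [pow_succ, mul_assoc]
    exact Submodule.mul_mem_mul hx (h.pow_mem hQ hτQ hPQ.symm i y hy)
  · rw [h.pow_eq_zero hτ hP hx, zero_mul]
    exact zero_mem _

theorem IsTwistedDer.lower (h : IsTwistedDer τ D) (hτ : τ 1 = 1) (hPQ : P * Q = Q * P)
    (hQ : ∀ x ∈ Q, D x = 0) (hP : ∀ x ∈ P, D x ∈ Q) (hτP : ∀ n, ∀ x ∈ P ^ n, τ x ∈ P ^ n)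
    (hτQ : ∀ n, ∀ x ∈ Q ^ n, τ x ∈ Q ^ n)
    {j i : ℕ} {x : B} (hx : x ∈ P ^ (j + 1) * Q ^ i) : D x ∈ P ^ j * Q ^ (i + 1) := by
  refine h.mul_mem (fun x hx y hy => ?_) (fun x hx y hy => ?_) hx
  · rw [h.pow_eq_zero hτ hQ hy, mul_zero]
    exact zero_mem _
  · have e : P ^ j * Q = Q * P ^ j := (Commute.pow_left (show Commute P Q from hPQ) j)
    rw [pow_succ', ← mul_assoc, e]
    exact Submodule.mul_mem_mul (h.pow_mem hP hτP hPQ j x hx) (hτQ _ _ hy)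

theorem IsTwistedDer.reduce (h : IsTwistedDer id D) (hP : ∀ x ∈ P, D x = 0)
    (hQ : ∀ x ∈ Q, D x ∈ (1 : Submodule ℝ B))
    {j i : ℕ} {x : B} (hx : x ∈ P ^ j * Q ^ (i + 1)) : D x ∈ P ^ j * Q ^ i := by
  refine h.mul_mem (fun x hx y hy => ?_) (fun x hx y hy => ?_) hx
  · refine Submodule.mul_mem_mul hx ?_
    simpa using h.pow_mem hQ (fun n x hx => hx) (by simp) i y hy
  · rw [h.pow_eq_zero rfl hP hx, zero_mul]
    exact zero_mem _

theorem IsTwistedDer.preserve (h : IsTwistedDer id D) (hP : ∀ x ∈ P, D x ∈ P)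
    (hQ : ∀ x ∈ Q, D x ∈ Q) {j i : ℕ} {x : B} (hx : x ∈ P ^ j * Q ^ i) : D x ∈ P ^ j * Q ^ i := by
  have key : ∀ (P : Submodule ℝ B) (_ : ∀ x ∈ P, D x ∈ P) (n : ℕ),
      ∀ x ∈ P ^ n, D x ∈ P ^ n := by
    intro P hP n x hx
    cases n with
    | zero =>
      rw [pow_zero] at hx ⊢
      obtain ⟨r, rfl⟩ := Submodule.mem_one.1 hx
      rw [Algebra.algebraMap_eq_smul_one, map_smul, h.map_one rfl, smul_zero]
      exact zero_mem _
    | succ n =>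
      rw [pow_succ']
      exact h.pow_mem hP (fun n x hx => hx) rfl n x hx
  exact h.mul_mem (fun x hx y hy => Submodule.mul_mem_mul hx (key Q hQ _ _ hy))
    (fun x hx y hy => Submodule.mul_mem_mul (key P hP _ _ hx) hy) hx

theorem algHom_pow_mul_pow {B' : Type*} [Ring B'] [Algebra ℝ B'] (f : B →ₐ[ℝ] B')
    {P' Q' : Submodule ℝ B'} (hP : ∀ x ∈ P, f x ∈ P') (hQ : ∀ x ∈ Q, f x ∈ Q')
    {j i : ℕ} {x : B} (hx : x ∈ P ^ j * Q ^ i) : f x ∈ P' ^ j * Q' ^ i := by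
  have : (P ^ j * Q ^ i).map f.toLinearMap ≤ P' ^ j * Q' ^ i := by
    rw [Submodule.map_mul, Submodule.map_pow, Submodule.map_pow]
    refine mul_le_mul' (pow_le_pow_left' ?_ _) (pow_le_pow_left' ?_ _)
    · rintro _ ⟨w, hw, rfl⟩; exact hP w hw
    · rintro _ ⟨u, hu, rfl⟩; exact hQ u hu
  exact this (Submodule.mem_map_of_mem hx)

theorem mul_mem_pow_succ_right {j i : ℕ} {x y : B} (hx : x ∈ P ^ j * Q ^ i)
    (hy : y ∈ Q) : x * y ∈ P ^ j * Q ^ (i + 1) := by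
  rw [pow_succ, ← mul_assoc]
  exact Submodule.mul_mem_mul hx hy

theorem IsTwistedDer.mul_pow_zero (h : IsTwistedDer τ D) (hτ : τ 1 = 1) (hP : ∀ x ∈ P, D x = 0)
    {j : ℕ} {x : B} (hx : x ∈ P ^ j * Q ^ 0) : D x = 0 := by
  rw [pow_zero, mul_one] at hx
  exact h.pow_eq_zero hτ hP hx

theorem IsTwistedDer.pow_zero_mul (h : IsTwistedDer τ D) (hτ : τ 1 = 1) (hQ : ∀ x ∈ Q, D x = 0)
    {i : ℕ} {x : B} (hx : x ∈ P ^ 0 * Q ^ i) : D x = 0 := by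
  rw [pow_zero, one_mul] at hx
  exact h.pow_eq_zero hτ hQ hx

theorem parity_pow_mem (p : B →ₐ[ℝ] B) (hp : ∀ x ∈ P, p x ∈ P) (n : ℕ) :
    ∀ x ∈ P ^ n, p x ∈ P ^ n := fun x hx => by
  have := algHom_pow_mul_pow (j := n) (i := 0) (Q := P) (Q' := P) p hp hp (by simpa using hx)
  simpa using this

theorem two_mul_eq_zero {x : B} (h : x + x = 0) : x = 0 := by
  rw [← two_smul ℝ] at h
  exact (smul_eq_zero.1 h).resolve_left two_ne_zero

end Generic

section Fibre

variable {W U : Type*} [AddCommGroup W] [Module ℝ W] [AddCommGroup U] [Module ℝ U]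

theorem inclExt_mul_inclSym (w : W) (u : U) :
    (inclExt w : ExtSym W U) * inclSym u = inclSym u * inclExt w := by
  simp [inclExt_apply, inclSym_apply]

theorem commute_inclSym (u : U) (x : ExtSym W U) : inclSym u * x = x * inclSym u := by
  induction x using ExtSym.induction with
  | hr r => rw [Algebra.commutes]
  | hw w => rw [inclExt_mul_inclSym]
  | hu v => simp [inclSym_apply, mul_comm]
  | hmul a b ha hb => rw [← mul_assoc, ha, mul_assoc, hb, mul_assoc]
  | hadd a b ha hb => rw [mul_add, ha, hb, add_mul]

theorem parity_boundary (r : W →ₗ[ℝ] U) (x : ExtSym W U) :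
    parity (boundary r x) = -boundary r (parity x) := by
  induction x using ExtSym.induction with
  | hr s =>
    rw [AlgHom.commutes, Algebra.algebraMap_eq_smul_one, map_smul,
      (boundary_isDer r).map_one (map_one _), smul_zero, map_zero, neg_zero]
  | hw w => simp
  | hu v => simp
  | hmul a b ha hb =>
    rw [boundary_isDer r, map_add, map_mul, map_mul, map_mul, boundary_isDer r, ha, hb]
    exact mul_neg_add_neg_mul (B := ExtSym W U) _ _ _ _
  | hadd a b ha hb => rw [map_add, map_add, ha, hb, map_add, map_add, neg_add]

/-- Twice `∂²` is the anticommutator of `∂` with itself, an even derivation, and it vanishes on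
generators. -/
theorem boundary_boundary (r : W →ₗ[ℝ] U) (x : ExtSym W U) : boundary r (boundary r x) = 0 := by
  have h := (IsTwistedDer.comp_add parity_parity (boundary_isDer r) (boundary_isDer r)
    (parity_boundary r) (parity_boundary r)).eq_zero rfl (by simp) (by simp) x
  exact two_mul_eq_zero (B := ExtSym W U) h

theorem slide_add (κ κ' : U →ₗ[ℝ] W) (x : ExtSym W U) :
    slide (κ + κ') x = slide κ x + slide κ' x :=
  (slide_isDer (κ + κ')).ext ((slide_isDer κ).add (slide_isDer κ')) (map_one _)
    (by simp) (by simp) x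

theorem slide_smul (a : ℝ) (κ : U →ₗ[ℝ] W) (x : ExtSym W U) :
    slide (a • κ) x = a • slide κ x :=
  (slide_isDer (a • κ)).ext (Q' := a • slide κ) (fun s t => by
    simp only [LinearMap.smul_apply, slide_isDer κ s t, smul_add, mul_smul_comm, smul_mul_assoc])
    (map_one _) (by simp) (by simp) x

/-- This turns the tail term `i(df)(c ∧ α)` into an odd derivation, so that tail terms obey the same
rules as all other slides. -/
theorem slide_smulRight (φ : U →ₗ[ℝ] ℝ) (w : W) (x : ExtSym W U) :
    slide (φ.smulRight w) x = contract φ x * inclExt w :=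
  (slide_isDer (φ.smulRight w)).ext
    (Q' := (LinearMap.mulRight ℝ (inclExt w : ExtSym W U)) ∘ₗ contract φ) (fun s t => by
      simp only [LinearMap.comp_apply, LinearMap.mulRight_apply, contract_isDer φ s t, id, add_mul,
        mul_assoc]
      rw [inclExt_mul_parity, parity_parity])
    (map_one _) (by simp) (fun u => by
      rw [slide_inclSym, LinearMap.comp_apply, contract_inclSym, LinearMap.smulRight_apply, map_smul]
      exact Algebra.smul_def (A := ExtSym W U) _ _) x

theorem contract_mul_inclExt (φ : U →ₗ[ℝ] ℝ) (x : ExtSym W U) (w : W) :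
    contract φ (x * inclExt w) = contract φ x * inclExt w := by
  rw [contract_isDer φ]; simp

/-! ### Bidegrees -/

/-- The summand as a product of powers inside one algebra is the form to which the lemmas on
derivations apply. -/
theorem bidegree_eq (j i : ℕ) : bidegree W U j i =
    LinearMap.range (inclExt : W →ₗ[ℝ] ExtSym W U) ^ j *
      LinearMap.range (inclSym : U →ₗ[ℝ] ExtSym W U) ^ i := by
  have h1 : LinearMap.range (inclExt : W →ₗ[ℝ] ExtSym W U) ^ j =
      (⋀[ℝ]^j W).map (Algebra.TensorProduct.includeLeft (R := ℝ) (S := ℝ)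
        (A := ExteriorAlgebra ℝ W) (B := SymmetricAlgebra ℝ U)).toLinearMap := by
    rw [Submodule.map_pow, inclExt, LinearMap.range_comp]
  have h2 : LinearMap.range (inclSym : U →ₗ[ℝ] ExtSym W U) ^ i =
      (LinearMap.range (SymmetricAlgebra.ι ℝ U) ^ i).map
      (Algebra.TensorProduct.includeRight (R := ℝ)
        (A := ExteriorAlgebra ℝ W) (B := SymmetricAlgebra ℝ U)).toLinearMap := by
    rw [Submodule.map_pow, inclSym, LinearMap.range_comp]
  rw [h1, h2, bidegree]
  apply le_antisymm
  · rw [Submodule.map₂_le]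
    intro a ha s hs
    have : TensorProduct.mk ℝ (ExteriorAlgebra ℝ W) (SymmetricAlgebra ℝ U) a s =
      (a ⊗ₜ 1) * (1 ⊗ₜ s) := by simp
    rw [this]
    exact Submodule.mul_mem_mul (Submodule.mem_map_of_mem ha) (Submodule.mem_map_of_mem hs)
  · rw [Submodule.mul_le]
    rintro _ ⟨a, ha, rfl⟩ _ ⟨s, hs, rfl⟩
    have : (Algebra.TensorProduct.includeLeft (R := ℝ) (S := ℝ)
        (A := ExteriorAlgebra ℝ W) (B := SymmetricAlgebra ℝ U)).toLinearMap a *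
      (Algebra.TensorProduct.includeRight (R := ℝ)
        (A := ExteriorAlgebra ℝ W) (B := SymmetricAlgebra ℝ U)).toLinearMap s =
      TensorProduct.mk ℝ (ExteriorAlgebra ℝ W) (SymmetricAlgebra ℝ U) a s := by simp
    rw [this]
    exact Submodule.apply_mem_map₂ _ ha hs

theorem range_mul_comm : LinearMap.range (inclExt : W →ₗ[ℝ] ExtSym W U) *
    LinearMap.range (inclSym : U →ₗ[ℝ] ExtSym W U) =
    LinearMap.range (inclSym : U →ₗ[ℝ] ExtSym W U) *
      LinearMap.range (inclExt : W →ₗ[ℝ] ExtSym W U) := by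
  apply le_antisymm
  · rw [Submodule.mul_le]
    rintro _ ⟨w, rfl⟩ _ ⟨u, rfl⟩
    rw [inclExt_mul_inclSym]
    exact Submodule.mul_mem_mul ⟨u, rfl⟩ ⟨w, rfl⟩
  · rw [Submodule.mul_le]
    rintro _ ⟨w, rfl⟩ _ ⟨u, rfl⟩
    rw [← inclExt_mul_inclSym]
    exact Submodule.mul_mem_mul ⟨u, rfl⟩ ⟨w, rfl⟩

theorem slide_ext_eq_zero (κ : U →ₗ[ℝ] W) :
    ∀ x ∈ LinearMap.range (inclExt : W →ₗ[ℝ] ExtSym W U), slide κ x = 0 := by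
  rintro _ ⟨w, rfl⟩
  simp

theorem parity_sym_mem : ∀ x ∈ LinearMap.range (inclSym : U →ₗ[ℝ] ExtSym W U),
    parity x ∈ LinearMap.range (inclSym : U →ₗ[ℝ] ExtSym W U) := by
  rintro _ ⟨w, rfl⟩
  simp

theorem parity_ext_mem : ∀ x ∈ LinearMap.range (inclExt : W →ₗ[ℝ] ExtSym W U),
    parity x ∈ LinearMap.range (inclExt : W →ₗ[ℝ] ExtSym W U) := by
  rintro _ ⟨w, rfl⟩
  exact ⟨-w, by simp⟩

theorem slide_bidegree_zero (κ : U →ₗ[ℝ] W) {j : ℕ} {x : ExtSym W U}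
    (hx : x ∈ bidegree W U j 0) : slide κ x = 0 := by
  rw [bidegree_eq] at hx
  exact (slide_isDer κ).mul_pow_zero (map_one _) (slide_ext_eq_zero κ) hx

theorem slide_bidegree (κ : U →ₗ[ℝ] W) {j i : ℕ} {x : ExtSym W U}
    (hx : x ∈ bidegree W U j (i + 1)) : slide κ x ∈ bidegree W U (j + 1) i := by
  rw [bidegree_eq] at hx ⊢
  exact (slide_isDer κ).raise (map_one _) range_mul_comm (slide_ext_eq_zero κ)
    (by rintro _ ⟨u, rfl⟩; simp) (parity_pow_mem _ parity_sym_mem) hx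

theorem boundary_sym_eq_zero (r : W →ₗ[ℝ] U) :
    ∀ x ∈ LinearMap.range (inclSym : U →ₗ[ℝ] ExtSym W U), boundary r x = 0 := by
  rintro _ ⟨w, rfl⟩
  simp

theorem boundary_bidegree_zero (r : W →ₗ[ℝ] U) {i : ℕ} {x : ExtSym W U}
    (hx : x ∈ bidegree W U 0 i) : boundary r x = 0 := by
  rw [bidegree_eq] at hx
  exact (boundary_isDer r).pow_zero_mul (map_one _) (boundary_sym_eq_zero r) hx

theorem boundary_bidegree (r : W →ₗ[ℝ] U) {j i : ℕ} {x : ExtSym W U}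
    (hx : x ∈ bidegree W U (j + 1) i) : boundary r x ∈ bidegree W U j (i + 1) := by
  rw [bidegree_eq] at hx ⊢
  exact (boundary_isDer r).lower (map_one _) range_mul_comm (boundary_sym_eq_zero r)
    (by rintro _ ⟨u, rfl⟩; simp) (parity_pow_mem _ parity_ext_mem)
    (parity_pow_mem _ parity_sym_mem) hx

theorem contract_ext_eq_zero (φ : U →ₗ[ℝ] ℝ) :
    ∀ x ∈ LinearMap.range (inclExt : W →ₗ[ℝ] ExtSym W U), contract φ x = 0 := by
  rintro _ ⟨w, rfl⟩
  simp

theorem contract_bidegree_zero (φ : U →ₗ[ℝ] ℝ) {j : ℕ} {x : ExtSym W U}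
    (hx : x ∈ bidegree W U j 0) : contract φ x = 0 := by
  rw [bidegree_eq] at hx
  exact (contract_isDer φ).mul_pow_zero rfl (contract_ext_eq_zero φ) hx

theorem contract_bidegree (φ : U →ₗ[ℝ] ℝ) {j i : ℕ} {x : ExtSym W U}
    (hx : x ∈ bidegree W U j (i + 1)) : contract φ x ∈ bidegree W U j i := by
  rw [bidegree_eq] at hx ⊢
  refine (contract_isDer φ).reduce (contract_ext_eq_zero φ) ?_ hx
  rintro _ ⟨u, rfl⟩
  rw [contract_inclSym]
  exact Submodule.algebraMap_mem _

theorem mul_inclSym_bidegree {j i : ℕ} {x : ExtSym W U} (hx : x ∈ bidegree W U j i) (u : U) :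
    x * inclSym u ∈ bidegree W U j (i + 1) := by
  rw [bidegree_eq] at hx ⊢
  exact mul_mem_pow_succ_right hx ⟨u, rfl⟩

theorem algHom_bidegree {W' U' : Type*} [AddCommGroup W'] [Module ℝ W'] [AddCommGroup U']
    [Module ℝ U'] (f : ExtSym W U →ₐ[ℝ] ExtSym W' U')
    (hw : ∀ w, f (inclExt w) ∈ LinearMap.range (inclExt : W' →ₗ[ℝ] ExtSym W' U'))
    (hu : ∀ u, f (inclSym u) ∈ LinearMap.range (inclSym : U' →ₗ[ℝ] ExtSym W' U'))
    {j i : ℕ} {x : ExtSym W U} (hx : x ∈ bidegree W U j i) : f x ∈ bidegree W' U' j i := by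
  rw [bidegree_eq] at hx ⊢
  exact algHom_pow_mul_pow f (by rintro _ ⟨w, rfl⟩; exact hw w) (by rintro _ ⟨u, rfl⟩; exact hu u) hx

theorem IsTwistedDer.bidegree {D : ExtSym W U →ₗ[ℝ] ExtSym W U} (h : IsTwistedDer id D)
    (hw : ∀ w, D (inclExt w) ∈ LinearMap.range (inclExt : W →ₗ[ℝ] ExtSym W U))
    (hu : ∀ u, D (inclSym u) ∈ LinearMap.range (inclSym : U →ₗ[ℝ] ExtSym W U))
    {j i : ℕ} {x : ExtSym W U} (hx : x ∈ bidegree W U j i) : D x ∈ bidegree W U j i := by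
  rw [bidegree_eq] at hx ⊢
  exact h.preserve (by rintro _ ⟨w, rfl⟩; exact hw w) (by rintro _ ⟨u, rfl⟩; exact hu u) hx

end Fibre

/-! ### Euler operators: when contractions or wedge products detect zero; derivations induced by
linear maps. -/

section Generic

variable {B : Type*} [Ring B] [Algebra ℝ B] {D : B →ₗ[ℝ] B} {P Q : Submodule ℝ B}

theorem euler_mul (h : ∀ p ∈ P, ∀ x, D (p * x) = p * x + p * D x) (j : ℕ) :
    ∀ x ∈ P ^ j, ∀ y, D (x * y) = (j : ℝ) • (x * y) + x * D y := by
  induction j with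
  | zero =>
    intro x hx y
    rw [pow_zero] at hx
    obtain ⟨r, rfl⟩ := Submodule.mem_one.1 hx
    simp [Algebra.algebraMap_eq_smul_one]
  | succ j ih =>
    intro x hx y
    rw [pow_succ'] at hx
    refine Submodule.mul_induction_on hx (fun m hm n hn => ?_) (fun a b ha hb => ?_)
    · rw [mul_assoc, h m hm, ih n hn, mul_add, mul_smul_comm, Nat.cast_succ, add_smul, one_smul]
      rw [mul_assoc]; abel
    · rw [add_mul, map_add, ha, hb, smul_add, add_mul]; abel

theorem euler_pow_mul_pow {T : Submodule ℝ B} (hT : ∀ y ∈ T, D y = 0)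
    (h : ∀ p ∈ P, ∀ x, D (p * x) = p * x + p * D x) {j : ℕ} {x : B} (hx : x ∈ P ^ j * T) :
    D x = (j : ℝ) • x := by
  refine Submodule.mul_induction_on hx (fun m hm n hn => ?_) (fun a b ha hb => ?_)
  · rw [euler_mul h j m hm, hT n hn, mul_zero, add_zero]
  · rw [map_add, ha, hb, smul_add]

theorem pow_eq_zero_of_central (h : ∀ q ∈ Q, ∀ x, D (q * x) = q * D x) (h1 : D 1 = 0) {i : ℕ}
    {x : B} (hx : x ∈ Q ^ i) : D x = 0 := by
  refine Submodule.pow_induction_on_left Q (C := fun x => D x = 0) (fun r => ?_)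
    (fun x y hx hy => by rw [map_add, hx, hy, add_zero])
    (fun m hm x hx => by rw [h m hm, hx, mul_zero]) hx
  rw [Algebra.algebraMap_eq_smul_one, map_smul, h1, smul_zero]

theorem mul_mem_pow_comm {j i : ℕ} (hPQ : P * Q = Q * P) :
    P ^ j * Q ^ i = Q ^ i * P ^ j :=
  Commute.pow_pow (show Commute P Q from hPQ) j i

end Generic

section Fibre

variable {W U : Type*} [AddCommGroup W] [Module ℝ W] [AddCommGroup U] [Module ℝ U]

/-- The contraction with `φ : W → ℝ` in the exterior factor. -/
def contractExt (φ : W →ₗ[ℝ] ℝ) : ExtSym W U →ₗ[ℝ] ExtSym W U :=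
  LinearMap.rTensor (SymmetricAlgebra ℝ U)
    (CliffordAlgebra.contractLeft (Q := (0 : QuadraticForm ℝ W)) φ)

theorem contractExt_inclExt_mul (φ : W →ₗ[ℝ] ℝ) (w : W) (x : ExtSym W U) :
    contractExt φ (inclExt w * x) = φ w • x - inclExt w * contractExt φ x := by
  induction x using TensorProduct.induction_on with
  | zero => simp
  | add a b ha hb => rw [mul_add, map_add, ha, hb, map_add, smul_add, mul_add]; abel
  | tmul a s =>
    have h : CliffordAlgebra.contractLeft (Q := (0 : QuadraticForm ℝ W)) φ
        (ExteriorAlgebra.ι ℝ w * a) = φ w • a - ExteriorAlgebra.ι ℝ w *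
          CliffordAlgebra.contractLeft (Q := (0 : QuadraticForm ℝ W)) φ a :=
      CliffordAlgebra.contractLeft_ι_mul _ _ _
    simp only [contractExt, inclExt_apply, Algebra.TensorProduct.tmul_mul_tmul, one_mul,
      LinearMap.rTensor_tmul, h, TensorProduct.sub_tmul, TensorProduct.smul_tmul']

theorem contractExt_inclSym_mul (φ : W →ₗ[ℝ] ℝ) (u : U) (x : ExtSym W U) :
    contractExt φ (inclSym u * x) = inclSym u * contractExt φ x := by
  induction x using TensorProduct.induction_on with
  | zero => simp
  | add a b ha hb => rw [mul_add, map_add, ha, hb, map_add, mul_add]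
  | tmul a s => simp [contractExt, inclSym_apply]

theorem contractExt_one (φ : W →ₗ[ℝ] ℝ) : contractExt φ (1 : ExtSym W U) = 0 := by
  have : CliffordAlgebra.contractLeft (Q := (0 : QuadraticForm ℝ W)) φ
        (1 : ExteriorAlgebra ℝ W) = 0 := CliffordAlgebra.contractLeft_one _ _
  rw [Algebra.TensorProduct.one_def, contractExt, LinearMap.rTensor_tmul, this,
    TensorProduct.zero_tmul]

section euler
variable [FiniteDimensional ℝ U]

/-- The Euler operator of the symmetric factor. -/
def eulerSym : ExtSym W U →ₗ[ℝ] ExtSym W U :=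
  ∑ a, LinearMap.mulLeft ℝ (inclSym (Module.finBasis ℝ U a) : ExtSym W U) ∘ₗ
    contract ((Module.finBasis ℝ U).coord a)

theorem eulerSym_apply (x : ExtSym W U) : eulerSym x =
    ∑ a, inclSym (Module.finBasis ℝ U a) * contract ((Module.finBasis ℝ U).coord a) x := by
  simp [eulerSym, LinearMap.sum_apply]

theorem eulerSym_inclExt_mul (w : W) (x : ExtSym W U) :
    eulerSym (inclExt w * x) = inclExt w * eulerSym x := by
  rw [eulerSym_apply, eulerSym_apply, Finset.mul_sum]
  refine Finset.sum_congr rfl fun a _ => ?_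
  rw [contract_isDer, contract_inclExt, zero_mul, add_zero, ← mul_assoc, ← mul_assoc,
    inclExt_mul_inclSym]

theorem eulerSym_inclSym_mul (u : U) (x : ExtSym W U) :
    eulerSym (inclSym u * x) = inclSym u * x + inclSym u * eulerSym x := by
  rw [eulerSym_apply, eulerSym_apply, Finset.mul_sum]
  have : ∀ a, inclSym (Module.finBasis ℝ U a) *
      contract ((Module.finBasis ℝ U).coord a) (inclSym u * x) =
      inclSym ((Module.finBasis ℝ U).repr u a • Module.finBasis ℝ U a) * x +
        inclSym u * (inclSym (Module.finBasis ℝ U a) *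
          contract ((Module.finBasis ℝ U).coord a) x) := fun a => by
    rw [contract_isDer, contract_inclSym, mul_add, ← mul_assoc, ← mul_assoc,
      commute_inclSym _ (inclSym u), id, add_comm, map_smul, Algebra.smul_def (A := ExtSym W U),
      ← mul_assoc, ← Algebra.commutes, mul_assoc, mul_assoc, mul_assoc, Module.Basis.coord_apply]
  simp_rw [this, Finset.sum_add_distrib, ← Finset.sum_mul, ← map_sum, Module.Basis.sum_repr]

theorem eulerSym_one : eulerSym (1 : ExtSym W U) = 0 := by
  rw [eulerSym_apply]
  refine Finset.sum_eq_zero fun a _ => ?_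
  rw [(contract_isDer _).map_one rfl, mul_zero]

theorem eulerSym_bidegree {j i : ℕ} {x : ExtSym W U} (hx : x ∈ bidegree W U j i) :
    eulerSym x = (i : ℝ) • x := by
  rw [bidegree_eq] at hx
  have hx := (mul_mem_pow_comm (j := j) (i := i) (range_mul_comm (W := W) (U := U))) ▸ hx
  refine euler_pow_mul_pow (T := LinearMap.range (inclExt : W →ₗ[ℝ] ExtSym W U) ^ j)
    (fun y hy => pow_eq_zero_of_central (Q := LinearMap.range (inclExt : W →ₗ[ℝ] ExtSym W U))
      ?_ eulerSym_one hy) ?_ hx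
  · rintro _ ⟨w, rfl⟩ x; exact eulerSym_inclExt_mul w x
  · rintro _ ⟨u, rfl⟩ x; exact eulerSym_inclSym_mul u x

/-- The Euler operator of `S U` is built from contractions and acts on `S^(i+1) U` as the nonzero
number `i + 1`. -/
theorem eq_zero_of_contract {j i : ℕ} {x : ExtSym W U} (hx : x ∈ bidegree W U j (i + 1))
    (h : ∀ φ, contract φ x = 0) : x = 0 := by
  have h1 := eulerSym_bidegree hx
  rw [eulerSym_apply, Finset.sum_eq_zero (fun a _ => by rw [h, mul_zero])] at h1
  exact (smul_eq_zero.1 h1.symm).resolve_left (by positivity)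

end euler

section euler
variable [FiniteDimensional ℝ W]

/-- The Euler operator of the exterior factor. -/
def eulerExt : ExtSym W U →ₗ[ℝ] ExtSym W U :=
  ∑ a, LinearMap.mulLeft ℝ (inclExt (Module.finBasis ℝ W a) : ExtSym W U) ∘ₗ
    contractExt ((Module.finBasis ℝ W).coord a)

theorem eulerExt_apply (x : ExtSym W U) : eulerExt x =
    ∑ a, inclExt (Module.finBasis ℝ W a) * contractExt ((Module.finBasis ℝ W).coord a) x := by
  simp [eulerExt, LinearMap.sum_apply]

theorem eulerExt_inclSym_mul (u : U) (x : ExtSym W U) :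
    eulerExt (inclSym u * x) = inclSym u * eulerExt x := by
  rw [eulerExt_apply, eulerExt_apply, Finset.mul_sum]
  refine Finset.sum_congr rfl fun a _ => ?_
  rw [contractExt_inclSym_mul, ← mul_assoc, ← mul_assoc, inclExt_mul_inclSym]

theorem eulerExt_inclExt_mul (w : W) (x : ExtSym W U) :
    eulerExt (inclExt w * x) = inclExt w * x + inclExt w * eulerExt x := by
  rw [eulerExt_apply, eulerExt_apply, Finset.mul_sum]
  have : ∀ a, inclExt (Module.finBasis ℝ W a) *
      contractExt ((Module.finBasis ℝ W).coord a) (inclExt w * x) =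
      inclExt ((Module.finBasis ℝ W).repr w a • Module.finBasis ℝ W a) * x +
        inclExt w * (inclExt (Module.finBasis ℝ W a) *
          contractExt ((Module.finBasis ℝ W).coord a) x) := fun a => by
    rw [contractExt_inclExt_mul, map_smul, ← mul_assoc (inclExt w), inclExt_anticomm w]
    generalize (inclExt (Module.finBasis ℝ W a) : ExtSym W U) = p
    generalize (inclExt w : ExtSym W U) = q
    generalize contractExt ((Module.finBasis ℝ W).coord a) x = z
    have : ∀ {B : Type _} [Ring B] [Algebra ℝ B] (p q z x : B) (r : ℝ),
        p * (r • x - q * z) = (r • p) * x + -(p * q) * z := fun p q z x r => by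
      rw [mul_sub, mul_smul_comm, smul_mul_assoc]; noncomm_ring
    exact this p q z x _
  simp_rw [this, Finset.sum_add_distrib, ← Finset.sum_mul, ← map_sum, Module.Basis.sum_repr]

theorem eulerExt_one : eulerExt (1 : ExtSym W U) = 0 := by
  rw [eulerExt_apply]
  refine Finset.sum_eq_zero fun a _ => ?_
  rw [contractExt_one, mul_zero]

theorem eulerExt_bidegree {j i : ℕ} {x : ExtSym W U} (hx : x ∈ bidegree W U j i) :
    eulerExt x = (j : ℝ) • x := by
  rw [bidegree_eq] at hx
  refine euler_pow_mul_pow (T := LinearMap.range (inclSym : U →ₗ[ℝ] ExtSym W U) ^ i)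
    (fun y hy => pow_eq_zero_of_central (Q := LinearMap.range (inclSym : U →ₗ[ℝ] ExtSym W U))
      ?_ eulerExt_one hy) ?_ hx
  · rintro _ ⟨w, rfl⟩ x; exact eulerExt_inclSym_mul w x
  · rintro _ ⟨u, rfl⟩ x; exact eulerExt_inclExt_mul u x

theorem sum_contractExt_inclExt_mul (x : ExtSym W U) :
    ∑ a, contractExt ((Module.finBasis ℝ W).coord a) (inclExt (Module.finBasis ℝ W a) * x) =
      (Module.finrank ℝ W : ℝ) • x - eulerExt x := by
  simp only [contractExt_inclExt_mul, Finset.sum_sub_distrib, eulerExt_apply]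
  simp [Nat.cast_smul_eq_nsmul]

/-- For a basis `e_a` of `W` with dual contractions `ι_a`, and `n = dim W`, one has `∑ ι_a(e_a ∧ x)
= (n - j) x` in exterior degree `j`. Only `j = n` is lost. Parity replaces the wedge product from
the right by the one from the left. -/
theorem eq_zero_of_mul_inclExt {j i : ℕ} {x : ExtSym W U} (hx : x ∈ bidegree W U j i)
    (hj : j ≠ Module.finrank ℝ W) (h : ∀ w, x * inclExt w = 0) : x = 0 := by
  have hp : parity x ∈ bidegree W U j i := algHom_bidegree _
    (fun w => ⟨-w, by simp⟩) (fun u => ⟨u, by simp⟩) hx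
  have h1 := sum_contractExt_inclExt_mul (parity x)
  rw [Finset.sum_eq_zero (fun a _ => by rw [← inclExt_mul_eq, h, map_zero]),
    eulerExt_bidegree hp] at h1
  have h2 : parity x = 0 := (smul_eq_zero.1 ((sub_smul _ _ _).trans h1.symm)).resolve_left
    (sub_ne_zero.2 (by exact_mod_cast hj.symm))
  rw [← parity_parity x, h2, map_zero]

theorem bidegree_eq_bot {j i : ℕ} (hj : Module.finrank ℝ W < j) : bidegree W U j i = ⊥ := by
  have : ⋀[ℝ]^j W = ⊥ := by
    rw [← ExteriorAlgebra.ιMulti_span_fixedDegree, Submodule.span_eq_bot]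
    rintro _ ⟨v, rfl⟩
    refine AlternatingMap.map_linearDependent _ _ fun hv => ?_
    have := hv.fintype_card_le_finrank
    simp at this
    omega
  rw [bidegree, this, Submodule.map₂_bot_left]

end euler

/-- The homomorphism `Λ W ⊗ S U → Λ W' ⊗ S U'` induced by linear maps. -/
def extSymMap {W' U' : Type*} [AddCommGroup W'] [Module ℝ W'] [AddCommGroup U']
    [Module ℝ U'] (f : W →ₗ[ℝ] W') (g : U →ₗ[ℝ] U') : ExtSym W U →ₐ[ℝ] ExtSym W' U' :=
  Algebra.TensorProduct.map (ExteriorAlgebra.map f)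
    (SymmetricAlgebra.lift (SymmetricAlgebra.ι ℝ U' ∘ₗ g))

@[simp]
theorem extSymMap_inclExt {W' U' : Type*} [AddCommGroup W'] [Module ℝ W'] [AddCommGroup U']
    [Module ℝ U'] (f : W →ₗ[ℝ] W') (g : U →ₗ[ℝ] U') (w : W) :
    extSymMap f g (inclExt w) = inclExt (f w) := by
  simp [extSymMap, inclExt_apply]

@[simp]
theorem extSymMap_inclSym {W' U' : Type*} [AddCommGroup W'] [Module ℝ W'] [AddCommGroup U']
    [Module ℝ U'] (f : W →ₗ[ℝ] W') (g : U →ₗ[ℝ] U') (u : U) :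
    extSymMap f g (inclSym u) = inclSym (g u) := by
  simp [extSymMap, inclSym_apply]

/-- A derivation `D` is the same as an algebra map `x ↦ x + ε D(x)` to the dual numbers. The
universal property provides it, since `w ∧ a(w) + a(w) ∧ w = 0`. -/
theorem exists_exteriorAlgebra_der (a : W →ₗ[ℝ] W) :
    ∃ D : ExteriorAlgebra ℝ W →ₗ[ℝ] ExteriorAlgebra ℝ W, IsTwistedDer id D ∧
      ∀ w, D (ExteriorAlgebra.ι ℝ w) = ExteriorAlgebra.ι ℝ (a w) := by
  let f : W →ₗ[ℝ] DualNumber (ExteriorAlgebra ℝ W) :=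
    { toFun := fun w => (ExteriorAlgebra.ι ℝ w, ExteriorAlgebra.ι ℝ (a w))
      map_add' := fun x y => by simp only [map_add]; rfl
      map_smul' := fun r x => by simp only [map_smul]; rfl }
  have hf : ∀ w, f w * f w = 0 := fun w => by
    ext
    · exact ExteriorAlgebra.ι_sq_zero w
    · rw [TrivSqZeroExt.snd_mul]
      exact ExteriorAlgebra.ι_add_mul_swap w (a w)
  let φ := ExteriorAlgebra.lift ℝ ⟨f, hf⟩
  have hφ : ∀ w, φ (ExteriorAlgebra.ι ℝ w) = f w := fun w => ExteriorAlgebra.lift_ι_apply _ _ _ _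
  have h1 : ∀ x, (φ x).fst = x := fun x => by
    have : (TrivSqZeroExt.fstHom ℝ (ExteriorAlgebra ℝ W) (ExteriorAlgebra ℝ W)).comp φ =
        AlgHom.id ℝ _ := by
      apply ExteriorAlgebra.hom_ext
      ext w
      simp [hφ]; rfl
    exact DFunLike.congr_fun this x
  refine ⟨{ toFun := fun x => (φ x).snd, map_add' := by simp, map_smul' := by simp }, ?_, ?_⟩
  · intro s t
    simp only [LinearMap.coe_mk, AddHom.coe_mk, map_mul, TrivSqZeroExt.snd_mul, h1]
    rfl
  · intro w
    simp only [LinearMap.coe_mk, AddHom.coe_mk, hφ]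
    rfl

theorem exists_symmetricAlgebra_der (a : U →ₗ[ℝ] U) :
    ∃ D : SymmetricAlgebra ℝ U →ₗ[ℝ] SymmetricAlgebra ℝ U, IsTwistedDer id D ∧
      ∀ w, D (SymmetricAlgebra.ι ℝ U w) = SymmetricAlgebra.ι ℝ U (a w) := by
  let f : U →ₗ[ℝ] DualNumber (SymmetricAlgebra ℝ U) :=
    { toFun := fun w => (SymmetricAlgebra.ι ℝ U w, SymmetricAlgebra.ι ℝ U (a w))
      map_add' := fun x y => by simp only [map_add]; rfl
      map_smul' := fun r x => by simp only [map_smul]; rfl }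
  let φ := SymmetricAlgebra.lift f
  have hφ : ∀ w, φ (SymmetricAlgebra.ι ℝ U w) = f w := fun w => SymmetricAlgebra.lift_ι_apply _ w
  have h1 : ∀ x, (φ x).fst = x := fun x => by
    have : (TrivSqZeroExt.fstHom ℝ (SymmetricAlgebra ℝ U) (SymmetricAlgebra ℝ U)).comp φ =
        AlgHom.id ℝ _ := by
      apply SymmetricAlgebra.algHom_ext
      ext w
      simp [hφ]; rfl
    exact DFunLike.congr_fun this x
  refine ⟨{ toFun := fun x => (φ x).snd, map_add' := by simp, map_smul' := by simp }, ?_, ?_⟩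
  · intro s t
    simp only [LinearMap.coe_mk, AddHom.coe_mk, map_mul, TrivSqZeroExt.snd_mul, h1]
    rfl
  · intro w
    simp only [LinearMap.coe_mk, AddHom.coe_mk, hφ]
    rfl

/-- It serves for the connection matrix part of a derivation written in local frames. -/
theorem exists_extSym_der (a : W →ₗ[ℝ] W) (b : U →ₗ[ℝ] U) :
    ∃ D : ExtSym W U →ₗ[ℝ] ExtSym W U, IsTwistedDer id D ∧
      (∀ w, D (inclExt w) = inclExt (a w)) ∧ ∀ u, D (inclSym u) = inclSym (b u) := by
  obtain ⟨D1, h1, h1'⟩ := exists_exteriorAlgebra_der a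
  obtain ⟨D2, h2, h2'⟩ := exists_symmetricAlgebra_der b
  refine ⟨LinearMap.rTensor _ D1 + LinearMap.lTensor _ D2, fun x y => ?_, fun w => ?_, fun u => ?_⟩
  · induction x using TensorProduct.induction_on with
    | zero => simp
    | add a b ha hb => simp only [add_mul, map_add, ha, hb]; abel
    | tmul a s =>
      induction y using TensorProduct.induction_on with
      | zero => simp
      | add c d hc hd => simp only [id, mul_add, map_add] at *; rw [hc, hd]; abel
      | tmul b t =>
        simp only [Algebra.TensorProduct.tmul_mul_tmul, LinearMap.add_apply, mul_add, add_mul,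
          LinearMap.rTensor_tmul, LinearMap.lTensor_tmul, h1 a b, h2 s t, TensorProduct.tmul_add,
          TensorProduct.add_tmul, id]
        abel
  · have := h2.map_one rfl
    simp [inclExt_apply, this, h1']
  · have := h1.map_one rfl
    simp [inclSym_apply, this, h2']

end Fibre

section Algebra

variable {W U : Type*} [AddCommGroup W] [Module ℝ W] [AddCommGroup U] [Module ℝ U]

theorem IsTwistedDer.algebraMap {B : Type*} [Ring B] [Algebra ℝ B] {τ : B → B} {Q : B →ₗ[ℝ] B}
    (h : IsTwistedDer τ Q) (hτ : τ 1 = 1) (r : ℝ) : Q (algebraMap ℝ B r) = 0 := by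
  rw [Algebra.algebraMap_eq_smul_one, LinearMap.map_smul, h.map_one hτ, smul_zero]

theorem slide_algebraMap (κ : U →ₗ[ℝ] W) (r : ℝ) :
    slide κ (algebraMap ℝ (ExtSym W U) r) = 0 :=
  (slide_isDer κ).algebraMap (map_one parity) r

theorem boundary_algebraMap (a : W →ₗ[ℝ] U) (r : ℝ) :
    boundary a (algebraMap ℝ (ExtSym W U) r) = 0 :=
  (boundary_isDer a).algebraMap (map_one parity) r

theorem contract_algebraMap (φ : U →ₗ[ℝ] ℝ) (r : ℝ) :
    contract φ (algebraMap ℝ (ExtSym W U) r) = 0 :=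
  (contract_isDer φ).algebraMap rfl r

/-- The augmentation of `S U` retracts `Λ W ⊗ S U` to `Λ W`, where `ι` has a left inverse. -/
theorem inclExt_injective : Function.Injective (inclExt : W → ExtSym W U) := by
  intro w w' h
  have h1 := congrArg (Algebra.TensorProduct.lift (AlgHom.id ℝ (ExteriorAlgebra ℝ W))
    ((Algebra.ofId ℝ (ExteriorAlgebra ℝ W)).comp SymmetricAlgebra.algebraMapInv)
    (fun a s => by
      rw [AlgHom.comp_apply, Algebra.ofId_apply]
      exact Algebra.commute_algebraMap_right _ a)) h
  simp only [inclExt_apply, Algebra.TensorProduct.lift_tmul, map_one, mul_one, AlgHom.id_apply] at h1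
  exact ExteriorAlgebra.ι_leftInverse.injective h1

end Algebra

/-! ## Calculus of cochains -/

section Calculus

/-- Families of maps `S^q → T`. -/
abbrev Coch (S T : Type*) : Type _ := ∀ q : ℕ, (Fin q → S) → T

variable {S T T' : Type*} [AddCommGroup S] [Module ℝ S] [AddCommGroup T] [Module ℝ T]
  [AddCommGroup T'] [Module ℝ T']

/-- Insertion into the first argument. -/
def ins (α : S) : Coch S T →ₗ[ℝ] Coch S T where
  toFun c q v := c (q + 1) (Fin.cons α v)
  map_add' _ _ := rfl
  map_smul' _ _ := rfl

/-- The parity operator `c^q ↦ (-1)^q c^q`. -/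
def eps : Coch S T →ₗ[ℝ] Coch S T where
  toFun c q v := (-1 : ℝ) ^ q • c q v
  map_add' _ _ := by ext; simp
  map_smul' r _ := by ext; exact smul_comm _ r _

/-- A linear map applied to the values. -/
def ptw (D : T →ₗ[ℝ] T') : Coch S T →ₗ[ℝ] Coch S T' where
  toFun c q v := D (c q v)
  map_add' _ _ := by ext; simp
  map_smul' _ _ := by ext; simp

/-- `c ↦ ∑ᵢ (-1)^i l(vᵢ)(c)(v₀, …, v̂ᵢ, …)`. -/
def actC (l : S → Coch S T →ₗ[ℝ] Coch S T') : Coch S T →ₗ[ℝ] Coch S T' where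
  toFun c q := match q with
    | 0 => fun _ => 0
    | q + 1 => fun v => ∑ i : Fin (q + 1), (-1 : ℝ) ^ (i : ℕ) • l (v i) c q (i.removeNth v)
  map_add' c c' := by
    ext q v; cases q <;> simp [Finset.sum_add_distrib]
  map_smul' r c := by
    ext q v; cases q <;> simp [Finset.smul_sum, smul_comm r]

/-- The entries of `v` with two of them omitted. -/
def omitPair {q : ℕ} (v : Fin (q + 2) → S) (j : Fin (q + 2)) (i : Fin (q + 1)) : Fin q → S :=
  fun l => v (j.succAbove (i.succAbove l))

/-- `c ↦ ∑_{i<j} (-1)^(i+j) o(vᵢ, vⱼ)(c)(v₀, …, v̂ᵢ, …, v̂ⱼ, …)`. -/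
def twoC (o : S → S → Coch S T →ₗ[ℝ] Coch S T') : Coch S T →ₗ[ℝ] Coch S T' where
  toFun c q := match q with
    | 0 => fun _ => 0
    | 1 => fun _ => 0
    | q + 2 => fun v => ∑ j : Fin (q + 2), ∑ i : Fin (q + 1), if i.castSucc < j then
        (-1 : ℝ) ^ ((i : ℕ) + (j : ℕ)) • o (v i.castSucc) (v j) c q (omitPair v j i) else 0
  map_add' c c' := by
    ext q v
    rcases q with _ | _ | q
    · simp
    · simp
    · simp only [Pi.add_apply, map_add, smul_add, ← Finset.sum_add_distrib]
      refine Finset.sum_congr rfl fun j _ => Finset.sum_congr rfl fun i _ => ?_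
      split_ifs <;> simp
  map_smul' r c := by
    ext q v
    rcases q with _ | _ | q
    · simp
    · simp
    · simp only [Pi.smul_apply, map_smul, Finset.smul_sum, RingHom.id_apply]
      refine Finset.sum_congr rfl fun j _ => Finset.sum_congr rfl fun i _ => ?_
      split_ifs <;> simp [smul_comm r]

theorem actC_zero_apply (l : S → Coch S T →ₗ[ℝ] Coch S T') (c : Coch S T) (v : Fin 0 → S) :
    actC l c 0 v = 0 := rfl

theorem actC_succ_apply (l : S → Coch S T →ₗ[ℝ] Coch S T') (c : Coch S T) (q : ℕ)
    (v : Fin (q + 1) → S) : actC l c (q + 1) v =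
      ∑ i : Fin (q + 1), (-1 : ℝ) ^ (i : ℕ) • l (v i) c q (i.removeNth v) := rfl

theorem twoC_zero_apply (o : S → S → Coch S T →ₗ[ℝ] Coch S T') (c : Coch S T) (v : Fin 0 → S) :
    twoC o c 0 v = 0 := rfl

theorem twoC_one_apply (o : S → S → Coch S T →ₗ[ℝ] Coch S T') (c : Coch S T) (v : Fin 1 → S) :
    twoC o c 1 v = 0 := rfl

theorem twoC_add_two_apply (o : S → S → Coch S T →ₗ[ℝ] Coch S T') (c : Coch S T) (q : ℕ)
    (v : Fin (q + 2) → S) : twoC o c (q + 2) v =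
      ∑ j : Fin (q + 2), ∑ i : Fin (q + 1), if i.castSucc < j then
        (-1 : ℝ) ^ ((i : ℕ) + (j : ℕ)) • o (v i.castSucc) (v j) c q (omitPair v j i) else 0 := rfl

theorem actC_congr {l l' : S → Coch S T →ₗ[ℝ] Coch S T'} {c c' : Coch S T}
    (h : ∀ β, l β c = l' β c') : actC l c = actC l' c' := by
  ext q v
  cases q with
  | zero => rfl
  | succ q => simp only [actC_succ_apply, h]

theorem twoC_congr {o o' : S → S → Coch S T →ₗ[ℝ] Coch S T'} {c c' : Coch S T}
    (h : ∀ α β, o α β c = o' α β c') : twoC o c = twoC o' c' := by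
  ext q v
  rcases q with _ | _ | q
  · rfl
  · rfl
  · simp only [twoC_add_two_apply, h]

theorem actC_add (l l' : S → Coch S T →ₗ[ℝ] Coch S T') (c : Coch S T) :
    actC (fun β => l β + l' β) c = actC l c + actC l' c := by
  ext q v
  cases q with
  | zero => simp [actC_zero_apply]
  | succ q => simp [actC_succ_apply, Finset.sum_add_distrib]

theorem actC_smul (r : ℝ) (l : S → Coch S T →ₗ[ℝ] Coch S T') (c : Coch S T) :
    actC (fun β => r • l β) c = r • actC l c := by
  ext q v
  cases q with
  | zero => simp [actC_zero_apply]
  | succ q => simp [actC_succ_apply, Finset.smul_sum, smul_comm r]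

theorem twoC_add (o o' : S → S → Coch S T →ₗ[ℝ] Coch S T') (c : Coch S T) :
    twoC (fun α β => o α β + o' α β) c = twoC o c + twoC o' c := by
  ext q v
  rcases q with _ | _ | q
  · simp [twoC_zero_apply]
  · simp [twoC_one_apply]
  · simp only [twoC_add_two_apply, Pi.add_apply, ← Finset.sum_add_distrib, LinearMap.add_apply]
    refine Finset.sum_congr rfl fun j _ => Finset.sum_congr rfl fun i _ => ?_
    split_ifs <;> simp

theorem twoC_smul (r : ℝ) (o : S → S → Coch S T →ₗ[ℝ] Coch S T') (c : Coch S T) :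
    twoC (fun α β => r • o α β) c = r • twoC o c := by
  ext q v
  rcases q with _ | _ | q
  · simp [twoC_zero_apply]
  · simp [twoC_one_apply]
  · simp only [twoC_add_two_apply, Pi.smul_apply, Finset.smul_sum, LinearMap.smul_apply]
    refine Finset.sum_congr rfl fun j _ => Finset.sum_congr rfl fun i _ => ?_
    split_ifs <;> simp [smul_comm r]

theorem removeNth_succ_cons {q : ℕ} (α : S) (v : Fin (q + 1) → S) (i : Fin (q + 1)) :
    (i.succ).removeNth (Fin.cons α v : Fin (q + 2) → S) = Fin.cons α (i.removeNth v) := by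
  ext l
  refine Fin.cases ?_ (fun l => ?_) l
  · simp [Fin.removeNth]
  · simp [Fin.removeNth]

/-- The term which uses the inserted argument splits off; all other positions shift by one, whence
the sign. Together with `ins_twoC` it replaces sums over positions by a recursion on the number of
arguments. -/
theorem ins_actC (γ : S) (l : S → Coch S T →ₗ[ℝ] Coch S T') (c : Coch S T) :
    ins γ (actC l c) = l γ c - actC (fun β => ins γ ∘ₗ l β) c := by
  ext q v
  change actC l c (q + 1) (Fin.cons γ v) = _ - actC _ c q v
  rw [actC_succ_apply, Fin.sum_univ_succ, sub_eq_add_neg]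
  congr 1
  · simp
  · cases q with
    | zero => simp [actC_zero_apply]
    | succ q =>
      rw [actC_succ_apply, ← Finset.sum_neg_distrib]
      refine Finset.sum_congr rfl fun i _ => ?_
      rw [removeNth_succ_cons, Fin.cons_succ, Fin.val_succ, pow_succ, mul_neg_one, neg_smul]
      rfl

theorem omitPair_succ_zero {q : ℕ} (α : S) (v : Fin (q + 1) → S) (j : Fin (q + 1)) :
    omitPair (Fin.cons α v : Fin (q + 2) → S) j.succ 0 = j.removeNth v := by
  ext l
  simp [omitPair, Fin.removeNth]

theorem omitPair_succ_succ {q : ℕ} (α : S) (v : Fin (q + 2) → S) (j : Fin (q + 2))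
    (i : Fin (q + 1)) :
    omitPair (Fin.cons α v : Fin (q + 3) → S) j.succ i.succ = Fin.cons α (omitPair v j i) := by
  ext l
  refine Fin.cases ?_ (fun l => ?_) l
  · simp [omitPair]
  · simp [omitPair]

/-- Pairs that contain the inserted argument give `-actC`. For the remaining pairs both indices
shift by one, so their sign does not change. -/
theorem ins_twoC (α : S) (o : S → S → Coch S T →ₗ[ℝ] Coch S T') (c : Coch S T) :
    ins α (twoC o c) = -actC (o α) c + twoC (fun β γ => ins α ∘ₗ o β γ) c := by
  ext q v
  change twoC o c (q + 1) (Fin.cons α v) = -actC _ c q v + twoC _ c q v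
  cases q with
  | zero => simp [twoC_zero_apply, twoC_one_apply, actC_zero_apply]
  | succ q =>
    -- No index lies below `j = 0`, so this part of the sum is zero.
    rw [twoC_add_two_apply, Fin.sum_univ_succ, Finset.sum_eq_zero (fun i _ => by simp), zero_add]
    rw [Finset.sum_congr rfl fun j _ => Fin.sum_univ_succ _, Finset.sum_add_distrib]
    congr 1
    · rw [actC_succ_apply, ← Finset.sum_neg_distrib]
      refine Finset.sum_congr rfl fun j _ => ?_
      rw [if_pos (show Fin.castSucc 0 < j.succ from Fin.succ_pos j), omitPair_succ_zero]
      simp [pow_succ]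
    · cases q with
      | zero => simp [twoC_one_apply]
      | succ q =>
        rw [twoC_add_two_apply]
        refine Finset.sum_congr rfl fun j _ => Finset.sum_congr rfl fun i _ => ?_
        rw [omitPair_succ_succ]
        have : (i.succ.castSucc < j.succ) ↔ i.castSucc < j := by
          rw [← Fin.succ_castSucc, Fin.succ_lt_succ_iff]
        simp only [this]
        refine if_congr Iff.rfl ?_ rfl
        rw [← Fin.succ_castSucc, Fin.cons_succ, Fin.cons_succ, Fin.val_succ, Fin.val_succ]
        rw [show (i : ℕ) + 1 + (j + 1) = i + j + 2 by ring, pow_add, neg_one_sq, mul_one]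
        rfl

/-! ### Induction over the number of arguments -/

/-- If every insertion reproduces the same expression in another cochain, induction on the number of
arguments kills it. The induction runs over all `c` with `P` at once, because `c` changes in each
step. This is the proof scheme for the cochain identities below. -/
theorem eq_zero_of_ins {P : Coch S T → Prop}
    {W : Coch S T → Coch S T'} (h0 : ∀ c, P c → ∀ v, W c 0 v = 0)
    (h : ∀ α c, P c → ∃ (s : ℝ) (c' : Coch S T), P c' ∧ ins α (W c) = s • W c')
    {c : Coch S T} (hc : P c) :
    W c = 0 := by
  have : ∀ q, ∀ c, P c → W c q = 0 := by
    intro q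
    induction q with
    | zero => intro c hc; ext v; exact h0 c hc v
    | succ q ih =>
      intro c hc
      ext v
      obtain ⟨s, c', hc', hs⟩ := h (v 0) c hc
      have h1 := congrFun (congrFun hs q) (Fin.tail v)
      have h2 : W c (q + 1) (Fin.cons (v 0) (Fin.tail v)) = s • W c' q (Fin.tail v) := h1
      rw [Fin.cons_self_tail, ih _ hc'] at h2
      simpa using h2
  ext q : 1
  exact this q c hc

/-- The cochains that are alternating and multilinear. -/
def altC : Submodule ℝ (Coch S T) where
  carrier := {c | ∀ q, ∃ g : AlternatingMap ℝ S T (Fin q), ⇑g = c q}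
  add_mem' := by
    rintro a b ha hb q
    obtain ⟨g, hg⟩ := ha q
    obtain ⟨g', hg'⟩ := hb q
    exact ⟨g + g', by ext; simp [← hg, ← hg']⟩
  zero_mem' := fun q => ⟨0, rfl⟩
  smul_mem' := by
    rintro r a ha q
    obtain ⟨g, hg⟩ := ha q
    exact ⟨r • g, by ext; simp [← hg]⟩

theorem ins_mem_altC (α : S) {c : Coch S T} (hc : c ∈ altC) : ins α c ∈ altC := fun q => by
  obtain ⟨g, hg⟩ := hc (q + 1)
  exact ⟨g.curryLeft α, by ext v; exact congrFun hg (Fin.cons α v)⟩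

theorem ins_add {c : Coch S T} (hc : c ∈ altC) (α β : S) :
    ins (α + β) c = ins α c + ins β c := by
  ext q v
  obtain ⟨g, hg⟩ := hc (q + 1)
  have := congrArg (fun f => f v) (g.curryLeft.map_add α β)
  change c (q + 1) (Fin.cons (α + β) v) = c (q + 1) (Fin.cons α v) + c (q + 1) (Fin.cons β v)
  rw [← hg]
  exact this

theorem ins_smul {c : Coch S T} (hc : c ∈ altC) (r : ℝ) (α : S) :
    ins (r • α) c = r • ins α c := by
  ext q v
  obtain ⟨g, hg⟩ := hc (q + 1)
  have := congrArg (fun f => f v) (g.curryLeft.map_smul r α)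
  change c (q + 1) (Fin.cons (r • α) v) = r • c (q + 1) (Fin.cons α v)
  rw [← hg]
  exact this

theorem ins_zero {c : Coch S T} (hc : c ∈ altC) : ins 0 c = 0 := by
  simpa using ins_smul hc 0 0

theorem ins_neg {c : Coch S T} (hc : c ∈ altC) (α : S) : ins (-α) c = -ins α c := by
  simpa using ins_smul hc (-1) α

theorem ins_sub {c : Coch S T} (hc : c ∈ altC) (α β : S) :
    ins (α - β) c = ins α c - ins β c := by
  rw [sub_eq_add_neg, ins_add hc, ins_neg hc, sub_eq_add_neg]

theorem ins_ins_self {c : Coch S T} (hc : c ∈ altC) (α : S) : ins α (ins α c) = 0 := by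
  ext q v
  obtain ⟨g, hg⟩ := hc (q + 2)
  simp only [ins, LinearMap.coe_mk, AddHom.coe_mk, ← hg]
  exact g.map_eq_zero_of_eq _ (i := 0) (j := 1) rfl (by simp)

theorem ins_ins {c : Coch S T} (hc : c ∈ altC) (α β : S) :
    ins α (ins β c) = -ins β (ins α c) := by
  have h := ins_ins_self hc (α + β)
  rw [ins_add hc, ins_add (add_mem (ins_mem_altC α hc) (ins_mem_altC β hc)), map_add, map_add,
    ins_ins_self hc, ins_ins_self hc, zero_add, add_zero] at h
  exact eq_neg_of_add_eq_zero_left h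

/-- Currying the first argument leaves one thing to check: an equality between the first argument
and a later one. The later argument is moved to the second place, where `hself` applies. -/
theorem alternating_of_ins {c : Coch S T} {q : ℕ}
    (h : ∀ α, ∃ g : AlternatingMap ℝ S T (Fin q), ⇑g = ins α c q)
    (hadd : ∀ α β, ins (α + β) c = ins α c + ins β c)
    (hsmul : ∀ (r : ℝ) α, ins (r • α) c = r • ins α c)
    (hself : ∀ α, ins α (ins α c) = 0) :
    ∃ g : AlternatingMap ℝ S T (Fin (q + 1)), ⇑g = c (q + 1) := by
  choose g hg using h
  let G : S →ₗ[ℝ] AlternatingMap ℝ S T (Fin q) :=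
    { toFun := g
      map_add' := fun α β => by
        ext v; simp only [hg, hadd, AlternatingMap.add_apply]; rfl
      map_smul' := fun r α => by
        ext v; simp only [hg, hsmul, AlternatingMap.smul_apply]; rfl }
  let m : MultilinearMap ℝ (fun _ : Fin (q + 1) => S) T :=
    LinearMap.uncurryLeft (AlternatingMap.toMultilinearMapLM (S := ℝ) ∘ₗ G)
  have hm : ∀ v, m v = c (q + 1) v := fun v => by
    have : m v = g (v 0) (Fin.tail v) := rfl
    rw [this, hg]
    change c (q + 1) (Fin.cons (v 0) (Fin.tail v)) = _
    rw [Fin.cons_self_tail]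
  have key : ∀ (v : Fin (q + 1) → S) (j : Fin q), v 0 = v j.succ → c (q + 1) v = 0 := by
    intro v j hj
    rw [← Fin.cons_self_tail v]
    change ins (v 0) c q (Fin.tail v) = 0
    rw [← hg]
    cases q with
    | zero => exact j.elim0
    | succ q =>
      -- Up to sign, the entry equal to `v 0` is brought to the front of the tail.
      rw [← Fin.insertNth_self_removeNth j (Fin.tail v), AlternatingMap.map_insertNth, hg]
      have h2 := congrFun (congrFun (hself (v 0)) q) (j.removeNth (Fin.tail v))
      have : (Fin.tail v) j = v 0 := hj.symm
      rw [this]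
      change _ • ins (v 0) (ins (v 0) c) q (j.removeNth (Fin.tail v)) = 0
      rw [h2]; simp
  refine ⟨⟨m, ?_⟩, funext hm⟩
  intro v i j hij hne
  change m v = 0
  rw [hm]
  induction i using Fin.cases with
  | zero =>
    obtain ⟨j, rfl⟩ := Fin.exists_succ_eq.2 hne.symm
    exact key v j hij
  | succ i =>
    induction j using Fin.cases with
    | zero => exact key v i hij.symm
    | succ j =>
      rw [← hm]
      change g (v 0) (Fin.tail v) = 0
      exact (g (v 0)).map_eq_zero_of_eq _ hij (fun h => hne (congrArg _ h))

/-- The hypotheses range over all of `altC` because the induction passes from `c` to `c₂`. -/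
theorem mem_altC_of_ins {Z : Coch S T → Coch S T'}
    (h : ∀ c ∈ altC, ∀ α, ∃ c₁ ∈ altC, ∃ (s : ℝ), ∃ c₂ ∈ altC, ins α (Z c) = c₁ + s • Z c₂)
    (hadd : ∀ c ∈ altC, ∀ α β, ins (α + β) (Z c) = ins α (Z c) + ins β (Z c))
    (hsmul : ∀ c ∈ altC, ∀ (r : ℝ) α, ins (r • α) (Z c) = r • ins α (Z c))
    (hself : ∀ c ∈ altC, ∀ α, ins α (ins α (Z c)) = 0) {c : Coch S T} (hc : c ∈ altC) :
    Z c ∈ altC := by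
  intro q
  induction q generalizing c with
  | zero =>
    refine ⟨AlternatingMap.constOfIsEmpty ℝ S (Fin 0) (Z c 0 ![]), ?_⟩
    ext v
    rw [Subsingleton.elim v ![]]
    rfl
  | succ q ih =>
    refine alternating_of_ins (fun α => ?_) (hadd c hc) (hsmul c hc) (hself c hc)
    obtain ⟨c₁, h1, s, c₂, h2, e⟩ := h c hc α
    obtain ⟨g, hg⟩ := h1 q
    obtain ⟨g', hg'⟩ := ih h2
    exact ⟨g + s • g', by ext v; simp [e, hg, hg']⟩

/-! ### Relations -/

/-- `c ↦ ∑ᵢ (-1)^i a(vᵢ)(c(v₀, …, v̂ᵢ, …))`. -/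
def act (a : S → T →ₗ[ℝ] T') : Coch S T →ₗ[ℝ] Coch S T' := actC fun β => ptw (a β)

/-- `c ↦ ∑_{i<j} (-1)^(i+j) w(vᵢ, vⱼ)(c(v₀, …, v̂ᵢ, …, v̂ⱼ, …))`. -/
def two (w : S → S → T →ₗ[ℝ] T') : Coch S T →ₗ[ℝ] Coch S T' := twoC fun α β => ptw (w α β)

theorem eps_eps (c : Coch S T) : eps (eps c) = c := by
  ext q v
  simp [eps, smul_smul, ← mul_pow]

theorem ins_eps (α : S) (c : Coch S T) : ins α (eps c) = -eps (ins α c) := by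
  ext q v
  simp [eps, ins, pow_succ]

theorem ptw_eps (D : T →ₗ[ℝ] T') (c : Coch S T) : ptw D (eps c) = eps (ptw D c) := by
  ext q v
  simp [eps, ptw]

theorem ins_ptw (α : S) (D : T →ₗ[ℝ] T') (c : Coch S T) : ins α (ptw D c) = ptw D (ins α c) := rfl

theorem ptw_add (D D' : T →ₗ[ℝ] T') (c : Coch S T) : ptw (D + D') c = ptw D c + ptw D' c := rfl

theorem ptw_neg (D : T →ₗ[ℝ] T') (c : Coch S T) : ptw (-D) c = -ptw D c := rfl

theorem ptw_smul (r : ℝ) (D : T →ₗ[ℝ] T') (c : Coch S T) : ptw (r • D) c = r • ptw D c := rfl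

theorem ptw_mem_altC (D : T →ₗ[ℝ] T') {c : Coch S T} (hc : c ∈ altC) : ptw D c ∈ altC :=
  fun q => by
    obtain ⟨g, hg⟩ := hc q
    exact ⟨D.compAlternatingMap g, by ext v; simp [ptw, ← hg]⟩

theorem eps_mem_altC {c : Coch S T} (hc : c ∈ altC) : eps c ∈ altC := fun q => by
  obtain ⟨g, hg⟩ := hc q
  exact ⟨(-1 : ℝ) ^ q • g, by ext v; simp [eps, ← hg]⟩

theorem act_eps (a : S → T →ₗ[ℝ] T') (c : Coch S T) : act a (eps c) = -eps (act a c) := by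
  ext q v
  cases q with
  | zero => simp [act, actC_zero_apply, eps]
  | succ q =>
    simp only [act, actC_succ_apply, eps, ptw, LinearMap.coe_mk, AddHom.coe_mk, map_smul,
      Pi.neg_apply, Finset.smul_sum, ← Finset.sum_neg_distrib]
    refine Finset.sum_congr rfl fun i _ => ?_
    rw [smul_comm, pow_succ, mul_neg_one, neg_smul, neg_neg]

theorem two_eps (w : S → S → T →ₗ[ℝ] T') (c : Coch S T) : two w (eps c) = eps (two w c) := by
  ext q v
  rcases q with _ | _ | q
  · simp [two, twoC_zero_apply, eps]
  · simp [two, twoC_one_apply, eps]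
  · simp only [two, twoC_add_two_apply, eps, ptw, LinearMap.coe_mk, AddHom.coe_mk, map_smul,
      Finset.smul_sum]
    refine Finset.sum_congr rfl fun j _ => Finset.sum_congr rfl fun i _ => ?_
    split_ifs
    · rw [smul_comm, pow_add _ q 2]; simp
    · simp

theorem ins_act (γ : S) (a : S → T →ₗ[ℝ] T') (c : Coch S T) :
    ins γ (act a c) = ptw (a γ) c - act a (ins γ c) := ins_actC γ _ c

theorem ins_two (γ : S) (w : S → S → T →ₗ[ℝ] T') (c : Coch S T) :
    ins γ (two w c) = -act (w γ) c + two w (ins γ c) := ins_twoC γ _ c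

theorem act_ptw (a : S → T →ₗ[ℝ] T) (D : T →ₗ[ℝ] T) (c : Coch S T) :
    act a (ptw D c) = act (fun β => a β ∘ₗ D) c := rfl

theorem ptw_act (a : S → T →ₗ[ℝ] T) (D : T →ₗ[ℝ] T) (c : Coch S T) :
    ptw D (act a c) = act (fun β => D ∘ₗ a β) c := by
  ext q v
  cases q with
  | zero => simp [act, actC_zero_apply, ptw]
  | succ q => simp [act, actC_succ_apply, ptw]

theorem act_add (a b : S → T →ₗ[ℝ] T') (c : Coch S T) :
    act (fun β => a β + b β) c = act a c + act b c :=
  actC_add (fun β => ptw (a β)) (fun β => ptw (b β)) c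

theorem act_neg (a : S → T →ₗ[ℝ] T') (c : Coch S T) :
    act (fun β => -a β) c = -act a c := by
  rw [← neg_one_smul ℝ (act a c), act, act, ← actC_smul]
  exact actC_congr fun β => by rw [LinearMap.smul_apply, ptw_neg, neg_one_smul]

theorem two_add (w w' : S → S → T →ₗ[ℝ] T') (c : Coch S T) :
    two (fun α β => w α β + w' α β) c = two w c + two w' c :=
  twoC_add (fun α β => ptw (w α β)) (fun α β => ptw (w' α β)) c

theorem two_smul_apply (r : ℝ) (w : S → S → T →ₗ[ℝ] T') (c : Coch S T) :
    two (fun α β => r • w α β) c = r • two w c := twoC_smul r (fun α β => ptw (w α β)) c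

theorem act_mem_altC (a : S →ₗ[ℝ] T →ₗ[ℝ] T') {c : Coch S T} (hc : c ∈ altC) :
    act a c ∈ altC := by
  refine mem_altC_of_ins (Z := act a) (fun c hc α => ⟨_, ptw_mem_altC (a α) hc, -1, _,
    ins_mem_altC α hc, ?_⟩) (fun c hc α β => ?_) (fun c hc r α => ?_) (fun c hc α => ?_) hc
  · rw [ins_act, neg_one_smul, sub_eq_add_neg]
  · rw [ins_act, ins_act, ins_act, ins_add hc, map_add, map_add, ptw_add]; abel
  · rw [ins_act, ins_act, ins_smul hc, map_smul, map_smul, ptw_smul, smul_sub]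
  · rw [ins_act, map_sub, ins_act, ins_ptw, ins_ins_self hc, map_zero]; simp

/-- Two positions `i < j` can be removed in either order. The two orders carry opposite signs, since
removing the earlier entry first shifts the later one. -/
theorem act_act (a b : S → T →ₗ[ℝ] T) (c : Coch S T) :
    act a (act b c) = two (fun α β => a β ∘ₗ b α - a α ∘ₗ b β) c := by
  rw [← sub_eq_zero]
  refine eq_zero_of_ins (P := fun _ => True)
    (W := fun c => act a (act b c) - two (fun α β => a β ∘ₗ b α - a α ∘ₗ b β) c)
    (fun c _ v => by simp [act, two, actC_zero_apply, twoC_zero_apply])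
    (fun α c _ => ⟨1, ins α c, trivial, ?_⟩) trivial
  have e : act (fun β => a β ∘ₗ b α - a α ∘ₗ b β) c = act a (ptw (b α) c) - ptw (a α) (act b c) := by
    rw [act_ptw, ptw_act, sub_eq_add_neg, ← act_neg, ← act_add]
    simp only [sub_eq_add_neg]
  rw [map_sub, ins_act, ins_act, ins_two, e, map_sub, one_smul]
  abel

theorem act_two_add_two_act (a : S → T →ₗ[ℝ] T) (w : S → S → T →ₗ[ℝ] T)
    (h : ∀ α β γ, a α ∘ₗ w β γ = -(w β γ ∘ₗ a α)) (c : Coch S T) :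
    act a (two w c) + two w (act a c) = 0 := by
  refine eq_zero_of_ins (P := fun _ => True)
    (W := fun c => act a (two w c) + two w (act a c))
    (fun c _ v => by simp [act, two, actC_zero_apply, twoC_zero_apply])
    (fun α c _ => ⟨-1, ins α c, trivial, ?_⟩) trivial
  have e1 : ptw (a α) (two w c) + two w (ptw (a α) c) = 0 := by
    ext q v
    rcases q with _ | _ | q
    · simp [two, twoC_zero_apply, ptw]
    · simp [two, twoC_one_apply, ptw]
    · simp only [two, twoC_add_two_apply, ptw, LinearMap.coe_mk, AddHom.coe_mk, map_sum,
        Pi.add_apply, ← Finset.sum_add_distrib]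
      refine Finset.sum_eq_zero fun j _ => Finset.sum_eq_zero fun i _ => ?_
      have := fun β γ x => LinearMap.congr_fun (h α β γ) x
      simp only [LinearMap.comp_apply, LinearMap.neg_apply] at this
      split_ifs <;> simp [this]
  -- Operators that anticommute on values have commuting actions on cochains, by the antisymmetry in
  -- `act_act`.
  have e2 : act a (act (w α) c) - act (w α) (act a c) = 0 := by
    rw [act_act, act_act, sub_eq_add_neg, ← neg_one_smul ℝ, ← two_smul_apply, ← two_add]
    rw [show (fun α_1 β => a β ∘ₗ w α α_1 - a α_1 ∘ₗ w α β +
        (-1 : ℝ) • (w α β ∘ₗ a α_1 - w α α_1 ∘ₗ a β)) = fun _ _ => 0 by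
      ext β γ x; simp [h]]
    ext q v
    rcases q with _ | _ | q
    · rfl
    · rfl
    · simp [two, twoC_add_two_apply, ptw]
  rw [map_add, ins_act, ins_two, ins_two, ins_act, map_add, map_neg, map_sub, neg_one_smul]
  calc _ = (ptw (a α) (two w c) + two w (ptw (a α) c)) +
        (act a (act (w α) c) - act (w α) (act a c)) +
        -(act a (two w (ins α c)) + two w (act a (ins α c))) := by abel
    _ = _ := by rw [e1, e2, zero_add, zero_add]

section Bracket

variable (br : S →ₗ[ℝ] S →ₗ[ℝ] S)

/-- The terms of the Koszul formula with brackets. -/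
def brC : Coch S T →ₗ[ℝ] Coch S T := twoC fun α β => ins (br α β)

/-- `c ↦ ∑ⱼ c(v₀, …, [α, vⱼ], …)` for alternating `c`. -/
def subC (α : S) : Coch S T →ₗ[ℝ] Coch S T := actC fun β => ins (br α β)

theorem ins_subC (α γ : S) {c : Coch S T} (hc : c ∈ altC) :
    ins γ (subC br α c) = ins (br α γ) c + subC br α (ins γ c) := by
  rw [subC, ins_actC, sub_eq_add_neg]
  congr 1
  rw [← neg_one_smul ℝ, ← actC_smul]
  exact actC_congr fun β => by
    rw [LinearMap.smul_apply, LinearMap.comp_apply, ins_ins hc, neg_one_smul, neg_neg]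

/-- Cartan's formula for the bracket part of the Koszul differential: its anticommutator with an
insertion is, up to sign, the action of `α` on the arguments. -/
theorem ins_brC (α : S) {c : Coch S T} (hc : c ∈ altC) :
    ins α (brC br c) = -subC br α c - brC br (ins α c) := by
  rw [brC, ins_twoC, sub_eq_add_neg]
  congr 1
  rw [← neg_one_smul ℝ, ← twoC_smul]
  exact twoC_congr fun β γ => by
    rw [LinearMap.smul_apply, LinearMap.comp_apply, ins_ins hc, neg_one_smul]

theorem subC_add (α β : S) {c : Coch S T} (hc : c ∈ altC) :
    subC br (α + β) c = subC br α c + subC br β c := by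
  rw [subC, subC, subC, ← actC_add]
  exact actC_congr fun γ => by rw [map_add, LinearMap.add_apply, ins_add hc]; rfl

theorem subC_smul (r : ℝ) (α : S) {c : Coch S T} (hc : c ∈ altC) :
    subC br (r • α) c = r • subC br α c := by
  rw [subC, subC, ← actC_smul]
  exact actC_congr fun γ => by rw [map_smul, LinearMap.smul_apply, ins_smul hc]; rfl

theorem subC_mem_altC (α : S) {c : Coch S T} (hc : c ∈ altC) : subC br α c ∈ altC := by
  refine mem_altC_of_ins (Z := subC br α) (fun c hc γ => ⟨_, ins_mem_altC (br α γ) hc, 1, _,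
    ins_mem_altC γ hc, ?_⟩) (fun c hc β γ => ?_) (fun c hc r γ => ?_) (fun c hc γ => ?_) hc
  · rw [ins_subC br _ _ hc, one_smul]
  · rw [ins_subC br _ _ hc, ins_subC br _ _ hc, ins_subC br _ _ hc, map_add, ins_add hc,
      ins_add hc, map_add]; abel
  · rw [ins_subC br _ _ hc, ins_subC br _ _ hc, map_smul, ins_smul hc, ins_smul hc, map_smul,
      smul_add]
  · rw [ins_subC br _ _ hc, map_add, ins_subC br _ _ (ins_mem_altC _ hc), ins_ins_self hc,
      map_zero, ins_ins hc]
    simp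

theorem brC_mem_altC (hbr : ∀ α, br α α = 0) {c : Coch S T} (hc : c ∈ altC) : brC br c ∈ altC := by
  refine mem_altC_of_ins (Z := brC br) (fun c hc γ => ⟨_, neg_mem (subC_mem_altC br γ hc), -1, _,
    ins_mem_altC γ hc, ?_⟩) (fun c hc β γ => ?_) (fun c hc r γ => ?_) (fun c hc γ => ?_) hc
  · rw [ins_brC br _ hc, neg_one_smul, sub_eq_add_neg]
  · rw [ins_brC br _ hc, ins_brC br _ hc, ins_brC br _ hc, subC_add br _ _ hc, ins_add hc,
      map_add]; abel
  · rw [ins_brC br _ hc, ins_brC br _ hc, subC_smul br _ _ hc, ins_smul hc, map_smul,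
      smul_sub, smul_neg]
  · rw [ins_brC br _ hc, map_sub, map_neg, ins_subC br _ _ hc, hbr, ins_zero hc,
      ins_brC br _ (ins_mem_altC _ hc), ins_ins_self hc]
    simp

end Bracket

end Calculus

section Calculus

variable {S T T' : Type*} [AddCommGroup S] [Module ℝ S] [AddCommGroup T] [Module ℝ T]
  [AddCommGroup T'] [Module ℝ T']

/-! ### The Chevalley-Eilenberg relations -/

section Bracket

variable (br : S →ₗ[ℝ] S →ₗ[ℝ] S)

theorem ptw_brC (D : T →ₗ[ℝ] T') (c : Coch S T) : ptw D (brC br c) = brC br (ptw D c) := by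
  ext q v
  rcases q with _ | _ | q
  · simp [brC, twoC_zero_apply, ptw]
  · simp [brC, twoC_one_apply, ptw]
  · simp only [brC, twoC_add_two_apply, ptw, ins, LinearMap.coe_mk, AddHom.coe_mk, map_sum]
    refine Finset.sum_congr rfl fun j _ => Finset.sum_congr rfl fun i _ => ?_
    split_ifs <;> simp

theorem ptw_subC (α : S) (D : T →ₗ[ℝ] T') (c : Coch S T) :
    ptw D (subC br α c) = subC br α (ptw D c) := by
  ext q v
  rcases q with _ | q
  · simp [subC, actC_zero_apply, ptw]
  · simp [subC, actC_succ_apply, ptw, ins]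

theorem brC_eps (c : Coch S T) : brC br (eps c) = -eps (brC br c) := by
  ext q v
  rcases q with _ | _ | q
  · simp [brC, twoC_zero_apply, eps]
  · simp [brC, twoC_one_apply, eps]
  · simp only [brC, twoC_add_two_apply, eps, ins, LinearMap.coe_mk, AddHom.coe_mk,
      Finset.smul_sum, Pi.neg_apply, ← Finset.sum_neg_distrib]
    refine Finset.sum_congr rfl fun j _ => Finset.sum_congr rfl fun i _ => ?_
    split_ifs
    · rw [smul_comm, pow_succ _ (q + 1), mul_neg_one, neg_smul, neg_neg]
    · simp

theorem subC_act (α : S) (a : S →ₗ[ℝ] T →ₗ[ℝ] T') {c : Coch S T} (hc : c ∈ altC) :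
    subC br α (act a c) = act a (subC br α c) + act (fun β => a (br α β)) c := by
  rw [← sub_eq_zero]
  refine eq_zero_of_ins (P := fun c => c ∈ altC) (W := fun c => subC br α (act a c) -
    (act a (subC br α c) + act (fun β => a (br α β)) c))
    (fun c _ v => by simp [act, subC, actC_zero_apply])
    (fun γ c hc => ⟨-1, ins γ c, ins_mem_altC γ hc, ?_⟩) hc
  rw [map_sub, map_add, ins_subC br _ _ (act_mem_altC a hc), ins_act, ins_act, ins_act, ins_act,
    ins_subC br _ _ hc, map_sub, map_add, ← ptw_subC, neg_one_smul]
  abel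

/-- For `a = L` this cancels `act L ∘ act L` in `d²`; for `a = θ` it is the bracket part of the
commutator of `insC θ` with `d`. -/
theorem act_brC (a : S →ₗ[ℝ] T →ₗ[ℝ] T') {c : Coch S T} (hc : c ∈ altC) :
    act a (brC br c) + brC br (act a c) = two (fun α β => a (br α β)) c := by
  rw [← sub_eq_zero]
  refine eq_zero_of_ins (P := fun c => c ∈ altC) (W := fun c => act a (brC br c) +
    brC br (act a c) - two (fun α β => a (br α β)) c)
    (fun c _ v => by simp [act, two, brC, actC_zero_apply, twoC_zero_apply])
    (fun γ c hc => ⟨1, ins γ c, ins_mem_altC γ hc, ?_⟩) hc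
  rw [map_sub, map_add, ins_brC br _ (act_mem_altC a hc), ins_act, ins_act, ins_two,
    ins_brC br _ hc, subC_act br γ a hc, map_sub, map_sub, map_neg, ← ptw_brC, one_smul]
  abel

variable {br} (hbr : ∀ α, br α α = 0)
  (hJ : ∀ α β γ, br α (br β γ) + br β (br γ α) + br γ (br α β) = 0)

theorem bracket_antisymm (hbr : ∀ α, br α α = 0) (α β : S) : br α β = -br β α := by
  have h := hbr (α + β)
  rw [map_add, map_add, LinearMap.add_apply, LinearMap.add_apply, hbr, hbr, zero_add,
    add_zero] at h
  exact eq_neg_of_add_eq_zero_right h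

theorem bracket_bracket (hbr : ∀ α, br α α = 0)
    (hJ : ∀ α β γ, br α (br β γ) + br β (br γ α) + br γ (br α β) = 0) (α β γ : S) :
    br α (br β γ) = br (br α β) γ + br β (br α γ) := by
  have h := hJ α β γ
  rw [bracket_antisymm hbr γ α, map_neg, bracket_antisymm hbr γ (br α β)] at h
  rw [← sub_eq_zero, ← h]; abel

/-- The action on arguments represents the bracket up to sign. Here the Jacobi identity is used, and
through this lemma it reaches `subC_brC` and `brC_brC`. -/
theorem subC_subC (hbr : ∀ α, br α α = 0)
    (hJ : ∀ α β γ, br α (br β γ) + br β (br γ α) + br γ (br α β) = 0) (α β : S)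
    {c : Coch S T} (hc : c ∈ altC) :
    subC br α (subC br β c) - subC br β (subC br α c) + subC br (br α β) c = 0 := by
  refine eq_zero_of_ins (P := fun c => c ∈ altC) (W := fun c =>
    subC br α (subC br β c) - subC br β (subC br α c) + subC br (br α β) c)
    (fun c _ v => by simp [subC, actC_zero_apply])
    (fun γ c hc => ⟨1, ins γ c, ins_mem_altC γ hc, ?_⟩) hc
  rw [map_add, map_sub, ins_subC br _ _ (subC_mem_altC br β hc), ins_subC br _ _ hc,
    ins_subC br _ _ (subC_mem_altC br α hc), ins_subC br _ _ hc, ins_subC br _ _ hc,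
    ins_subC br _ _ hc, ins_subC br _ _ hc, map_add, map_add, bracket_bracket hbr hJ α β γ,
    ins_add hc, one_smul]
  abel

theorem subC_brC (hbr : ∀ α, br α α = 0)
    (hJ : ∀ α β γ, br α (br β γ) + br β (br γ α) + br γ (br α β) = 0) (α : S)
    {c : Coch S T} (hc : c ∈ altC) : subC br α (brC br c) = brC br (subC br α c) := by
  rw [← sub_eq_zero]
  refine eq_zero_of_ins (P := fun c => c ∈ altC) (W := fun c =>
    subC br α (brC br c) - brC br (subC br α c))
    (fun c _ v => by simp [subC, brC, actC_zero_apply, twoC_zero_apply])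
    (fun γ c hc => ⟨-1, ins γ c, ins_mem_altC γ hc, ?_⟩) hc
  rw [map_sub, ins_subC br _ _ (brC_mem_altC br hbr hc), ins_brC br _ hc, ins_brC br _ hc,
    ins_brC br _ (subC_mem_altC br α hc), ins_subC br _ _ hc, map_sub, map_neg, map_add,
    neg_one_smul]
  have h := subC_subC hbr hJ α γ hc
  rw [add_eq_zero_iff_neg_eq] at h
  rw [← h]
  abel

theorem brC_brC (hbr : ∀ α, br α α = 0)
    (hJ : ∀ α β γ, br α (br β γ) + br β (br γ α) + br γ (br α β) = 0)
    {c : Coch S T} (hc : c ∈ altC) : brC br (brC br c) = 0 := by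
  refine eq_zero_of_ins (P := fun c => c ∈ altC) (W := fun c => brC br (brC br c))
    (fun c _ v => by simp [brC, twoC_zero_apply])
    (fun γ c hc => ⟨1, ins γ c, ins_mem_altC γ hc, ?_⟩) hc
  rw [ins_brC br _ (brC_mem_altC br hbr hc), ins_brC br _ hc, map_sub, map_neg,
    subC_brC hbr hJ γ hc, one_smul]
  abel

end Bracket

/-! ### Exponentials -/

/-- `W` does not increase the number of arguments by less than a fixed number. -/
def IsLocal (W : Coch S T →ₗ[ℝ] Coch S T') : Prop :=
  ∃ n, ∀ c q, (∀ q' ≤ q + n, c q' = 0) → W c q = 0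

/-- `W` increases the number of arguments. -/
def Raises (W : Coch S T →ₗ[ℝ] Coch S T') : Prop :=
  ∀ c q, (∀ q' < q, c q' = 0) → W c q = 0

theorem Raises.isLocal {W : Coch S T →ₗ[ℝ] Coch S T'} (h : Raises W) : IsLocal W :=
  ⟨0, fun c q hc => h c q fun q' hq => hc q' (by omega)⟩

theorem IsLocal.add {W W' : Coch S T →ₗ[ℝ] Coch S T'} (h : IsLocal W) (h' : IsLocal W') :
    IsLocal (W + W') := by
  obtain ⟨n, hn⟩ := h
  obtain ⟨n', hn'⟩ := h'
  refine ⟨n + n', fun c q hc => ?_⟩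
  rw [LinearMap.add_apply, Pi.add_apply, hn c q fun q' hq => hc q' (by omega),
    hn' c q fun q' hq => hc q' (by omega), add_zero]

theorem IsLocal.smul {W : Coch S T →ₗ[ℝ] Coch S T'} (h : IsLocal W) (r : ℝ) :
    IsLocal (r • W) := by
  obtain ⟨n, hn⟩ := h
  exact ⟨n, fun c q hc => by rw [LinearMap.smul_apply, Pi.smul_apply, hn c q hc, smul_zero]⟩

theorem IsLocal.neg {W : Coch S T →ₗ[ℝ] Coch S T'} (h : IsLocal W) : IsLocal (-W) := by
  rw [← neg_one_smul ℝ W]; exact h.smul (-1)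

theorem IsLocal.sub {W W' : Coch S T →ₗ[ℝ] Coch S T'} (h : IsLocal W) (h' : IsLocal W') :
    IsLocal (W - W') := by
  rw [sub_eq_add_neg]; exact h.add h'.neg

theorem IsLocal.comp {T'' : Type*} [AddCommGroup T''] [Module ℝ T'']
    {W : Coch S T' →ₗ[ℝ] Coch S T''} {W' : Coch S T →ₗ[ℝ] Coch S T'}
    (h : IsLocal W) (h' : IsLocal W') : IsLocal (W ∘ₗ W') := by
  obtain ⟨n, hn⟩ := h
  obtain ⟨n', hn'⟩ := h'
  exact ⟨n + n', fun c q hc => hn _ _ fun q' hq => hn' _ _ fun q'' hq' => hc _ (by omega)⟩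

theorem isLocal_zero : IsLocal (0 : Coch S T →ₗ[ℝ] Coch S T') := ⟨0, fun _ _ _ => rfl⟩

theorem isLocal_ins (α : S) : IsLocal (ins α : Coch S T →ₗ[ℝ] Coch S T) :=
  ⟨1, fun c q hc => by ext v; exact congrFun (hc (q + 1) le_rfl) _⟩

theorem isLocal_ptw (D : T →ₗ[ℝ] T') : IsLocal (ptw D : Coch S T →ₗ[ℝ] Coch S T') :=
  ⟨0, fun c q hc => by ext v; simp [ptw, hc]⟩

theorem isLocal_eps : IsLocal (eps : Coch S T →ₗ[ℝ] Coch S T) :=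
  ⟨0, fun c q hc => by ext v; simp [eps, hc]⟩

theorem raises_act (a : S → T →ₗ[ℝ] T') : Raises (act a) := by
  intro c q hc
  cases q with
  | zero => rfl
  | succ q => ext v; simp [act, actC_succ_apply, ptw, hc]

theorem isLocal_two (w : S → S → T →ₗ[ℝ] T') : IsLocal (two w) := by
  refine ⟨0, fun c q hc => ?_⟩
  rcases q with _ | _ | q
  · rfl
  · rfl
  · ext v; simp [two, twoC_add_two_apply, ptw, hc q (by omega)]

theorem isLocal_brC (br : S →ₗ[ℝ] S →ₗ[ℝ] S) :
    IsLocal (brC br : Coch S T →ₗ[ℝ] Coch S T) := by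
  refine ⟨0, fun c q hc => ?_⟩
  rcases q with _ | _ | q
  · rfl
  · rfl
  · ext v; simp [brC, twoC_add_two_apply, ins, hc]

/-- The exponential of an operator that increases the number of arguments. -/
def expC (N : Coch S T →ₗ[ℝ] Coch S T) : Coch S T →ₗ[ℝ] Coch S T :=
  LinearMap.pi fun q => ∑ r ∈ Finset.range (q + 1),
    ((r.factorial : ℝ)⁻¹) • (LinearMap.proj q ∘ₗ N ^ r)

/-- The partial sum with `m` terms of the exponential series. -/
def expTrunc (N : Coch S T →ₗ[ℝ] Coch S T) (m : ℕ) (c : Coch S T) : Coch S T :=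
  ∑ r ∈ Finset.range m, ((r.factorial : ℝ)⁻¹) • (N ^ r) c

theorem expC_apply (N : Coch S T →ₗ[ℝ] Coch S T) (c : Coch S T) (q : ℕ) :
    expC N c q = expTrunc N (q + 1) c q := by
  simp [expC, expTrunc]

theorem Raises.pow_apply {N : Coch S T →ₗ[ℝ] Coch S T} (h : Raises N) (c : Coch S T) (r : ℕ) :
    ∀ q < r, (N ^ r) c q = 0 := by
  induction r with
  | zero => intro q hq; omega
  | succ r ih =>
    intro q hq
    rw [pow_succ', Module.End.mul_apply]
    exact h _ _ fun q' hq' => ih q' (by omega)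

theorem Raises.expC_eq {N : Coch S T →ₗ[ℝ] Coch S T} (h : Raises N) (c : Coch S T) {m q : ℕ}
    (hq : q < m) : expC N c q = expTrunc N m c q := by
  rw [expC_apply, expTrunc, expTrunc, Finset.sum_apply, Finset.sum_apply]
  refine Finset.sum_subset (fun r hr => ?_) fun r _ hr => ?_
  · simp only [Finset.mem_range] at hr ⊢; omega
  · simp only [Finset.mem_range] at hr
    rw [Pi.smul_apply, h.pow_apply c r q (by omega), smul_zero]

theorem expC_zero_apply {N : Coch S T →ₗ[ℝ] Coch S T} (c : Coch S T) :
    expC N c 0 = c 0 := by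
  rw [expC_apply]; simp [expTrunc]

/-- A local operator reads finitely many components at each `q`, and in those the exponential series
is a finite sum. -/
theorem Raises.local_expC {N : Coch S T →ₗ[ℝ] Coch S T} (h : Raises N)
    {W : Coch S T →ₗ[ℝ] Coch S T} (hW : IsLocal W) (c : Coch S T) (q : ℕ) :
    ∃ m₀, ∀ m, m₀ ≤ m → W (expC N c) q = W (expTrunc N m c) q := by
  obtain ⟨n, hn⟩ := hW
  refine ⟨q + n + 1, fun m hm => ?_⟩
  rw [← sub_eq_zero, ← Pi.sub_apply, ← map_sub]
  exact hn _ _ fun q' hq => by rw [Pi.sub_apply, h.expC_eq c (show q' < m by omega), sub_self]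

theorem expTerm_succ (N : Coch S T →ₗ[ℝ] Coch S T) (c : Coch S T) (r : ℕ) :
    N (((r.factorial : ℝ)⁻¹) • (N ^ r) c) =
      ((r : ℝ) + 1) • (((r + 1).factorial : ℝ)⁻¹) • (N ^ (r + 1)) c := by
  rw [map_smul, pow_succ', Module.End.mul_apply, smul_smul]
  congr 1
  rw [Nat.factorial_succ]
  push_cast
  have : (r : ℝ) + 1 ≠ 0 := by positivity
  field_simp

/-- Formally `exp(N) X exp(-N) = X + [N, X] + [N, [N, X]]/2`, the triple commutator being zero. The
relations are asked on a stable subspace `P` only, since those with the bracket hold for alternating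
cochains. -/
theorem expC_conj {N X Y Z : Coch S T →ₗ[ℝ] Coch S T} (hN : Raises N) (hX : IsLocal X)
    (hY : IsLocal Y) (hZ : IsLocal Z) {P : Submodule ℝ (Coch S T)}
    (hP : ∀ c ∈ P, N c ∈ P) (h1 : ∀ c ∈ P, N (X c) = X (N c) + Y c)
    (h2 : ∀ c ∈ P, N (Y c) = Y (N c) + Z c) (h3 : ∀ c ∈ P, N (Z c) = Z (N c))
    {c : Coch S T} (hc : c ∈ P) :
    expC N (X c) = X (expC N c) + Y (expC N c) + (2⁻¹ : ℝ) • Z (expC N c) := by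
  set a : ℕ → Coch S T := fun r => ((r.factorial : ℝ)⁻¹) • (N ^ r) c with ha
  set b : ℕ → Coch S T := fun r => ((r.factorial : ℝ)⁻¹) • (N ^ r) (X c) with hb
  have haP : ∀ r, a r ∈ P := by
    intro r
    refine P.smul_mem _ ?_
    induction r with
    | zero => exact hc
    | succ r ih => rw [pow_succ', Module.End.mul_apply]; exact hP _ ih
  have hNa : ∀ r : ℕ, N (a r) = ((r : ℝ) + 1) • a (r + 1) := expTerm_succ N c
  have hNb : ∀ r : ℕ, N (b r) = ((r : ℝ) + 1) • b (r + 1) := expTerm_succ N (X c)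
  have b0 : b 0 = X (a 0) := by simp [ha, hb]
  have b1 : b 1 = X (a 1) + Y (a 0) := by
    have h := hNb 0
    rw [b0, h1 _ (haP 0), hNa 0] at h
    simpa using h.symm
  -- Comparison of coefficients, by induction from `N (b r) = (r + 1) b (r + 1)` and the same rule
  -- for `a`.
  have b2 : ∀ r, b (r + 2) = X (a (r + 2)) + Y (a (r + 1)) + (2⁻¹ : ℝ) • Z (a r) := by
    clear_value a b
    intro r
    have hne : ((r + 1 : ℕ) : ℝ) + 1 ≠ 0 := by positivity
    apply smul_right_injective _ hne
    change _ • b (r + 2) = _ • _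
    rw [← hNb (r + 1)]
    induction r with
    | zero =>
      rw [b1, map_add, h1 _ (haP 1), h2 _ (haP 0), hNa 1, hNa 0]
      simp only [map_smul, smul_add, smul_smul]
      norm_num [two_smul]
      module
    | succ r ih =>
      have hne' : ((r + 1 : ℕ) : ℝ) + 1 ≠ 0 := by positivity
      have ih' : b (r + 2) = X (a (r + 2)) + Y (a (r + 1)) + (2⁻¹ : ℝ) • Z (a r) := by
        apply smul_right_injective _ hne'
        change _ • b (r + 2) = _ • _
        rw [← hNb (r + 1)]
        exact ih hne'
      rw [ih', map_add, map_add, map_smul, h1 _ (haP _), h2 _ (haP _), h3 _ (haP _), hNa, hNa,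
        hNa]
      simp only [map_smul]
      push_cast
      module
  -- The lengths `m + 2`, `m + 1`, `m` differ because `Y` and `Z` come with `a` shifted by one and
  -- by two.
  have hsum : ∀ m, expTrunc N (m + 2) (X c) = X (expTrunc N (m + 2) c) +
      Y (expTrunc N (m + 1) c) + (2⁻¹ : ℝ) • Z (expTrunc N m c) := by
    intro m
    change ∑ r ∈ Finset.range (m + 2), b r = X (∑ r ∈ Finset.range (m + 2), a r) +
      Y (∑ r ∈ Finset.range (m + 1), a r) + (2⁻¹ : ℝ) • Z (∑ r ∈ Finset.range m, a r)
    induction m with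
    | zero => simp [Finset.sum_range_succ, b0, b1, add_assoc]
    | succ m ih =>
      rw [Finset.sum_range_succ, ih, b2, Finset.sum_range_succ _ (m + 2),
        Finset.sum_range_succ _ (m + 1), Finset.sum_range_succ a m]
      simp only [map_add, smul_add]
      abel
  ext q : 1
  obtain ⟨m1, e1⟩ := hN.local_expC hX c q
  obtain ⟨m2, e2⟩ := hN.local_expC hY c q
  obtain ⟨m3, e3⟩ := hN.local_expC hZ c q
  rw [Pi.add_apply, Pi.add_apply, Pi.smul_apply, e1 (q + m1 + m2 + m3 + 2) (by omega),
    e2 (q + m1 + m2 + m3 + 1) (by omega), e3 (q + m1 + m2 + m3) (by omega),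
    hN.expC_eq (X c) (show q < q + m1 + m2 + m3 + 2 by omega), hsum]
  rfl

theorem expC_commute {N X : Coch S T →ₗ[ℝ] Coch S T} (hN : Raises N) (hX : IsLocal X)
    (h : ∀ c, N (X c) = X (N c)) (c : Coch S T) : expC N (X c) = X (expC N c) := by
  simpa using expC_conj (P := ⊤) hN hX isLocal_zero isLocal_zero (fun _ _ => trivial)
    (fun c _ => by simpa using h c) (fun _ _ => by simp) (fun _ _ => by simp) (c := c) trivial

theorem expC_mem_of_mem {N : Coch S T →ₗ[ℝ] Coch S T} {c : Coch S T}
    (hc : c ∈ altC) (hN : ∀ c ∈ altC, N c ∈ altC) : expC N c ∈ altC := fun q => by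
  rw [expC_apply]
  have : expTrunc N (q + 1) c ∈ altC := sum_mem fun r hr => Submodule.smul_mem _ _ (by
    clear hr
    induction r with
    | zero => exact hc
    | succ r ih => rw [pow_succ', Module.End.mul_apply]; exact hN _ ih)
  exact this q

end Calculus

section Calculus

variable {S T : Type*} [AddCommGroup S] [Module ℝ S] [AddCommGroup T] [Module ℝ T]

/-! ### The differential of the intrinsic complex -/

/-- The relations between the bracket, the Lie derivative and the boundary operator. -/
structure IsCartan (br : S →ₗ[ℝ] S →ₗ[ℝ] S) (L : S →ₗ[ℝ] T →ₗ[ℝ] T) (del : T →ₗ[ℝ] T) : Prop where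
  bracket_self : ∀ α, br α α = 0
  jacobi : ∀ α β γ, br α (br β γ) + br β (br γ α) + br γ (br α β) = 0
  lie_lie : ∀ α β x, L α (L β x) - L β (L α x) = L (br α β) x
  del_del : ∀ x, del (del x) = 0
  lie_del : ∀ α x, L α (del x) = del (L α x)

/-- The differential `br + L - (-1)^q ∂`. -/
def dC (br : S →ₗ[ℝ] S →ₗ[ℝ] S) (L : S →ₗ[ℝ] T →ₗ[ℝ] T) (del : T →ₗ[ℝ] T) :
    Coch S T →ₗ[ℝ] Coch S T :=
  brC br + act L - eps ∘ₗ ptw del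

theorem act_congr {a b : S → T →ₗ[ℝ] T} (h : ∀ β x, a β x = b β x) (c : Coch S T) :
    act a c = act b c := by
  have : a = b := funext fun β => LinearMap.ext (h β)
  rw [this]

theorem two_congr {a b : S → S → T →ₗ[ℝ] T} (h : ∀ α β x, a α β x = b α β x) (c : Coch S T) :
    two a c = two b c := by
  have : a = b := funext fun α => funext fun β => LinearMap.ext (h α β)
  rw [this]

theorem two_neg (w : S → S → T →ₗ[ℝ] T) (c : Coch S T) :
    two (fun α β => -w α β) c = -two w c := by
  rw [← neg_one_smul ℝ (two w c), ← two_smul_apply]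
  exact two_congr (fun α β x => by simp) c

theorem act_act_add (a b : S → T →ₗ[ℝ] T) (c : Coch S T) :
    act a (act b c) + act b (act a c) =
      two (fun α β => (b β ∘ₗ a α - a α ∘ₗ b β) - (b α ∘ₗ a β - a β ∘ₗ b α)) c := by
  rw [act_act, act_act, ← two_add]
  exact two_congr (fun α β x => by simp; abel) c

variable {br : S →ₗ[ℝ] S →ₗ[ℝ] S} {L : S →ₗ[ℝ] T →ₗ[ℝ] T} {del : T →ₗ[ℝ] T}

theorem ins_dC (α : S) {c : Coch S T} (hc : c ∈ altC) :
    ins α (dC br L del c) = ptw (L α) c - subC br α c - dC br L del (ins α c) := by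
  simp only [dC, LinearMap.sub_apply, LinearMap.add_apply, LinearMap.comp_apply, map_sub, map_add,
    ins_brC br α hc, ins_act, ins_eps, ins_ptw]
  abel

theorem IsCartan.dC_mem (h : IsCartan br L del) {c : Coch S T} (hc : c ∈ altC) :
    dC br L del c ∈ altC :=
  sub_mem (add_mem (brC_mem_altC br h.bracket_self hc) (act_mem_altC L hc))
    (eps_mem_altC (ptw_mem_altC del hc))

/-- The bracket part squares to zero by Jacobi, and `act L ∘ act L` cancels the mixed terms of `L`
with the bracket by `lie_lie`. The sign `(-1)^q` makes the `∂` term anticommute with the rest. -/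
theorem IsCartan.dC_dC (h : IsCartan br L del) {c : Coch S T} (hc : c ∈ altC) :
    dC br L del (dC br L del c) = 0 := by
  have e1 := act_brC br L hc
  have e2 : act L (act L c) = -two (fun α β => L (br α β)) c := by
    rw [act_act, ← two_neg]
    exact two_congr (fun α β x => by rw [LinearMap.neg_apply, ← h.lie_lie]; simp) c
  have e3 : act L (ptw del c) = ptw del (act L c) := by
    rw [act_ptw, ptw_act]
    exact act_congr (fun β x => h.lie_del β x) c
  have e4 : ptw del (ptw del c) = 0 := by
    ext q v; exact h.del_del _
  simp only [dC, LinearMap.sub_apply, LinearMap.add_apply, LinearMap.comp_apply, map_sub, map_add,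
    act_eps, brC_eps, ptw_eps, ptw_brC, brC_brC h.bracket_self h.jacobi hc, e2, e3, e4,
    ← e1, map_zero]
  abel

/-! ### Conjugation by the exponential of an insertion operator -/

/-- The operator `c^q ↦ (-1)^q c^q` applied to `c ↦ ∑ᵢ (-1)^i θ(vᵢ)(c(v₀, …, v̂ᵢ, …))`. -/
def insC (θ : S →ₗ[ℝ] T →ₗ[ℝ] T) : Coch S T →ₗ[ℝ] Coch S T := eps ∘ₗ act θ

theorem raises_insC (θ : S →ₗ[ℝ] T →ₗ[ℝ] T) : Raises (insC θ) := fun c q hc => by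
  ext v
  simp [insC, eps, raises_act θ c q hc]

theorem insC_mem (θ : S →ₗ[ℝ] T →ₗ[ℝ] T) {c : Coch S T} (hc : c ∈ altC) : insC θ c ∈ altC :=
  eps_mem_altC (act_mem_altC θ hc)

theorem expC_mem (θ : S →ₗ[ℝ] T →ₗ[ℝ] T) {c : Coch S T} (hc : c ∈ altC) :
    expC (insC θ) c ∈ altC :=
  expC_mem_of_mem hc fun _ h => insC_mem θ h

theorem ins_insC (α : S) (θ : S →ₗ[ℝ] T →ₗ[ℝ] T) (c : Coch S T) :
    ins α (insC θ c) = insC θ (ins α c) - eps (ptw (θ α) c) := by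
  simp only [insC, LinearMap.comp_apply, ins_eps, ins_act, map_sub]
  abel

theorem act_eq_neg {θ : S →ₗ[ℝ] T →ₗ[ℝ] T} {κ : T →ₗ[ℝ] T}
    (h : ∀ γ x, θ γ (κ x) = -κ (θ γ x)) (c : Coch S T) :
    act θ (ptw κ c) = -ptw κ (act θ c) := by
  rw [act_ptw, ptw_act, ← act_neg]
  exact act_congr (fun β x => h β x) c

theorem expC_eps_ptw {θ : S →ₗ[ℝ] T →ₗ[ℝ] T} {κ : T →ₗ[ℝ] T}
    (h : ∀ γ x, θ γ (κ x) = -κ (θ γ x)) (c : Coch S T) :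
    expC (insC θ) (eps (ptw κ c)) = eps (ptw κ (expC (insC θ) c)) := by
  refine expC_commute (X := eps ∘ₗ ptw κ) (raises_insC θ) (isLocal_eps.comp (isLocal_ptw κ))
    (fun c => ?_) c
  simp only [insC, LinearMap.comp_apply, act_eps, ptw_eps, act_eq_neg h, map_neg, neg_neg]

theorem expC_ptw {θ : S →ₗ[ℝ] T →ₗ[ℝ] T} {κ : T →ₗ[ℝ] T}
    (h : ∀ γ x, θ γ (κ x) = κ (θ γ x)) (c : Coch S T) :
    expC (insC θ) (ptw κ c) = ptw κ (expC (insC θ) c) := by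
  refine expC_commute (X := ptw κ) (raises_insC θ) (isLocal_ptw κ) (fun c => ?_) c
  simp only [insC, LinearMap.comp_apply, ptw_eps, ptw_act, act_ptw]
  rw [act_congr (a := fun β => θ β ∘ₗ κ) (b := fun β => κ ∘ₗ θ β) (fun β x => h β x) c]

/-- The commutator of `insC θ` with an insertion is `eps ∘ ptw (θ α)`. It commutes with `insC θ` as
the `θ`'s anticommute, so the exponential contributes a single correction term. -/
theorem ins_expC {θ : S →ₗ[ℝ] T →ₗ[ℝ] T} (hθ : ∀ α β x, θ α (θ β x) = -θ β (θ α x)) (α : S)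
    (c : Coch S T) :
    ins α (expC (insC θ) c) = expC (insC θ) (ins α c - eps (ptw (θ α) c)) := by
  have h := expC_conj (P := ⊤) (X := ins α) (Y := eps ∘ₗ ptw (θ α)) (Z := 0) (raises_insC θ)
    (isLocal_ins α) (isLocal_eps.comp (isLocal_ptw _)) isLocal_zero (fun _ _ => trivial)
    (fun c _ => by rw [ins_insC]; simp)
    (fun c _ => by
      simp only [insC, LinearMap.comp_apply, act_eps, ptw_eps, act_eq_neg (fun γ => hθ γ α),
        map_neg, neg_neg, LinearMap.zero_apply, add_zero]) (fun _ _ => by simp) (c := c) trivial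
  rw [map_sub, h, expC_eps_ptw (fun γ => hθ γ α)]
  simp

/-- Anticommuting values make the operators `insC θ` and `insC θ'` commute, so exponents add.
Comparing insertions of both sides avoids the binomial expansion. -/
theorem expC_expC {θ θ' : S →ₗ[ℝ] T →ₗ[ℝ] T} (hθ : ∀ α β x, θ α (θ β x) = -θ β (θ α x))
    (hθ' : ∀ α β x, θ' α (θ' β x) = -θ' β (θ' α x))
    (hθθ' : ∀ α β x, θ α (θ' β x) = -θ' β (θ α x)) (c : Coch S T) :
    expC (insC θ) (expC (insC θ') c) = expC (insC (θ + θ')) c := by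
  rw [← sub_eq_zero]
  refine eq_zero_of_ins (P := fun _ => True)
    (W := fun c => expC (insC θ) (expC (insC θ') c) - expC (insC (θ + θ')) c)
    (fun c _ v => ?_)
    (fun α c _ => ⟨1, ins α c - eps (ptw (θ α + θ' α) c), trivial, ?_⟩) trivial
  · rw [Pi.sub_apply, expC_zero_apply, expC_zero_apply, expC_zero_apply]
    simp
  · have h : ∀ α β x, (θ + θ') α ((θ + θ') β x) = -(θ + θ') β ((θ + θ') α x) := by
      intro α β x
      simp only [LinearMap.add_apply, map_add]
      rw [hθ α β, hθ' α β, hθθ' α β, hθθ' β α]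
      abel
    rw [map_sub, ins_expC h, ins_expC hθ, ins_expC hθ']
    simp only [LinearMap.add_apply, ptw_add, one_smul, map_sub, map_add]
    rw [expC_eps_ptw (θ := θ') (κ := θ α) fun γ x => by rw [hθθ', neg_neg]]
    abel

theorem insC_zero : insC (0 : S →ₗ[ℝ] T →ₗ[ℝ] T) = 0 := by
  ext c q v
  have h : act (T := T) (T' := T) (⇑(0 : S →ₗ[ℝ] T →ₗ[ℝ] T)) c = 0 := by
    ext q v
    cases q with
    | zero => rfl
    | succ q => simp [act, actC_succ_apply, ptw]
  simp [insC, h]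

theorem expC_zero (c : Coch S T) : expC 0 c = c := by
  ext q : 1
  rw [expC_apply, expTrunc, Finset.sum_range_succ', Finset.sum_eq_zero]
  · simp
  · intro r _
    simp [pow_succ]

theorem expC_neg_expC {θ : S →ₗ[ℝ] T →ₗ[ℝ] T} (hθ : ∀ α β x, θ α (θ β x) = -θ β (θ α x))
    (c : Coch S T) : expC (insC (-θ)) (expC (insC θ) c) = c := by
  rw [expC_expC (fun α β x => by simp [hθ α β]) hθ (fun α β x => by simp [hθ α β])]
  rw [neg_add_cancel, insC_zero, expC_zero]

/-- The parity operator `eps` anticommutes with `insC θ`, so it reverses the sign of the exponent.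
-/
theorem expC_eps (θ : S →ₗ[ℝ] T →ₗ[ℝ] T) (c : Coch S T) :
    expC (insC θ) (eps c) = eps (expC (insC (-θ)) c) := by
  have h : ∀ r : ℕ, ∀ c, (insC θ ^ r) (eps c) = eps ((insC (-θ) ^ r) c) := by
    intro r
    induction r with
    | zero => intro c; rfl
    | succ r ih =>
      intro c
      rw [pow_succ, Module.End.mul_apply, pow_succ, Module.End.mul_apply, ← ih]
      congr 1
      have : act (⇑(-θ)) c = -act θ c := act_neg _ c
      simp only [insC, LinearMap.comp_apply, act_eps, this, map_neg]
  ext q v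
  rw [expC_apply]
  change _ = (-1 : ℝ) ^ q • expC (insC (-θ)) c q v
  rw [expC_apply]
  simp only [expTrunc, h, Finset.sum_apply, Pi.smul_apply, Finset.smul_sum]
  refine Finset.sum_congr rfl fun r _ => ?_
  simp only [eps, LinearMap.coe_mk, AddHom.coe_mk]
  rw [smul_comm]

/-- The twisted differential `br + bas + (-1)^q ∂ - (-1)^q R`. -/
def twistedC (br : S →ₗ[ℝ] S →ₗ[ℝ] S) (bas : S → T →ₗ[ℝ] T) (del : T →ₗ[ℝ] T)
    (R : S → S → T →ₗ[ℝ] T) : Coch S T →ₗ[ℝ] Coch S T :=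
  brC br + act bas + eps ∘ₗ ptw del - eps ∘ₗ two R

/-- The first commutator of `insC θ` with `dC` has the part `κ`, from `∂`, and the part `ω₁`, from
the bracket and `L`; the second commutator is `ω₂`, from `κ`. The third vanishes, because `θ`
anticommutes with both two-forms. The outer `eps` anticommutes with `brC` and `act` but commutes
with the `∂` and curvature terms, which turns `-∂` in `dC` into `+∂` in `twistedC` and produces the
overall minus sign. -/
theorem expC_dC {θ : S →ₗ[ℝ] T →ₗ[ℝ] T}
    {κ bas : S → T →ₗ[ℝ] T} {ω₁ ω₂ R : S → S → T →ₗ[ℝ] T}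
    (hκ : ∀ α x, κ α x = θ α (del x) + del (θ α x))
    (hbas : ∀ α x, bas α x = L α x + κ α x)
    (hω₁ : ∀ α β x, ω₁ α β x = θ (br α β) x + (L β (θ α x) - θ α (L β x)) -
      (L α (θ β x) - θ β (L α x)))
    (hω₂ : ∀ α β x, ω₂ α β x = (κ β (θ α x) - θ α (κ β x)) - (κ α (θ β x) - θ β (κ α x)))
    (hR : ∀ α β x, R α β x = ω₁ α β x + (2⁻¹ : ℝ) • ω₂ α β x)
    (hθω₁ : ∀ α β γ x, θ α (ω₁ β γ x) = -ω₁ β γ (θ α x))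
    (hθω₂ : ∀ α β γ x, θ α (ω₂ β γ x) = -ω₂ β γ (θ α x))
    {c : Coch S T} (hc : c ∈ altC) :
    eps (expC (insC θ) (dC br L del c)) = -twistedC br bas del R (eps (expC (insC θ) c)) := by
  have e1 : ∀ c ∈ altC, two ω₁ c = act θ (brC br c) + brC br (act θ c) +
      (act θ (act L c) + act L (act θ c)) := by
    intro c hc
    rw [act_brC br θ hc, act_act_add, ← two_add]
    exact two_congr (fun α β x => by rw [hω₁]; simp; abel) c
  have e2 : ∀ c, two ω₂ c = act θ (act κ c) + act κ (act θ c) := by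
    intro c
    rw [act_act_add]
    exact two_congr (fun α β x => by rw [hω₂]; simp) c
  have e3 : ∀ c, act κ c = act θ (ptw del c) + ptw del (act θ c) := by
    intro c
    rw [act_ptw, ptw_act, ← act_add]
    exact act_congr (fun β x => by rw [hκ]; simp) c
  have e4 : ∀ c, act θ (two ω₂ c) = -two ω₂ (act θ c) := fun c =>
    eq_neg_of_add_eq_zero_left
      (act_two_add_two_act _ _ (fun α β γ => LinearMap.ext (hθω₂ α β γ)) c)
  have e5 : ∀ c, act θ (two ω₁ c) = -two ω₁ (act θ c) := fun c =>
    eq_neg_of_add_eq_zero_left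
      (act_two_add_two_act _ _ (fun α β γ => LinearMap.ext (hθω₁ α β γ)) c)
  have key := expC_conj (N := insC θ) (P := altC) (X := dC br L del)
    (Y := act κ + eps ∘ₗ two ω₁) (Z := eps ∘ₗ two ω₂) (raises_insC θ)
    (((isLocal_brC br).add (raises_act _).isLocal).sub (isLocal_eps.comp (isLocal_ptw _)))
    ((raises_act _).isLocal.add (isLocal_eps.comp (isLocal_two _)))
    (isLocal_eps.comp (isLocal_two _)) (fun c hc => insC_mem θ hc)
    (fun c hc => by
      simp only [insC, dC, LinearMap.sub_apply, LinearMap.add_apply, LinearMap.comp_apply, map_sub,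
        map_add, act_eps, brC_eps, ptw_eps, eps_eps, e1 c hc, e3, map_neg]
      abel)
    (fun c hc => by
      simp only [insC, LinearMap.add_apply, LinearMap.comp_apply, map_add, act_eps, two_eps,
        eps_eps, e2, e5, map_neg]
      abel)
    (fun c hc => by
      simp only [insC, LinearMap.comp_apply, act_eps, two_eps, eps_eps, e4, map_neg, neg_neg]) hc
  have e6 : ∀ c, act bas c = act L c + act κ c := by
    intro c
    rw [← act_add]
    exact act_congr (fun β x => by rw [hbas]; simp) c
  have e7 : ∀ c, two R c = two ω₁ c + (2⁻¹ : ℝ) • two ω₂ c := by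
    intro c
    rw [← two_smul_apply, ← two_add]
    exact two_congr (fun α β x => by rw [hR]; simp) c
  rw [key]
  simp only [twistedC, dC, LinearMap.sub_apply, LinearMap.add_apply, LinearMap.comp_apply, map_sub,
    map_add, act_eps, brC_eps, ptw_eps, two_eps, eps_eps, e6, e7, map_smul]
  abel

end Calculus

section Calculus

variable {S T : Type*} [AddCommGroup S] [Module ℝ S] [AddCommGroup T] [Module ℝ T]

/-! ### Tail relations -/

/-- The relation `c(f α, …) = f c(α, …) + (-1)^q K_{f,α} c(…)`. -/
def IsTailed {Φ : Type*} (sm : Φ → S → S) (m : Φ → T →ₗ[ℝ] T) (K : Φ → S → T →ₗ[ℝ] T)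
    (c : Coch S T) : Prop :=
  ∀ f α, ins (sm f α) c = ptw (m f) (ins α c) + eps (ptw (K f α) c)

/-- The relation `c(f α, …) = f c(α, …)`. -/
def IsFormLinear {Φ : Type*} (sm : Φ → S → S) (m : Φ → T →ₗ[ℝ] T) (c : Coch S T) : Prop :=
  ∀ f α, ins (sm f α) c = ptw (m f) (ins α c)

variable {Φ : Type*} {sm : Φ → S → S} {m : Φ → T →ₗ[ℝ] T} {K : Φ → S → T →ₗ[ℝ] T}

/-- By `ins_expC` the exponential changes the insertion of `fα` by `θ(fα) = f θ(α) + K`; its `K`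
part cancels the tail. -/
theorem IsTailed.expC {c : Coch S T} (h : IsTailed sm m K c) {θ : S →ₗ[ℝ] T →ₗ[ℝ] T}
    (hθ : ∀ α β x, θ α (θ β x) = -θ β (θ α x)) (hm : ∀ f α x, θ α (m f x) = m f (θ α x))
    (hsm : ∀ f α x, θ (sm f α) x = m f (θ α x) + K f α x) :
    IsFormLinear sm m (expC (insC θ) c) := by
  intro f α
  have e : ∀ c : Coch S T, ptw (θ (sm f α)) c = ptw (m f) (ptw (θ α) c) + ptw (K f α) c := by
    intro c; ext q v; exact hsm f α _
  rw [ins_expC hθ, ins_expC hθ, h f α, ← expC_ptw (hm f)]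
  simp only [map_sub, map_add, ptw_eps, e]
  abel

/-- The converse, for `θ` with the opposite correction: the tail is created instead of removed. -/
theorem IsFormLinear.expC {c : Coch S T} (h : IsFormLinear sm m c) {θ : S →ₗ[ℝ] T →ₗ[ℝ] T}
    (hθ : ∀ α β x, θ α (θ β x) = -θ β (θ α x)) (hm : ∀ f α x, θ α (m f x) = m f (θ α x))
    (hK : ∀ f α β x, θ β (K f α x) = -K f α (θ β x))
    (hsm : ∀ f α x, θ (sm f α) x = m f (θ α x) - K f α x) :
    IsTailed sm m K (expC (insC θ) c) := by
  intro f α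
  have e : ∀ c : Coch S T, ptw (θ (sm f α)) c = ptw (m f) (ptw (θ α) c) - ptw (K f α) c := by
    intro c; ext q v; exact hsm f α _
  rw [ins_expC hθ, ins_expC hθ, h f α, ← expC_ptw (hm f), ← expC_eps_ptw (hK f α)]
  simp only [map_sub, ptw_eps, e]
  abel

theorem IsFormLinear.expC_of_linear {c : Coch S T} (h : IsFormLinear sm m c)
    {θ : S →ₗ[ℝ] T →ₗ[ℝ] T}
    (hθ : ∀ α β x, θ α (θ β x) = -θ β (θ α x)) (hm : ∀ f α x, θ α (m f x) = m f (θ α x))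
    (hsm : ∀ f α x, θ (sm f α) x = m f (θ α x)) :
    IsFormLinear sm m (LieAlgebroidCohomology.expC (insC θ) c) := by
  intro f α
  have e : ∀ c : Coch S T, ptw (θ (sm f α)) c = ptw (m f) (ptw (θ α) c) := by
    intro c; ext q v; exact hsm f α _
  rw [ins_expC hθ, ins_expC hθ, h f α, ← expC_ptw (hm f)]
  simp only [map_sub, ptw_eps, e]

theorem IsFormLinear.eps {c : Coch S T} (h : IsFormLinear sm m c) :
    IsFormLinear sm m (eps c) := by
  intro f α
  rw [ins_eps, ins_eps, h f α, map_neg, ptw_eps]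

theorem IsFormLinear.smul {c : Coch S T} (h : IsFormLinear sm m c) (r : ℝ) :
    IsFormLinear sm m (r • c) := by
  intro f α
  rw [map_smul, map_smul, h f α, map_smul]

/-- The relations which involve functions. -/
structure IsLeibniz (br : S →ₗ[ℝ] S →ₗ[ℝ] S) (L : S →ₗ[ℝ] T →ₗ[ℝ] T) (del : T →ₗ[ℝ] T)
    (sm : Φ → S → S) (m : Φ → T →ₗ[ℝ] T) (K : Φ → S → T →ₗ[ℝ] T) (r : S → Φ → Φ) : Prop where
  bracket_smul : ∀ f α β, br (sm f α) β = sm f (br α β) - sm (r β f) α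
  lie_smul : ∀ f α x, L (sm f α) x = m f (L α x) - (K f α (del x) + del (K f α x))
  del_mul : ∀ f x, del (m f x) = m f (del x)
  lie_mul : ∀ f β x, L β (m f x) = m f (L β x) + m (r β f) x
  lie_contract : ∀ f α β x, L β (K f α x) = K f α (L β x) + K (r β f) α x - K f (br α β) x

/-- Derivatives of `f` arise from `[fα, β]` and from `L_β(f ·)`, and they cancel. The terms `K f [α,
β]` and `K (ρ(β)f) α` from brackets cancel those from `L_β K`. What is left is `K ∂ + ∂ K` from
`L_{fα}`, of which `∂ K` is compensated by `∂` applied to the tail of `c`, and `K ∂` is the `∂` part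
of the tail of `dC c`. -/
theorem IsTailed.dC {br : S →ₗ[ℝ] S →ₗ[ℝ] S} {L : S →ₗ[ℝ] T →ₗ[ℝ] T} {del : T →ₗ[ℝ] T}
    {r : S → Φ → Φ} (hL : IsLeibniz br L del sm m K r) {c : Coch S T} (hc : c ∈ altC)
    (h : IsTailed sm m K c) : IsTailed sm m K (dC br L del c) := by
  intro f α
  have e1 : subC br (sm f α) c = ptw (m f) (subC br α c) - act (fun β => m (r β f)) (ins α c) +
      (act (fun β => K f (br α β)) (eps c) - act (fun β => K (r β f) α) (eps c)) := by
    have e0 : subC br (sm f α) c = actC (fun β => (ptw (m f) ∘ₗ ins (br α β) +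
        (-1 : ℝ) • (ptw (m (r β f)) ∘ₗ ins α)) + (ptw (K f (br α β)) ∘ₗ eps +
        (-1 : ℝ) • (ptw (K (r β f) α) ∘ₗ eps))) c := by
      refine actC_congr fun β => ?_
      rw [hL.bracket_smul, ins_sub hc, h, h]
      simp only [LinearMap.add_apply, LinearMap.smul_apply, LinearMap.comp_apply, ptw_eps]
      module
    rw [e0, actC_add, actC_add, actC_add, actC_smul, actC_smul]
    have e2 : actC (fun β => ptw (m f) ∘ₗ ins (br α β)) c = ptw (m f) (subC br α c) := by
      ext q v
      cases q with
      | zero => simp [actC_zero_apply, subC, ptw]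
      | succ q => simp [actC_succ_apply, subC, ptw]
    rw [e2]
    change _ + (-1 : ℝ) • act (fun β => m (r β f)) (ins α c) +
      (act (fun β => K f (br α β)) (eps c) + (-1 : ℝ) • act (fun β => K (r β f) α) (eps c)) = _
    module
  have e3 : act L (ptw (m f) (ins α c)) = ptw (m f) (act L (ins α c)) +
      act (fun β => m (r β f)) (ins α c) := by
    rw [act_ptw, ptw_act, ← act_add]
    exact act_congr (fun β x => by simp [hL.lie_mul]) _
  have e4 : act L (ptw (K f α) c) = ptw (K f α) (act L c) + (act (fun β => K (r β f) α) c -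
      act (fun β => K f (br α β)) c) := by
    rw [act_ptw, ptw_act, sub_eq_add_neg, ← act_neg, ← act_add, ← act_add]
    exact act_congr (fun β x => by simp [hL.lie_contract]; abel) _
  have e5 : ptw (L (sm f α)) c = ptw (m f) (ptw (L α) c) - (ptw (K f α) (ptw del c) +
      ptw del (ptw (K f α) c)) := by
    ext q v; exact hL.lie_smul f α _
  have e6 : ptw del (ptw (m f) (ins α c)) = ptw (m f) (ptw del (ins α c)) := by
    ext q v; exact hL.del_mul f _
  rw [ins_dC _ hc, ins_dC _ hc, h f α, e1, e5]
  simp only [LieAlgebroidCohomology.dC, LinearMap.sub_apply, LinearMap.add_apply,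
    LinearMap.comp_apply, map_sub, map_add, act_eps, brC_eps, ptw_eps, eps_eps, ptw_brC, e3, e4,
    e6]
  abel

end Calculus

/-! ## Smooth functions and sections -/

section Geometry

variable {E : Type*} [NormedAddCommGroup E] [NormedSpace ℝ E] [FiniteDimensional ℝ E]
  {M : Type*} [TopologicalSpace M] [ChartedSpace E M] [IsManifold 𝓘(ℝ, E) ∞ M]
  {F : Type*} [NormedAddCommGroup F] [NormedSpace ℝ F] [FiniteDimensional ℝ F]
  {V : M → Type*} [TopologicalSpace (TotalSpace F V)]
  [∀ x, AddCommGroup (V x)] [∀ x, Module ℝ (V x)] [∀ x, TopologicalSpace (V x)]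
  [∀ x, IsTopologicalAddGroup (V x)] [∀ x, ContinuousSMul ℝ (V x)]
  [FiberBundle F V] [VectorBundle ℝ F V] [ContMDiffVectorBundle ∞ F V 𝓘(ℝ, E)]

@[simp] theorem fsmul_apply (f : Func E M) (α : Sect E F V) (x : M) : fsmul f α x = f x • α x := rfl

@[simp] theorem sect_add_apply (α β : Sect E F V) (x : M) : (α + β) x = α x + β x := rfl

@[simp] theorem sect_sub_apply (α β : Sect E F V) (x : M) : (α - β) x = α x - β x := rfl

@[simp] theorem sect_neg_apply (α : Sect E F V) (x : M) : (-α) x = -α x := rfl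

@[simp] theorem sect_zero_apply (x : M) : (0 : Sect E F V) x = 0 := rfl

@[simp] theorem sect_smul_apply (r : ℝ) (α : Sect E F V) (x : M) : (r • α) x = r • α x := rfl

theorem sect_sum_apply {ι : Type*} (s : Finset ι) (α : ι → Sect E F V) (x : M) :
    (∑ i ∈ s, α i) x = ∑ i ∈ s, α i x := by
  classical
  induction s using Finset.induction_on with
  | empty => simp
  | insert i s hi ih => rw [Finset.sum_insert hi, Finset.sum_insert hi, sect_add_apply, ih]

theorem sect_ext {α β : Sect E F V} (h : ∀ x, α x = β x) : α = β := ContMDiffSection.ext h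

theorem func_ext {f g : Func E M} (h : ∀ x, f x = g x) : f = g := ContMDiffMap.ext h

@[simp] theorem func_add_apply (f g : Func E M) (x : M) : (f + g) x = f x + g x := rfl

@[simp] theorem func_sub_apply (f g : Func E M) (x : M) : (f - g) x = f x - g x := rfl

@[simp] theorem func_mul_apply (f g : Func E M) (x : M) : (f * g) x = f x * g x := rfl

@[simp] theorem func_one_apply (x : M) : (1 : Func E M) x = 1 := rfl

@[simp] theorem func_smul_apply (r : ℝ) (f : Func E M) (x : M) : (r • f) x = r * f x := rfl

theorem func_mdifferentiableAt (f : Func E M) (x : M) : MDifferentiableAt 𝓘(ℝ, E) 𝓘(ℝ) f x :=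
  (f.contMDiff x).mdifferentiableAt (by simp)

theorem sect_mdifferentiableAt (α : Sect E F V) (x : M) :
    MDifferentiableAt 𝓘(ℝ, E) (𝓘(ℝ, E).prod 𝓘(ℝ, F))
      (fun y => (⟨y, α y⟩ : TotalSpace F V)) x :=
  (α.contMDiff x).mdifferentiableAt (by simp)

/-! ### The differential of a function -/

theorem dAt_add (f g : Func E M) (x : M) : dAt (f + g) x = dAt f x + dAt g x := by
  have := mvfderiv_add (func_mdifferentiableAt f x) (func_mdifferentiableAt g x)
  ext v
  exact congrArg (fun l => l v) this

theorem dAt_mul (f g : Func E M) (x : M) : dAt (f * g) x = f x • dAt g x + g x • dAt f x := by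
  have := mvfderiv_mul (func_mdifferentiableAt f x) (func_mdifferentiableAt g x)
  ext v
  exact congrArg (fun l => l v) this

theorem dAt_const (r : ℝ) (x : M) : dAt (algebraMap ℝ (Func E M) r) x = 0 := by
  have := mvfderiv_const (I := 𝓘(ℝ, E)) r (x := x)
  ext v
  exact congrArg (fun l => l v) this

theorem dAt_smul (r : ℝ) (f : Func E M) (x : M) : dAt (r • f) x = r • dAt f x := by
  rw [Algebra.smul_def, dAt_mul, dAt_const, smul_zero, add_zero]
  rfl

/-! ### Germs -/

variable [T2Space M] [SigmaCompactSpace M]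

/-- The alternative at every `y` is what extension by zero needs: either local data are available
near `y`, or the product with `χ` vanishes near `y`. -/
theorem exists_bump {x : M} {u : Set M} (hu : u ∈ 𝓝 x) :
    ∃ χ : Func E M, (∀ᶠ y in 𝓝 x, χ y = 1) ∧ ∀ y, u ∈ 𝓝 y ∨ ∀ᶠ z in 𝓝 y, χ z = 0 := by
  have : LocallyCompactSpace M := Manifold.locallyCompact_of_finiteDimensional 𝓘(ℝ, E)
  obtain ⟨t, ht, htc, htu⟩ := exists_mem_nhds_isClosed_subset (interior_mem_nhds.2 hu)
  obtain ⟨χ, h1, h0, -⟩ := exists_contMDiffMap_one_nhds_of_subset_interior (n := ⊤) 𝓘(ℝ, E)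
    (isClosed_singleton (x := x)) (t := t) (by simpa using mem_interior_iff_mem_nhds.2 ht)
  refine ⟨χ, by simpa using h1, fun y => ?_⟩
  by_cases hy : y ∈ t
  · exact Or.inl (mem_interior_iff_mem_nhds.1 (htu hy))
  · right
    filter_upwards [htc.isOpen_compl.mem_nhds hy] with z hz using h0 z hz

theorem exists_func {x : M} {u : Set M} (hu : u ∈ 𝓝 x) {g : M → ℝ}
    (hg : ∀ y, u ∈ 𝓝 y → ContMDiffAt 𝓘(ℝ, E) 𝓘(ℝ) ∞ g y) :
    ∃ f : Func E M, ∀ᶠ y in 𝓝 x, f y = g y := by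
  obtain ⟨χ, h1, h0⟩ := exists_bump (E := E) hu
  refine ⟨⟨fun y => χ y * g y, fun y => ?_⟩, ?_⟩
  · rcases h0 y with hy | hy
    · exact (χ.contMDiff y).mul (hg y hy)
    · refine (contMDiffAt_const (c := (0 : ℝ))).congr_of_eventuallyEq ?_
      filter_upwards [hy] with z hz
      simp [hz]
  · filter_upwards [h1] with y hy
    change χ y * g y = g y
    rw [hy, one_mul]

theorem exists_sect {x : M} {u : Set M} (hu : u ∈ 𝓝 x) {σ : ∀ y, V y}
    (hσ : ∀ y, u ∈ 𝓝 y → ContMDiffAt 𝓘(ℝ, E) (𝓘(ℝ, E).prod 𝓘(ℝ, F)) ∞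
      (fun z => (⟨z, σ z⟩ : TotalSpace F V)) y) :
    ∃ α : Sect E F V, ∀ᶠ y in 𝓝 x, α y = σ y := by
  obtain ⟨χ, h1, h0⟩ := exists_bump (E := E) hu
  refine ⟨⟨fun y => χ y • σ y, fun y => ?_⟩, ?_⟩
  · rcases h0 y with hy | hy
    · exact (χ.contMDiff y).smul_section (hσ y hy)
    · refine ((0 : Sect E F V).contMDiff y).congr_of_eventuallyEq ?_
      filter_upwards [hy] with z hz
      simp [hz]
  · filter_upwards [h1] with y hy
    change χ y • σ y = σ y
    rw [hy, one_smul]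

/-- Near every point, the bundle has a frame consisting of global sections. -/
theorem exists_frame (x : M) : ∃ (ê : Fin (Module.finrank ℝ F) → Sect E F V)
    (l : ∀ y, V y →ₗ[ℝ] (Fin (Module.finrank ℝ F) → ℝ)),
    (∀ (α : Sect E F V) (i), ∃ f : Func E M, ∀ᶠ y in 𝓝 x, f y = l y (α y) i) ∧
    (∀ᶠ y in 𝓝 x, ∀ v : V y, v = ∑ i, l y v i • ê i y) ∧
    (∀ᶠ y in 𝓝 x, ∀ i, l y (ê i y) = Pi.single i 1) := by
  have : ContMDiffVectorBundle 1 F V 𝓘(ℝ, E) := ContMDiffVectorBundle.of_le (n := ∞) (by simp)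
  set e := trivializationAt F V x
  have hx : x ∈ e.baseSet := mem_baseSet_trivializationAt F V x
  have hu : e.baseSet ∈ 𝓝 x := e.open_baseSet.mem_nhds hx
  set b := Module.finBasis ℝ F
  have hê : ∀ i, ∃ α : Sect E F V, ∀ᶠ y in 𝓝 x, α y = e.localFrame b i y := fun i =>
    exists_sect hu fun y hy => contMDiffAt_localFrame_of_mem ∞ e b i (mem_of_mem_nhds hy)
  choose ê hê using hê
  have hê' : ∀ᶠ y in 𝓝 x, ∀ i, ê i y = e.localFrame b i y := Filter.eventually_all.2 hê
  have hc : ∀ y (hy : y ∈ e.baseSet) (v : V y) i,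
      e.localFrameCoeff 𝓘(ℝ, E) b i y v = (e.basisAt b hy).repr v i := by
    classical
    intro y hy v i
    -- The available formula concerns sections; it is applied to the section equal to `v` at `y` and
    -- zero elsewhere.
    have := e.localFrameCoeff_apply_of_mem_baseSet (I := 𝓘(ℝ, E)) b hy
      (Function.update (fun z => (0 : V z)) y v) i
    simpa only [Function.update_self] using this
  refine ⟨ê, fun y => LinearMap.pi fun i => e.localFrameCoeff 𝓘(ℝ, E) b i y, fun α i => ?_, ?_, ?_⟩
  · exact exists_func hu fun y hy =>
      contMDiffAt_localFrameCoeff b (mem_of_mem_nhds hy) (α.contMDiff y) i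
  · filter_upwards [hu, hê'] with y hy h v
    simp only [LinearMap.pi_apply, h, hc y hy, e.localFrame_apply_of_mem_baseSet b hy]
    exact ((e.basisAt b hy).sum_repr v).symm
  · filter_upwards [hu, hê'] with y hy h i
    ext j
    rw [h, LinearMap.pi_apply, hc y hy, e.localFrame_apply_of_mem_baseSet b hy,
      Module.Basis.repr_self, Finsupp.single_apply, Pi.single_apply]
    simp only [eq_comm]

theorem exists_sect_eq (x : M) (v : V x) : ∃ α : Sect E F V, α x = v := by
  obtain ⟨ê, l, -, h, -⟩ := exists_frame (E := E) (F := F) (V := V) x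
  refine ⟨∑ i, l x v i • ê i, ?_⟩
  rw [sect_sum_apply]
  exact (h.self_of_nhds v).symm

end Geometry

section Geometry

variable {E : Type*} [NormedAddCommGroup E] [NormedSpace ℝ E] [FiniteDimensional ℝ E]
  {M : Type*} [TopologicalSpace M] [ChartedSpace E M] [IsManifold 𝓘(ℝ, E) ∞ M]
  {F : Type*} [NormedAddCommGroup F] [NormedSpace ℝ F] [FiniteDimensional ℝ F]
  {V : M → Type*} [TopologicalSpace (TotalSpace F V)]
  [∀ x, AddCommGroup (V x)] [∀ x, Module ℝ (V x)] [∀ x, TopologicalSpace (V x)]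
  [∀ x, IsTopologicalAddGroup (V x)] [∀ x, ContinuousSMul ℝ (V x)]
  [FiberBundle F V] [VectorBundle ℝ F V] [ContMDiffVectorBundle ∞ F V 𝓘(ℝ, E)]

section Cobump

variable [T2Space M] [SigmaCompactSpace M]

theorem exists_cobump {x : M} {u : Set M} (hu : u ∈ 𝓝 x) :
    ∃ χ : Func E M, (∀ᶠ y in 𝓝 x, χ y = 0) ∧ ∀ y, y ∈ u ∨ χ y = 1 := by
  obtain ⟨χ, h1, h0⟩ := exists_bump (E := E) hu
  refine ⟨1 - χ, ?_, fun y => ?_⟩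
  · filter_upwards [h1] with y hy
    simp [hy]
  · rcases h0 y with hy | hy
    · exact Or.inl (mem_of_mem_nhds hy)
    · right; simp [hy.self_of_nhds]

/-- The usual locality device: by a Leibniz rule, a derivation applied to `χ f` vanishes at `x`,
since both factors vanish there. -/
theorem exists_mul_eq_self {f : Func E M} {x : M} (h : ∀ᶠ y in 𝓝 x, f y = 0) :
    ∃ χ : Func E M, (∀ᶠ y in 𝓝 x, χ y = 0) ∧ χ * f = f := by
  obtain ⟨χ, h0, h1⟩ := exists_cobump (E := E) h
  refine ⟨χ, h0, func_ext fun y => ?_⟩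
  rcases h1 y with hy | hy
  · have : f y = 0 := hy
    simp [this]
  · simp [hy]

theorem exists_fsmul_eq_self {α : Sect E F V} {x : M} (h : ∀ᶠ y in 𝓝 x, α y = 0) :
    ∃ χ : Func E M, (∀ᶠ y in 𝓝 x, χ y = 0) ∧ fsmul χ α = α := by
  obtain ⟨χ, h0, h1⟩ := exists_cobump (E := E) h
  refine ⟨χ, h0, sect_ext fun y => ?_⟩
  rcases h1 y with hy | hy
  · have : α y = 0 := hy
    simp [this]
  · simp [hy]

/-- The hypothesis concerns only products in which both factors vanish at `x`; so it covers
derivations as well as `C^∞(M)`-linear maps. -/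
theorem eq_of_eventuallyEq_of_fsmul {W : Type*} [AddCommGroup W] [Module ℝ W] {x : M}
    (κ : Sect E F V →ₗ[ℝ] W) (hκ : ∀ f α, f x = 0 → α x = 0 → κ (fsmul f α) = 0)
    {α β : Sect E F V} (h : ∀ᶠ y in 𝓝 x, α y = β y) : κ α = κ β := by
  obtain ⟨χ, h0, h1⟩ := exists_fsmul_eq_self (α := α - β) (x := x)
    (h.mono fun y hy => by simp [hy])
  rw [← sub_eq_zero, ← map_sub, ← h1]
  exact hκ _ _ h0.self_of_nhds (by simp [h.self_of_nhds])

/-- A `C^∞(M)`-linear map on sections is given by a linear map on every fibre. -/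
theorem exists_linearMap_of_tensorial {W : Type*} [AddCommGroup W] [Module ℝ W] {x : M}
    (κ : Sect E F V →ₗ[ℝ] W) (hκ : ∀ f α, κ (fsmul f α) = f x • κ α) :
    ∃ φ : V x →ₗ[ℝ] W, ∀ α, φ (α x) = κ α := by
  obtain ⟨ê, l, h1, h2, -⟩ := exists_frame (E := E) (F := F) (V := V) x
  refine ⟨∑ i, (LinearMap.proj i ∘ₗ l x).smulRight (κ (ê i)), fun α => ?_⟩
  choose f hf using h1 α
  have h3 : ∀ᶠ y in 𝓝 x, α y = (∑ i, fsmul (f i) (ê i)) y := by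
    filter_upwards [h2, Filter.eventually_all.2 hf] with y hy hy'
    rw [sect_sum_apply]
    simp only [fsmul_apply, hy']
    exact hy _
  rw [eq_of_eventuallyEq_of_fsmul κ (fun f α h _ => by rw [hκ, h, zero_smul]) h3, map_sum]
  simp only [hκ, (hf _).self_of_nhds]
  simp

/-! ### Tangent vectors as derivations -/

/-- The functional is read in the chart at `x`, whose differential at `x` is the identity, and cut
off. -/
theorem exists_dAt_eq (x : M) (φ : TangentSpace 𝓘(ℝ, E) x →ₗ[ℝ] ℝ) :
    ∃ f : Func E M, dAt f x = φ := by
  let ψ : E →L[ℝ] ℝ := LinearMap.toContinuousLinearMap (show E →ₗ[ℝ] ℝ from φ)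
  have hu : (chartAt E x).source ∈ 𝓝 x := chart_source_mem_nhds E x
  obtain ⟨f, hf⟩ := exists_func (E := E) (g := fun y => ψ (extChartAt 𝓘(ℝ, E) x y)) hu
    (fun y hy => by
      have h1 : ContMDiffAt 𝓘(ℝ, E) 𝓘(ℝ, E) ∞ (extChartAt 𝓘(ℝ, E) x) y :=
        contMDiffAt_extChartAt' (mem_of_mem_nhds hy)
      exact ψ.contMDiff.contMDiffAt.comp y h1)
  refine ⟨f, ?_⟩
  ext v
  have h1 : (f : M → ℝ) =ᶠ[𝓝 x] ψ ∘ extChartAt 𝓘(ℝ, E) x := hf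
  have h2 : mfderiv 𝓘(ℝ, E) 𝓘(ℝ) f x = ψ := by
    rw [h1.mfderiv_eq, mfderiv_comp x ψ.differentiableAt.mdifferentiableAt
      (mdifferentiableAt_extChartAt (mem_chart_source E x)), mfderiv_extChartAt_self,
      mfderiv_eq_fderiv, ψ.fderiv]
    rfl
  change mfderiv 𝓘(ℝ, E) 𝓘(ℝ) f x v = _
  rw [h2]
  rfl

theorem eq_zero_of_dAt {x : M} {v : TangentSpace 𝓘(ℝ, E) x} (h : ∀ f : Func E M, dAt f x v = 0) :
    v = 0 := by
  have h' : ∀ φ : E →ₗ[ℝ] ℝ, φ v = 0 := fun φ => by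
    obtain ⟨f, hf⟩ := exists_dAt_eq x φ
    rw [← hf]; exact h f
  exact (Module.forall_dual_apply_eq_zero_iff ℝ (V := E) v).1 h'

end Cobump

/-! ### Vector fields -/

@[simp] theorem vecDeriv_apply (X : VecField E M) (f : Func E M) (x : M) :
    vecDeriv X f x = dAt f x (X x) := rfl

theorem vecDeriv_add (X : VecField E M) (f g : Func E M) :
    vecDeriv X (f + g) = vecDeriv X f + vecDeriv X g :=
  func_ext fun x => by simp [dAt_add]

theorem vecDeriv_smul (X : VecField E M) (r : ℝ) (f : Func E M) :
    vecDeriv X (r • f) = r • vecDeriv X f :=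
  func_ext fun x => by simp [dAt_smul]

theorem vecDeriv_mul (X : VecField E M) (f g : Func E M) :
    vecDeriv X (f * g) = vecDeriv X f * g + f * vecDeriv X g :=
  func_ext fun x => by simp [dAt_mul]; ring

theorem vecField_mdifferentiableAt (X : VecField E M) (x : M) :
    MDifferentiableAt 𝓘(ℝ, E) 𝓘(ℝ, E).tangent (fun y => (X y : TangentBundle 𝓘(ℝ, E) M)) x :=
  sect_mdifferentiableAt X x

theorem vecBracket_self (X : VecField E M) : vecBracket X X = 0 :=
  sect_ext fun x => by
    change VectorField.mlieBracket 𝓘(ℝ, E) X X x = 0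
    simp

theorem vecBracket_add_right (X Y Z : VecField E M) :
    vecBracket X (Y + Z) = vecBracket X Y + vecBracket X Z :=
  sect_ext fun x => VectorField.mlieBracket_add_right (vecField_mdifferentiableAt Y x)
    (vecField_mdifferentiableAt Z x)

theorem vecBracket_swap (X Y : VecField E M) : vecBracket X Y = -vecBracket Y X :=
  sect_ext fun x => congrFun (VectorField.mlieBracket_swap (V := X) (W := Y)) x

theorem vecBracket_fsmul_right (X Y : VecField E M) (f : Func E M) :
    vecBracket X (fsmul f Y) = fsmul (vecDeriv X f) Y + fsmul f (vecBracket X Y) :=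
  sect_ext fun x => VectorField.mlieBracket_smul_right (func_mdifferentiableAt f x)
    (vecField_mdifferentiableAt Y x)

theorem vecBracket_smul_right (X Y : VecField E M) (r : ℝ) :
    vecBracket X (r • Y) = r • vecBracket X Y :=
  sect_ext fun x => VectorField.mlieBracket_const_smul_right (vecField_mdifferentiableAt Y x)

theorem vecBracket_jacobi (X Y Z : VecField E M) :
    vecBracket X (vecBracket Y Z) = vecBracket (vecBracket X Y) Z + vecBracket Y (vecBracket X Z) :=
  sect_ext fun x => by
    have : IsManifold 𝓘(ℝ, E) (minSmoothness ℝ 3) M := by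
      rw [minSmoothness_of_isRCLikeNormedField]
      exact IsManifold.of_le (n := ∞) 
        (WithTop.coe_le_coe.2 (le_top : (3 : ℕ∞) ≤ ⊤))
    refine VectorField.leibniz_identity_mlieBracket_apply (x := x) ?_ ?_ ?_
    all_goals
      rw [minSmoothness_of_isRCLikeNormedField]
    · exact (X.contMDiff x).of_le (WithTop.coe_le_coe.2 (le_top : (2 : ℕ∞) ≤ ⊤))
    · exact (Y.contMDiff x).of_le (WithTop.coe_le_coe.2 (le_top : (2 : ℕ∞) ≤ ⊤))
    · exact (Z.contMDiff x).of_le (WithTop.coe_le_coe.2 (le_top : (2 : ℕ∞) ≤ ⊤))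

variable (E M) in
/-- The tangent bundle as a Lie algebroid. -/
def tangentAlgebroid : LieAlgebroid E E (TangentSpace 𝓘(ℝ, E) : M → Type _) where
  anchor _ := LinearMap.id
  contMDiff_anchor := contMDiff_id
  bracket := LinearMap.mk₂ ℝ vecBracket
    (fun X Y Z => by
      rw [vecBracket_swap, vecBracket_add_right, neg_add, ← vecBracket_swap, ← vecBracket_swap])
    (fun r X Y => by
      rw [vecBracket_swap, vecBracket_smul_right, ← smul_neg, ← vecBracket_swap])
    vecBracket_add_right (fun r X Y => vecBracket_smul_right X Y r)
  bracket_self := vecBracket_self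
  jacobi X Y Z := by
    simp only [LinearMap.mk₂_apply]
    rw [vecBracket_jacobi X Y Z, vecBracket_swap Z X, vecBracket_swap Z (vecBracket X Y),
      vecBracket_swap Y (-vecBracket X Z), vecBracket_swap (-vecBracket X Z) Y]
    have : vecBracket Y (-vecBracket X Z) = -vecBracket Y (vecBracket X Z) := by
      simpa using vecBracket_smul_right Y (vecBracket X Z) (-1)
    rw [this]; simp
  leibniz f X Y x := by
    have h := congrArg (fun Z : VecField E M => Z x) (vecBracket_fsmul_right X Y f)
    exact h.trans (add_comm _ _)

namespace LieAlgebroid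

variable (A : LieAlgebroid E F V)

@[simp] theorem rho_apply (α : Sect E F V) (x : M) : A.rho α x = A.anchor x (α x) := rfl

theorem rho_add (α β : Sect E F V) : A.rho (α + β) = A.rho α + A.rho β :=
  sect_ext fun x => by simp

theorem rho_smul (r : ℝ) (α : Sect E F V) : A.rho (r • α) = r • A.rho α :=
  sect_ext fun x => by simp

theorem rho_fsmul (f : Func E M) (α : Sect E F V) : A.rho (fsmul f α) = fsmul f (A.rho α) :=
  sect_ext fun x => by simp

theorem bracket_swap (α β : Sect E F V) : A.bracket α β = -A.bracket β α :=
  bracket_antisymm A.bracket_self α β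

theorem bracket_fsmul_right (f : Func E M) (α β : Sect E F V) :
    A.bracket α (fsmul f β) = fsmul (vecDeriv (A.rho α) f) β + fsmul f (A.bracket α β) :=
  sect_ext fun x => (A.leibniz f α β x).trans (add_comm _ _)

theorem bracket_fsmul_left (f : Func E M) (α β : Sect E F V) :
    A.bracket (fsmul f α) β = fsmul f (A.bracket α β) - fsmul (vecDeriv (A.rho β) f) α := by
  rw [bracket_swap, bracket_fsmul_right, bracket_swap A β α]
  refine sect_ext fun x => ?_
  simp
  abel

theorem jacobi' (α β γ : Sect E F V) :
    A.bracket α (A.bracket β γ) = A.bracket (A.bracket α β) γ + A.bracket β (A.bracket α γ) :=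
  bracket_bracket A.bracket_self A.jacobi α β γ

variable [T2Space M] [SigmaCompactSpace M]

/-- Subtract `f` times the Jacobi identity for `α, β, γ` from the one for `α, β, f γ`. By the
Leibniz identity what remains is the difference of the two sides, multiplied by `γ`. Choose `γ`
nonzero at `x`; if the fibre is zero, both sides vanish. -/
theorem vecDeriv_rho_bracket (α β : Sect E F V) (f : Func E M) :
    vecDeriv (A.rho (A.bracket α β)) f =
      vecDeriv (A.rho α) (vecDeriv (A.rho β) f) - vecDeriv (A.rho β) (vecDeriv (A.rho α) f) := by
  refine func_ext fun x => ?_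
  by_cases hx : ∀ v : V x, v = 0
  · simp only [func_sub_apply, vecDeriv_apply, rho_apply, hx (α x), hx (β x),
      hx (A.bracket α β x), map_zero, sub_zero]
  · push Not at hx
    obtain ⟨v, hv⟩ := hx
    obtain ⟨γ, rfl⟩ := exists_sect_eq (E := E) (F := F) (V := V) x v
    have h := congrArg (fun δ : Sect E F V => δ x) (A.jacobi' α β (fsmul f γ))
    have h' := congrArg (fun δ : Sect E F V => f x • δ x) (A.jacobi' α β γ)
    simp only [bracket_fsmul_right, map_add, sect_add_apply, fsmul_apply, smul_add] at h h'
    rw [h', ← sub_eq_zero] at h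
    rw [← sub_eq_zero]
    refine (smul_eq_zero.1 ?_).resolve_right hv
    rw [← neg_eq_zero, ← h, func_sub_apply]
    module

end LieAlgebroid

section Bracket

variable [T2Space M] [SigmaCompactSpace M]

/-- For `TM` as a Lie algebroid, the Jacobi identity of vector fields already forces this formula.
-/
theorem vecDeriv_vecBracket (X Y : VecField E M) (f : Func E M) :
    vecDeriv (vecBracket X Y) f = vecDeriv X (vecDeriv Y f) - vecDeriv Y (vecDeriv X f) :=
  (tangentAlgebroid E M).vecDeriv_rho_bracket X Y f

theorem LieAlgebroid.rho_bracket (A : LieAlgebroid E F V) (α β : Sect E F V) :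
    A.rho (A.bracket α β) = vecBracket (A.rho α) (A.rho β) := by
  refine sect_ext fun x => sub_eq_zero.1 (eq_zero_of_dAt fun f => ?_)
  rw [map_sub, sub_eq_zero]
  change vecDeriv (A.rho (A.bracket α β)) f x = vecDeriv (vecBracket (A.rho α) (A.rho β)) f x
  rw [A.vecDeriv_rho_bracket, vecDeriv_vecBracket]

end Bracket

end Geometry

/-! ## Operators on smooth sections of `Λ A ⊗ S TM` -/

section TwistedDer

variable {B : Type*} [Ring B] [Algebra ℝ B] {p : B →ₐ[ℝ] B} {D D' Q Q' : B →ₗ[ℝ] B}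

theorem IsTwistedDer.lie (h : IsTwistedDer id D) (h' : IsTwistedDer p Q)
    (hp : ∀ x, p (D x) = D (p x)) : IsTwistedDer p (D ∘ₗ Q - Q ∘ₗ D) := fun s t => by
  have e1 := h' s t
  have e2 := h s t
  have e3 := h s (Q t)
  have e4 := h (Q s) (p t)
  have e5 := h' s (D t)
  have e6 := h' (D s) t
  simp only [id] at *
  simp only [LinearMap.sub_apply, LinearMap.comp_apply, e1, e2, map_add, e3, e4, e5, e6, hp,
    mul_sub, sub_mul]
  abel

theorem IsTwistedDer.lie_id (h : IsTwistedDer id D) (h' : IsTwistedDer id D') :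
    IsTwistedDer id (D ∘ₗ D' - D' ∘ₗ D) := fun s t => by
  have e1 := h' s t
  have e2 := h s t
  have e3 := h s (D' t)
  have e4 := h (D' s) t
  have e5 := h' s (D t)
  have e6 := h' (D s) t
  simp only [id] at *
  simp only [LinearMap.sub_apply, LinearMap.comp_apply, e1, e2, map_add, e3, e4, e5, e6,
    mul_sub, sub_mul]
  abel

theorem IsTwistedDer.smul {τ : B → B} (h : IsTwistedDer τ Q) (r : ℝ) :
    IsTwistedDer τ (r • Q) := fun s t => by
  simp only [LinearMap.smul_apply, h s t, smul_add, mul_smul_comm, smul_mul_assoc]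

theorem IsTwistedDer.mulLeft {τ : B → B} (h : IsTwistedDer τ Q) {f : B} (hf : ∀ x, f * x = x * f) :
    IsTwistedDer τ (LinearMap.mulLeft ℝ f ∘ₗ Q) := fun s t => by
  simp only [LinearMap.comp_apply, LinearMap.mulLeft_apply, h s t, mul_add]
  rw [← mul_assoc, hf s, mul_assoc, mul_assoc]

theorem IsTwistedDer.conj (hp : ∀ x, p (p x) = x) (h : IsTwistedDer p Q) :
    IsTwistedDer p (p.toLinearMap ∘ₗ Q ∘ₗ p.toLinearMap) := fun s t => by
  simp only [LinearMap.comp_apply, AlgHom.toLinearMap_apply, map_mul, h _ _, map_add, hp]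

theorem IsTwistedDer.conj_id (hp : ∀ x, p (p x) = x) (h : IsTwistedDer id Q) :
    IsTwistedDer id (p.toLinearMap ∘ₗ Q ∘ₗ p.toLinearMap) := fun s t => by
  have e := h (p s) (p t)
  simp only [id] at *
  simp only [LinearMap.comp_apply, AlgHom.toLinearMap_apply, map_mul, e, map_add, hp]

end TwistedDer

section Smooth

variable {E : Type*} [NormedAddCommGroup E] [NormedSpace ℝ E] [FiniteDimensional ℝ E]
  {M : Type*} [TopologicalSpace M] [ChartedSpace E M] [IsManifold 𝓘(ℝ, E) ∞ M]
  {F : Type*} [NormedAddCommGroup F] [NormedSpace ℝ F] [FiniteDimensional ℝ F]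
  {V : M → Type*} [TopologicalSpace (TotalSpace F V)]
  [∀ x, AddCommGroup (V x)] [∀ x, Module ℝ (V x)] [∀ x, TopologicalSpace (V x)]
  [∀ x, IsTopologicalAddGroup (V x)] [∀ x, ContinuousSMul ℝ (V x)]
  [FiberBundle F V] [VectorBundle ℝ F V] [ContMDiffVectorBundle ∞ F V 𝓘(ℝ, E)]

theorem ofFunc_apply (f : Func E M) (x : M) :
    (ofFunc f : Tensor E V) x = algebraMap ℝ _ (f x) := rfl

theorem ofSect_apply (α : Sect E F V) (x : M) : (ofSect α : Tensor E V) x = inclExt (α x) := rfl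

theorem ofVec_apply (X : VecField E M) (x : M) : (ofVec X : Tensor E V) x = inclSym (X x) := rfl

theorem ofFunc_mul_apply (f : Func E M) (s : Tensor E V) (x : M) :
    (ofFunc f * s : Tensor E V) x = f x • s x :=
  (Algebra.smul_def (f x) (s x)).symm

theorem polySections_le : polySections E F V ≤ smoothSections E F V :=
  fun s hs _ => ⟨s, hs, Filter.Eventually.of_forall fun _ => rfl⟩

theorem ofFunc_mem_poly (f : Func E M) : (ofFunc f : Tensor E V) ∈ polySections E F V :=
  Algebra.subset_adjoin (Or.inl (Or.inl ⟨f, rfl⟩))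

theorem ofSect_mem_poly (α : Sect E F V) : (ofSect α : Tensor E V) ∈ polySections E F V :=
  Algebra.subset_adjoin (Or.inl (Or.inr ⟨α, rfl⟩))

theorem ofVec_mem_poly (X : VecField E M) : (ofVec X : Tensor E V) ∈ polySections E F V :=
  Algebra.subset_adjoin (Or.inr ⟨X, rfl⟩)

theorem poly_induction {C : Tensor E V → Prop} (hf : ∀ f, C (ofFunc f))
    (hα : ∀ α : Sect E F V, C (ofSect α)) (hX : ∀ X, C (ofVec X))
    (hadd : ∀ s ∈ polySections E F V, ∀ t ∈ polySections E F V, C s → C t → C (s + t))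
    (hmul : ∀ s ∈ polySections E F V, ∀ t ∈ polySections E F V, C s → C t → C (s * t))
    {s : Tensor E V} (hs : s ∈ polySections E F V) : C s := by
  refine Algebra.adjoin_induction (p := fun s _ => C s) ?_ (fun r => ?_)
    (fun s t hs ht h h' => hadd s hs t ht h h') (fun s t hs ht h h' => hmul s hs t ht h h') hs
  · rintro s ((⟨f, rfl⟩ | ⟨α, rfl⟩) | ⟨X, rfl⟩)
    · exact hf f
    · exact hα α
    · exact hX X
  · exact hf (algebraMap ℝ (Func E M) r)

theorem mem_smooth_of_local {s : Tensor E V}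
    (h : ∀ x, ∃ t ∈ smoothSections E F V, ∀ᶠ y in 𝓝 x, s y = t y) : s ∈ smoothSections E F V := by
  intro x
  obtain ⟨t, ht, hst⟩ := h x
  obtain ⟨t', ht', htt'⟩ := ht x
  refine ⟨t', ht', ?_⟩
  filter_upwards [hst, htt'] with y h1 h2
  rw [h1, h2]

variable (E F V) in
/-- The algebra of smooth sections of `Λ A ⊗ S TM`. -/
def Smooth : Type _ := ↥(smoothSections E F V)

instance : Ring (Smooth E F V) := inferInstanceAs (Ring ↥(smoothSections E F V))

instance : Algebra ℝ (Smooth E F V) := inferInstanceAs (Algebra ℝ ↥(smoothSections E F V))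

namespace Smooth

/-- A smooth section, from its values. -/
def mk (s : Tensor E V) (hs : s ∈ smoothSections E F V) : Smooth E F V := Subtype.mk s hs

/-- A function, as a smooth section. -/
def func (f : Func E M) : Smooth E F V := mk (ofFunc f) (polySections_le (ofFunc_mem_poly f))

/-- A section of `A`, as a smooth section. -/
def sect (α : Sect E F V) : Smooth E F V := mk (ofSect α) (polySections_le (ofSect_mem_poly α))

/-- A vector field, as a smooth section. -/
def vec (X : VecField E M) : Smooth E F V := mk (ofVec X) (polySections_le (ofVec_mem_poly X))

theorem ext {s t : Smooth E F V} (h : ∀ x, s.1 x = t.1 x) : s = t := Subtype.ext (funext h)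

theorem func_mul_eq (f : Func E M) (s : Smooth E F V) : func f * s = s * func f :=
  ext fun x => Algebra.commutes (f x) (s.1 x)

theorem func_mul_apply (f : Func E M) (s : Smooth E F V) (x : M) :
    (func f * s).1 x = f x • s.1 x := ofFunc_mul_apply f s.1 x

theorem func_add (f g : Func E M) : (func (f + g) : Smooth E F V) = func f + func g :=
  ext fun x => map_add (algebraMap ℝ (ExtSym (V x) (TangentSpace 𝓘(ℝ, E) x))) (f x) (g x)

theorem func_sub (f g : Func E M) : (func (f - g) : Smooth E F V) = func f - func g :=
  ext fun x => map_sub (algebraMap ℝ (ExtSym (V x) (TangentSpace 𝓘(ℝ, E) x))) (f x) (g x)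

theorem func_mul (f g : Func E M) : (func (f * g) : Smooth E F V) = func f * func g :=
  ext fun x => map_mul (algebraMap ℝ (ExtSym (V x) (TangentSpace 𝓘(ℝ, E) x))) (f x) (g x)

theorem func_zero : (func 0 : Smooth E F V) = 0 :=
  ext fun x => map_zero (algebraMap ℝ (ExtSym (V x) (TangentSpace 𝓘(ℝ, E) x)))

theorem sect_add (α β : Sect E F V) : sect (α + β) = sect α + sect β :=
  ext fun x => map_add inclExt (α x) (β x)

theorem sect_sub (α β : Sect E F V) : sect (α - β) = sect α - sect β :=
  ext fun x => map_sub inclExt (α x) (β x)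

theorem sect_smul (r : ℝ) (α : Sect E F V) : sect (r • α) = r • sect α :=
  ext fun x => map_smul inclExt r (α x)

theorem sect_fsmul (f : Func E M) (α : Sect E F V) : sect (fsmul f α) = func f * sect α :=
  ext fun x => (map_smul inclExt (f x) (α x)).trans (func_mul_apply f (sect α) x).symm

theorem vec_add (X Y : VecField E M) : (vec (X + Y) : Smooth E F V) = vec X + vec Y :=
  ext fun x => map_add inclSym (X x) (Y x)

theorem vec_sub (X Y : VecField E M) : (vec (X - Y) : Smooth E F V) = vec X - vec Y :=
  ext fun x => map_sub inclSym (X x) (Y x)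

theorem vec_smul (r : ℝ) (X : VecField E M) : (vec (r • X) : Smooth E F V) = r • vec X :=
  ext fun x => map_smul inclSym r (X x)

theorem vec_fsmul (f : Func E M) (X : VecField E M) :
    (vec (fsmul f X) : Smooth E F V) = func f * vec X :=
  ext fun x => (map_smul inclSym (f x) (X x)).trans (func_mul_apply f (vec X) x).symm

end Smooth

/-! ### Twisted derivations are determined by their values on generators -/

section Unique

variable [T2Space M] [SigmaCompactSpace M]

namespace Smooth

theorem exists_func_mul_eq_self {s : Smooth E F V} {x : M} (h : ∀ᶠ y in 𝓝 x, s.1 y = 0) :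
    ∃ χ : Func E M, (∀ᶠ y in 𝓝 x, χ y = 0) ∧ func χ * s = s := by
  obtain ⟨χ, h0, h1⟩ := exists_cobump (E := E) h
  refine ⟨χ, h0, ext fun y => ?_⟩
  rw [func_mul_apply]
  rcases h1 y with hy | hy
  · have : s.1 y = 0 := hy
    rw [this]; exact smul_zero (χ y)
  · rw [hy]; exact one_smul ℝ (s.1 y)

/-- Write `s = χ s` with `χ` zero near `x`; in `χ K(s) + K(χ) τ(s)` both terms vanish at `x`. -/
theorem twistedDer_local {τ : Smooth E F V → Smooth E F V} {K : Smooth E F V →ₗ[ℝ] Smooth E F V}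
    (h : IsTwistedDer τ K) {x : M}
    (hf : ∀ χ : Func E M, (∀ᶠ y in 𝓝 x, χ y = 0) → (K (func χ)).1 x = 0)
    {s : Smooth E F V} (hs : ∀ᶠ y in 𝓝 x, s.1 y = 0) : (K s).1 x = 0 := by
  obtain ⟨χ, h0, h1⟩ := exists_func_mul_eq_self hs
  rw [← h1, h]
  change (func χ * K s).1 x + (K (func χ)).1 x * (τ s).1 x = 0
  rw [func_mul_apply, h0.self_of_nhds, hf χ h0]
  exact (congrArg₂ (· + ·) (zero_smul ℝ ((K s).1 x)) (zero_mul ((τ s).1 x))).trans (add_zero 0)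

/-- Generators settle the polynomial sections. A smooth section agrees with such a one only near
each point, and `twistedDer_local` bridges the gap. -/
theorem twistedDer_eq_zero {τ : Smooth E F V → Smooth E F V}
    {K : Smooth E F V →ₗ[ℝ] Smooth E F V} (h : IsTwistedDer τ K)
    (hf : ∀ f, K (func f) = 0) (hα : ∀ α, K (sect α) = 0) (hX : ∀ X, K (vec X) = 0) : K = 0 := by
  have hp : ∀ s (hs : s ∈ polySections E F V), K (mk s (polySections_le hs)) = 0 := by
    intro s hs
    refine poly_induction (C := fun s => ∀ hs : s ∈ smoothSections E F V, K (mk s hs) = 0)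
      (fun f _ => hf f) (fun α _ => hα α) (fun X _ => hX X) ?_ ?_ hs _
    · intro s hs t ht h1 h2 hst
      have : mk (s + t) hst =
        mk s (polySections_le hs) + mk t (polySections_le ht) := rfl
      rw [this, map_add, h1, h2, add_zero]
    · intro s hs t ht h1 h2 hst
      have : mk (s * t) hst =
        mk s (polySections_le hs) * mk t (polySections_le ht) := rfl
      rw [this, h, h1, h2, mul_zero, zero_mul, add_zero]
  refine LinearMap.ext fun s => ext fun x => ?_
  obtain ⟨t, ht, hst⟩ := s.2 x
  have h1 : (K (s - mk t (polySections_le ht))).1 x = 0 := by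
    refine twistedDer_local h (fun χ _ => by rw [hf]; rfl) ?_
    filter_upwards [hst] with y hy
    exact sub_eq_zero.2 hy
  rw [LinearMap.map_sub, hp t ht, sub_zero] at h1
  exact h1

theorem twistedDer_ext {τ : Smooth E F V → Smooth E F V}
    {Q Q' : Smooth E F V →ₗ[ℝ] Smooth E F V} (h : IsTwistedDer τ Q) (h' : IsTwistedDer τ Q')
    (hf : ∀ f, Q (func f) = Q' (func f)) (hα : ∀ α, Q (sect α) = Q' (sect α))
    (hX : ∀ X, Q (vec X) = Q' (vec X)) : Q = Q' :=
  sub_eq_zero.1 (twistedDer_eq_zero (h.sub h') (fun f => sub_eq_zero.2 (hf f))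
    (fun α => sub_eq_zero.2 (hα α)) (fun X => sub_eq_zero.2 (hX X)))

end Smooth

end Unique

/-! ### Fibrewise operators -/

section Fibrewise

/-- An operator on all sections given by operators on the fibres. -/
def fibrewise (Q : ∀ x : M, ExtSym (V x) (TangentSpace 𝓘(ℝ, E) x) →ₗ[ℝ]
    ExtSym (V x) (TangentSpace 𝓘(ℝ, E) x)) : Tensor E V →ₗ[ℝ] Tensor E V :=
  LinearMap.pi fun x => (Q x).comp (LinearMap.proj x)

/-- A fibrewise operator is local, so smoothness of its values can be tested on polynomial sections,
and there the product rule leaves only the generators. -/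
theorem fibrewise_mem {Q : ∀ x : M, ExtSym (V x) (TangentSpace 𝓘(ℝ, E) x) →ₗ[ℝ]
    ExtSym (V x) (TangentSpace 𝓘(ℝ, E) x)} {τ : Tensor E V → Tensor E V}
    (hQ : ∀ (s t : Tensor E V) x, Q x (s x * t x) = s x * Q x (t x) + Q x (s x) * τ t x)
    (hτ : ∀ s ∈ smoothSections E F V, τ s ∈ smoothSections E F V)
    (hf : ∀ f, fibrewise Q (ofFunc f) ∈ smoothSections E F V)
    (hα : ∀ α : Sect E F V, fibrewise Q (ofSect α) ∈ smoothSections E F V)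
    (hX : ∀ X, fibrewise Q (ofVec X) ∈ smoothSections E F V) {s : Tensor E V}
    (hs : s ∈ smoothSections E F V) : fibrewise Q s ∈ smoothSections E F V := by
  have hp : ∀ s ∈ polySections E F V, fibrewise Q s ∈ smoothSections E F V := by
    intro s hs
    refine poly_induction (C := fun s => fibrewise Q s ∈ smoothSections E F V) hf hα hX ?_ ?_ hs
    · intro s _ t _ h1 h2
      rw [map_add]; exact add_mem h1 h2
    · intro s hs t ht h1 h2
      have : fibrewise Q (s * t) = s * fibrewise Q t + fibrewise Q s * τ t := funext (hQ s t)
      rw [this]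
      exact add_mem (mul_mem (polySections_le hs) h2) (mul_mem h1 (hτ t (polySections_le ht)))
  refine mem_smooth_of_local fun x => ?_
  obtain ⟨t, ht, hst⟩ := hs x
  refine ⟨_, hp t ht, hst.mono fun y hy => ?_⟩
  change Q y (s y) = Q y (t y)
  rw [hy]

/-- The parity automorphism of all sections. -/
def parityT : Tensor E V →ₗ[ℝ] Tensor E V := fibrewise fun _ => parity.toLinearMap

theorem parityT_mem {s : Tensor E V} (hs : s ∈ smoothSections E F V) :
    parityT s ∈ smoothSections E F V := by
  have hp : ∀ s ∈ polySections E F V, parityT s ∈ smoothSections E F V := by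
    intro s hs
    refine poly_induction (C := fun s => parityT s ∈ smoothSections E F V) (fun f => ?_)
      (fun α => ?_) (fun X => ?_) ?_ ?_ hs
    · have : parityT (ofFunc f : Tensor E V) = ofFunc f := funext fun x =>
        AlgHom.commutes parity (f x)
      rw [this]; exact (Smooth.func f).2
    · have : parityT (ofSect α : Tensor E V) = (-Smooth.sect α).1 := 
        funext fun x => parity_inclExt (α x)
      rw [this]; exact (-Smooth.sect α).2
    · have : parityT (ofVec X : Tensor E V) = ofVec X := funext fun x =>
        parity_inclSym (X x)
      rw [this]; exact (Smooth.vec X).2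
    · intro s _ t _ h1 h2
      rw [map_add]; exact add_mem h1 h2
    · intro s _ t _ h1 h2
      have : parityT (s * t) = parityT s * parityT t := funext fun x => map_mul parity (s x) (t x)
      rw [this]
      exact mul_mem h1 h2
  refine mem_smooth_of_local fun x => ?_
  obtain ⟨t, ht, hst⟩ := hs x
  refine ⟨_, hp t ht, hst.mono fun y hy => ?_⟩
  change parity (s y) = parity (t y)
  rw [hy]

namespace Smooth

/-- The parity automorphism. -/
def par : Smooth E F V →ₐ[ℝ] Smooth E F V where
  toFun s := mk (parityT s.1) (parityT_mem s.2)
  map_one' := ext fun _ => map_one parity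
  map_mul' s t := ext fun x => map_mul parity (s.1 x) (t.1 x)
  map_zero' := ext fun _ => map_zero parity
  map_add' s t := ext fun x => map_add parity (s.1 x) (t.1 x)
  commutes' r := ext fun _ => AlgHom.commutes parity r

theorem par_par (s : Smooth E F V) : par (par s) = s := ext fun x => parity_parity (s.1 x)

@[simp] theorem par_func (f : Func E M) : par (func f : Smooth E F V) = func f :=
  ext fun x => AlgHom.commutes parity (f x)

@[simp] theorem par_sect (α : Sect E F V) : par (sect α) = -sect α :=
  ext fun x => parity_inclExt (α x)

@[simp] theorem par_vec (X : VecField E M) : par (vec X : Smooth E F V) = vec X :=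
  ext fun x => parity_inclSym (X x)

/-- The operator given by a fibrewise operator that preserves smooth sections. -/
def ofMem (Q : Tensor E V →ₗ[ℝ] Tensor E V)
    (hQ : ∀ s ∈ smoothSections E F V, Q s ∈ smoothSections E F V) :
    Smooth E F V →ₗ[ℝ] Smooth E F V where
  toFun s := mk (Q s.1) (hQ s.1 s.2)
  map_add' s t := Subtype.ext (map_add Q s.1 t.1)
  map_smul' r s := Subtype.ext (map_smul Q r s.1)

theorem sect_injective : Function.Injective (sect : Sect E F V → Smooth E F V) := by
  intro α β h
  refine sect_ext fun x => ?_
  have h1 : (inclExt (α x) : ExtSym (V x) (TangentSpace 𝓘(ℝ, E) x)) = inclExt (β x) :=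
    congrArg (fun s : Smooth E F V => s.1 x) h
  exact inclExt_injective h1

end Smooth

theorem fibrewise_slide_mem {κ : ∀ x : M, TangentSpace 𝓘(ℝ, E) x →ₗ[ℝ] V x}
    {K : VecField E M → Sect E F V} (hκ : ∀ X x, κ x (X x) = K X x) :
    ∀ s ∈ smoothSections E F V, fibrewise (fun x => slide (κ x)) s ∈ smoothSections E F V := by
  intro s hs
  refine fibrewise_mem (F := F) (τ := parityT) (fun s t x => slide_isDer (κ x) (s x) (t x))
    (fun s hs => parityT_mem hs) (fun f => ?_) (fun α => ?_) (fun X => ?_) hs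
  · have : fibrewise (fun x => slide (κ x)) (ofFunc f : Tensor E V) = 0 := funext fun x =>
      slide_algebraMap (κ x) (f x)
    rw [this]; exact zero_mem _
  · have : fibrewise (fun x => slide (κ x)) (ofSect α : Tensor E V) = 0 := funext fun x =>
      slide_inclExt (κ x) (α x)
    rw [this]; exact zero_mem _
  · have : fibrewise (fun x => slide (κ x)) (ofVec X : Tensor E V) = ofSect (K X) :=
      funext fun x => (slide_inclSym (κ x) (X x)).trans (congrArg inclExt (hκ X x))
    rw [this]; exact (Smooth.sect (K X)).2

theorem del_mem (A : LieAlgebroid E F V) :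
    ∀ s ∈ smoothSections E F V, A.del s ∈ smoothSections E F V := by
  intro s hs
  refine fibrewise_mem (F := F) (Q := fun x => boundary (A.anchor x)) (τ := parityT)
    (fun s t x => boundary_isDer (A.anchor x) (s x) (t x))
    (fun s hs => parityT_mem hs) (fun f => ?_) (fun α => ?_) (fun X => ?_) hs
  · have : fibrewise (fun x => boundary (A.anchor x)) (ofFunc f : Tensor E V) = 0 := funext fun x =>
      boundary_algebraMap (A.anchor x) (f x)
    rw [this]; exact zero_mem _
  · have : fibrewise (fun x => boundary (A.anchor x)) (ofSect α : Tensor E V) = ofVec (A.rho α) :=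
      funext fun x => boundary_inclExt (A.anchor x) (α x)
    rw [this]; exact (Smooth.vec _).2
  · have : fibrewise (fun x => boundary (A.anchor x)) (ofVec X : Tensor E V) = 0 :=
      funext fun x => boundary_inclSym (A.anchor x) (X x)
    rw [this]; exact zero_mem _

theorem contractD_mem (f : Func E M) :
    ∀ s ∈ smoothSections E F V, contractD f s ∈ smoothSections E F V := by
  intro s hs
  refine fibrewise_mem (F := F) (Q := fun x => contract (dAt f x)) (τ := id)
    (fun s t x => contract_isDer (dAt f x) (s x) (t x))
    (fun s hs => hs) (fun g => ?_) (fun α => ?_) (fun X => ?_) hs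
  · have : fibrewise (fun x => contract (dAt f x)) (ofFunc g : Tensor E V) = 0 := funext fun x =>
      contract_algebraMap (dAt f x) (g x)
    rw [this]; exact zero_mem _
  · have : fibrewise (fun x => contract (dAt f x)) (ofSect α : Tensor E V) = 0 :=
      funext fun x => contract_inclExt (dAt f x) (α x)
    rw [this]; exact zero_mem _
  · have : fibrewise (fun x => contract (dAt f x)) (ofVec X : Tensor E V) =
        ofFunc (vecDeriv X f) :=
      funext fun x => contract_inclSym (dAt f x) (X x)
    rw [this]; exact (Smooth.func _).2

end Fibrewise

end Smooth

/-! ## Existence of derivation extensions -/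

section Coefficients

variable {C B : Type*} [CommRing C] [Algebra ℝ C] [Ring B] [Algebra ℝ B]

/-- The evaluation `f ⊗ b ↦ ε(f) b`. -/
def evCoeff (ε : C →ₐ[ℝ] ℝ) : C ⊗[ℝ] B →ₐ[ℝ] B :=
  Algebra.TensorProduct.lift ((Algebra.ofId ℝ B).comp ε) (AlgHom.id ℝ B) fun f b => by
    rw [AlgHom.comp_apply, Algebra.ofId_apply]
    exact Algebra.commute_algebraMap_left _ _

/-- The map `f ⊗ b ↦ d(f) b`. -/
def derCoeff (d : C →ₗ[ℝ] ℝ) : C ⊗[ℝ] B →ₗ[ℝ] B :=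
  TensorProduct.lift (LinearMap.lsmul ℝ B ∘ₗ d)

theorem evCoeff_tmul (ε : C →ₐ[ℝ] ℝ) (f : C) (b : B) : evCoeff ε (f ⊗ₜ[ℝ] b) = ε f • b := by
  simp [evCoeff, Algebra.ofId_apply, Algebra.smul_def]

theorem derCoeff_tmul (d : C →ₗ[ℝ] ℝ) (f : C) (b : B) : derCoeff d (f ⊗ₜ[ℝ] b) = d f • b := rfl

theorem derCoeff_mul {ε : C →ₐ[ℝ] ℝ} {d : C →ₗ[ℝ] ℝ} (hd : ∀ f g, d (f * g) = d f * ε g + ε f * d g)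
    (z z' : C ⊗[ℝ] B) :
    derCoeff d (z * z') = derCoeff d z * evCoeff ε z' + evCoeff ε z * derCoeff d z' := by
  induction z using TensorProduct.induction_on with
  | zero => simp
  | add a b ha hb => simp only [add_mul, map_add, ha, hb]; abel
  | tmul f b =>
    induction z' using TensorProduct.induction_on with
    | zero => simp
    | add c d hc hd => simp only [mul_add, map_add, hc, hd]; abel
    | tmul g c =>
      simp only [Algebra.TensorProduct.tmul_mul_tmul, derCoeff_tmul, evCoeff_tmul, hd, add_smul,
        smul_mul_smul_comm]

/-- An element of `C ⊗ B` is a finite sum, so applying `φ` to its `B` factors gives an honest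
element of `C`, and no topology on `B` is needed. -/
theorem exists_pairing (φ : B →ₗ[ℝ] ℝ) (z : C ⊗[ℝ] B) :
    ∃ g : C, (∀ ε : C →ₐ[ℝ] ℝ, ε g = φ (evCoeff ε z)) ∧
      ∀ d : C →ₗ[ℝ] ℝ, d g = φ (derCoeff d z) := by
  induction z using TensorProduct.induction_on with
  | zero => exact ⟨0, by simp, by simp⟩
  | add a b ha hb =>
    obtain ⟨g, h1, h2⟩ := ha
    obtain ⟨g', h1', h2'⟩ := hb
    exact ⟨g + g', fun ε => by simp only [map_add, h1, h1'], fun d => by simp only [map_add, h2, h2']⟩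
  | tmul f b =>
    exact ⟨φ b • f, fun ε => by simp [evCoeff_tmul, mul_comm],
      fun d => by simp [derCoeff_tmul, mul_comm]⟩

theorem IsTwistedDer.add_mul_add_mul_add {R : B →ₗ[ℝ] B} (h : IsTwistedDer id R) (a b s t : B) :
    (a + R s) * t + s * (b + R t) = a * t + s * b + R (s * t) := by
  rw [h]
  simp only [id, add_mul, mul_add]
  abel

/-- A vector outside `N` is detected by a functional `φ` that kills `N`; pairing with `φ` reduces
the claim to a single coefficient `g`. -/
theorem derCoeff_mem {d : C →ₗ[ℝ] ℝ} {z : C ⊗[ℝ] B} {N : Submodule ℝ B}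
    (h : ∀ g : C, (∀ φ : B →ₗ[ℝ] ℝ, N ≤ LinearMap.ker φ →
      (∀ ε : C →ₐ[ℝ] ℝ, ε g = φ (evCoeff ε z)) → d g = 0)) : derCoeff d z ∈ N := by
  by_contra hz
  obtain ⟨φ, hφ, hN⟩ := Submodule.exists_le_ker_of_notMem hz
  obtain ⟨g, h1, h2⟩ := exists_pairing φ z
  exact hφ ((h2 d).symm.trans (h g φ hN h1))

end Coefficients

section Exists

variable {E : Type*} [NormedAddCommGroup E] [NormedSpace ℝ E] [FiniteDimensional ℝ E]
  {M : Type*} [TopologicalSpace M] [ChartedSpace E M] [IsManifold 𝓘(ℝ, E) ∞ M]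
  {F : Type*} [NormedAddCommGroup F] [NormedSpace ℝ F] [FiniteDimensional ℝ F]
  {V : M → Type*} [TopologicalSpace (TotalSpace F V)]
  [∀ x, AddCommGroup (V x)] [∀ x, Module ℝ (V x)] [∀ x, TopologicalSpace (V x)]
  [∀ x, IsTopologicalAddGroup (V x)] [∀ x, ContinuousSMul ℝ (V x)]
  [FiberBundle F V] [VectorBundle ℝ F V] [ContMDiffVectorBundle ∞ F V 𝓘(ℝ, E)]

variable (E M) in
/-- The evaluation of functions at a point. -/
def evalFunc (x : M) : Func E M →ₐ[ℝ] ℝ where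
  toFun f := f x
  map_one' := rfl
  map_mul' _ _ := rfl
  map_zero' := rfl
  map_add' _ _ := rfl
  commutes' _ := rfl

/-- `D` is a derivation of the `C^∞(M)`-module of sections along the derivation `δ`. -/
def IsDerivationAlong (δ : Func E M →ₗ[ℝ] Func E M) (D : Sect E F V →ₗ[ℝ] Sect E F V) : Prop :=
  ∀ f α, D (fsmul f α) = fsmul (δ f) α + fsmul f (D α)

section Local

variable [T2Space M] [SigmaCompactSpace M]

theorem IsDerivationAlong.congr {δ : Func E M →ₗ[ℝ] Func E M} {D : Sect E F V →ₗ[ℝ] Sect E F V}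
    (h : IsDerivationAlong δ D) {x : M} {α β : Sect E F V} (hα : ∀ᶠ y in 𝓝 x, α y = β y) :
    D α x = D β x := by
  let κ : Sect E F V →ₗ[ℝ] V x :=
    { toFun := fun α => D α x
      map_add' := fun α β => by rw [map_add]; rfl
      map_smul' := fun r α => by rw [map_smul]; rfl }
  refine eq_of_eventuallyEq_of_fsmul κ (fun f α hf hα => ?_) hα
  change D (fsmul f α) x = 0
  rw [h, sect_add_apply, fsmul_apply, fsmul_apply, hf, hα, smul_zero, zero_smul, add_zero]

/-- In a frame, a derivation is `δ` on the coefficients plus a matrix, whose columns are the values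
on the frame. -/
theorem IsDerivationAlong.frame {δ : Func E M →ₗ[ℝ] Func E M} {D : Sect E F V →ₗ[ℝ] Sect E F V}
    (h : IsDerivationAlong δ D) {x : M} {ê : Fin (Module.finrank ℝ F) → Sect E F V}
    {l : ∀ y, V y →ₗ[ℝ] (Fin (Module.finrank ℝ F) → ℝ)}
    (h1 : ∀ (α : Sect E F V) (i), ∃ f : Func E M, ∀ᶠ y in 𝓝 x, f y = l y (α y) i)
    (h2 : ∀ᶠ y in 𝓝 x, ∀ v : V y, v = ∑ i, l y v i • ê i y)
    (h3 : ∀ᶠ y in 𝓝 x, ∀ i, l y (ê i y) = Pi.single i 1) (α : Sect E F V) :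
    ∃ f : Fin (Module.finrank ℝ F) → Func E M, (∀ᶠ y in 𝓝 x, ∀ i, f i y = l y (α y) i) ∧
      l x (D α x) = (fun i => δ (f i) x) + ∑ i, l x (α x) i • l x (D (ê i) x) := by
  choose f hf using h1 α
  have hf' : ∀ᶠ y in 𝓝 x, ∀ i, f i y = l y (α y) i := Filter.eventually_all.2 hf
  refine ⟨f, hf', ?_⟩
  have h4 : ∀ᶠ y in 𝓝 x, α y = (∑ i, fsmul (f i) (ê i)) y := by
    filter_upwards [hf', h2] with y h5 h6
    rw [sect_sum_apply, h6 (α y)]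
    refine Finset.sum_congr rfl fun i _ => ?_
    rw [fsmul_apply, h5]
  rw [h.congr h4, map_sum, sect_sum_apply, map_sum]
  simp only [h _ _, sect_add_apply, fsmul_apply, map_add, map_smul, h3.self_of_nhds,
    Finset.sum_add_distrib, hf'.self_of_nhds]
  congr 1
  ext j
  simp [Finset.sum_apply, Pi.single_apply]

end Local

/-- The graph of the derivation extension of `(δ, DA, DT)` on sums of products of smooth functions
and sections. -/
inductive DerivationGraph (δ : Func E M →ₗ[ℝ] Func E M) (DA : Sect E F V →ₗ[ℝ] Sect E F V)
    (DT : VecField E M →ₗ[ℝ] VecField E M) : Tensor E V → Tensor E V → Prop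
  | func (f) : DerivationGraph δ DA DT (ofFunc f) (ofFunc (δ f))
  | sect (α) : DerivationGraph δ DA DT (ofSect α) (ofSect (DA α))
  | vec (X) : DerivationGraph δ DA DT (ofVec X) (ofVec (DT X))
  | add {s d t e} : DerivationGraph δ DA DT s d → DerivationGraph δ DA DT t e →
      DerivationGraph δ DA DT (s + t) (d + e)
  | smul {s d} (r : ℝ) : DerivationGraph δ DA DT s d → DerivationGraph δ DA DT (r • s) (r • d)
  | mul {s d t e} : DerivationGraph δ DA DT s d → DerivationGraph δ DA DT t e →
      DerivationGraph δ DA DT (s * t) (d * t + s * e)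

namespace DerivationGraph

variable {δ : Func E M →ₗ[ℝ] Func E M} {DA : Sect E F V →ₗ[ℝ] Sect E F V}
  {DT : VecField E M →ₗ[ℝ] VecField E M}

theorem mem {s d : Tensor E V} (h : DerivationGraph δ DA DT s d) :
    s ∈ polySections E F V ∧ d ∈ polySections E F V := by
  induction h with
  | func f => exact ⟨ofFunc_mem_poly _, ofFunc_mem_poly _⟩
  | sect α => exact ⟨ofSect_mem_poly _, ofSect_mem_poly _⟩
  | vec X => exact ⟨ofVec_mem_poly _, ofVec_mem_poly _⟩
  | add _ _ h1 h2 => exact ⟨add_mem h1.1 h2.1, add_mem h1.2 h2.2⟩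
  | smul r _ h => exact ⟨Subalgebra.smul_mem _ h.1 r, Subalgebra.smul_mem _ h.2 r⟩
  | mul _ _ h1 h2 =>
    exact ⟨mul_mem h1.1 h2.1, add_mem (mul_mem h1.2 h2.1) (mul_mem h1.1 h2.2)⟩

theorem exists_of_mem {s : Tensor E V} (hs : s ∈ polySections E F V) :
    ∃ d, DerivationGraph δ DA DT s d :=
  poly_induction (C := fun s => ∃ d, DerivationGraph δ DA DT s d) (fun f => ⟨_, func f⟩)
    (fun α => ⟨_, sect α⟩) (fun X => ⟨_, vec X⟩)
    (fun _ _ _ _ ⟨_, h1⟩ ⟨_, h2⟩ => ⟨_, h1.add h2⟩)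
    (fun _ _ _ _ ⟨_, h1⟩ ⟨_, h2⟩ => ⟨_, h1.mul h2⟩) hs

variable [T2Space M] [SigmaCompactSpace M]

-- Frames of `A` and `TM` near `x` identify the nearby fibres with one model algebra: `Λ y` takes
-- coordinates, `Γ` inverts `Λ x`, and `R` is the derivation of the model given by the matrices at
-- `x`. In coordinates a section becomes an element `z` with function coefficients, and the
-- derivation becomes `δ` on coefficients plus `R`. Both descriptions respect sums and products, so
-- induction over the graph applies.
set_option maxHeartbeats 1000000 in
theorem exists_coeff (hδ : ∀ f g, δ (f * g) = δ f * g + f * δ g) (hA : IsDerivationAlong δ DA)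
    (hT : IsDerivationAlong δ DT) (x : M) :
    ∃ (n m : ℕ) (Λ : ∀ y, ExtSym (V y) (TangentSpace 𝓘(ℝ, E) y) →ₐ[ℝ]
        ExtSym (Fin n → ℝ) (Fin m → ℝ))
      (Γ : ExtSym (Fin n → ℝ) (Fin m → ℝ) →ₐ[ℝ] ExtSym (V x) (TangentSpace 𝓘(ℝ, E) x))
      (R : ExtSym (Fin n → ℝ) (Fin m → ℝ) →ₗ[ℝ] ExtSym (Fin n → ℝ) (Fin m → ℝ)),
      (∀ s, Γ (Λ x s) = s) ∧
      (∀ y j i, ∀ s ∈ bidegree _ _ j i, Λ y s ∈ bidegree _ _ j i) ∧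
      (∀ j i, ∀ s ∈ bidegree _ _ j i, Γ s ∈ bidegree _ _ j i) ∧
      (∀ j i, ∀ s ∈ bidegree _ _ j i, R s ∈ bidegree _ _ j i) ∧
      ∀ s d, DerivationGraph δ DA DT s d → ∃ z : Func E M ⊗[ℝ] ExtSym (Fin n → ℝ) (Fin m → ℝ),
        (∀ᶠ y in 𝓝 x, Λ y (s y) = evCoeff (evalFunc E M y) z) ∧
        Λ x (d x) = derCoeff ((evalFunc E M x).toLinearMap ∘ₗ δ) z + R (Λ x (s x)) := by
  obtain ⟨ê, l, h1, h2, h3⟩ := exists_frame (E := E) (F := F) (V := V) x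
  obtain ⟨û, m, k1, k2, k3⟩ := exists_frame (E := E) (F := E)
    (V := (TangentSpace 𝓘(ℝ, E) : M → Type _)) x
  obtain ⟨R, hR, hRw, hRu⟩ := exists_extSym_der
    (∑ i, (LinearMap.proj (R := ℝ) (φ := fun _ => ℝ) i).smulRight (l x (DA (ê i) x)))
    (∑ i, (LinearMap.proj (R := ℝ) (φ := fun _ => ℝ) i).smulRight (m x (DT (û i) x)))
  refine ⟨_, _, fun y => extSymMap (l y) (m y),
    extSymMap (∑ i, (LinearMap.proj (R := ℝ) (φ := fun _ => ℝ) i).smulRight (ê i x))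
      (∑ i, (LinearMap.proj (R := ℝ) (φ := fun _ => ℝ) i).smulRight (û i x)), R,
    fun s => ?_, ?_, ?_, ?_, ?_⟩
  · refine AlgHom.congr_fun (ExtSym.algHom_ext (f := (extSymMap _ _).comp (extSymMap _ _))
      (g := AlgHom.id ℝ _) (fun w => ?_) (fun u => ?_)) s
    · rw [AlgHom.comp_apply, extSymMap_inclExt, extSymMap_inclExt, AlgHom.id_apply]
      congr 1
      rw [LinearMap.sum_apply]
      exact (h2.self_of_nhds w).symm
    · rw [AlgHom.comp_apply, extSymMap_inclSym, extSymMap_inclSym, AlgHom.id_apply]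
      congr 1
      rw [LinearMap.sum_apply]
      exact (k2.self_of_nhds u).symm
  · intro y j i s hs
    exact algHom_bidegree _ (fun w => ⟨_, (extSymMap_inclExt _ _ w).symm⟩)
      (fun u => ⟨_, (extSymMap_inclSym _ _ u).symm⟩) hs
  · intro j i s hs
    exact algHom_bidegree _ (fun w => ⟨_, (extSymMap_inclExt _ _ w).symm⟩)
      (fun u => ⟨_, (extSymMap_inclSym _ _ u).symm⟩) hs
  · intro j i s hs
    exact hR.bidegree (fun w => ⟨_, (hRw w).symm⟩) (fun u => ⟨_, (hRu u).symm⟩) hs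
  · intro s d h
    induction h with
    | func f =>
      refine ⟨f ⊗ₜ 1, Filter.Eventually.of_forall fun y => ?_, ?_⟩
      · rw [evCoeff_tmul, ← Algebra.algebraMap_eq_smul_one]
        exact AlgHom.commutes _ _
      · rw [derCoeff_tmul, ← Algebra.algebraMap_eq_smul_one, ofFunc_apply, ofFunc_apply,
          AlgHom.commutes, AlgHom.commutes, hR.algebraMap rfl, add_zero]
        rfl
    | sect α =>
      obtain ⟨f, hf, hD⟩ := hA.frame h1 h2 h3 α
      refine ⟨∑ i, f i ⊗ₜ inclExt (Pi.single i 1), hf.mono fun y hy => ?_, ?_⟩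
      · rw [ofSect_apply, extSymMap_inclExt, map_sum, pi_eq_sum_univ' (l y (α y)), map_sum]
        refine Finset.sum_congr rfl fun i _ => ?_
        rw [evCoeff_tmul, ← hy i, map_smul]
        rfl
      · rw [ofSect_apply, ofSect_apply, extSymMap_inclExt, extSymMap_inclExt, hRw, hD, map_add]
        refine congrArg₂ (· + ·) ?_ (by rw [LinearMap.sum_apply]; rfl)
        rw [map_sum, pi_eq_sum_univ' (fun i => δ (f i) x), map_sum]
        refine Finset.sum_congr rfl fun i _ => ?_
        rw [derCoeff_tmul, map_smul]
        rfl
    | vec X =>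
      obtain ⟨f, hf, hD⟩ := hT.frame k1 k2 k3 X
      refine ⟨∑ i, f i ⊗ₜ inclSym (Pi.single i 1), hf.mono fun y hy => ?_, ?_⟩
      · rw [ofVec_apply, extSymMap_inclSym, map_sum, pi_eq_sum_univ' (m y (X y)), map_sum]
        refine Finset.sum_congr rfl fun i _ => ?_
        rw [evCoeff_tmul, ← hy i, map_smul]
        rfl
      · rw [ofVec_apply, ofVec_apply, extSymMap_inclSym, extSymMap_inclSym, hRu, hD, map_add]
        refine congrArg₂ (· + ·) ?_ (by rw [LinearMap.sum_apply]; rfl)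
        rw [map_sum, pi_eq_sum_univ' (fun i => δ (f i) x), map_sum]
        refine Finset.sum_congr rfl fun i _ => ?_
        rw [derCoeff_tmul, map_smul]
        rfl
    | add _ _ ih1 ih2 =>
      obtain ⟨z, a1, a2⟩ := ih1
      obtain ⟨z', b1, b2⟩ := ih2
      refine ⟨z + z', ?_, ?_⟩
      · filter_upwards [a1, b1] with y ha hb
        rw [Pi.add_apply, map_add, map_add, ha, hb]
      · rw [Pi.add_apply, Pi.add_apply, map_add, map_add, map_add, map_add, a2, b2]
        abel
    | @smul s d r _ ih =>
      obtain ⟨z, a1, a2⟩ := ih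
      refine ⟨r • z, ?_, ?_⟩
      · filter_upwards [a1] with y ha
        exact (map_smul (extSymMap (l y) (m y)) r (s y)).trans
          ((congrArg (r • ·) ha).trans (map_smul (evCoeff (evalFunc E M y)) r z).symm)
      · have e1 : extSymMap (l x) (m x) ((r • d : Tensor E V) x) = r • extSymMap (l x) (m x) (d x) :=
          map_smul (extSymMap (l x) (m x)) r (d x)
        have e2 : extSymMap (l x) (m x) ((r • s : Tensor E V) x) = r • extSymMap (l x) (m x) (s x) :=
          map_smul (extSymMap (l x) (m x)) r (s x)
        rw [e1, e2, map_smul, LinearMap.map_smul, a2, smul_add]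
    | @mul s d t e _ _ ih1 ih2 =>
      obtain ⟨z, a1, a2⟩ := ih1
      obtain ⟨z', b1, b2⟩ := ih2
      refine ⟨z * z', ?_, ?_⟩
      · filter_upwards [a1, b1] with y ha hb
        exact (map_mul (extSymMap (l y) (m y)) (s y) (t y)).trans
          ((congrArg₂ (· * ·) ha hb).trans (map_mul (evCoeff (evalFunc E M y)) z z').symm)
      · have e1 := derCoeff_mul (ε := evalFunc E M x)
          (d := (evalFunc E M x).toLinearMap ∘ₗ δ) (fun f g => by
            simp only [LinearMap.comp_apply, hδ]; rfl) z z'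
        rw [← a1.self_of_nhds, ← b1.self_of_nhds] at e1
        have e2 : extSymMap (l x) (m x) ((d * t + s * e : Tensor E V) x) =
            extSymMap (l x) (m x) (d x) * extSymMap (l x) (m x) (t x) +
              extSymMap (l x) (m x) (s x) * extSymMap (l x) (m x) (e x) :=
          (map_add (extSymMap (l x) (m x)) (d x * t x) (s x * e x)).trans
            (congrArg₂ (· + ·) (map_mul (extSymMap (l x) (m x)) (d x) (t x))
              (map_mul (extSymMap (l x) (m x)) (s x) (e x)))
        have e3 : extSymMap (l x) (m x) ((s * t : Tensor E V) x) =
            extSymMap (l x) (m x) (s x) * extSymMap (l x) (m x) (t x) :=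
          map_mul (extSymMap (l x) (m x)) (s x) (t x)
        rw [e1, e2, e3, a2, b2]
        generalize extSymMap (l x) (m x) (s x) = s'
        generalize extSymMap (l x) (m x) (t x) = t'
        exact hR.add_mul_add_mul_add _ _ s' t'

/-- Independence of the representative and preservation of the bidegree are one statement: if the
coordinates lie in `N` near `x`, so does the derivative of the coefficients. The first takes `N =
⊥`, the second a summand of the model. -/
theorem apply_mem (hδ : ∀ f g, δ (f * g) = δ f * g + f * δ g) (hA : IsDerivationAlong δ DA)
    (hT : IsDerivationAlong δ DT) {s d : Tensor E V} (h : DerivationGraph δ DA DT s d) {x : M} :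
    ((∀ᶠ y in 𝓝 x, s y = 0) → d x = 0) ∧
    ∀ j i, (∀ᶠ y in 𝓝 x, s y ∈ bidegree _ _ j i) → d x ∈ bidegree _ _ j i := by
  obtain ⟨n, m, Λ, Γ, R, h1, h2, h3, h4, h5⟩ := exists_coeff hδ hA hT x
  obtain ⟨z, hz, hd⟩ := h5 s d h
  have key : ∀ N : Submodule ℝ (ExtSym (Fin n → ℝ) (Fin m → ℝ)),
      (∀ᶠ y in 𝓝 x, Λ y (s y) ∈ N) →
        derCoeff ((evalFunc E M x).toLinearMap ∘ₗ δ) z ∈ N := by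
    intro N hN
    refine derCoeff_mem fun g φ hφ hg => ?_
    have hg0 : ∀ᶠ y in 𝓝 x, g y = 0 := by
      filter_upwards [hz, hN] with y ha hb
      exact (hg (evalFunc E M y)).trans (by rw [← ha]; exact hφ hb)
    -- The coefficient `g` vanishes near `x`, and a derivation of functions is local.
    obtain ⟨χ, hχ, hχg⟩ := exists_mul_eq_self hg0
    change δ g x = 0
    rw [← hχg, hδ, func_add_apply, func_mul_apply, func_mul_apply, hχ.self_of_nhds,
      hg0.self_of_nhds, mul_zero, zero_mul, add_zero]
  constructor
  · intro hs
    have h6 : derCoeff ((evalFunc E M x).toLinearMap ∘ₗ δ) z = 0 :=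
      (Submodule.mem_bot ℝ).1 (key ⊥ (hs.mono fun y hy => by rw [hy, map_zero]; exact zero_mem _))
    rw [← h1 (d x), hd, h6, hs.self_of_nhds, map_zero, map_zero, add_zero, map_zero]
  · intro j i hs
    rw [← h1 (d x), hd]
    exact h3 _ _ _ (add_mem (key _ (hs.mono fun y hy => h2 y j i _ hy))
      (h4 _ _ _ (h2 x _ _ _ hs.self_of_nhds)))

end DerivationGraph

variable [T2Space M] [SigmaCompactSpace M]

theorem DerivationGraph.unique {δ : Func E M →ₗ[ℝ] Func E M} {DA : Sect E F V →ₗ[ℝ] Sect E F V}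
    {DT : VecField E M →ₗ[ℝ] VecField E M} (hδ : ∀ f g, δ (f * g) = δ f * g + f * δ g)
    (hA : IsDerivationAlong δ DA) (hT : IsDerivationAlong δ DT) {s d s' d' : Tensor E V}
    (h : DerivationGraph δ DA DT s d) (h' : DerivationGraph δ DA DT s' d') {x : M}
    (hs : ∀ᶠ y in 𝓝 x, s y = s' y) : d x = d' x := by
  have h1 := ((h.add (h'.smul (-1))).apply_mem hδ hA hT (x := x)).1 (hs.mono fun y hy => by
    rw [Pi.add_apply, hy]
    exact (congrArg (s' y + ·) (neg_one_smul ℝ (s' y))).trans (add_neg_cancel (s' y)))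
  have h2 : d x + -d' x = 0 := (congrArg (d x + ·) (neg_one_smul ℝ (d' x))).symm.trans h1
  exact add_neg_eq_zero.1 h2

/-- Near each point a smooth section has a polynomial representative, whose partner in the graph has
a well-defined germ by `DerivationGraph.unique`. These germs fit together to the value of the
derivation. -/
theorem exists_derivationExtension (δ : Func E M →ₗ[ℝ] Func E M) (DA : Sect E F V →ₗ[ℝ] Sect E F V)
    (DT : VecField E M →ₗ[ℝ] VecField E M) (hδ : ∀ f g, δ (f * g) = δ f * g + f * δ g)
    (hA : IsDerivationAlong δ DA) (hT : IsDerivationAlong δ DT) :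
    ∃ D : Tensor E V →ₗ[ℝ] Tensor E V, IsDerivationExtension δ DA DT D ∧
      ∀ s ∈ smoothSections E F V, ∀ j i x, (∀ᶠ y in 𝓝 x, s y ∈ bidegree _ _ j i) →
        D s x ∈ bidegree _ _ j i := by
  have hex : ∀ s : Smooth E F V, ∃ e : Tensor E V, ∀ x t d, DerivationGraph δ DA DT t d →
      (∀ᶠ y in 𝓝 x, s.1 y = t y) → e x = d x := by
    intro s
    choose t ht hst using s.2
    choose d hd using fun x => DerivationGraph.exists_of_mem (δ := δ) (DA := DA) (DT := DT) (ht x)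
    refine ⟨fun x => d x x, fun x t' d' h' hs' => (hd x).unique hδ hA hT h' ?_⟩
    filter_upwards [hs', hst x] with y ha hb
    rw [← ha, hb]
  choose D hD using hex
  have hgr : ∀ (s : Smooth E F V) x, ∃ t d, DerivationGraph δ DA DT t d ∧
      ∀ᶠ y in 𝓝 x, s.1 y = t y ∧ D s y = d y := by
    intro s x
    obtain ⟨t, ht, hst⟩ := s.2 x
    obtain ⟨d, hd⟩ := DerivationGraph.exists_of_mem (δ := δ) (DA := DA) (DT := DT) ht
    exact ⟨t, d, hd, hst.and (hst.eventually_nhds.mono fun y hy => hD s y t d hd hy)⟩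
  let D' : Smooth E F V →ₗ[ℝ] Tensor E V :=
    { toFun := D
      map_add' := fun s s' => funext fun x => by
        obtain ⟨t, d, h, hst⟩ := hgr s x
        obtain ⟨t', d', h', hst'⟩ := hgr s' x
        rw [hD (s + s') x _ _ (h.add h') (by
          filter_upwards [hst, hst'] with y ha hb
          exact congrArg₂ (· + ·) ha.1 hb.1)]
        exact (congrArg₂ (· + ·) hst.self_of_nhds.2 hst'.self_of_nhds.2).symm
      map_smul' := fun r s => funext fun x => by
        obtain ⟨t, d, h, hst⟩ := hgr s x
        rw [hD (r • s) x _ _ (h.smul r) (by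
          filter_upwards [hst] with y ha
          exact congrArg (r • ·) ha.1)]
        exact (congrArg (r • ·) hst.self_of_nhds.2).symm }
  -- An arbitrary linear extension to non-smooth sections; no property of it is used outside the
  -- smooth ones.
  obtain ⟨D₁, hD₁⟩ := LinearMap.exists_extend
    (p := Subalgebra.toSubmodule (smoothSections E F V)) D'
  have hD₂ : ∀ s (hs : s ∈ smoothSections E F V), D₁ s = D (Smooth.mk s hs) := fun s hs =>
    LinearMap.congr_fun hD₁ ⟨s, hs⟩
  have hgen : ∀ {s d : Tensor E V}, DerivationGraph δ DA DT s d → D₁ s = d := fun {s d} h => by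
    rw [hD₂ s (polySections_le h.mem.1)]
    exact funext fun x => hD _ x s d h (Filter.Eventually.of_forall fun _ => rfl)
  refine ⟨D₁, ⟨fun s hs x => ?_, fun s hs t ht => funext fun x => ?_, fun f => hgen (.func f),
    fun α => hgen (.sect α), fun X => hgen (.vec X)⟩, fun s hs j i x hx => ?_⟩
  · obtain ⟨t, d, h, hst⟩ := hgr (Smooth.mk s hs) x
    rw [hD₂ s hs]
    exact ⟨d, h.mem.2, hst.mono fun y hy => hy.2⟩
  · obtain ⟨s', d, h, hs'⟩ := hgr (Smooth.mk s hs) x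
    obtain ⟨t', e, h', ht'⟩ := hgr (Smooth.mk t ht) x
    rw [hD₂ s hs, hD₂ t ht, hD₂ (s * t) (mul_mem hs ht), hD _ x _ _ (h.mul h') (by
      filter_upwards [hs', ht'] with y ha hb
      exact congrArg₂ (· * ·) ha.1 hb.1)]
    obtain ⟨a1, a2⟩ := hs'.self_of_nhds
    obtain ⟨b1, b2⟩ := ht'.self_of_nhds
    exact (congrArg₂ (· + ·) (congrArg₂ (· * ·) a2 b1) (congrArg₂ (· * ·) a1 b2)).symm
  · obtain ⟨s', d, h, hs'⟩ := hgr (Smooth.mk s hs) x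
    rw [hD₂ s hs, hs'.self_of_nhds.2]
    refine (h.apply_mem hδ hA hT).2 j i ?_
    filter_upwards [hs', hx] with y ha hb
    rw [← ha.1]
    exact hb

end Exists

section Operators

variable {E : Type*} [NormedAddCommGroup E] [NormedSpace ℝ E] [FiniteDimensional ℝ E]
  {M : Type*} [TopologicalSpace M] [ChartedSpace E M] [IsManifold 𝓘(ℝ, E) ∞ M]
  {F : Type*} [NormedAddCommGroup F] [NormedSpace ℝ F] [FiniteDimensional ℝ F]
  {V : M → Type*} [TopologicalSpace (TotalSpace F V)]
  [∀ x, AddCommGroup (V x)] [∀ x, Module ℝ (V x)] [∀ x, TopologicalSpace (V x)]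
  [∀ x, IsTopologicalAddGroup (V x)] [∀ x, ContinuousSMul ℝ (V x)]
  [FiberBundle F V] [VectorBundle ℝ F V] [ContMDiffVectorBundle ∞ F V 𝓘(ℝ, E)]

namespace Smooth

/-! ### Derivations and slides -/

/-- `D` is the derivation which extends `(δ, DA, DT)`. -/
structure IsDer (D : Smooth E F V →ₗ[ℝ] Smooth E F V) (δ : Func E M → Func E M)
    (DA : Sect E F V → Sect E F V) (DT : VecField E M → VecField E M) : Prop where
  der : IsTwistedDer id D
  func : ∀ f, D (func f) = Smooth.func (δ f)
  sect : ∀ α, D (sect α) = Smooth.sect (DA α)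
  vec : ∀ X, D (vec X) = Smooth.vec (DT X)

/-- `Q` is the graded derivation which extends `K : Γ(TM) → Γ(A)`. -/
structure IsSlide (Q : Smooth E F V →ₗ[ℝ] Smooth E F V) (K : VecField E M → Sect E F V) :
    Prop where
  der : IsTwistedDer par Q
  func : ∀ f, Q (func f) = 0
  sect : ∀ α, Q (sect α) = 0
  vec : ∀ X, Q (vec X) = Smooth.sect (K X)

variable {D D' Q Q' : Smooth E F V →ₗ[ℝ] Smooth E F V} {δ δ' : Func E M → Func E M}
    {DA DA' : Sect E F V → Sect E F V} {DT DT' : VecField E M → VecField E M}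
    {K K' : VecField E M → Sect E F V}

theorem IsSlide.add (h : IsSlide Q K) (h' : IsSlide Q' K') :
    IsSlide (Q + Q') (fun X => K X + K' X) where
  der := h.der.add h'.der
  func f := by rw [LinearMap.add_apply, h.func, h'.func, add_zero]
  sect f := by rw [LinearMap.add_apply, h.sect, h'.sect, add_zero]
  vec f := by rw [LinearMap.add_apply, h.vec, h'.vec, sect_add]

theorem IsSlide.sub (h : IsSlide Q K) (h' : IsSlide Q' K') :
    IsSlide (Q - Q') (fun X => K X - K' X) where
  der := h.der.sub h'.der
  func f := by rw [LinearMap.sub_apply, h.func, h'.func, sub_zero]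
  sect f := by rw [LinearMap.sub_apply, h.sect, h'.sect, sub_zero]
  vec f := by rw [LinearMap.sub_apply, h.vec, h'.vec, sect_sub]

theorem IsSlide.smul (h : IsSlide Q K) (r : ℝ) : IsSlide (r • Q) (fun X => r • K X) where
  der := h.der.smul r
  func f := by rw [LinearMap.smul_apply, h.func, smul_zero]
  sect f := by rw [LinearMap.smul_apply, h.sect, smul_zero]
  vec f := by rw [LinearMap.smul_apply, h.vec, sect_smul]

theorem IsSlide.func_mul (h : IsSlide Q K) (f : Func E M) (s : Smooth E F V) :
    Q (Smooth.func f * s) = Smooth.func f * Q s := by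
  rw [h.der, h.func, zero_mul, add_zero]

theorem IsSlide.mulLeft (h : IsSlide Q K) (f : Func E M) :
    IsSlide (LinearMap.mulLeft ℝ (Smooth.func f) ∘ₗ Q) (fun X => fsmul f (K X)) where
  der := h.der.mulLeft (func_mul_eq f)
  func g := by rw [LinearMap.comp_apply, h.func, map_zero]
  sect α := by rw [LinearMap.comp_apply, h.sect, map_zero]
  vec X := by rw [LinearMap.comp_apply, h.vec, sect_fsmul]; rfl

/-- A slide is linear over functions, so any `K` obtained from one is `C^∞(M)`-linear. This is how
the tensoriality of `R^bas` is obtained without a separate computation. -/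
theorem IsSlide.map_fsmul (h : IsSlide Q K) (f : Func E M) (X : VecField E M) :
    K (fsmul f X) = fsmul f (K X) := by
  apply sect_injective
  rw [← h.vec, vec_fsmul, h.func_mul, h.vec, sect_fsmul]

theorem IsSlide.map_add (h : IsSlide Q K) (X Y : VecField E M) : K (X + Y) = K X + K Y := by
  apply sect_injective
  rw [← h.vec, vec_add, _root_.map_add, h.vec, h.vec, sect_add]

theorem IsSlide.map_smul (h : IsSlide Q K) (r : ℝ) (X : VecField E M) : K (r • X) = r • K X := by
  apply sect_injective
  rw [← h.vec, vec_smul, LinearMap.map_smul, h.vec, sect_smul]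

theorem IsSlide.lie (hD : IsDer D δ DA DT) (hp : ∀ s, par (D s) = D (par s)) (h : IsSlide Q K) :
    IsSlide (D ∘ₗ Q - Q ∘ₗ D) (fun X => DA (K X) - K (DT X)) where
  der := hD.der.lie h.der hp
  func f := by
    rw [LinearMap.sub_apply, LinearMap.comp_apply, LinearMap.comp_apply, h.func, hD.func, h.func,
      map_zero, sub_zero]
  sect α := by
    rw [LinearMap.sub_apply, LinearMap.comp_apply, LinearMap.comp_apply, h.sect, hD.sect, h.sect,
      map_zero, sub_zero]
  vec X := by
    rw [LinearMap.sub_apply, LinearMap.comp_apply, LinearMap.comp_apply, h.vec, hD.vec, h.vec,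
      hD.sect, sect_sub]

theorem IsDer.lie (h : IsDer D δ DA DT) (h' : IsDer D' δ' DA' DT') :
    IsDer (D ∘ₗ D' - D' ∘ₗ D) (fun f => δ (δ' f) - δ' (δ f)) (fun α => DA (DA' α) - DA' (DA α))
      (fun X => DT (DT' X) - DT' (DT X)) where
  der := h.der.lie_id h'.der
  func f := by
    rw [LinearMap.sub_apply, LinearMap.comp_apply, LinearMap.comp_apply, h.func, h'.func, h'.func,
      h.func, func_sub]
  sect f := by
    rw [LinearMap.sub_apply, LinearMap.comp_apply, LinearMap.comp_apply, h.sect, h'.sect, h'.sect,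
      h.sect, sect_sub]
  vec f := by
    rw [LinearMap.sub_apply, LinearMap.comp_apply, LinearMap.comp_apply, h.vec, h'.vec, h'.vec,
      h.vec, vec_sub]

theorem IsDer.add (h : IsDer D δ DA DT) (h' : IsDer D' δ' DA' DT') :
    IsDer (D + D') (fun f => δ f + δ' f) (fun α => DA α + DA' α) (fun X => DT X + DT' X) where
  der := h.der.add h'.der
  func f := by rw [LinearMap.add_apply, h.func, h'.func, func_add]
  sect f := by rw [LinearMap.add_apply, h.sect, h'.sect, sect_add]
  vec f := by rw [LinearMap.add_apply, h.vec, h'.vec, vec_add]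

theorem IsDer.sub (h : IsDer D δ DA DT) (h' : IsDer D' δ' DA' DT') :
    IsDer (D - D') (fun f => δ f - δ' f) (fun α => DA α - DA' α) (fun X => DT X - DT' X) where
  der := h.der.sub h'.der
  func f := by rw [LinearMap.sub_apply, h.func, h'.func, func_sub]
  sect f := by rw [LinearMap.sub_apply, h.sect, h'.sect, sect_sub]
  vec f := by rw [LinearMap.sub_apply, h.vec, h'.vec, vec_sub]

theorem func_smul (r : ℝ) (f : Func E M) : (func (r • f) : Smooth E F V) = r • func f := by
  rw [Algebra.smul_def, func_mul, Algebra.smul_def]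
  rfl

theorem IsDer.smul (h : IsDer D δ DA DT) (r : ℝ) :
    IsDer (r • D) (fun f => r • δ f) (fun α => r • DA α) (fun X => r • DT X) where
  der := h.der.smul r
  func f := by rw [LinearMap.smul_apply, h.func, func_smul]
  sect f := by rw [LinearMap.smul_apply, h.sect, sect_smul]
  vec f := by rw [LinearMap.smul_apply, h.vec, vec_smul]

theorem IsDer.mulLeft (h : IsDer D δ DA DT) (f : Func E M) :
    IsDer (LinearMap.mulLeft ℝ (Smooth.func f) ∘ₗ D) (fun g => f * δ g) (fun α => fsmul f (DA α))
      (fun X => fsmul f (DT X)) where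
  der := h.der.mulLeft (func_mul_eq f)
  func g := by rw [LinearMap.comp_apply, h.func, Smooth.func_mul]; rfl
  sect α := by rw [LinearMap.comp_apply, h.sect, sect_fsmul]; rfl
  vec X := by rw [LinearMap.comp_apply, h.vec, vec_fsmul]; rfl

variable [T2Space M] [SigmaCompactSpace M]

theorem IsDer.ext (h : IsDer D δ DA DT) (h' : IsDer D' δ' DA' DT') (hf : ∀ f, δ f = δ' f)
    (hα : ∀ α, DA α = DA' α) (hX : ∀ X, DT X = DT' X) (s : Smooth E F V) : D s = D' s :=
  LinearMap.congr_fun (twistedDer_ext h.der h'.der (fun f => by rw [h.func, h'.func, hf])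
    (fun α => by rw [h.sect, h'.sect, hα]) (fun X => by rw [h.vec, h'.vec, hX])) s

theorem IsSlide.ext (h : IsSlide Q K) (h' : IsSlide Q' K') (hX : ∀ X, K X = K' X)
    (s : Smooth E F V) : Q s = Q' s :=
  LinearMap.congr_fun (twistedDer_ext h.der h'.der (fun f => by rw [h.func, h'.func])
    (fun α => by rw [h.sect, h'.sect]) (fun X => by rw [h.vec, h'.vec, hX])) s

theorem IsDer.par_apply (h : IsDer D δ DA DT) (s : Smooth E F V) : par (D s) = D (par s) := by
  have h1 := twistedDer_ext (h.der.conj_id (p := par) par_par) h.der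
    (fun f => by simp [h.func]) (fun α => by simp [h.sect]) (fun X => by simp [h.vec])
  have h2 := LinearMap.congr_fun h1 (par s)
  simpa [par_par] using h2

theorem IsSlide.par_apply (h : IsSlide Q K) (s : Smooth E F V) : par (Q s) = -Q (par s) := by
  have h1 := twistedDer_ext (h.der.conj par_par) (h.der.smul (-1))
    (fun f => by simp [h.func]) (fun α => by simp [h.sect]) (fun X => by simp [h.vec])
  have h2 := LinearMap.congr_fun h1 (par s)
  simpa [par_par] using h2

/-- The anticommutator is an even derivation. It kills the generators, because a slide takes vector
fields to sections of `A` and kills those. -/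
theorem IsSlide.anticomm (h : IsSlide Q K) (h' : IsSlide Q' K') (s : Smooth E F V) :
    Q (Q' s) = -Q' (Q s) := by
  have h1 := twistedDer_eq_zero (h.der.comp_add par_par h'.der h.par_apply h'.par_apply)
    (fun f => by simp [h.func, h'.func]) (fun α => by simp [h.sect, h'.sect])
    (fun X => by simp [h.vec, h'.vec, h.sect, h'.sect])
  exact eq_neg_of_add_eq_zero_left (LinearMap.congr_fun h1 s)

theorem IsSlide.exists_linearMap (h : IsSlide Q K) (x : M) :
    ∃ φ : TangentSpace 𝓘(ℝ, E) x →ₗ[ℝ] V x, ∀ X : VecField E M, φ (X x) = K X x := by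
  let κ : VecField E M →ₗ[ℝ] V x :=
    { toFun := fun X => K X x
      map_add' := fun X Y => by rw [h.map_add]; rfl
      map_smul' := fun r X => by rw [h.map_smul]; rfl }
  refine exists_linearMap_of_tensorial κ fun f X => ?_
  change K (fsmul f X) x = f x • K X x
  rw [h.map_fsmul]
  rfl

end Smooth

theorem isSlide_fibrewise {κ : ∀ x : M, TangentSpace 𝓘(ℝ, E) x →ₗ[ℝ] V x}
    {K : VecField E M → Sect E F V} (hκ : ∀ X x, κ x (X x) = K X x) :
    Smooth.IsSlide (Smooth.ofMem (fibrewise fun x => slide (κ x)) (fibrewise_slide_mem hκ)) K where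
  der s t := Smooth.ext fun x => slide_isDer (κ x) (s.1 x) (t.1 x)
  func f := Smooth.ext fun x => slide_algebraMap (κ x) (f x)
  sect α := Smooth.ext fun x => slide_inclExt (κ x) (α x)
  vec X := Smooth.ext fun x => (slide_inclSym (κ x) (X x)).trans (congrArg inclExt (hκ X x))

/-! ### Derivation extensions -/

section Extension

theorem IsDerivationExtension.isDer {δ : Func E M → Func E M} {DA : Sect E F V → Sect E F V}
    {DT : VecField E M → VecField E M} {D : Tensor E V →ₗ[ℝ] Tensor E V}
    (h : IsDerivationExtension δ DA DT D) :
    Smooth.IsDer (Smooth.ofMem D h.mem) δ DA DT where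
  der s t := Subtype.ext ((h.mul s.1 s.2 t.1 t.2).trans (add_comm _ _))
  func f := Subtype.ext (h.func f)
  sect α := Subtype.ext (h.sect α)
  vec X := Subtype.ext (h.vec X)

variable [T2Space M] [SigmaCompactSpace M]

/-- By uniqueness on smooth sections, the chosen extension agrees with the constructed one and
inherits its compatibility with the bidegree. -/
theorem derivationExtension_spec (δ : Func E M →ₗ[ℝ] Func E M) (DA : Sect E F V →ₗ[ℝ] Sect E F V)
    (DT : VecField E M →ₗ[ℝ] VecField E M) (hδ : ∀ f g, δ (f * g) = δ f * g + f * δ g)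
    (hA : IsDerivationAlong δ DA) (hT : IsDerivationAlong δ DT) :
    IsDerivationExtension δ DA DT (derivationExtension δ DA DT) ∧
      ∀ s ∈ smoothSections E F V, ∀ j i x, (∀ᶠ y in 𝓝 x, s y ∈ bidegree _ _ j i) →
        derivationExtension δ DA DT s x ∈ bidegree _ _ j i := by
  obtain ⟨D, hD, hb⟩ := exists_derivationExtension δ DA DT hδ hA hT
  have h : ∃ D, IsDerivationExtension δ DA DT D := ⟨D, hD⟩
  have h1 : IsDerivationExtension δ DA DT (derivationExtension δ DA DT) := by
    rw [derivationExtension, dif_pos h]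
    exact h.choose_spec
  refine ⟨h1, fun s hs j i x hx => ?_⟩
  have h2 : derivationExtension δ DA DT s = D s :=
    congrArg Subtype.val (h1.isDer.ext hD.isDer (fun _ => rfl) (fun _ => rfl) (fun _ => rfl)
      (Smooth.mk s hs))
  rw [h2]
  exact hb s hs j i x hx

end Extension

/-! ### Covariant derivatives -/

section Cov

variable (nabla : CovariantDerivative 𝓘(ℝ, E) F V)
  [CovariantDerivative.ContMDiffCovariantDerivative nabla ∞]

theorem nabla_add (α β : Sect E F V) (x : M) :
    nabla (⇑(α + β)) x = nabla α x + nabla β x :=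
  nabla.isCovariantDerivativeOnUniv.add (sect_mdifferentiableAt α x) (sect_mdifferentiableAt β x)

theorem nabla_fsmul (f : Func E M) (α : Sect E F V) (x : M) :
    (nabla (⇑(fsmul f α)) x).toLinearMap =
      f x • (nabla α x).toLinearMap + (dAt f x).smulRight (α x) :=
  congrArg ContinuousLinearMap.toLinearMap (nabla.isCovariantDerivativeOnUniv.leibniz
    (sect_mdifferentiableAt α x) (func_mdifferentiableAt f x))

theorem nabla_smul (r : ℝ) (α : Sect E F V) (x : M) :
    (nabla (⇑(r • α)) x).toLinearMap = r • (nabla α x).toLinearMap := by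
  have h := nabla_fsmul nabla (algebraMap ℝ (Func E M) r) α x
  rw [dAt_const] at h
  refine Eq.trans h ?_
  ext v
  change r • nabla α x v + (0 : ℝ) • α x = _
  rw [zero_smul, add_zero]
  rfl

theorem cov_add_left (X Y : VecField E M) (α : Sect E F V) :
    cov nabla (X + Y) α = cov nabla X α + cov nabla Y α :=
  sect_ext fun x => map_add (nabla α x) (X x) (Y x)

theorem cov_smul_left (r : ℝ) (X : VecField E M) (α : Sect E F V) :
    cov nabla (r • X) α = r • cov nabla X α :=
  sect_ext fun x => map_smul (nabla α x) r (X x)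

theorem cov_fsmul_left (f : Func E M) (X : VecField E M) (α : Sect E F V) :
    cov nabla (fsmul f X) α = fsmul f (cov nabla X α) :=
  sect_ext fun x => map_smul (nabla α x) (f x) (X x)

theorem cov_add_right (X : VecField E M) (α β : Sect E F V) :
    cov nabla X (α + β) = cov nabla X α + cov nabla X β :=
  sect_ext fun x => congrArg (fun l => l (X x)) (nabla_add nabla α β x)

theorem cov_smul_right (r : ℝ) (X : VecField E M) (α : Sect E F V) :
    cov nabla X (r • α) = r • cov nabla X α :=
  sect_ext fun x => congrArg (fun l => l (X x)) (nabla_smul nabla r α x)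

theorem cov_fsmul_right (f : Func E M) (X : VecField E M) (α : Sect E F V) :
    cov nabla X (fsmul f α) = fsmul f (cov nabla X α) + fsmul (vecDeriv X f) α :=
  sect_ext fun x => congrArg (fun l => l (X x)) (nabla_fsmul nabla f α x)

end Cov

end Operators

/-! ### Lie derivative, boundary, basic connection and basic curvature on smooth sections. -/

section AlgebroidOperators

variable {E : Type*} [NormedAddCommGroup E] [NormedSpace ℝ E] [FiniteDimensional ℝ E]
  {M : Type*} [TopologicalSpace M] [ChartedSpace E M] [IsManifold 𝓘(ℝ, E) ∞ M]
  [T2Space M] [SigmaCompactSpace M]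
  {F : Type*} [NormedAddCommGroup F] [NormedSpace ℝ F] [FiniteDimensional ℝ F]
  {V : M → Type*} [TopologicalSpace (TotalSpace F V)]
  [∀ x, AddCommGroup (V x)] [∀ x, Module ℝ (V x)] [∀ x, TopologicalSpace (V x)]
  [∀ x, IsTopologicalAddGroup (V x)] [∀ x, ContinuousSMul ℝ (V x)]
  [FiberBundle F V] [VectorBundle ℝ F V] [ContMDiffVectorBundle ∞ F V 𝓘(ℝ, E)]

/-- The derivation of functions given by a vector field. -/
def vecDerivHom (X : VecField E M) : Func E M →ₗ[ℝ] Func E M where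
  toFun := vecDeriv X
  map_add' := vecDeriv_add X
  map_smul' r f := vecDeriv_smul X r f

theorem isDerivationAlong_vecBracket (X : VecField E M) :
    IsDerivationAlong (vecDerivHom X) ((tangentAlgebroid E M).bracket X) := fun f Y =>
  vecBracket_fsmul_right X Y f

theorem vecBracket_add_left (X Y Z : VecField E M) :
    vecBracket (X + Y) Z = vecBracket X Z + vecBracket Y Z :=
  congrArg (fun l => l Z) (map_add (tangentAlgebroid E M).bracket X Y)

theorem vecBracket_smul_left (r : ℝ) (X Y : VecField E M) :
    vecBracket (r • X) Y = r • vecBracket X Y :=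
  congrArg (fun l => l Y) (map_smul (tangentAlgebroid E M).bracket r X)

theorem vecBracket_fsmul_left (X Y : VecField E M) (f : Func E M) :
    vecBracket (fsmul f X) Y = fsmul f (vecBracket X Y) - fsmul (vecDeriv Y f) X :=
  (tangentAlgebroid E M).bracket_fsmul_left f X Y

theorem vecDeriv_add_left (X Y : VecField E M) (f : Func E M) :
    vecDeriv (X + Y) f = vecDeriv X f + vecDeriv Y f :=
  func_ext fun x => map_add (dAt f x) (X x) (Y x)

theorem vecDeriv_smul_left (r : ℝ) (X : VecField E M) (f : Func E M) :
    vecDeriv (r • X) f = r • vecDeriv X f :=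
  func_ext fun x => map_smul (dAt f x) r (X x)

theorem vecDeriv_fsmul_left (g : Func E M) (X : VecField E M) (f : Func E M) :
    vecDeriv (fsmul g X) f = g * vecDeriv X f :=
  func_ext fun x => map_smul (dAt f x) (g x) (X x)

/-- The operator `K_{f,α}`, the slide of `df ⊗ α`. -/
def contractWedge (f : Func E M) (α : Sect E F V) : Smooth E F V →ₗ[ℝ] Smooth E F V :=
  Smooth.ofMem (fibrewise fun x => slide ((dAt f x).smulRight (α x)))
    (fibrewise_slide_mem (K := fun X => fsmul (vecDeriv X f) α) fun _ _ => rfl)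

theorem isSlide_contractWedge (f : Func E M) (α : Sect E F V) :
    Smooth.IsSlide (contractWedge f α) (fun X => fsmul (vecDeriv X f) α) :=
  isSlide_fibrewise fun _ _ => rfl

/-- The link between the tail term of the definition and the slide used in the calculus. -/
theorem contractWedge_coe (f : Func E M) (α : Sect E F V) (s : Smooth E F V) :
    (contractWedge f α s).1 = contractD f (s.1 * ofSect α) :=
  funext fun x => (slide_smulRight (dAt f x) (α x) (s.1 x)).trans
    (contract_mul_inclExt (dAt f x) (s.1 x) (α x)).symm

section Insertion

variable {θ : Sect E F V → ∀ x : M, TangentSpace 𝓘(ℝ, E) x →ₗ[ℝ] V x}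
  {K : Sect E F V → VecField E M → Sect E F V}

/-- The slides of a family of bundle maps `θ(α) : TM → A`, linear in `α`. -/
def slideFamily (hκ : ∀ α X x, θ α x (X x) = K α X x)
    (hadd : ∀ α β X, K (α + β) X = K α X + K β X) (hsmul : ∀ (r : ℝ) α X, K (r • α) X = r • K α X) :
    Sect E F V →ₗ[ℝ] Smooth E F V →ₗ[ℝ] Smooth E F V where
  toFun α := Smooth.ofMem (fibrewise fun x => slide (θ α x)) (fibrewise_slide_mem (hκ α))
  map_add' α β := LinearMap.ext fun s => (isSlide_fibrewise (hκ (α + β))).ext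
    ((isSlide_fibrewise (hκ α)).add (isSlide_fibrewise (hκ β))) (fun X => hadd α β X) s
  map_smul' r α := LinearMap.ext fun s => (isSlide_fibrewise (hκ (r • α))).ext
    ((isSlide_fibrewise (hκ α)).smul r) (fun X => hsmul r α X) s

theorem isSlide_slideFamily (hκ : ∀ α X x, θ α x (X x) = K α X x)
    (hadd : ∀ α β X, K (α + β) X = K α X + K β X) (hsmul : ∀ (r : ℝ) α X, K (r • α) X = r • K α X)
    (α : Sect E F V) : Smooth.IsSlide (slideFamily hκ hadd hsmul α) (K α) :=
  isSlide_fibrewise (hκ α)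

end Insertion

namespace LieAlgebroid

variable (A : LieAlgebroid E F V)

theorem isDerivationAlong_bracket (α : Sect E F V) :
    IsDerivationAlong (vecDerivHom (A.rho α)) (A.bracket α) := fun f β =>
  A.bracket_fsmul_right f α β

theorem lie_spec (α : Sect E F V) :
    IsDerivationExtension (fun f => vecDeriv (A.rho α) f) (fun β => A.bracket α β)
      (fun X => vecBracket (A.rho α) X) (A.lie α) ∧
    ∀ s ∈ smoothSections E F V, ∀ j i x, (∀ᶠ y in 𝓝 x, s y ∈ bidegree _ _ j i) →
        A.lie α s x ∈ bidegree _ _ j i :=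
  derivationExtension_spec (vecDerivHom (A.rho α)) (A.bracket α)
    ((tangentAlgebroid E M).bracket (A.rho α)) (vecDeriv_mul _) (A.isDerivationAlong_bracket α)
    (isDerivationAlong_vecBracket _)

theorem isDer_ofMem_lie (α : Sect E F V) :
    Smooth.IsDer (Smooth.ofMem (A.lie α) (A.lie_spec α).1.mem) (fun f => vecDeriv (A.rho α) f)
      (fun β => A.bracket α β) (fun X => vecBracket (A.rho α) X) :=
  (A.lie_spec α).1.isDer

/-- The Lie derivative of smooth sections. -/
def lieS : Sect E F V →ₗ[ℝ] Smooth E F V →ₗ[ℝ] Smooth E F V where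
  toFun α := Smooth.ofMem (A.lie α) (A.lie_spec α).1.mem
  map_add' α β := LinearMap.ext fun s => (A.isDer_ofMem_lie (α + β)).ext
    ((A.isDer_ofMem_lie α).add (A.isDer_ofMem_lie β))
    (fun f => by rw [A.rho_add, vecDeriv_add_left]) (fun γ => by rw [map_add]; rfl)
    (fun X => by rw [A.rho_add, vecBracket_add_left]) s
  map_smul' r α := LinearMap.ext fun s => (A.isDer_ofMem_lie (r • α)).ext
    ((A.isDer_ofMem_lie α).smul r)
    (fun f => by rw [A.rho_smul, vecDeriv_smul_left]) (fun γ => by rw [map_smul]; rfl)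
    (fun X => by rw [A.rho_smul, vecBracket_smul_left]) s

theorem isDer_lieS (α : Sect E F V) :
    Smooth.IsDer (A.lieS α) (fun f => vecDeriv (A.rho α) f)
      (fun β => A.bracket α β) (fun X => vecBracket (A.rho α) X) := A.isDer_ofMem_lie α

/-- The operator `∂` on smooth sections. -/
def delS : Smooth E F V →ₗ[ℝ] Smooth E F V := Smooth.ofMem A.del (del_mem A)

theorem isTwistedDer_delS : IsTwistedDer Smooth.par A.delS := fun s t =>
  Smooth.ext fun x => boundary_isDer (A.anchor x) (s.1 x) (t.1 x)

@[simp] theorem delS_func (f : Func E M) : A.delS (.func f) = 0 :=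
  Smooth.ext fun x => boundary_algebraMap (A.anchor x) (f x)

@[simp] theorem delS_sect (α : Sect E F V) : A.delS (.sect α) = .vec (A.rho α) :=
  Smooth.ext fun x => boundary_inclExt (A.anchor x) (α x)

@[simp] theorem delS_vec (X : VecField E M) : A.delS (.vec X) = 0 :=
  Smooth.ext fun x => boundary_inclSym (A.anchor x) (X x)

theorem delS_delS (s : Smooth E F V) : A.delS (A.delS s) = 0 :=
  Smooth.ext fun x => boundary_boundary (A.anchor x) (s.1 x)

theorem par_delS (s : Smooth E F V) : Smooth.par (A.delS s) = -A.delS (Smooth.par s) :=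
  Smooth.ext fun x => parity_boundary (A.anchor x) (s.1 x)

/-- The last commutators are derivations, so they are compared on generators: there `L` represents
the bracket by the Jacobi identities, and `L` commutes with `∂` because the anchor preserves
brackets. -/
theorem isCartan : IsCartan A.bracket A.lieS A.delS where
  bracket_self := A.bracket_self
  jacobi := A.jacobi
  lie_lie α β := ((A.isDer_lieS α).lie (A.isDer_lieS β)).ext (A.isDer_lieS (A.bracket α β))
    (fun f => (A.vecDeriv_rho_bracket α β f).symm)
    (fun γ => by rw [A.jacobi' α β γ, add_sub_cancel_right])
    (fun X => by rw [vecBracket_jacobi, A.rho_bracket, add_sub_cancel_right])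
  del_del := A.delS_delS
  lie_del α s := by
    have h := Smooth.twistedDer_eq_zero
      ((A.isDer_lieS α).der.lie A.isTwistedDer_delS (A.isDer_lieS α).par_apply)
      (fun f => by simp [(A.isDer_lieS α).func])
      (fun β => by
        simp [(A.isDer_lieS α).sect, (A.isDer_lieS α).vec, A.rho_bracket])
      (fun X => by simp [(A.isDer_lieS α).vec])
    exact sub_eq_zero.1 (LinearMap.congr_fun h s)

/-- The derivation `Q ∂ + ∂ Q`. -/
theorem isDer_slide_del {Q : Smooth E F V →ₗ[ℝ] Smooth E F V} {K : VecField E M → Sect E F V}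
    (h : Smooth.IsSlide Q K) :
    Smooth.IsDer (Q ∘ₗ A.delS + A.delS ∘ₗ Q) (fun _ => 0) (fun α => K (A.rho α))
      (fun X => A.rho (K X)) where
  der := h.der.comp_add Smooth.par_par A.isTwistedDer_delS h.par_apply A.par_delS
  func f := by simp [h.func, Smooth.func_zero]
  sect α := by simp [h.sect, h.vec]
  vec X := by simp [h.vec]

/-- On generators `L_{fα} - f L_α` is `0` on functions, `β ↦ -ρ(β)(f) α` and `X ↦ -X(f) ρ(α)`; these
are, up to sign, the values of `K ∂ + ∂ K` for `K` the slide of `df ⊗ α`. -/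
theorem isLeibniz : IsLeibniz A.bracket A.lieS A.delS fsmul
    (fun f => LinearMap.mulLeft ℝ (Smooth.func f : Smooth E F V)) contractWedge
    (fun β f => vecDeriv (A.rho β) f) where
  bracket_smul f α β := A.bracket_fsmul_left f α β
  lie_smul f α := (A.isDer_lieS (fsmul f α)).ext (((A.isDer_lieS α).mulLeft f).sub
      (A.isDer_slide_del (isSlide_contractWedge f α)))
    (fun g => by rw [A.rho_fsmul, vecDeriv_fsmul_left, sub_zero])
    (fun β => A.bracket_fsmul_left f α β)
    (fun X => by rw [A.rho_fsmul, vecBracket_fsmul_left, A.rho_fsmul])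
  del_mul f x := by
    rw [LinearMap.mulLeft_apply, A.isTwistedDer_delS, delS_func, zero_mul, add_zero]; rfl
  lie_mul f β x := by
    rw [LinearMap.mulLeft_apply, (A.isDer_lieS β).der, (A.isDer_lieS β).func]; rfl
  lie_contract f α β x := by
    have h := ((isSlide_contractWedge f α).lie (A.isDer_lieS β) (A.isDer_lieS β).par_apply).ext
      ((isSlide_contractWedge (vecDeriv (A.rho β) f) α).sub
        (isSlide_contractWedge f (A.bracket α β))) (fun X => by
        rw [A.bracket_fsmul_right, vecDeriv_vecBracket, A.bracket_swap β α]
        refine sect_ext fun x => ?_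
        simp only [sect_sub_apply, sect_add_apply, fsmul_apply, func_sub_apply, sect_neg_apply,
          sub_smul, smul_neg]
        abel) x
    simp only [LinearMap.sub_apply, LinearMap.comp_apply] at h
    rw [add_sub_assoc, ← h]
    abel

section Connection

variable (nabla nabla' : CovariantDerivative 𝓘(ℝ, E) F V)
  [CovariantDerivative.ContMDiffCovariantDerivative nabla ∞]
  [CovariantDerivative.ContMDiffCovariantDerivative nabla' ∞]

theorem basA_eq (α β : Sect E F V) :
    A.basA nabla α β = A.bracket α β + cov nabla (A.rho β) α := add_comm _ _

theorem basT_eq (α : Sect E F V) (X : VecField E M) :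
    A.basT nabla α X = vecBracket (A.rho α) X + A.rho (cov nabla X α) := add_comm _ _

theorem bas_spec (α : Sect E F V) :
    IsDerivationExtension (fun f => vecDeriv (A.rho α) f) (A.basA nabla α) (A.basT nabla α)
      (A.bas nabla α) ∧
    ∀ s ∈ smoothSections E F V, ∀ j i x, (∀ᶠ y in 𝓝 x, s y ∈ bidegree _ _ j i) →
        A.bas nabla α s x ∈ bidegree _ _ j i := by
  let DA : Sect E F V →ₗ[ℝ] Sect E F V :=
    { toFun := A.basA nabla α
      map_add' := fun β γ => by
        simp only [basA_eq, A.rho_add, cov_add_left, map_add]; abel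
      map_smul' := fun r β => by
        simp only [basA_eq, A.rho_smul, cov_smul_left, map_smul, smul_add, RingHom.id_apply] }
  let DT : VecField E M →ₗ[ℝ] VecField E M :=
    { toFun := A.basT nabla α
      map_add' := fun X Y => by
        simp only [basT_eq, cov_add_left, A.rho_add, vecBracket_add_right]; abel
      map_smul' := fun r X => by
        simp only [basT_eq, cov_smul_left, A.rho_smul, vecBracket_smul_right, smul_add,
          RingHom.id_apply] }
  refine derivationExtension_spec (vecDerivHom (A.rho α)) DA DT (vecDeriv_mul _) (fun f β => ?_)
    (fun f X => ?_)
  · change A.basA nabla α (fsmul f β) = fsmul (vecDeriv (A.rho α) f) β + fsmul f (A.basA nabla α β)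
    rw [basA_eq, basA_eq, A.bracket_fsmul_right, A.rho_fsmul, cov_fsmul_left]
    refine sect_ext fun x => ?_
    simp only [sect_add_apply, fsmul_apply, smul_add]
    abel
  · change A.basT nabla α (fsmul f X) = fsmul (vecDeriv (A.rho α) f) X + fsmul f (A.basT nabla α X)
    rw [basT_eq, basT_eq, vecBracket_fsmul_right, cov_fsmul_left, A.rho_fsmul]
    refine sect_ext fun x => ?_
    simp only [sect_add_apply, fsmul_apply, smul_add]
    abel

/-- The connection on smooth sections. -/
def basS (α : Sect E F V) : Smooth E F V →ₗ[ℝ] Smooth E F V :=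
  Smooth.ofMem (A.bas nabla α) (A.bas_spec nabla α).1.mem

theorem isDer_basS (α : Sect E F V) : Smooth.IsDer (A.basS nabla α)
    (fun f => vecDeriv (A.rho α) f) (A.basA nabla α) (A.basT nabla α) :=
  (A.bas_spec nabla α).1.isDer

end Connection

end LieAlgebroid

section Connection

variable (nabla nabla' : CovariantDerivative 𝓘(ℝ, E) F V)
  [CovariantDerivative.ContMDiffCovariantDerivative nabla ∞]
  [CovariantDerivative.ContMDiffCovariantDerivative nabla' ∞]

/-- The slides of `X ↦ ∇_X α`. -/
def covS : Sect E F V →ₗ[ℝ] Smooth E F V →ₗ[ℝ] Smooth E F V :=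
  slideFamily (θ := fun α x => (nabla α x).toLinearMap) (K := fun α X => cov nabla X α)
    (fun _ _ _ => rfl) (fun α β X => cov_add_right nabla X α β)
    (fun r α X => cov_smul_right nabla r X α)

theorem isSlide_covS (α : Sect E F V) :
    Smooth.IsSlide (covS nabla α) (fun X => cov nabla X α) :=
  isSlide_slideFamily _ _ _ α

theorem covS_fsmul (f : Func E M) (α : Sect E F V) (s : Smooth E F V) :
    covS nabla (fsmul f α) s = Smooth.func f * covS nabla α s + contractWedge f α s :=
  (isSlide_covS nabla (fsmul f α)).ext (((isSlide_covS nabla α).mulLeft f).add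
    (isSlide_contractWedge f α)) (fun X => cov_fsmul_right nabla f X α) s

theorem covS_sub_fsmul (f : Func E M) (α : Sect E F V) (s : Smooth E F V) :
    (covS nabla - covS nabla') (fsmul f α) s =
      Smooth.func f * (covS nabla - covS nabla') α s := by
  rw [LinearMap.sub_apply, LinearMap.sub_apply, LinearMap.sub_apply, LinearMap.sub_apply,
    covS_fsmul, covS_fsmul, mul_sub]
  abel

end Connection

namespace LieAlgebroid

section Curvature

variable (A : LieAlgebroid E F V) (nabla : CovariantDerivative 𝓘(ℝ, E) F V)
  [CovariantDerivative.ContMDiffCovariantDerivative nabla ∞]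

/-- The derivation `θ(α) ∂ + ∂ θ(α)`, for `θ(α) = ∇ α`. -/
def kappaS (α : Sect E F V) : Smooth E F V →ₗ[ℝ] Smooth E F V :=
  covS nabla α ∘ₗ A.delS + A.delS ∘ₗ covS nabla α

theorem isDer_kappaS (α : Sect E F V) : Smooth.IsDer (A.kappaS nabla α) (fun _ => 0)
    (fun β => cov nabla (A.rho β) α) (fun X => A.rho (cov nabla X α)) :=
  A.isDer_slide_del (isSlide_covS nabla α)

/-- The basic connection is the Lie derivative corrected by the anticommutator of `∇α` with `∂`,
which is the term produced when `∂` is conjugated by `exp(N_∇)`. -/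
theorem basS_eq (α : Sect E F V) (s : Smooth E F V) :
    A.basS nabla α s = A.lieS α s + A.kappaS nabla α s :=
  (A.isDer_basS nabla α).ext ((A.isDer_lieS α).add (A.isDer_kappaS nabla α))
    (fun _ => (add_zero _).symm) (fun β => A.basA_eq nabla α β) (fun X => A.basT_eq nabla α X) s

/-- The part of the basic curvature which is linear in the connection. -/
def curvOne (α β : Sect E F V) : Smooth E F V →ₗ[ℝ] Smooth E F V :=
  covS nabla (A.bracket α β) + (A.lieS β ∘ₗ covS nabla α - covS nabla α ∘ₗ A.lieS β) -
    (A.lieS α ∘ₗ covS nabla β - covS nabla β ∘ₗ A.lieS α)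

/-- Twice the part of the basic curvature which is quadratic in the connection. -/
def curvTwo (α β : Sect E F V) : Smooth E F V →ₗ[ℝ] Smooth E F V :=
  (A.kappaS nabla β ∘ₗ covS nabla α - covS nabla α ∘ₗ A.kappaS nabla β) -
    (A.kappaS nabla α ∘ₗ covS nabla β - covS nabla β ∘ₗ A.kappaS nabla α)

theorem isSlide_curvOne (α β : Sect E F V) : Smooth.IsSlide (A.curvOne nabla α β) fun X =>
    cov nabla X (A.bracket α β) + (A.bracket β (cov nabla X α) -
      cov nabla (vecBracket (A.rho β) X) α) - (A.bracket α (cov nabla X β) -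
      cov nabla (vecBracket (A.rho α) X) β) :=
  ((isSlide_covS nabla _).add ((isSlide_covS nabla α).lie (A.isDer_lieS β)
    (A.isDer_lieS β).par_apply)).sub ((isSlide_covS nabla β).lie (A.isDer_lieS α)
    (A.isDer_lieS α).par_apply)

theorem isSlide_curvTwo (α β : Sect E F V) : Smooth.IsSlide (A.curvTwo nabla α β) fun X =>
    (cov nabla (A.rho (cov nabla X α)) β - cov nabla (A.rho (cov nabla X β)) α) -
      (cov nabla (A.rho (cov nabla X β)) α - cov nabla (A.rho (cov nabla X α)) β) :=
  ((isSlide_covS nabla α).lie (A.isDer_kappaS nabla β) (A.isDer_kappaS nabla β).par_apply).sub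
    ((isSlide_covS nabla β).lie (A.isDer_kappaS nabla α) (A.isDer_kappaS nabla α).par_apply)

/-- The basic curvature as an operator on smooth sections. -/
def curvS (α β : Sect E F V) : Smooth E F V →ₗ[ℝ] Smooth E F V :=
  A.curvOne nabla α β + (2⁻¹ : ℝ) • A.curvTwo nabla α β

/-- Expanding `∇^bas X` in `R^bas` gives the quadratic terms `∇_{ρ(∇_X α)} β - ∇_{ρ(∇_X β)} α`. Each
of the two commutators in `curvTwo` yields them once, whence the factor `1/2`. -/
theorem isSlide_curvS (α β : Sect E F V) :
    Smooth.IsSlide (A.curvS nabla α β) (A.basCurvature nabla α β) := by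
  have h := (A.isSlide_curvOne nabla α β).add ((A.isSlide_curvTwo nabla α β).smul 2⁻¹)
  refine ⟨h.der, h.func, h.sect, fun X => (h.vec X).trans (congrArg Smooth.sect ?_)⟩
  rw [basCurvature, basT_eq, basT_eq, cov_add_left, cov_add_left,
    A.bracket_swap (cov nabla X α) β]
  module

/-- As `R^bas(α, β)` comes from a slide it is tensorial, so `tensorAt` is not at its default value
`0`. -/
theorem curvatureExt_coe (α β : Sect E F V) (s : Smooth E F V) :
    A.curvatureExt nabla α β s.1 = (A.curvS nabla α β s).1 := by
  have h : ∀ X x, tensorAt (A.basCurvature nabla α β) x (X x) = A.basCurvature nabla α β X x := by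
    intro X x
    have hx := (A.isSlide_curvS nabla α β).exists_linearMap x
    rw [tensorAt, dif_pos hx]
    exact hx.choose_spec X
  exact congrArg Subtype.val ((isSlide_fibrewise h).ext (A.isSlide_curvS nabla α β)
    (fun _ => rfl) s)

theorem expC_dC {c : Coch (Sect E F V) (Smooth E F V)} (hc : c ∈ altC) :
    eps (expC (insC (covS nabla)) (dC A.bracket A.lieS A.delS c)) =
      -twistedC A.bracket (A.basS nabla) A.delS (A.curvS nabla)
        (eps (expC (insC (covS nabla)) c)) :=
  LieAlgebroidCohomology.expC_dC (κ := A.kappaS nabla) (ω₁ := A.curvOne nabla)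
    (ω₂ := A.curvTwo nabla) (fun _ _ => rfl) (A.basS_eq nabla) (fun _ _ _ => rfl)
    (fun _ _ _ => rfl) (fun _ _ _ => rfl)
    (fun α β γ => (isSlide_covS nabla α).anticomm (A.isSlide_curvOne nabla β γ))
    (fun α β γ => (isSlide_covS nabla α).anticomm (A.isSlide_curvTwo nabla β γ)) hc

end Curvature

end LieAlgebroid

end AlgebroidOperators

/-! ## Comparison of cohomologies -/

section CohomologyEquiv

variable {N N' : Type*} [AddCommGroup N] [Module ℝ N] [AddCommGroup N'] [Module ℝ N']
  {C : ℕ → Submodule ℝ N} {D : N →ₗ[ℝ] N} {C' : ℕ → Submodule ℝ N'} {D' : N' →ₗ[ℝ] N'}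
  {f : ℕ → N →ₗ[ℝ] N'}

/-- A degreewise bijection which commutes with the differentials matches cocycles and coboundaries.
To pull a cocycle back, injectivity in degree `p + 1` is needed. -/
theorem exists_cohomology_equiv (hD : ∀ p, ∀ c ∈ C p, D c ∈ C (p + 1))
    (hf : ∀ p, Set.BijOn (f p) (C p) (C' p)) (hfD : ∀ p, ∀ c ∈ C p, f (p + 1) (D c) = D' (f p c))
    (p : ℕ) : ∃ e : Cohomology C D p ≃ₗ[ℝ] Cohomology C' D' p,
      ∀ (c : N) (hc : c ∈ cocycles C D p), ∃ hc' : f p c ∈ cocycles C' D' p,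
        e (cohomologyClass C D p c hc) = cohomologyClass C' D' p (f p c) hc' := by
  have h1 : ∀ c ∈ cocycles C D p, f p c ∈ cocycles C' D' p := fun c hc =>
    ⟨(hf p).mapsTo hc.1, by
      change D' (f p c) = 0
      rw [← hfD p c hc.1, show D c = 0 from hc.2, map_zero]⟩
  let g : cocycles C D p →ₗ[ℝ] cocycles C' D' p := (f p).restrict h1
  have hg : Function.Bijective g := by
    constructor
    · intro a b hab
      exact Subtype.ext ((hf p).injOn a.2.1 b.2.1 (congrArg Subtype.val hab))
    · rintro ⟨c', hc', hc''⟩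
      obtain ⟨c, hc, rfl⟩ := (hf p).surjOn hc'
      have h2 : D c = 0 := (hf (p + 1)).injOn (hD p c hc) (zero_mem (C (p + 1))) (by
        rw [hfD p c hc, map_zero]; exact hc'')
      exact ⟨⟨c, hc, h2⟩, rfl⟩
  have h3 : ((coboundaries C D p).submoduleOf (cocycles C D p)).map
      (LinearEquiv.ofBijective g hg).toLinearMap =
      (coboundaries C' D' p).submoduleOf (cocycles C' D' p) := by
    ext ⟨c', hc'⟩
    rw [Submodule.mem_map]
    change (∃ y : cocycles C D p, y.1 ∈ coboundaries C D p ∧ g y = _) ↔ c' ∈ coboundaries C' D' p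
    cases p with
    | zero =>
      constructor
      · rintro ⟨y, hy, h⟩
        have h' : f 0 y.1 = c' := congrArg Subtype.val h
        rw [← h']
        change f 0 y.1 ∈ (⊥ : Submodule ℝ N')
        rw [(Submodule.mem_bot ℝ).1 hy, map_zero]
        exact zero_mem _
      · intro h
        exact ⟨0, zero_mem _, Subtype.ext ((map_zero (f 0)).trans
          ((Submodule.mem_bot ℝ).1 h).symm)⟩
    | succ p =>
      constructor
      · rintro ⟨y, ⟨b, hb, hby⟩, h⟩
        refine ⟨f p b, (hf p).mapsTo hb, ?_⟩
        rw [← hfD p b hb, hby]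
        exact congrArg Subtype.val h
      · rintro ⟨b', hb', hb''⟩
        obtain ⟨b, hb, rfl⟩ := (hf p).surjOn hb'
        rw [← hfD p b hb] at hb''
        obtain ⟨y, hy⟩ := hg.2 ⟨c', hc'⟩
        refine ⟨y, ⟨b, hb, ?_⟩, hy⟩
        exact (hf (p + 1)).injOn (hD p b hb) y.2.1 (hb''.trans (congrArg Subtype.val hy).symm)
  exact ⟨Submodule.Quotient.equiv _ _ (LinearEquiv.ofBijective g hg) h3,
    fun c hc => ⟨h1 c hc, rfl⟩⟩

end CohomologyEquiv

/-! ## First and last arguments -/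

section Snoc

variable {S T : Type*} [AddCommGroup S] [Module ℝ S] [AddCommGroup T] [Module ℝ T]

/-- The function relations are stated in the last argument, while the calculus inserts first
arguments; the cyclic permutation between the two has sign `(-1)^q`. -/
theorem snoc_eq_of_mem_altC {c : Coch S T} (hc : c ∈ altC) (q : ℕ) (v : Fin q → S) (α : S) :
    c (q + 1) (Fin.snoc v α) = (-1 : ℝ) ^ q • c (q + 1) (Fin.cons α v) := by
  obtain ⟨g, hg⟩ := hc (q + 1)
  rw [← hg, Fin.snoc_eq_cons_rotate]
  have h := g.map_perm (Fin.cons α v) (finRotate (q + 1))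
  rw [sign_finRotate] at h
  refine h.trans ?_
  rcases Nat.even_or_odd q with hq | hq
  · simp [hq.neg_one_pow]
  · simp [hq.neg_one_pow]

end Snoc

section Transfer

variable {E : Type*} [NormedAddCommGroup E] [NormedSpace ℝ E] [FiniteDimensional ℝ E]
  {M : Type*} [TopologicalSpace M] [ChartedSpace E M] [IsManifold 𝓘(ℝ, E) ∞ M]
  {F : Type*} [NormedAddCommGroup F] [NormedSpace ℝ F] [FiniteDimensional ℝ F]
  {V : M → Type*} [TopologicalSpace (TotalSpace F V)]
  [∀ x, AddCommGroup (V x)] [∀ x, Module ℝ (V x)] [∀ x, TopologicalSpace (V x)]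
  [∀ x, IsTopologicalAddGroup (V x)] [∀ x, ContinuousSMul ℝ (V x)]
  [FiberBundle F V] [VectorBundle ℝ F V] [ContMDiffVectorBundle ∞ F V 𝓘(ℝ, E)]

/-! ## The grading -/

variable (E F V) in
/-- The smooth sections of `Λ^(k-i) A ⊗ S^i TM`, for `q + i = p`. -/
def level (k p q : ℕ) : Submodule ℝ (Smooth E F V) where
  carrier := {s | ∀ x, s.1 x ∈ ⨆ (i : ℕ) (j : ℕ) (_ : q + i = p) (_ : j + i = k),
      bidegree (V x) (TangentSpace 𝓘(ℝ, E) x) j i}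
  add_mem' h h' x := add_mem (h x) (h' x)
  zero_mem' _ := zero_mem _
  smul_mem' r _ h x := Submodule.smul_mem _ r (h x)

/-- The numbers `k, p, q` determine `i` and `j`, so the supremum has at most one term, and none if
`q > p` or `i > k`. -/
theorem mem_level {k p q : ℕ} {s : Smooth E F V} : s ∈ level E F V k p q ↔
    s = 0 ∨ ∃ i j, q + i = p ∧ j + i = k ∧
      ∀ x, s.1 x ∈ bidegree (V x) (TangentSpace 𝓘(ℝ, E) x) j i := by
  constructor
  · intro h
    by_cases hij : ∃ i j, q + i = p ∧ j + i = k
    · obtain ⟨i, j, hi, hj⟩ := hij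
      refine Or.inr ⟨i, j, hi, hj, fun x => ?_⟩
      refine (iSup_le fun i' => iSup_le fun j' => iSup_le fun hi' => iSup_le fun hj' => ?_ :
        _ ≤ bidegree (V x) (TangentSpace 𝓘(ℝ, E) x) j i) (h x)
      obtain rfl : i' = i := by omega
      obtain rfl : j' = j := by omega
      exact le_rfl
    · refine Or.inl (Smooth.ext fun x => (Submodule.mem_bot ℝ).1 ?_)
      have h0 : (⨆ (i : ℕ) (j : ℕ) (_ : q + i = p) (_ : j + i = k),
          bidegree (V x) (TangentSpace 𝓘(ℝ, E) x) j i) ≤ ⊥ :=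
        iSup_le fun i' => iSup_le fun j' => iSup_le fun hi' => iSup_le fun hj' =>
          absurd ⟨i', j', hi', hj'⟩ hij
      exact h0 (h x)
  · rintro (rfl | ⟨i, j, hi, hj, h⟩)
    · exact zero_mem _
    · intro x
      exact Submodule.mem_iSup_of_mem i (Submodule.mem_iSup_of_mem j
        (Submodule.mem_iSup_of_mem hi (Submodule.mem_iSup_of_mem hj (h x))))

theorem level_succ (k p q : ℕ) : level E F V k (p + 1) (q + 1) = level E F V k p q := by
  ext s
  rw [mem_level, mem_level]
  refine or_congr Iff.rfl (exists_congr fun i => exists_congr fun j => and_congr ?_ Iff.rfl)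
  omega

theorem level_of_lt {k p q : ℕ} (h : p < q) {s : Smooth E F V} (hs : s ∈ level E F V k p q) :
    s = 0 := by
  rcases mem_level.1 hs with h' | ⟨i, j, hi, -⟩
  · exact h'
  · omega

theorem ofMem_mem_level {D : Tensor E V →ₗ[ℝ] Tensor E V}
    {hD : ∀ s ∈ smoothSections E F V, D s ∈ smoothSections E F V}
    (h : ∀ s ∈ smoothSections E F V, ∀ j i x, (∀ᶠ y in 𝓝 x, s y ∈ bidegree _ _ j i) →
      D s x ∈ bidegree _ _ j i) {k p q : ℕ} {s : Smooth E F V} (hs : s ∈ level E F V k p q) :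
    Smooth.ofMem D hD s ∈ level E F V k p q := by
  rw [mem_level] at hs ⊢
  rcases hs with rfl | ⟨i, j, hi, hj, hs⟩
  · exact Or.inl (map_zero _)
  · exact Or.inr ⟨i, j, hi, hj, fun x => h s.1 s.2 j i x (Filter.Eventually.of_forall hs)⟩

theorem slide_mem_level {κ : ∀ x : M, TangentSpace 𝓘(ℝ, E) x →ₗ[ℝ] V x}
    {Q : Smooth E F V →ₗ[ℝ] Smooth E F V} (hQ : ∀ s x, (Q s).1 x = slide (κ x) (s.1 x))
    {k p q : ℕ} {s : Smooth E F V} (hs : s ∈ level E F V k p q) :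
    Q s ∈ level E F V k p (q + 1) := by
  rw [mem_level] at hs ⊢
  rcases hs with rfl | ⟨_ | i, j, hi, hj, hs⟩
  · exact Or.inl (map_zero _)
  · exact Or.inl (Smooth.ext fun x => (hQ s x).trans (slide_bidegree_zero _ (hs x)))
  · refine Or.inr ⟨i, j + 1, by omega, by omega, fun x => ?_⟩
    rw [hQ]
    exact slide_bidegree _ (hs x)

theorem LieAlgebroid.delS_mem_level (A : LieAlgebroid E F V) {k p q : ℕ} {s : Smooth E F V}
    (hs : s ∈ level E F V k p q) : A.delS s ∈ level E F V k (p + 1) q := by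
  rw [mem_level] at hs ⊢
  rcases hs with rfl | ⟨i, _ | j, hi, hj, hs⟩
  · exact Or.inl (map_zero _)
  · exact Or.inl (Smooth.ext fun x => boundary_bidegree_zero _ (hs x))
  · exact Or.inr ⟨i + 1, j, by omega, by omega, fun x => boundary_bidegree _ (hs x)⟩

variable (E F V) in
/-- The families with `c^q` in `Λ^(k-i) A ⊗ S^i TM`, for `q + i = p`. -/
def levelC (k p : ℕ) : Submodule ℝ (Coch (Sect E F V) (Smooth E F V)) where
  carrier := {c | ∀ q v, c q v ∈ level E F V k p q}
  add_mem' h h' q v := add_mem (h q v) (h' q v)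
  zero_mem' _ _ := zero_mem _
  smul_mem' r _ h q v := Submodule.smul_mem _ r (h q v)

section LevelC

variable {k p : ℕ} {c : Coch (Sect E F V) (Smooth E F V)}

theorem eps_mem_levelC (hc : c ∈ levelC E F V k p) : eps c ∈ levelC E F V k p :=
  fun q v => Submodule.smul_mem _ _ (hc q v)

theorem act_mem_levelC {p' : ℕ} {a : Sect E F V → Smooth E F V →ₗ[ℝ] Smooth E F V}
    (ha : ∀ α q, ∀ s ∈ level E F V k p q, a α s ∈ level E F V k p' (q + 1))
    (hc : c ∈ levelC E F V k p) : act a c ∈ levelC E F V k p' := by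
  rintro (_ | q) v
  · exact zero_mem _
  · exact sum_mem fun i _ => Submodule.smul_mem _ _ (ha _ _ _ (hc _ _))

theorem brC_mem_levelC (br : Sect E F V →ₗ[ℝ] Sect E F V →ₗ[ℝ] Sect E F V)
    (hc : c ∈ levelC E F V k p) : brC br c ∈ levelC E F V k (p + 1) := by
  rintro (_ | _ | q) v
  · exact zero_mem _
  · exact zero_mem _
  · rw [brC, twoC_add_two_apply]
    refine sum_mem fun j _ => sum_mem fun i _ => ?_
    split_ifs
    · refine Submodule.smul_mem _ _ ?_
      rw [level_succ]
      exact hc _ _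
    · exact zero_mem _

theorem expC_mem_levelC {N : Coch (Sect E F V) (Smooth E F V) →ₗ[ℝ]
      Coch (Sect E F V) (Smooth E F V)}
    (hN : ∀ c ∈ levelC E F V k p, N c ∈ levelC E F V k p) (hc : c ∈ levelC E F V k p) :
    expC N c ∈ levelC E F V k p := fun q v => by
  rw [expC_apply]
  have h : expTrunc N (q + 1) c ∈ levelC E F V k p := sum_mem fun r hr =>
    Submodule.smul_mem _ _ (by
      clear hr
      induction r with
      | zero => exact hc
      | succ r ih => rw [pow_succ']; exact hN _ ih)
  exact h q v

end LevelC

/-! ## Transfer between cochains and smooth cochains -/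

namespace Smooth

variable (E F V) in
/-- The inclusion of the smooth sections in all sections. -/
def incl : Smooth E F V →ₗ[ℝ] Tensor E V where
  toFun s := s.1
  map_add' _ _ := rfl
  map_smul' _ _ := rfl

theorem incl_injective : Function.Injective (incl E F V) := Subtype.val_injective

end Smooth

variable (E F V) in
/-- A family of maps with smooth values, as a family of maps. -/
def inclC : Coch (Sect E F V) (Smooth E F V) →ₗ[ℝ] Cochain E F V := ptw (Smooth.incl E F V)

theorem inclC_injective : Function.Injective (inclC E F V) := fun _ _ h =>
  funext fun q => funext fun v => Smooth.incl_injective (congrFun (congrFun h q) v)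

/-- Strings are replaced by families with values in the algebra `Smooth`, in which derivations are
determined by generators. -/
theorem mem_strings {k p : ℕ} {c : Cochain E F V} : c ∈ strings E F V k p ↔
    ∃ c' ∈ altC, c' ∈ levelC E F V k p ∧ inclC E F V c' = c := by
  constructor
  · intro h
    refine ⟨fun q v => Smooth.mk (c q v) ((h q).2.1 v), fun q => ?_,
      fun q v => (h q).2.2 v, rfl⟩
    obtain ⟨g, hg⟩ := (h q).1
    exact ⟨{ toFun := fun v => Smooth.mk (c q v) ((h q).2.1 v)
             map_update_add' := fun v i a b => Subtype.ext (by
              change c q _ = c q _ + c q _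
              rw [← hg]
              exact g.map_update_add' v i a b)
             map_update_smul' := fun v i r a => Subtype.ext (by
              change c q _ = r • c q _
              rw [← hg]
              exact g.map_update_smul' v i r a)
             map_eq_zero_of_eq' := fun v i j hv hij => Subtype.ext (by
              change c q _ = 0
              rw [← hg]
              exact g.map_eq_zero_of_eq' v i j hv hij) }, rfl⟩
  · rintro ⟨c', h1, h2, rfl⟩ q
    exact ⟨ptw_mem_altC _ h1 q, fun v => (c' q v).2, fun v x => h2 q v x⟩

/-- Multiplication by a function. -/
def mulFunc (f : Func E M) : Smooth E F V →ₗ[ℝ] Smooth E F V :=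
  LinearMap.mulLeft ℝ (Smooth.func f)

theorem smul_eq_iff {T : Type*} [AddCommGroup T] [Module ℝ T] {s : ℝ} (hs : s * s = 1)
    (m : T →ₗ[ℝ] T) (X Y Z : T) : s • X = m (s • Y) + Z ↔ X = m Y + s • Z := by
  constructor
  · intro h
    rw [← one_smul ℝ X, ← hs, mul_smul, h, smul_add, map_smul, smul_smul, hs, one_smul]
  · intro h
    rw [h, smul_add, map_smul, smul_smul, hs, one_smul]

theorem neg_one_pow_mul_self (q : ℕ) : (-1 : ℝ) ^ q * (-1) ^ q = 1 := by
  rw [← mul_pow]; simp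

variable [T2Space M] [SigmaCompactSpace M]

/-- Passing from the last to the first argument puts `(-1)^q` on both values of `c^(q+1)` but not on
the tail; this is the `eps` in `IsTailed`. -/
theorem isTailed_iff {c : Coch (Sect E F V) (Smooth E F V)} (hc : c ∈ altC) :
    IsTailed fsmul mulFunc contractWedge c ↔ ∀ q (v : Fin q → Sect E F V) (f : Func E M)
      (α : Sect E F V), inclC E F V c (q + 1) (Fin.snoc v (fsmul f α)) =
        ofFunc f * inclC E F V c (q + 1) (Fin.snoc v α) +
          contractD f (inclC E F V c q v * ofSect α) := by
  have key : ∀ q (v : Fin q → Sect E F V) (f : Func E M) (α : Sect E F V),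
      inclC E F V c (q + 1) (Fin.snoc v (fsmul f α)) =
        ofFunc f * inclC E F V c (q + 1) (Fin.snoc v α) +
          contractD f (inclC E F V c q v * ofSect α) ↔
      c (q + 1) (Fin.cons (fsmul f α) v) = mulFunc f (c (q + 1) (Fin.cons α v)) +
        (-1 : ℝ) ^ q • contractWedge f α (c q v) := by
    intro q v f α
    rw [← smul_eq_iff (neg_one_pow_mul_self q), ← snoc_eq_of_mem_altC hc,
      ← snoc_eq_of_mem_altC hc]
    change (c (q + 1) _).1 = _ + contractD f ((c q v).1 * ofSect α) ↔ _
    rw [← contractWedge_coe]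
    exact (Smooth.incl_injective (E := E) (F := F) (V := V)).eq_iff
      (a := c (q + 1) (Fin.snoc v (fsmul f α)))
      (b := mulFunc f (c (q + 1) (Fin.snoc v α)) + contractWedge f α (c q v))
  constructor
  · intro h q v f α
    exact (key q v f α).2 (congrFun (congrFun (h f α) q) v)
  · intro h f α
    ext q v
    exact (key q v f α).1 (h q v f α)

theorem isFormLinear_iff {c : Coch (Sect E F V) (Smooth E F V)} (hc : c ∈ altC) :
    IsFormLinear fsmul mulFunc c ↔ ∀ q (v : Fin q → Sect E F V) (f : Func E M)
      (α : Sect E F V), inclC E F V c (q + 1) (Fin.snoc v (fsmul f α)) =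
        ofFunc f * inclC E F V c (q + 1) (Fin.snoc v α) := by
  have key : ∀ q (v : Fin q → Sect E F V) (f : Func E M) (α : Sect E F V),
      inclC E F V c (q + 1) (Fin.snoc v (fsmul f α)) =
        ofFunc f * inclC E F V c (q + 1) (Fin.snoc v α) ↔
      c (q + 1) (Fin.cons (fsmul f α) v) = mulFunc f (c (q + 1) (Fin.cons α v)) := by
    intro q v f α
    have h := smul_eq_iff (neg_one_pow_mul_self q) (mulFunc f) (c (q + 1) (Fin.cons (fsmul f α) v))
      (c (q + 1) (Fin.cons α v)) 0
    rw [add_zero, smul_zero, add_zero] at h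
    rw [← h, ← snoc_eq_of_mem_altC hc, ← snoc_eq_of_mem_altC hc]
    exact (Smooth.incl_injective (E := E) (F := F) (V := V)).eq_iff
      (a := c (q + 1) (Fin.snoc v (fsmul f α))) (b := mulFunc f (c (q + 1) (Fin.snoc v α)))
  constructor
  · intro h q v f α
    exact (key q v f α).2 (congrFun (congrFun (h f α) q) v)
  · intro h f α
    ext q v
    exact (key q v f α).1 (h q v f α)

theorem mem_intrinsic {k p : ℕ} {c : Cochain E F V} : c ∈ intrinsic E F V k p ↔
    ∃ c' ∈ altC, c' ∈ levelC E F V k p ∧ IsTailed fsmul mulFunc contractWedge c' ∧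
      inclC E F V c' = c := by
  constructor
  · rintro ⟨h, h'⟩
    obtain ⟨c', h1, h2, rfl⟩ := mem_strings.1 h
    exact ⟨c', h1, h2, (isTailed_iff h1).2 h', rfl⟩
  · rintro ⟨c', h1, h2, h3, rfl⟩
    exact ⟨mem_strings.2 ⟨c', h1, h2, rfl⟩, (isTailed_iff h1).1 h3⟩

theorem mem_forms {k p : ℕ} {c : Cochain E F V} : c ∈ forms E F V k p ↔
    ∃ c' ∈ altC, c' ∈ levelC E F V k p ∧ IsFormLinear fsmul mulFunc c' ∧
      inclC E F V c' = c := by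
  constructor
  · rintro ⟨h, h'⟩
    obtain ⟨c', h1, h2, rfl⟩ := mem_strings.1 h
    exact ⟨c', h1, h2, (isFormLinear_iff h1).2 h', rfl⟩
  · rintro ⟨c', h1, h2, h3, rfl⟩
    exact ⟨mem_strings.2 ⟨c', h1, h2, rfl⟩, (isFormLinear_iff h1).1 h3⟩

end Transfer

section Transfer

variable {E : Type*} [NormedAddCommGroup E] [NormedSpace ℝ E] [FiniteDimensional ℝ E]
  {M : Type*} [TopologicalSpace M] [ChartedSpace E M] [IsManifold 𝓘(ℝ, E) ∞ M]
  [T2Space M] [SigmaCompactSpace M]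
  {F : Type*} [NormedAddCommGroup F] [NormedSpace ℝ F] [FiniteDimensional ℝ F]
  {V : M → Type*} [TopologicalSpace (TotalSpace F V)]
  [∀ x, AddCommGroup (V x)] [∀ x, Module ℝ (V x)] [∀ x, TopologicalSpace (V x)]
  [∀ x, IsTopologicalAddGroup (V x)] [∀ x, ContinuousSMul ℝ (V x)]
  [FiberBundle F V] [VectorBundle ℝ F V] [ContMDiffVectorBundle ∞ F V 𝓘(ℝ, E)]

/-! ### Transfer of operators -/

theorem inclC_apply (c : Coch (Sect E F V) (Smooth E F V)) (q : ℕ) (v : Fin q → Sect E F V) :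
    inclC E F V c q v = Smooth.incl E F V (c q v) := rfl

namespace LieAlgebroid

variable (A : LieAlgebroid E F V)

theorem bracketTerms_inclC (c : Coch (Sect E F V) (Smooth E F V)) (q : ℕ)
    (v : Fin q → Sect E F V) :
    A.bracketTerms q v (inclC E F V c) = inclC E F V (brC A.bracket c) q v := by
  rcases q with _ | _ | q
  · rfl
  · rfl
  · rw [inclC_apply, brC, twoC_add_two_apply, map_sum, bracketTerms, LinearMap.sum_apply]
    refine Finset.sum_congr rfl fun j _ => ?_
    rw [map_sum, LinearMap.sum_apply]
    refine Finset.sum_congr rfl fun i _ => ?_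
    split_ifs
    · rfl
    · rfl

theorem actionTerms_inclC {a : Sect E F V → Tensor E V →ₗ[ℝ] Tensor E V}
    {b : Sect E F V → Smooth E F V →ₗ[ℝ] Smooth E F V} (h : ∀ α s, a α s.1 = (b α s).1)
    (c : Coch (Sect E F V) (Smooth E F V)) (q : ℕ) (v : Fin q → Sect E F V) :
    actionTerms a q v (inclC E F V c) = inclC E F V (act b c) q v := by
  rcases q with _ | q
  · rfl
  · rw [inclC_apply, act, actC_succ_apply, map_sum, actionTerms, LinearMap.sum_apply]
    refine Finset.sum_congr rfl fun i _ => ?_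
    rw [LinearMap.map_smul]
    exact congrArg ((-1 : ℝ) ^ (i : ℕ) • ·) (h (v i) (c q (i.removeNth v)))

theorem koszul_inclC {a : Sect E F V → Tensor E V →ₗ[ℝ] Tensor E V}
    {b : Sect E F V → Smooth E F V →ₗ[ℝ] Smooth E F V} (h : ∀ α s, a α s.1 = (b α s).1)
    (c : Coch (Sect E F V) (Smooth E F V)) :
    A.koszul a (inclC E F V c) = inclC E F V (brC A.bracket c + act b c) := by
  funext q v
  rw [map_add]
  exact congrArg₂ (· + ·) (A.bracketTerms_inclC c q v) (actionTerms_inclC h c q v)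

theorem delTerm_inclC (c : Coch (Sect E F V) (Smooth E F V)) :
    A.delTerm (inclC E F V c) = inclC E F V (eps (ptw A.delS c)) := rfl

theorem d_inclC (c : Coch (Sect E F V) (Smooth E F V)) :
    A.d (inclC E F V c) = inclC E F V (dC A.bracket A.lieS A.delS c) := by
  rw [d, LinearMap.sub_apply, A.koszul_inclC (b := A.lieS) (fun _ _ => rfl), delTerm_inclC,
    ← map_sub]
  rfl

variable (nabla : CovariantDerivative 𝓘(ℝ, E) F V)
  [CovariantDerivative.ContMDiffCovariantDerivative nabla ∞]

theorem curvatureTerms_inclC (c : Coch (Sect E F V) (Smooth E F V)) (q : ℕ)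
    (v : Fin q → Sect E F V) : A.curvatureTerms nabla q v (inclC E F V c) =
      inclC E F V (-eps (two (A.curvS nabla) c)) q v := by
  rcases q with _ | _ | q
  · have h : (-eps (two (A.curvS nabla) c)) 0 v = 0 :=
      neg_eq_zero.2 (smul_zero ((-1 : ℝ) ^ 0))
    rw [inclC_apply, h, map_zero]
    rfl
  · have h : (-eps (two (A.curvS nabla) c)) 1 v = 0 :=
      neg_eq_zero.2 (smul_zero ((-1 : ℝ) ^ 1))
    rw [inclC_apply, h, map_zero]
    rfl
  · have h : (-eps (two (A.curvS nabla) c)) (q + 2) v = ∑ j : Fin (q + 2), ∑ i : Fin (q + 1),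
        if i.castSucc < j then (-1 : ℝ) ^ (q + (i : ℕ) + (j : ℕ) + 1) •
          A.curvS nabla (v i.castSucc) (v j) (c q (omitPair v j i)) else 0 := by
      change -((-1 : ℝ) ^ (q + 2) • two (A.curvS nabla) c (q + 2) v) = _
      rw [two, twoC_add_two_apply, Finset.smul_sum, ← Finset.sum_neg_distrib]
      refine Finset.sum_congr rfl fun j _ => ?_
      rw [Finset.smul_sum, ← Finset.sum_neg_distrib]
      refine Finset.sum_congr rfl fun i _ => ?_
      split_ifs
      · rw [smul_smul, ← neg_smul]
        refine congrArg (· • _) ?_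
        ring
      · rw [smul_zero, neg_zero]
    rw [inclC_apply, h, map_sum, curvatureTerms, LinearMap.sum_apply]
    refine Finset.sum_congr rfl fun j _ => ?_
    rw [map_sum, LinearMap.sum_apply]
    refine Finset.sum_congr rfl fun i _ => ?_
    split_ifs
    · rw [LinearMap.map_smul]
      exact congrArg ((-1 : ℝ) ^ (q + (i : ℕ) + (j : ℕ) + 1) • ·)
        (A.curvatureExt_coe nabla (v i.castSucc) (v j) (c q (omitPair v j i)))
    · rfl

theorem structureOp_inclC (c : Coch (Sect E F V) (Smooth E F V)) :
    A.structureOp nabla (inclC E F V c) =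
      inclC E F V (twistedC A.bracket (A.basS nabla) A.delS (A.curvS nabla) c) := by
  have h : twistedC A.bracket (A.basS nabla) A.delS (A.curvS nabla) c =
      eps (ptw A.delS c) + (brC A.bracket c + act (A.basS nabla) c) +
        -eps (two (A.curvS nabla) c) := by
    simp only [twistedC, LinearMap.sub_apply, LinearMap.add_apply, LinearMap.comp_apply]
    abel
  rw [h, map_add, map_add, ← A.delTerm_inclC, ← A.koszul_inclC (a := A.bas nabla) (fun _ _ => rfl)]
  exact congrArg (A.delTerm (inclC E F V c) + A.koszul (A.bas nabla) (inclC E F V c) + ·)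
    (funext fun q => funext fun v => A.curvatureTerms_inclC nabla c q v)

end LieAlgebroid

theorem insertion_inclC {θ : Sect E F V → ∀ x : M, TangentSpace 𝓘(ℝ, E) x →ₗ[ℝ] V x}
    {θ' : Sect E F V →ₗ[ℝ] Smooth E F V →ₗ[ℝ] Smooth E F V}
    (h : ∀ α s x, slide (θ α x) (s.1 x) = (θ' α s).1 x) (c : Coch (Sect E F V) (Smooth E F V)) :
    insertion θ (inclC E F V c) = inclC E F V (insC θ' c) := by
  funext q v
  rcases q with _ | q
  · have h0 : insC θ' c 0 v = 0 := smul_zero ((-1 : ℝ) ^ 0)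
    rw [inclC_apply, h0, map_zero]
    rfl
  · have h1 : insC θ' c (q + 1) v = ∑ i : Fin (q + 1),
        (-1 : ℝ) ^ ((i : ℕ) + q + 1) • θ' (v i) (c q (i.removeNth v)) := by
      change (-1 : ℝ) ^ (q + 1) • act θ' c (q + 1) v = _
      rw [act, actC_succ_apply, Finset.smul_sum]
      refine Finset.sum_congr rfl fun i _ => ?_
      rw [smul_smul]
      refine congrArg (· • _) ?_
      ring
    rw [inclC_apply, h1, map_sum]
    refine (LinearMap.sum_apply _ _ _).trans (Finset.sum_congr rfl fun i _ => ?_)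
    rw [LinearMap.map_smul]
    exact congrArg ((-1 : ℝ) ^ ((i : ℕ) + q + 1) • ·)
      (funext fun x => h (v i) (c q (i.removeNth v)) x)

theorem expInsertion_inclC {θ : Sect E F V → ∀ x : M, TangentSpace 𝓘(ℝ, E) x →ₗ[ℝ] V x}
    {θ' : Sect E F V →ₗ[ℝ] Smooth E F V →ₗ[ℝ] Smooth E F V}
    (h : ∀ α s x, slide (θ α x) (s.1 x) = (θ' α s).1 x) (c : Coch (Sect E F V) (Smooth E F V)) :
    expInsertion θ (inclC E F V c) = inclC E F V (expC (insC θ') c) := by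
  have hr : ∀ r : ℕ, (insertion θ ^ r) (inclC E F V c) = inclC E F V ((insC θ' ^ r) c) := by
    intro r
    induction r with
    | zero => rfl
    | succ r ih => rw [pow_succ', pow_succ', Module.End.mul_apply, Module.End.mul_apply, ih,
        insertion_inclC h]
  have h1 : ∀ q, expInsertion θ (inclC E F V c) q = inclC E F V (expTrunc (insC θ') (q + 1) c) q := by
    intro q
    rw [expInsertion, expTrunc, map_sum, LinearMap.pi_apply, LinearMap.sum_apply,
      Finset.sum_apply]
    refine Finset.sum_congr rfl fun r _ => ?_
    rw [LinearMap.map_smul, ← hr]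
    rfl
  funext q v
  rw [h1, inclC_apply, inclC_apply, expC_apply]

section Connection

variable (nabla nabla' : CovariantDerivative 𝓘(ℝ, E) F V)
  [CovariantDerivative.ContMDiffCovariantDerivative nabla ∞]
  [CovariantDerivative.ContMDiffCovariantDerivative nabla' ∞]

theorem comparison_inclC (p : ℕ) (c : Coch (Sect E F V) (Smooth E F V)) :
    comparison nabla p (inclC E F V c) =
      (-1 : ℝ) ^ p • inclC E F V (eps (expC (insC (covS nabla)) c)) := by
  have h := expInsertion_inclC (θ := fun α x => (nabla α x).toLinearMap) (θ' := covS nabla)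
    (fun _ _ _ => rfl) c
  funext q v
  change (-1 : ℝ) ^ (p + q) • expInsertion (fun α x => (nabla α x).toLinearMap) _ q v = _
  rw [h, pow_add, mul_smul]
  rfl

theorem transition_inclC (c : Coch (Sect E F V) (Smooth E F V)) :
    transition nabla nabla' (inclC E F V c) =
      inclC E F V (expC (insC (covS nabla - covS nabla')) c) := by
  refine expInsertion_inclC (fun α s x => ?_) c
  have h := slide_add (nabla α x - nabla' α x).toLinearMap (nabla' α x).toLinearMap (s.1 x)
  have hl : (nabla α x - nabla' α x).toLinearMap + (nabla' α x).toLinearMap =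
      (nabla α x).toLinearMap := LinearMap.ext fun v => sub_add_cancel (nabla α x v) (nabla' α x v)
  rw [hl] at h
  exact eq_sub_of_add_eq h.symm

end Connection

end Transfer

section Complexes

variable {E : Type*} [NormedAddCommGroup E] [NormedSpace ℝ E] [FiniteDimensional ℝ E]
  {M : Type*} [TopologicalSpace M] [ChartedSpace E M] [IsManifold 𝓘(ℝ, E) ∞ M]
  [T2Space M] [SigmaCompactSpace M]
  {F : Type*} [NormedAddCommGroup F] [NormedSpace ℝ F] [FiniteDimensional ℝ F]
  {V : M → Type*} [TopologicalSpace (TotalSpace F V)]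
  [∀ x, AddCommGroup (V x)] [∀ x, Module ℝ (V x)] [∀ x, TopologicalSpace (V x)]
  [∀ x, IsTopologicalAddGroup (V x)] [∀ x, ContinuousSMul ℝ (V x)]
  [FiberBundle F V] [VectorBundle ℝ F V] [ContMDiffVectorBundle ∞ F V 𝓘(ℝ, E)]

/-! ## The complexes -/

/-- Intrinsic cochains with values in the smooth sections. -/
structure IsIntrinsic (k p : ℕ) (c : Coch (Sect E F V) (Smooth E F V)) : Prop where
  alt : c ∈ altC
  level : c ∈ levelC E F V k p
  tail : IsTailed fsmul mulFunc contractWedge c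

/-- Forms with values in the smooth sections. -/
structure IsForm (k p : ℕ) (c : Coch (Sect E F V) (Smooth E F V)) : Prop where
  alt : c ∈ altC
  level : c ∈ levelC E F V k p
  linear : IsFormLinear fsmul mulFunc c

theorem mem_intrinsic_iff {k p : ℕ} {c : Cochain E F V} : c ∈ intrinsic E F V k p ↔
    ∃ c', IsIntrinsic k p c' ∧ inclC E F V c' = c :=
  mem_intrinsic.trans ⟨fun ⟨c', h1, h2, h3, h⟩ => ⟨c', ⟨h1, h2, h3⟩, h⟩,
    fun ⟨c', ⟨h1, h2, h3⟩, h⟩ => ⟨c', h1, h2, h3, h⟩⟩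

theorem mem_forms_iff {k p : ℕ} {c : Cochain E F V} : c ∈ forms E F V k p ↔
    ∃ c', IsForm k p c' ∧ inclC E F V c' = c :=
  mem_forms.trans ⟨fun ⟨c', h1, h2, h3, h⟩ => ⟨c', ⟨h1, h2, h3⟩, h⟩,
    fun ⟨c', ⟨h1, h2, h3⟩, h⟩ => ⟨c', h1, h2, h3, h⟩⟩

variable {k p : ℕ} {c : Coch (Sect E F V) (Smooth E F V)}

namespace LieAlgebroid

variable (A : LieAlgebroid E F V)

theorem dC_mem_levelC (hc : c ∈ levelC E F V k p) :
    dC A.bracket A.lieS A.delS c ∈ levelC E F V k (p + 1) := by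
  refine sub_mem (add_mem (brC_mem_levelC _ hc) (act_mem_levelC (fun α q s hs => ?_) hc))
    (eps_mem_levelC fun q v => A.delS_mem_level (hc q v))
  rw [level_succ]
  exact ofMem_mem_level (hD := (A.lie_spec α).1.mem) (A.lie_spec α).2 hs

theorem isIntrinsic_dC (h : IsIntrinsic k p c) :
    IsIntrinsic k (p + 1) (dC A.bracket A.lieS A.delS c) :=
  ⟨A.isCartan.dC_mem h.alt, A.dC_mem_levelC h.level, h.tail.dC A.isLeibniz h.alt⟩

theorem d_mem_intrinsic {c : Cochain E F V} (hc : c ∈ intrinsic E F V k p) :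
    A.d c ∈ intrinsic E F V k (p + 1) := by
  obtain ⟨c', h, rfl⟩ := mem_intrinsic_iff.1 hc
  rw [d_inclC]
  exact mem_intrinsic_iff.2 ⟨_, A.isIntrinsic_dC h, rfl⟩

theorem d_d {c : Cochain E F V} (hc : c ∈ intrinsic E F V k p) : A.d (A.d c) = 0 := by
  obtain ⟨c', h, rfl⟩ := mem_intrinsic_iff.1 hc
  rw [d_inclC, d_inclC, A.isCartan.dC_dC h.alt, map_zero]

/-- A string of degree `p` has no component with `p + 1` arguments, so the `∂` term is absent there.
-/
theorem d_apply_succ {c : Cochain E F V} (hc : c ∈ intrinsic E F V k p) :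
    A.d c (p + 1) = A.koszul A.lie c (p + 1) := by
  obtain ⟨c', h, rfl⟩ := mem_intrinsic_iff.1 hc
  have h0 : A.delTerm (inclC E F V c') (p + 1) = 0 := by
    funext v
    have h1 : c' (p + 1) v = 0 := level_of_lt (Nat.lt_succ_self p) (h.level (p + 1) v)
    rw [delTerm_inclC]
    change Smooth.incl E F V ((-1 : ℝ) ^ (p + 1) • A.delS (c' (p + 1) v)) = 0
    rw [h1, map_zero, smul_zero, map_zero]
  change A.koszul A.lie (inclC E F V c') (p + 1) - A.delTerm (inclC E F V c') (p + 1) = _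
  rw [h0, sub_zero]

end LieAlgebroid

section Connection

variable (nabla nabla' : CovariantDerivative 𝓘(ℝ, E) F V)
  [CovariantDerivative.ContMDiffCovariantDerivative nabla ∞]
  [CovariantDerivative.ContMDiffCovariantDerivative nabla' ∞]

theorem isSlide_covS_sub (α : Sect E F V) : Smooth.IsSlide ((covS nabla - covS nabla') α)
    (fun X => cov nabla X α - cov nabla' X α) :=
  (isSlide_covS nabla α).sub (isSlide_covS nabla' α)

theorem isSlide_neg_covS (α : Sect E F V) : Smooth.IsSlide ((-covS nabla) α)
    (fun X => (-1 : ℝ) • cov nabla X α) := by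
  have h : (-covS nabla) α = (-1 : ℝ) • covS nabla α := LinearMap.ext fun s =>
    (neg_one_smul ℝ (covS nabla α s)).symm
  rw [h]
  exact (isSlide_covS nabla α).smul (-1)

theorem insC_mem_levelC {θ : Sect E F V →ₗ[ℝ] Smooth E F V →ₗ[ℝ] Smooth E F V}
    {κ : Sect E F V → ∀ x : M, TangentSpace 𝓘(ℝ, E) x →ₗ[ℝ] V x}
    (hκ : ∀ α s x, (θ α s).1 x = slide (κ α x) (s.1 x)) (hc : c ∈ levelC E F V k p) :
    insC θ c ∈ levelC E F V k p :=
  eps_mem_levelC (act_mem_levelC (fun α _ _ hs => slide_mem_level (hκ α) hs) hc)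

/-- The comparison map on cochains with values in the smooth sections, up to sign. -/
def compareS : Coch (Sect E F V) (Smooth E F V) →ₗ[ℝ] Coch (Sect E F V) (Smooth E F V) :=
  eps ∘ₗ expC (insC (covS nabla))

/-- The inverse of `compareS`. -/
def compareInvS : Coch (Sect E F V) (Smooth E F V) →ₗ[ℝ] Coch (Sect E F V) (Smooth E F V) :=
  expC (insC (-covS nabla)) ∘ₗ eps

theorem covS_anticomm (α β : Sect E F V) (s : Smooth E F V) :
    covS nabla α (covS nabla β s) = -covS nabla β (covS nabla α s) :=
  (isSlide_covS nabla α).anticomm (isSlide_covS nabla β) s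

theorem neg_covS_anticomm (α β : Sect E F V) (s : Smooth E F V) :
    (-covS nabla) α ((-covS nabla) β s) = -(-covS nabla) β ((-covS nabla) α s) :=
  (isSlide_neg_covS nabla α).anticomm (isSlide_neg_covS nabla β) s

theorem covS_sub_anticomm (α β : Sect E F V) (s : Smooth E F V) :
    (covS nabla - covS nabla') α ((covS nabla - covS nabla') β s) =
      -(covS nabla - covS nabla') β ((covS nabla - covS nabla') α s) :=
  (isSlide_covS_sub nabla nabla' α).anticomm (isSlide_covS_sub nabla nabla' β) s

theorem isForm_compareS (h : IsIntrinsic k p c) : IsForm k p (compareS nabla c) :=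
  ⟨eps_mem_altC (expC_mem _ h.alt),
    eps_mem_levelC (expC_mem_levelC (fun _ hc => insC_mem_levelC (fun _ _ _ => rfl) hc) h.level),
    (h.tail.expC (covS_anticomm nabla) (fun f α s => (isSlide_covS nabla α).func_mul f s)
      (covS_fsmul nabla)).eps⟩

/-- The family `-∇` satisfies `θ(fα) = f θ(α) - df ⊗ α`, so `exp(-N_∇)` restores exactly the
required tails. -/
theorem isIntrinsic_compareInvS (h : IsForm k p c) : IsIntrinsic k p (compareInvS nabla c) := by
  refine ⟨expC_mem _ (eps_mem_altC h.alt), expC_mem_levelC (fun c hc => ?_)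
    (eps_mem_levelC h.level), h.linear.eps.expC (neg_covS_anticomm nabla)
    (fun f α s => (isSlide_neg_covS nabla α).func_mul f s)
    (fun f α β s => (isSlide_neg_covS nabla β).anticomm (isSlide_contractWedge f α) s)
    (fun f α s => ?_)⟩
  · refine insC_mem_levelC (κ := fun α x => -(nabla α x).toLinearMap) (fun α s x => ?_) hc
    have h2 := slide_smul (-1 : ℝ) (nabla α x).toLinearMap (s.1 x)
    rw [neg_one_smul] at h2
    exact ((neg_one_smul ℝ (slide (nabla α x).toLinearMap (s.1 x))).symm.trans h2.symm)
  · rw [LinearMap.neg_apply, LinearMap.neg_apply, LinearMap.neg_apply, LinearMap.neg_apply,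
      covS_fsmul, map_neg, neg_add, sub_eq_add_neg]
    rfl

theorem compareS_compareInvS (c : Coch (Sect E F V) (Smooth E F V)) :
    compareS nabla (compareInvS nabla c) = c := by
  have h := expC_neg_expC (neg_covS_anticomm nabla) (eps c)
  have e : - -covS nabla = covS nabla :=
    LinearMap.ext fun α => LinearMap.ext fun s => neg_neg (covS nabla α s)
  rw [e] at h
  exact (congrArg eps h).trans (eps_eps c)

theorem compareInvS_compareS (c : Coch (Sect E F V) (Smooth E F V)) :
    compareInvS nabla (compareS nabla c) = c := by
  refine (congrArg (expC (insC (-covS nabla))) (eps_eps _)).trans ?_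
  exact expC_neg_expC (covS_anticomm nabla) c

theorem comparison_apply (p : ℕ) (c : Coch (Sect E F V) (Smooth E F V)) :
    comparison nabla p (inclC E F V c) = (-1 : ℝ) ^ p • inclC E F V (compareS nabla c) :=
  comparison_inclC nabla p c

theorem IsForm.smul (h : IsForm k p c) (r : ℝ) : IsForm k p (r • c) :=
  ⟨Submodule.smul_mem _ r h.alt, Submodule.smul_mem _ r h.level, h.linear.smul r⟩

theorem comparison_bijOn (k p : ℕ) :
    Set.BijOn (comparison nabla p) (intrinsic E F V k p) (forms E F V k p) := by
  refine ⟨fun c hc => ?_, fun c hc c' hc' h => ?_, fun η hη => ?_⟩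
  · obtain ⟨c, h, rfl⟩ := mem_intrinsic_iff.1 hc
    rw [comparison_apply, ← map_smul]
    exact mem_forms_iff.2 ⟨_, (isForm_compareS nabla h).smul _, rfl⟩
  · obtain ⟨c, -, rfl⟩ := mem_intrinsic_iff.1 hc
    obtain ⟨c', -, rfl⟩ := mem_intrinsic_iff.1 hc'
    rw [comparison_apply, comparison_apply] at h
    have h1 := inclC_injective (smul_right_injective _ (pow_ne_zero p (by norm_num)) h)
    rw [← compareInvS_compareS nabla c, h1, compareInvS_compareS]
  · obtain ⟨η, h, rfl⟩ := mem_forms_iff.1 hη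
    refine ⟨inclC E F V (compareInvS nabla ((-1 : ℝ) ^ p • η)),
      mem_intrinsic_iff.2 ⟨_, isIntrinsic_compareInvS nabla (h.smul _), rfl⟩, ?_⟩
    rw [comparison_apply, compareS_compareInvS, map_smul, smul_smul, neg_one_pow_mul_self, one_smul]

variable (A : LieAlgebroid E F V)

theorem compareS_dC (hc : c ∈ altC) : compareS nabla (dC A.bracket A.lieS A.delS c) =
    -twistedC A.bracket (A.basS nabla) A.delS (A.curvS nabla) (compareS nabla c) :=
  A.expC_dC nabla hc

/-- The minus sign of `compareS_dC` is offset by the prefactor, which changes from `(-1)^p` to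
`(-1)^(p+1)`. -/
theorem comparison_d {c : Cochain E F V} (hc : c ∈ intrinsic E F V k p) :
    comparison nabla (p + 1) (A.d c) = A.structureOp nabla (comparison nabla p c) := by
  obtain ⟨c, h, rfl⟩ := mem_intrinsic_iff.1 hc
  rw [A.d_inclC, comparison_apply, comparison_apply, LinearMap.map_smul, A.structureOp_inclC,
    compareS_dC nabla A h.alt, map_neg, pow_succ]
  module

/-- Every form is the image of an intrinsic cochain, so the property is carried over from `dC`. In
the same way `twistedC_twistedC` needs no Bianchi identity for the basic curvature. -/
theorem isForm_twistedC (h : IsForm k p c) : IsForm k (p + 1)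
    (twistedC A.bracket (A.basS nabla) A.delS (A.curvS nabla) c) := by
  have h1 := isIntrinsic_compareInvS nabla h
  have h2 := (isForm_compareS nabla (A.isIntrinsic_dC h1)).smul (-1)
  rwa [compareS_dC nabla A h1.alt, compareS_compareInvS, neg_one_smul, neg_neg] at h2

theorem twistedC_twistedC (h : IsForm k p c) :
    twistedC A.bracket (A.basS nabla) A.delS (A.curvS nabla)
      (twistedC A.bracket (A.basS nabla) A.delS (A.curvS nabla) c) = 0 := by
  have h1 := isIntrinsic_compareInvS nabla h
  have h2 := compareS_dC nabla A (A.isIntrinsic_dC h1).alt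
  rw [A.isCartan.dC_dC h1.alt, map_zero, compareS_dC nabla A h1.alt, compareS_compareInvS,
    map_neg, neg_neg] at h2
  exact h2.symm

theorem structureOp_mem_forms {η : Cochain E F V} (hη : η ∈ forms E F V k p) :
    A.structureOp nabla η ∈ forms E F V k (p + 1) := by
  obtain ⟨η, h, rfl⟩ := mem_forms_iff.1 hη
  rw [A.structureOp_inclC]
  exact mem_forms_iff.2 ⟨_, isForm_twistedC nabla A h, rfl⟩

theorem structureOp_structureOp {η : Cochain E F V} (hη : η ∈ forms E F V k p) :
    A.structureOp nabla (A.structureOp nabla η) = 0 := by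
  obtain ⟨η, h, rfl⟩ := mem_forms_iff.1 hη
  rw [A.structureOp_inclC, A.structureOp_inclC, twistedC_twistedC nabla A h, map_zero]

/-! ### Change of the connection -/

theorem isForm_transitionS (h : IsForm k p c) :
    IsForm k p (expC (insC (covS nabla - covS nabla')) c) := by
  refine ⟨expC_mem _ h.alt, expC_mem_levelC (fun c hc => ?_) h.level,
    h.linear.expC_of_linear (covS_sub_anticomm nabla nabla')
      (fun f α s => (isSlide_covS_sub nabla nabla' α).func_mul f s)
      (covS_sub_fsmul nabla nabla')⟩
  refine insC_mem_levelC (κ := fun α x => (nabla α x).toLinearMap - (nabla' α x).toLinearMap)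
    (fun α s x => ?_) hc
  have h1 := slide_add ((nabla α x).toLinearMap - (nabla' α x).toLinearMap)
    (nabla' α x).toLinearMap (s.1 x)
  rw [sub_add_cancel] at h1
  exact sub_eq_of_eq_add h1

theorem neg_covS_sub : -(covS nabla - covS nabla') = covS nabla' - covS nabla :=
  LinearMap.ext fun α => LinearMap.ext fun s => neg_sub (covS nabla α s) (covS nabla' α s)

theorem transition_transition (c : Coch (Sect E F V) (Smooth E F V)) :
    expC (insC (covS nabla' - covS nabla)) (expC (insC (covS nabla - covS nabla')) c) = c := by
  have h := expC_neg_expC (covS_sub_anticomm nabla nabla') c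
  rwa [neg_covS_sub] at h

theorem transition_bijOn (k p : ℕ) :
    Set.BijOn (transition nabla nabla') (forms E F V k p) (forms E F V k p) := by
  refine ⟨fun c hc => ?_, fun c hc c' hc' h => ?_, fun η hη => ?_⟩
  · obtain ⟨c, h, rfl⟩ := mem_forms_iff.1 hc
    rw [transition_inclC]
    exact mem_forms_iff.2 ⟨_, isForm_transitionS nabla nabla' h, rfl⟩
  · obtain ⟨c, -, rfl⟩ := mem_forms_iff.1 hc
    obtain ⟨c', -, rfl⟩ := mem_forms_iff.1 hc'
    rw [transition_inclC, transition_inclC] at h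
    rw [← transition_transition nabla nabla' c, inclC_injective h, transition_transition]
  · obtain ⟨η, h, rfl⟩ := mem_forms_iff.1 hη
    refine ⟨inclC E F V (expC (insC (covS nabla' - covS nabla)) η),
      mem_forms_iff.2 ⟨_, isForm_transitionS nabla' nabla h, rfl⟩, ?_⟩
    rw [transition_inclC, transition_transition]

/-- Moving the exponential past `eps` replaces `∇ - ∇'` by `∇' - ∇`, and then the exponents add up
to `∇'`. This accounts for the order of the difference in `transition`. -/
theorem transition_compareS (c : Coch (Sect E F V) (Smooth E F V)) :
    expC (insC (covS nabla - covS nabla')) (compareS nabla c) = compareS nabla' c := by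
  have h : covS nabla' - covS nabla + covS nabla = covS nabla' :=
    LinearMap.ext fun α => LinearMap.ext fun s => sub_add_cancel (covS nabla' α s) (covS nabla α s)
  refine (expC_eps _ _).trans (congrArg eps ?_)
  rw [neg_covS_sub, expC_expC (covS_sub_anticomm nabla' nabla) (covS_anticomm nabla)
    (fun α β s => (isSlide_covS_sub nabla' nabla α).anticomm (isSlide_covS nabla β) s), h]

theorem transition_comparison {c : Cochain E F V} (hc : c ∈ intrinsic E F V k p) :
    transition nabla nabla' (comparison nabla p c) = comparison nabla' p c := by
  obtain ⟨c, h, rfl⟩ := mem_intrinsic_iff.1 hc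
  rw [comparison_apply, comparison_apply, LinearMap.map_smul, transition_inclC,
    transition_compareS]

/-- Both differentials are images of the same `d` under comparison maps, and every form is such an
image. -/
theorem transition_structureOp {η : Cochain E F V} (hη : η ∈ forms E F V k p) :
    transition nabla nabla' (A.structureOp nabla η) =
      A.structureOp nabla' (transition nabla nabla' η) := by
  obtain ⟨c, hc, rfl⟩ := (comparison_bijOn nabla k p).surjOn hη
  rw [← comparison_d nabla A hc, transition_comparison nabla nabla' (A.d_mem_intrinsic hc),
    transition_comparison nabla nabla' hc, comparison_d nabla' A hc]

end Connection

end Complexes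

/-! ## Derivations of the algebra of smooth functions -/

/-- Smooth dependence on parameters is taken from convolutions: the integral is the convolution at
`0` of the indicator of `(0, 1]` with the reflected integrand, cut off by a bump function that
equals `1` on `[0, 1]`. -/
theorem contDiff_intervalIntegral {E G : Type*} [NormedAddCommGroup E] [NormedSpace ℝ E]
    [NormedAddCommGroup G] [NormedSpace ℝ G] [CompleteSpace G] {g : E → ℝ → G}
    (hg : ContDiff ℝ ∞ fun p : E × ℝ => g p.1 p.2) :
    ContDiff ℝ ∞ fun p => ∫ t in (0 : ℝ)..1, g p t := by
  let φ : ContDiffBump (0 : ℝ) := ⟨1, 2, one_pos, one_lt_two⟩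
  let h : E → ℝ → G := fun p s => φ (-s) • g p (-s)
  let f : ℝ → ℝ := Set.indicator (Set.Ioc 0 1) 1
  have hh : ContDiff ℝ ∞ fun p : E × ℝ => h p.1 p.2 :=
    (φ.contDiff.comp contDiff_snd.neg).smul (hg.comp (contDiff_fst.prodMk contDiff_snd.neg))
  have hf : MeasureTheory.LocallyIntegrable f MeasureTheory.volume :=
    ((MeasureTheory.integrable_indicator_iff measurableSet_Ioc).2
      (MeasureTheory.integrableOn_const (C := (1 : ℝ)) (by simp))).locallyIntegrable
  have key := MeasureTheory.contDiffOn_convolution_right_with_param (μ := MeasureTheory.volume)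
    (ContinuousLinearMap.lsmul ℝ ℝ) (g := h) isOpen_univ (isCompact_closedBall (0 : ℝ) 2)
    (fun p x _ hx => by
      have h0 : φ (-x) = 0 := φ.zero_of_le_dist (by
        rw [Metric.mem_closedBall, not_le] at hx
        simpa using hx.le)
      change φ (-x) • g p (-x) = 0
      rw [h0, zero_smul]) hf (n := ⊤) hh.contDiffOn
  rw [Set.univ_prod_univ, contDiffOn_univ] at key
  -- The convolution variable is set to `0`.
  have h2 := key.comp (contDiff_id.prodMk (contDiff_const (c := (0 : ℝ))))
  convert h2 using 2 with p
  rw [Function.comp_apply, MeasureTheory.convolution_def, intervalIntegral.integral_of_le zero_le_one,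
    ← MeasureTheory.integral_indicator measurableSet_Ioc]
  congr 1
  ext t
  by_cases ht : t ∈ Set.Ioc (0 : ℝ) 1
  · have h1 : φ t = 1 := φ.one_of_mem_closedBall (by
      rw [Metric.mem_closedBall, Real.dist_eq, sub_zero, abs_of_pos ht.1]
      exact ht.2)
    simp [f, h, ht, h1]
  · simp [f, h, ht]

/-- Hadamard's lemma. -/
theorem exists_eq_add_apply_sub {E : Type*} [NormedAddCommGroup E] [NormedSpace ℝ E]
    {f : E → ℝ} (hf : ContDiff ℝ ∞ f) (a : E) :
    ∃ H : E → E →L[ℝ] ℝ, ContDiff ℝ ∞ H ∧ H a = fderiv ℝ f a ∧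
      ∀ y, f y = f a + H y (y - a) := by
  have hd : ContDiff ℝ ∞ (fderiv ℝ f) := hf.fderiv_right (by simp)
  have hg : ContDiff ℝ ∞ fun p : E × ℝ => fderiv ℝ f (a + p.2 • (p.1 - a)) :=
    hd.comp (contDiff_const.add (contDiff_snd.smul (contDiff_fst.sub contDiff_const)))
  refine ⟨fun y => ∫ t in (0 : ℝ)..1, fderiv ℝ f (a + t • (y - a)),
    contDiff_intervalIntegral (g := fun y t => fderiv ℝ f (a + t • (y - a))) hg, by simp,
    fun y => ?_⟩
  have hc : Continuous fun t : ℝ => fderiv ℝ f (a + t • (y - a)) :=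
    hd.continuous.comp (by fun_prop)
  have h1 : ∀ t : ℝ, HasDerivAt (fun t : ℝ => f (a + t • (y - a)))
      (fderiv ℝ f (a + t • (y - a)) (y - a)) t := fun t => by
    have h2 : HasDerivAt (fun t : ℝ => a + t • (y - a)) (y - a) t := by
      simpa using ((hasDerivAt_id t).smul_const (y - a)).const_add a
    exact ((hf.differentiable (by simp)) _).hasFDerivAt.comp_hasDerivAt t h2
  have h3 := intervalIntegral.integral_eq_sub_of_hasDerivAt (a := 0) (b := 1) (fun t _ => h1 t)
    ((hc.clm_apply continuous_const).intervalIntegrable 0 1)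
  have h4 := ContinuousLinearMap.intervalIntegral_apply (μ := MeasureTheory.volume) (hc.intervalIntegrable 0 1) (y - a)
  rw [h4, h3]
  simp

section Geometry

variable {E : Type*} [NormedAddCommGroup E] [NormedSpace ℝ E] [FiniteDimensional ℝ E]
  {M : Type*} [TopologicalSpace M] [ChartedSpace E M] [IsManifold 𝓘(ℝ, E) ∞ M]
  [T2Space M] [SigmaCompactSpace M]

/-- In Hadamard's formula the coefficients take the value of the differential at the base point. If
it is zero, both the coordinates and the coefficients vanish at `x`, so `f - f(x)` is locally in the
square of the maximal ideal. -/
theorem exists_eventuallyEq_sum_mul {f : Func E M} {x : M} (hf : dAt f x = 0) :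
    ∃ u h : Fin (Module.finrank ℝ E) → Func E M, (∀ i, u i x = 0) ∧ (∀ i, h i x = 0) ∧
      ∀ᶠ y in 𝓝 x, f y = (f x • (1 : Func E M) + ∑ i, u i * h i) y := by
  have : ProperSpace E := FiniteDimensional.proper_real E
  set e := extChartAt 𝓘(ℝ, E) x
  have hu : e.target ∈ 𝓝 (e x) := extChartAt_target_mem_nhds x
  -- The local expression of `f` is cut off to a smooth function on all of `E`, where the segments
  -- in Hadamard's lemma are available.
  obtain ⟨φ, hφ⟩ := exists_func (E := E) (M := E) (g := f ∘ e.symm) hu fun y hy => by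
    have h1 : ContMDiffAt 𝓘(ℝ, E) 𝓘(ℝ, E) ∞ e.symm y :=
      (contMDiffOn_extChartAt_symm (I := 𝓘(ℝ, E)) (n := ∞) x).contMDiffAt hy
    exact (f.contMDiff _).comp y h1
  obtain ⟨H, hH, hH0, hH1⟩ := exists_eq_add_apply_sub φ.contMDiff.contDiff (e x)
  have hd : fderiv ℝ φ (e x) = 0 := by
    have h1 : (φ : E → ℝ) =ᶠ[𝓝 (e x)] f ∘ e.symm := hφ
    have h2 : mfderiv 𝓘(ℝ, E) 𝓘(ℝ) f x = 0 := by
      ext v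
      exact congrArg (fun l => l v) hf
    rw [(func_mdifferentiableAt f x).mfderiv] at h2
    rw [h1.fderiv_eq]
    have h3 : writtenInExtChartAt 𝓘(ℝ, E) 𝓘(ℝ) x f = f ∘ e.symm := by
      simp [writtenInExtChartAt, e]; rfl
    have h4 : Set.range 𝓘(ℝ, E) = Set.univ := by simp
    rw [h3, h4, fderivWithin_univ] at h2
    exact h2
  set b := Module.finBasis ℝ E
  have hs : e.source ∈ 𝓝 x := extChartAt_source_mem_nhds x
  have he : ∀ y, e.source ∈ 𝓝 y → ContMDiffAt 𝓘(ℝ, E) 𝓘(ℝ, E) ∞ e y := fun y hy =>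
    contMDiffAt_extChartAt' (by simpa [e] using mem_of_mem_nhds hy)
  have hu' : ∀ i, ∃ u : Func E M, ∀ᶠ y in 𝓝 x, u y = b.coord i (e y - e x) := fun i =>
    exists_func hs fun y hy => by
      have h1 : ContDiff ℝ ∞ fun z : E => b.coord i (z - e x) :=
        (LinearMap.toContinuousLinearMap (b.coord i)).contDiff.comp
          (contDiff_id.sub contDiff_const)
      exact h1.contMDiff.contMDiffAt.comp y (he y hy)
  have hh' : ∀ i, ∃ h : Func E M, ∀ᶠ y in 𝓝 x, h y = H (e y) (b i) := fun i =>
    exists_func hs fun y hy => by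
      have h1 : ContDiff ℝ ∞ fun z : E => H z (b i) := hH.clm_apply contDiff_const
      exact h1.contMDiff.contMDiffAt.comp y (he y hy)
  choose u hu' using hu'
  choose h hh' using hh'
  refine ⟨u, h, fun i => ?_, fun i => ?_, ?_⟩
  · rw [(hu' i).self_of_nhds, sub_self, map_zero]
  · rw [(hh' i).self_of_nhds, hH0, hd]
    rfl
  have hc : Filter.Tendsto e (𝓝 x) (𝓝 (e x)) := continuousAt_extChartAt x
  filter_upwards [hc.eventually hφ, hs, Filter.eventually_all.2 hu', Filter.eventually_all.2 hh']
    with y h1 h2 h3 h4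
  have h5 : f y = φ (e y) := by rw [h1, Function.comp_apply, e.left_inv h2]
  have h6 : φ (e x) = f x := by
    rw [hφ.self_of_nhds, Function.comp_apply, e.left_inv (mem_of_mem_nhds hs)]
  have h7 : (∑ i, u i * h i : Func E M) y = ∑ i, u i y * h i y := by
    exact map_sum (⟨⟨fun g : Func E M => g y, rfl⟩, fun _ _ => rfl⟩ : Func E M →+ ℝ) _ _
  rw [h5, hH1, h6, func_add_apply, func_smul_apply, func_one_apply, mul_one, h7]
  conv_lhs => rw [← b.sum_repr (e y - e x)]
  simp only [map_sum, map_smul, h3, h4, smul_eq_mul, Module.Basis.coord_apply]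

variable {G : Type*} [AddCommGroup G] [Module ℝ G]

/-- A derivation at a point depends on the differential only. -/
theorem derivationAt_eq_zero {x : M} (D : Func E M →ₗ[ℝ] G)
    (hD : ∀ f g, D (f * g) = f x • D g + g x • D f) {f : Func E M} (hf : dAt f x = 0) :
    D f = 0 := by
  have hloc : ∀ f : Func E M, (∀ᶠ y in 𝓝 x, f y = 0) → D f = 0 := fun f h => by
    obtain ⟨χ, h0, h1⟩ := exists_mul_eq_self h
    rw [← h1, hD, h0.self_of_nhds, h.self_of_nhds, zero_smul, zero_smul, add_zero]
  have h1 : D 1 = 0 := by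
    have h := hD 1 1
    rwa [mul_one, func_one_apply, one_smul, left_eq_add] at h
  obtain ⟨u, h, hu, hh, he⟩ := exists_eventuallyEq_sum_mul hf
  have h2 := hloc (f - (f x • (1 : Func E M) + ∑ i, u i * h i)) (he.mono fun y hy => by
    rw [func_sub_apply, hy, sub_self])
  rw [map_sub, sub_eq_zero] at h2
  rw [h2, map_add, LinearMap.map_smul, h1, smul_zero, zero_add, map_sum]
  exact Finset.sum_eq_zero fun i _ => by rw [hD, hu, hh, zero_smul, zero_smul, add_zero]

/-- Local coordinates, with the coordinate vector fields. -/
theorem exists_coordinates (x : M) : ∃ (g : Fin (Module.finrank ℝ E) → Func E M)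
    (X : Fin (Module.finrank ℝ E) → VecField E M),
    ∀ᶠ y in 𝓝 x, ∀ v : TangentSpace 𝓘(ℝ, E) y, v = ∑ i, dAt (g i) y v • X i y := by
  have : ContMDiffVectorBundle 1 E (TangentSpace 𝓘(ℝ, E) : M → Type _) 𝓘(ℝ, E) :=
    ContMDiffVectorBundle.of_le (n := ∞) (by simp)
  set e := trivializationAt E (TangentSpace 𝓘(ℝ, E) : M → Type _) x
  have hx : x ∈ e.baseSet := mem_baseSet_trivializationAt E _ x
  have hu : e.baseSet ∈ 𝓝 x := e.open_baseSet.mem_nhds hx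
  have hb : e.baseSet = (chartAt E x).source := rfl
  set b := Module.finBasis ℝ E
  have hX : ∀ i, ∃ X : VecField E M, ∀ᶠ y in 𝓝 x, X y = e.localFrame b i y := fun i =>
    exists_sect hu fun y hy => contMDiffAt_localFrame_of_mem ∞ e b i (mem_of_mem_nhds hy)
  have hg : ∀ i, ∃ g : Func E M, ∀ᶠ y in 𝓝 x, g y =
      LinearMap.toContinuousLinearMap (b.coord i) (extChartAt 𝓘(ℝ, E) x y) := fun i =>
    exists_func hu fun y hy => by
      have h1 : ContMDiffAt 𝓘(ℝ, E) 𝓘(ℝ, E) ∞ (extChartAt 𝓘(ℝ, E) x) y :=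
        contMDiffAt_extChartAt' (mem_of_mem_nhds hy)
      exact (LinearMap.toContinuousLinearMap (b.coord i)).contMDiff.contMDiffAt.comp y h1
  choose X hX using hX
  choose g hg using hg
  refine ⟨g, X, ?_⟩
  filter_upwards [hu, Filter.eventually_all.2 hX,
    (Filter.eventually_all.2 hg).eventually_nhds] with y hy h1 h2 v
  have h3 : ∀ i, dAt (g i) y v = (e.basisAt b hy).repr v i := fun i => by
    set l := LinearMap.toContinuousLinearMap (b.coord i)
    have h4 : (g i : M → ℝ) =ᶠ[𝓝 y] l ∘ extChartAt 𝓘(ℝ, E) x := h2.mono fun z hz => hz i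
    have h5 : mfderiv 𝓘(ℝ, E) 𝓘(ℝ) (g i) y v =
        l (mfderiv 𝓘(ℝ, E) 𝓘(ℝ, E) (extChartAt 𝓘(ℝ, E) x) y v) := by
      rw [h4.mfderiv_eq, mfderiv_comp y l.differentiableAt.mdifferentiableAt
        (mdifferentiableAt_extChartAt hy), mfderiv_eq_fderiv, l.fderiv]
      rfl
    refine h5.trans ?_
    -- The trivialization of `TM` at `x` is the differential of the chart, so frame coefficients are
    -- derivatives of coordinates.
    rw [← TangentBundle.continuousLinearMapAt_trivializationAt hy]
    change b.repr (e.continuousLinearMapAt ℝ y v) i = _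
    rw [Trivialization.basisAt, Module.Basis.map_repr]
    simp [e.coe_linearMapAt_of_mem hy]
  rw [← (e.basisAt b hy).sum_repr v]
  conv_rhs => rw [(e.basisAt b hy).sum_repr v]
  simp only [h3, h1, e.localFrame_apply_of_mem_baseSet b hy]

end Geometry

section Algebra

variable {W U : Type*} [AddCommGroup W] [Module ℝ W] [AddCommGroup U] [Module ℝ U]

theorem contract_add_left (φ ψ : U →ₗ[ℝ] ℝ) (x : ExtSym W U) :
    contract (φ + ψ) x = contract φ x + contract ψ x :=
  (contract_isDer (φ + ψ)).ext ((contract_isDer φ).add (contract_isDer ψ)) rfl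
    (by simp) (fun u => by
      rw [LinearMap.add_apply, contract_inclSym, contract_inclSym, contract_inclSym,
        LinearMap.add_apply, map_add]) x

theorem contract_smul_left (a : ℝ) (φ : U →ₗ[ℝ] ℝ) (x : ExtSym W U) :
    contract (a • φ) x = a • contract φ x :=
  (contract_isDer (a • φ)).ext ((contract_isDer φ).smul a) rfl
    (by simp) (fun u => by
      rw [LinearMap.smul_apply, contract_inclSym, contract_inclSym, LinearMap.smul_apply,
        smul_eq_mul, map_mul]
      exact (Algebra.smul_def a _).symm) x

theorem contract_mul_inclSym {j : ℕ} {x : ExtSym W U} (hx : x ∈ bidegree W U j 0)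
    (φ : U →ₗ[ℝ] ℝ) (u : U) : contract φ (x * inclSym u) = φ u • x := by
  have h := contract_isDer φ x (inclSym u)
  rw [contract_bidegree_zero φ hx, contract_inclSym, zero_mul, add_zero] at h
  rw [h, Algebra.algebraMap_eq_smul_one]
  exact (mul_smul_comm _ _ _).trans (congrArg (fun y => φ u • y) (mul_one x))

end Algebra

section Geometry

variable {E : Type*} [NormedAddCommGroup E] [NormedSpace ℝ E] [FiniteDimensional ℝ E]
  {M : Type*} [TopologicalSpace M] [ChartedSpace E M] [IsManifold 𝓘(ℝ, E) ∞ M]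
  [T2Space M] [SigmaCompactSpace M]
  {F : Type*} [NormedAddCommGroup F] [NormedSpace ℝ F] [FiniteDimensional ℝ F]
  {V : M → Type*} [TopologicalSpace (TotalSpace F V)]
  [∀ x, AddCommGroup (V x)] [∀ x, Module ℝ (V x)] [∀ x, TopologicalSpace (V x)]
  [∀ x, IsTopologicalAddGroup (V x)] [∀ x, ContinuousSMul ℝ (V x)]
  [FiberBundle F V] [VectorBundle ℝ F V] [ContMDiffVectorBundle ∞ F V 𝓘(ℝ, E)]

/-! ### Contractions with differentials -/

theorem contractD_apply (f : Func E M) (s : Tensor E V) (x : M) :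
    contractD f s x = contract (dAt f x) (s x) := rfl

theorem contractD_add_left (f g : Func E M) (s : Tensor E V) :
    contractD (f + g) s = contractD f s + contractD g s :=
  funext fun x => by
    rw [contractD_apply, dAt_add]
    exact contract_add_left _ _ _

theorem contractD_smul_left (r : ℝ) (f : Func E M) (s : Tensor E V) :
    contractD (r • f) s = r • contractD f s :=
  funext fun x => by
    rw [contractD_apply, dAt_smul]
    exact contract_smul_left _ _ _

theorem contractD_mul_left (f g : Func E M) (s : Tensor E V) :
    contractD (f * g) s = contractD f s * ofFunc g + ofFunc f * contractD g s :=
  funext fun x => by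
    rw [contractD_apply, dAt_mul]
    refine (contract_add_left _ _ _).trans ?_
    rw [contract_smul_left, contract_smul_left, add_comm]
    refine congrArg₂ (· + ·) ?_ (ofFunc_mul_apply f (contractD g s) x).symm
    exact (Algebra.smul_def (A := ExtSym (V x) (TangentSpace 𝓘(ℝ, E) x)) (g x) _).trans
      (Algebra.commutes (A := ExtSym (V x) (TangentSpace 𝓘(ℝ, E) x)) (g x) _)

theorem contractD_mul_ofSect (f : Func E M) (s : Tensor E V) (α : Sect E F V) :
    contractD f (s * ofSect α) = contractD f s * ofSect α :=
  funext fun x => contract_mul_inclExt (dAt f x) (s x) (α x)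

theorem eq_zero_of_contractD {j i : ℕ} {s : Tensor E V} {x : M}
    (hs : s x ∈ bidegree (V x) (TangentSpace 𝓘(ℝ, E) x) j (i + 1))
    (h : ∀ f : Func E M, contractD f s x = 0) : s x = 0 := by
  have : FiniteDimensional ℝ (TangentSpace 𝓘(ℝ, E) x) := inferInstanceAs (FiniteDimensional ℝ E)
  refine eq_zero_of_contract hs fun φ => ?_
  obtain ⟨f, rfl⟩ := exists_dAt_eq x φ
  exact h f

/-! ### Almost differentials on functions -/

/-- A derivation `C^∞(M) → Γ(Λ^j A)` is the contraction with a section of `Λ^j A ⊗ TM`. -/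
theorem exists_contractD_eq {j : ℕ} {δ : Func E M → Tensor E V} (hl : IsLinearMap ℝ δ)
    (hm : ∀ f, δ f ∈ multisections E F V j)
    (hd : ∀ f g : Func E M, δ (f * g) = δ f * ofFunc g + ofFunc f * δ g) :
    ∃ s ∈ smoothSections E F V,
      (∀ x, s x ∈ bidegree (V x) (TangentSpace 𝓘(ℝ, E) x) j 1) ∧ ∀ f, contractD f s = δ f := by
  -- At a point, `g` and `∑ dg(X_i) u_i` have the same differential, so `δ` takes the same value on
  -- both.
  have hδ : ∀ x (g : Func E M) {ι : Type} [Fintype ι] (u : ι → Func E M)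
      (X : ι → TangentSpace 𝓘(ℝ, E) x),
      (∀ v : TangentSpace 𝓘(ℝ, E) x, v = ∑ i, dAt (u i) x v • X i) →
      δ g x = ∑ i, dAt g x (X i) • δ (u i) x := by
    intro x g ι _ u X hX
    let D : Func E M →ₗ[ℝ] ExtSym (V x) (TangentSpace 𝓘(ℝ, E) x) :=
      LinearMap.proj x ∘ₗ hl.mk' δ
    have h1 := derivationAt_eq_zero (x := x) D (fun f g => by
      change δ (f * g) x = f x • δ g x + g x • δ f x
      rw [hd, add_comm]
      refine congrArg₂ (· + ·) (ofFunc_mul_apply f (δ g) x) ?_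
      exact ((Algebra.smul_def (g x) _).trans (Algebra.commutes (g x) _)).symm)
      (f := g - ∑ i, dAt g x (X i) • u i) (by
        let d : Func E M →ₗ[ℝ] (TangentSpace 𝓘(ℝ, E) x →ₗ[ℝ] ℝ) :=
          ⟨⟨fun f => dAt f x, fun f g => dAt_add f g x⟩, fun r f => dAt_smul r f x⟩
        change d (g - ∑ i, dAt g x (X i) • u i) = 0
        rw [map_sub, map_sum, sub_eq_zero]
        refine LinearMap.ext fun v => ?_
        change dAt g x v = _
        conv_lhs => rw [hX v]
        rw [map_sum, LinearMap.sum_apply]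
        refine Finset.sum_congr rfl fun i _ => ?_
        rw [LinearMap.map_smul, LinearMap.map_smul, smul_eq_mul, mul_comm]
        rfl)
    rw [LinearMap.map_sub, map_sum, sub_eq_zero] at h1
    refine h1.trans (Finset.sum_congr rfl fun i _ => ?_)
    rw [LinearMap.map_smul]
    rfl
  -- In coordinates `u_i` with coordinate fields `X_i`, the section must be `∑ δ(u_i) ⊗ X_i`.
  have hloc : ∀ x : M, ∃ t ∈ smoothSections E F V, ∀ᶠ y in 𝓝 x,
      t y ∈ bidegree (V y) (TangentSpace 𝓘(ℝ, E) y) j 1 ∧ ∀ f, contractD f t y = δ f y := by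
    intro x
    obtain ⟨u, X, h⟩ := exists_coordinates (E := E) x
    refine ⟨∑ i, δ (u i) * ofVec (X i), sum_mem fun i _ => mul_mem (hm _).1
      (polySections_le (ofVec_mem_poly _)), ?_⟩
    filter_upwards [h] with y hy
    have e : (∑ i, δ (u i) * ofVec (X i) : Tensor E V) y =
      ∑ i, δ (u i) y * inclSym (X i y) := Finset.sum_apply _ _ _
    refine ⟨?_, fun f => ?_⟩
    · rw [e]
      exact Submodule.sum_mem _ fun i _ => mul_inclSym_bidegree ((hm (u i)).2 y) (X i y)
    · rw [contractD_apply, e, map_sum, hδ y f u (fun i => X i y) hy]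
      exact Finset.sum_congr rfl fun i _ => contract_mul_inclSym ((hm (u i)).2 y) _ _
  choose t ht h using hloc
  -- Contractions with differentials separate `Λ^j A ⊗ TM`, so the local solutions agree where both
  -- are defined and glue.
  have huniq : ∀ x, ∀ᶠ y in 𝓝 x, t y y = t x y := fun x => by
    filter_upwards [h x] with y hy
    have hy' := (h y).self_of_nhds
    refine sub_eq_zero.1 (eq_zero_of_contractD (s := t y - t x) (i := 0)
      (Submodule.sub_mem _ hy'.1 hy.1) fun f => ?_)
    rw [LinearMap.map_sub]
    exact sub_eq_zero.2 ((hy'.2 f).trans (hy.2 f).symm)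
  exact ⟨fun x => t x x, mem_smooth_of_local fun x => ⟨t x, ht x, huniq x⟩,
    fun x => (h x).self_of_nhds.1, fun f => funext fun x => (h x).self_of_nhds.2 f⟩

/-! ### Cochains of degree one -/

theorem mem_bidegree_of_mem_strings {k p q i j : ℕ} {c : Cochain E F V}
    (hc : c ∈ strings E F V k p) (hi : q + i = p) (hj : j + i = k) (v : Fin q → Sect E F V)
    (x : M) : c q v x ∈ bidegree (V x) (TangentSpace 𝓘(ℝ, E) x) j i := by
  refine (iSup_le fun i' => iSup_le fun j' => iSup_le fun h => iSup_le fun h' => ?_ :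
    _ ≤ bidegree (V x) (TangentSpace 𝓘(ℝ, E) x) j i) ((hc q).2.2 v x)
  obtain rfl : i' = i := by omega
  obtain rfl : j' = j := by omega
  exact le_rfl

theorem eq_zero_of_mem_strings {k p q : ℕ} {c : Cochain E F V} (hc : c ∈ strings E F V k p)
    (h : ∀ i j, q + i = p → j + i ≠ k) : c q = 0 := by
  refine funext fun v => funext fun x => ?_
  exact (Submodule.mem_bot ℝ).1 ((iSup_le fun i => iSup_le fun j => iSup_le fun h1 =>
    iSup_le fun h2 => absurd h2 (h i j h1) :
    _ ≤ (⊥ : Submodule ℝ (ExtSym (V x) (TangentSpace 𝓘(ℝ, E) x)))) ((hc q).2.2 v x))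

theorem apply_one_fsmul {k p : ℕ} {c : Cochain E F V} (hc : c ∈ intrinsic E F V k p)
    (f : Func E M) (α : Sect E F V) : c 1 ![fsmul f α] =
      contractD f (c 0 ![]) * ofSect α + ofFunc f * c 1 ![α] := by
  have h := hc.2 0 ![] f α
  have e : ∀ β : Sect E F V, (Fin.snoc ![] β : Fin 1 → Sect E F V) = ![β] := fun β => by
    ext i; fin_cases i; rfl
  rw [e, e, contractD_mul_ofSect] at h
  exact h.trans (add_comm _ _)

variable {k : ℕ}

theorem isAlmostKDifferential_toPair (hk : 1 ≤ k) {c : Cochain E F V}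
    (hc : c ∈ intrinsic E F V k 1) : IsAlmostKDifferential k (toPair c) where
  linear_func := ⟨fun f g => contractD_add_left f g _, fun r f => contractD_smul_left r f _⟩
  linear_sect := by
    obtain ⟨g, hg⟩ := (hc.1 1).1
    refine ⟨fun α β => ?_, fun r α => ?_⟩
    · change c 1 ![α + β] = c 1 ![α] + c 1 ![β]
      rw [← hg]
      exact g.map_vecCons_add ![] α β
    · change c 1 ![r • α] = r • c 1 ![α]
      rw [← hg]
      exact g.map_vecCons_smul ![] r α
  mem_func f := ⟨contractD_mem f _ ((hc.1 0).2.1 _), fun x => contract_bidegree _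
    (mem_bidegree_of_mem_strings hc.1 (by omega) (by omega) _ x)⟩
  mem_sect α := ⟨(hc.1 1).2.1 _,
    mem_bidegree_of_mem_strings hc.1 (by omega) (by omega) _⟩
  func_mul f g := contractD_mul_left f g _
  sect_mul f α := apply_one_fsmul hc f α

theorem toPair_injOn (hk : 1 ≤ k) : Set.InjOn (toPair : Cochain E F V → _)
    (intrinsic E F V k 1 : Set (Cochain E F V)) := by
  intro c hc c' hc' h
  have h1 : ∀ f, contractD f (c 0 ![]) = contractD f (c' 0 ![]) := fun f =>
    congrFun (congrArg Prod.fst h) f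
  have h2 : ∀ α, c 1 ![α] = c' 1 ![α] := fun α => congrFun (congrArg Prod.snd h) α
  funext q v
  match q, v with
  | 0, v =>
    rw [Subsingleton.elim v ![]]
    refine funext fun x => sub_eq_zero.1 (eq_zero_of_contractD (s := c 0 ![] - c' 0 ![]) (i := 0)
      (j := k - 1) (Submodule.sub_mem _
        (mem_bidegree_of_mem_strings hc.1 (by omega) (by omega) _ x)
        (mem_bidegree_of_mem_strings hc'.1 (by omega) (by omega) _ x)) fun f => ?_)
    rw [LinearMap.map_sub, h1, sub_self]
    rfl
  | 1, v =>
    have e : v = ![v 0] := by ext i; fin_cases i; rfl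
    rw [e, h2]
  | q + 2, v =>
    rw [eq_zero_of_mem_strings hc.1 (by omega), eq_zero_of_mem_strings hc'.1 (by omega)]

/-- The cochain of degree one with components `s` and `δ`. -/
def cochainOne (s : Tensor E V) (δ : Sect E F V → Tensor E V) : Cochain E F V
  | 0, _ => s
  | 1, v => δ (v 0)
  | _ + 2, _ => 0

theorem cochainOne_mem (hk : 1 ≤ k) {s : Tensor E V} {δ : (Func E M → Tensor E V) ×
    (Sect E F V → Tensor E V)} (hδ : IsAlmostKDifferential k δ) (hs : s ∈ smoothSections E F V)
    (hs' : ∀ x, s x ∈ bidegree (V x) (TangentSpace 𝓘(ℝ, E) x) (k - 1) 1)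
    (h : ∀ f, contractD f s = δ.1 f) : cochainOne s δ.2 ∈ intrinsic E F V k 1 := by
  refine ⟨fun q => ?_, fun q v f α => ?_⟩
  · match q with
    | 0 =>
      refine ⟨⟨AlternatingMap.constOfIsEmpty ℝ _ _ s, rfl⟩, fun _ => hs, fun _ x => ?_⟩
      exact Submodule.mem_iSup_of_mem 1 (Submodule.mem_iSup_of_mem (k - 1)
        (Submodule.mem_iSup_of_mem rfl (Submodule.mem_iSup_of_mem (by omega) (hs' x))))
    | 1 =>
      refine ⟨⟨AlternatingMap.ofSubsingleton ℝ _ _ 0 (hδ.linear_sect.mk' δ.2), ?_⟩,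
        fun v => (hδ.mem_sect _).1, fun v x => ?_⟩
      · ext v; rfl
      · exact Submodule.mem_iSup_of_mem 0 (Submodule.mem_iSup_of_mem k
          (Submodule.mem_iSup_of_mem rfl (Submodule.mem_iSup_of_mem rfl ((hδ.mem_sect _).2 x))))
    | q + 2 =>
      exact ⟨⟨0, rfl⟩, fun _ => zero_mem _, fun _ _ => zero_mem _⟩
  · match q, v with
    | 0, v =>
      change δ.2 (fsmul f α) = ofFunc f * δ.2 α + contractD f (s * ofSect α)
      rw [hδ.sect_mul, contractD_mul_ofSect, h, add_comm]
    | 1, v =>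
      -- There is no component with two arguments; the relation holds because `δ(v 0)` has no
      -- symmetric part to contract.
      change 0 = ofFunc f * 0 + contractD f (δ.2 (v 0) * ofSect α)
      rw [contractD_mul_ofSect, mul_zero, zero_add]
      refine funext fun x => ?_
      have h1 : contractD f (δ.2 (v 0)) x = 0 :=
        contract_bidegree_zero _ ((hδ.mem_sect (v 0)).2 x)
      change 0 = contractD f (δ.2 (v 0)) x * ofSect α x
      rw [h1, zero_mul]
    | q + 2, v =>
      change 0 = ofFunc f * 0 + contractD f (0 * ofSect α)
      rw [mul_zero, zero_mul, LinearMap.map_zero, zero_add]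

theorem toPair_bijOn (hk : 1 ≤ k) : Set.BijOn (toPair : Cochain E F V → _)
    (intrinsic E F V k 1 : Set (Cochain E F V)) {δ | IsAlmostKDifferential k δ} := by
  refine ⟨fun c hc => isAlmostKDifferential_toPair hk hc, toPair_injOn hk, fun δ hδ => ?_⟩
  obtain ⟨s, hs, hs', h⟩ := exists_contractD_eq hδ.linear_func hδ.mem_func hδ.func_mul
  exact ⟨cochainOne s δ.2, cochainOne_mem hk hδ hs hs' h, Prod.ext (funext h) rfl⟩

end Geometry

section Geometry

variable {E : Type*} [NormedAddCommGroup E] [NormedSpace ℝ E] [FiniteDimensional ℝ E]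
  {M : Type*} [TopologicalSpace M] [ChartedSpace E M] [IsManifold 𝓘(ℝ, E) ∞ M]
  [T2Space M] [SigmaCompactSpace M]
  {F : Type*} [NormedAddCommGroup F] [NormedSpace ℝ F] [FiniteDimensional ℝ F]
  {V : M → Type*} [TopologicalSpace (TotalSpace F V)]
  [∀ x, AddCommGroup (V x)] [∀ x, Module ℝ (V x)] [∀ x, TopologicalSpace (V x)]
  [∀ x, IsTopologicalAddGroup (V x)] [∀ x, ContinuousSMul ℝ (V x)]
  [FiberBundle F V] [VectorBundle ℝ F V] [ContMDiffVectorBundle ∞ F V 𝓘(ℝ, E)]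

/-! ### Cocycles of degree one -/

variable (F V) in
theorem exists_fibre_equiv (x : M) : Nonempty (V x ≃ₗ[ℝ] F) :=
  ⟨((trivializationAt F V x).continuousLinearEquivAt ℝ x
    (mem_baseSet_trivializationAt F V x)).toLinearEquiv⟩

/-- Away from the top exterior power, a component of an intrinsic cochain vanishes if the next one
does. -/
theorem eq_zero_of_apply_succ_eq_zero {k p q i j : ℕ} {c : Cochain E F V}
    (hc : c ∈ intrinsic E F V k p) (h : c (q + 1) = 0) (hi : q + (i + 1) = p)
    (hj : j + (i + 1) = k) (hr : j ≠ Module.finrank ℝ F) : c q = 0 := by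
  refine funext fun v => funext fun x => eq_zero_of_contractD (s := c q v)
    (mem_bidegree_of_mem_strings hc.1 hi hj v x) fun f => ?_
  obtain ⟨l⟩ := exists_fibre_equiv F V x
  have : FiniteDimensional ℝ (V x) := l.symm.finiteDimensional
  refine eq_zero_of_mul_inclExt (j := j) (i := i)
    (contract_bidegree _ (mem_bidegree_of_mem_strings hc.1 hi hj v x))
    (by rwa [l.finrank_eq]) fun w => ?_
  obtain ⟨α, rfl⟩ := exists_sect_eq (E := E) (F := F) (V := V) x w
  -- With `c^(q+1) = 0` the tail relation says that `i(df)(c^q) ∧ α = 0`.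
  have h1 := hc.2 q v f α
  rw [h, contractD_mul_ofSect] at h1
  change 0 = ofFunc f * 0 + contractD f (c q v) * ofSect α at h1
  rw [mul_zero, zero_add] at h1
  exact (congrFun h1 x).symm

namespace LieAlgebroid

variable (A : LieAlgebroid E F V)

/-- The commutator of `L_α` with `i(df)` is a derivation. On a vector field `X` it gives `ρ(α)(X f)
- [ρ(α), X] f = X(ρ(α) f)`, the value of `i(d(ρ(α) f))`. -/
theorem lie_contractD (α : Sect E F V) (f : Func E M) {s : Tensor E V}
    (hs : s ∈ smoothSections E F V) :
    A.lie α (contractD f s) =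
      contractD f (A.lie α s) + contractD (vecDeriv (A.rho α) f) s := by
  have hder : ∀ f : Func E M, IsTwistedDer id (Smooth.ofMem (F := F) (V := V) (contractD f)
      (contractD_mem f)) := fun f s t => Smooth.ext fun x => contract_isDer (dAt f x) (s.1 x) (t.1 x)
  have hf : ∀ f g : Func E M, Smooth.ofMem (contractD f) (contractD_mem f)
      (Smooth.func g : Smooth E F V) = 0 := fun f g =>
    Smooth.ext fun x => contract_algebraMap (dAt f x) (g x)
  have hα : ∀ (f : Func E M) (β : Sect E F V), Smooth.ofMem (contractD f) (contractD_mem f)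
      (Smooth.sect β) = 0 := fun f β => Smooth.ext fun x => contract_inclExt (dAt f x) (β x)
  have hX : ∀ (f : Func E M) (X : VecField E M), Smooth.ofMem (contractD f) (contractD_mem f)
      (Smooth.vec X : Smooth E F V) = Smooth.func (vecDeriv X f) := fun f X =>
    Smooth.ext fun x => contract_inclSym (dAt f x) (X x)
  have hL := A.isDer_lieS α
  have h := Smooth.twistedDer_ext (hL.der.lie_id (hder f)) (hder (vecDeriv (A.rho α) f))
    (fun g => by
      rw [LinearMap.sub_apply, LinearMap.comp_apply, LinearMap.comp_apply, hL.func, hf, hf, hf,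
        map_zero, sub_zero])
    (fun β => by
      rw [LinearMap.sub_apply, LinearMap.comp_apply, LinearMap.comp_apply, hL.sect, hα, hα, hα,
        map_zero, sub_zero])
    (fun X => by
      rw [LinearMap.sub_apply, LinearMap.comp_apply, LinearMap.comp_apply, hL.vec, hX, hX, hX,
        hL.func, ← Smooth.func_sub, vecDeriv_vecBracket, sub_sub_cancel])
  have h1 := congrArg Subtype.val (LinearMap.congr_fun h (Smooth.mk s hs))
  exact eq_add_of_sub_eq' h1

theorem d_apply_zero (c : Cochain E F V) (v : Fin 0 → Sect E F V) :
    A.d c 0 v = -A.del (c 0 v) := by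
  change (0 + 0 : Tensor E V) - (-1 : ℝ) ^ 0 • A.del (c 0 v) = _
  rw [add_zero, pow_zero, one_smul, zero_sub]

theorem d_apply_one (c : Cochain E F V) (α : Sect E F V) :
    A.d c 1 ![α] = A.lie α (c 0 ![]) + A.del (c 1 ![α]) := by
  have h : actionTerms A.lie 1 ![α] c = A.lie α (c 0 ![]) := by
    simp only [actionTerms, Fin.sum_univ_succ, Finset.univ_eq_empty,
      Finset.sum_empty, add_zero]
    change (-1 : ℝ) ^ 0 • A.lie α (c 0 _) = _
    rw [pow_zero, one_smul, Subsingleton.elim (Fin.removeNth 0 ![α]) ![]]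
  change (0 + actionTerms A.lie 1 ![α] c : Tensor E V) - (-1 : ℝ) ^ 1 • A.del (c 1 ![α]) = _
  rw [h, zero_add, pow_one]
  module

theorem d_apply_two {k : ℕ} {c : Cochain E F V} (hc : c ∈ intrinsic E F V k 1)
    (α β : Sect E F V) :
    A.d c 2 ![α, β] = -c 1 ![A.bracket α β] + (A.lie α (c 1 ![β]) - A.lie β (c 1 ![α])) := by
  have h1 : A.bracketTerms 2 ![α, β] c = -c 1 ![A.bracket α β] := by
    have e : (Fin.cons (A.bracket α β) (omitTwo ![α, β] 1 0) : Fin 1 → Sect E F V) =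
        ![A.bracket α β] := by
      ext i; fin_cases i; rfl
    have e' : A.bracketTerms 2 ![α, β] =
        (-1 : ℝ) ^ (0 + 1) • evalAt 1 (Fin.cons (A.bracket α β) (omitTwo ![α, β] 1 0)) := by
      simp [bracketTerms, Fin.sum_univ_succ]
    rw [e', e, zero_add, pow_one]
    exact neg_one_smul ℝ (c 1 ![A.bracket α β])
  have h2 : actionTerms A.lie 2 ![α, β] c = A.lie α (c 1 ![β]) - A.lie β (c 1 ![α]) := by
    have e : (Fin.removeNth 0 ![α, β] : Fin 1 → Sect E F V) = ![β] := by
      ext i; fin_cases i; rfl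
    have e' : (Fin.removeNth 1 ![α, β] : Fin 1 → Sect E F V) = ![α] := by
      ext i; fin_cases i; rfl
    have e'' : actionTerms A.lie 2 ![α, β] c =
        (-1 : ℝ) ^ 0 • A.lie α (c 1 (Fin.removeNth 0 ![α, β])) +
        (-1 : ℝ) ^ 1 • A.lie β (c 1 (Fin.removeNth 1 ![α, β])) := by
      simp only [actionTerms, LinearMap.sum_apply]
      exact (Fin.sum_univ_two _).trans rfl
    rw [e'', e, e', pow_zero, pow_one]
    module
  rw [A.d_apply_succ hc, ← h1, ← h2]
  rfl

variable {k : ℕ} {c : Cochain E F V}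

theorem d_apply_two_eq_zero_iff (hc : c ∈ intrinsic E F V k 1) : A.d c 2 = 0 ↔
    ∀ α β, (toPair c).2 (A.bracket α β) =
      -A.lie β ((toPair c).2 α) + A.lie α ((toPair c).2 β) := by
  have h : ∀ α β, A.d c 2 ![α, β] = 0 ↔ (toPair c).2 (A.bracket α β) =
      -A.lie β ((toPair c).2 α) + A.lie α ((toPair c).2 β) := fun α β => by
    rw [A.d_apply_two hc, neg_add_eq_zero, sub_eq_neg_add]
    rfl
  refine ⟨fun h0 α β => (h α β).1 (congrFun h0 _), fun h0 => funext fun v => ?_⟩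
  have e : v = ![v 0, v 1] := by ext i; fin_cases i <;> rfl
  rw [e]
  exact (h _ _).2 (h0 _ _)

/-- Contracting `L_α c₁ + ∂ c₀(α)` with `df` and moving `i(df)` past `L_α` gives the identity on
functions; these contractions detect zero in `Λ^(k-1) A ⊗ TM`. -/
theorem d_apply_one_eq_zero_iff (hk : 1 ≤ k) (hc : c ∈ intrinsic E F V k 1) :
    A.d c 1 = 0 ↔ A.FunctionBracketIdentity (toPair c) := by
  have hs : c 0 ![] ∈ smoothSections E F V := (hc.1 0).2.1 _
  have h : ∀ α f, contractD f (A.d c 1 ![α]) = 0 ↔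
      contractD (vecDeriv (A.rho α) f) (c 0 ![]) =
        contractD f (A.del (c 1 ![α])) + A.lie α (contractD f (c 0 ![])) := fun α f => by
    rw [A.d_apply_one, A.lie_contractD α f hs, LinearMap.map_add, ← add_assoc, right_eq_add,
      add_comm]
  refine ⟨fun h0 α f => (h α f).1 (by rw [h0]; exact LinearMap.map_zero _),
    fun h0 => funext fun v => funext fun x => ?_⟩
  have e : v = ![v 0] := by ext i; fin_cases i; rfl
  rw [e]
  exact eq_zero_of_contractD (s := A.d c 1 ![v 0]) (i := 0) (mem_bidegree_of_mem_strings (j := k - 1)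
    (A.d_mem_intrinsic hc).1 (by omega) (by omega) _ x)
    fun f => congrFun ((h _ f).2 (h0 (v 0) f)) x

/-- This component lies in `Λ^(k-2) A ⊗ S² TM`, so the tail relation settles it unless the rank is
`k - 2`. In that rank `Λ^(k-1) A = 0`, hence `c₁ = 0` and `∂ c₁ = 0`. -/
theorem d_apply_zero_eq_zero (hk : 1 ≤ k) (hc : c ∈ intrinsic E F V k 1) (h : A.d c 1 = 0) :
    A.d c 0 = 0 := by
  have hd := A.d_mem_intrinsic hc
  by_cases hk2 : k < 2
  · exact eq_zero_of_mem_strings hd.1 (by omega)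
  by_cases hr : k - 2 = Module.finrank ℝ F
  · refine funext fun v => ?_
    have h0 : c 0 v = 0 := funext fun x => by
      obtain ⟨l⟩ := exists_fibre_equiv F V x
      have : FiniteDimensional ℝ (V x) := l.symm.finiteDimensional
      have h1 := mem_bidegree_of_mem_strings hc.1 (i := 1) (j := k - 1) (by omega) (by omega) v x
      rw [bidegree_eq_bot (by rw [l.finrank_eq]; omega)] at h1
      exact (Submodule.mem_bot ℝ).1 h1
    rw [A.d_apply_zero, h0, LinearMap.map_zero, neg_zero]
    rfl
  · exact eq_zero_of_apply_succ_eq_zero hd h (i := 1) (j := k - 2) (by omega) (by omega) hr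

theorem d_eq_zero_iff (hk : 1 ≤ k) (hc : c ∈ intrinsic E F V k 1) : A.d c = 0 ↔
    (∀ α β, (toPair c).2 (A.bracket α β) =
      -A.lie β ((toPair c).2 α) + A.lie α ((toPair c).2 β)) ∧
    A.FunctionBracketIdentity (toPair c) := by
  rw [← A.d_apply_two_eq_zero_iff hc, ← A.d_apply_one_eq_zero_iff hk hc]
  refine ⟨fun h => ⟨congrFun h 2, congrFun h 1⟩, fun ⟨h2, h1⟩ => funext fun q => ?_⟩
  match q with
  | 0 => exact A.d_apply_zero_eq_zero hk hc h1
  | 1 => exact h1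
  | 2 => exact h2
  | q + 3 => exact eq_zero_of_mem_strings (A.d_mem_intrinsic hc).1 (by omega)

/-- The tail relation of the cochain `d c` links its components, and wedge products detect zero in
`Λ^(k-1) A` unless `k - 1` is the rank. -/
theorem d_apply_one_eq_zero_of_finrank_ne (hk : 1 ≤ k) (hr : Module.finrank ℝ F ≠ k - 1)
    (hc : c ∈ intrinsic E F V k 1) (h : A.d c 2 = 0) : A.d c 1 = 0 :=
  eq_zero_of_apply_succ_eq_zero (A.d_mem_intrinsic hc) h (i := 0) (j := k - 1) (by omega)
    (by omega) hr.symm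

theorem toPair_bijOn_cocycles_of_iff (hk : 1 ≤ k)
    {S : Set ((Func E M → Tensor E V) × (Sect E F V → Tensor E V))}
    (hS : ∀ δ ∈ S, IsAlmostKDifferential k δ)
    (h : ∀ c ∈ intrinsic E F V k 1, A.d c = 0 ↔ toPair c ∈ S) :
    Set.BijOn toPair (cocycles (intrinsic E F V k) A.d 1 : Set (Cochain E F V)) S := by
  refine ⟨fun c hc => (h c hc.1).1 hc.2, (toPair_injOn hk).mono fun c hc => hc.1, fun δ hδ => ?_⟩
  obtain ⟨c, hc, rfl⟩ := (toPair_bijOn hk).surjOn (hS δ hδ)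
  exact ⟨c, ⟨hc, (h c hc).2 hδ⟩, rfl⟩

/-- In degree one, the cocycles are the differentials that are compatible with the bracket with
functions. -/
theorem toPair_bijOn_cocycles (hk : 1 ≤ k) :
    Set.BijOn toPair (cocycles (intrinsic E F V k) A.d 1 : Set (Cochain E F V))
      {δ | A.IsKDifferential k δ ∧ A.FunctionBracketIdentity δ} :=
  A.toPair_bijOn_cocycles_of_iff hk (fun _ hδ => hδ.1.toIsAlmostKDifferential) fun _ hc =>
    (A.d_eq_zero_iff hk hc).trans
      ⟨fun h => ⟨⟨isAlmostKDifferential_toPair hk hc, h.1⟩, h.2⟩, fun h => ⟨h.1.bracket, h.2⟩⟩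

theorem toPair_bijOn_cocycles_of_finrank_ne (hk : 1 ≤ k) (hr : Module.finrank ℝ F ≠ k - 1) :
    Set.BijOn toPair (cocycles (intrinsic E F V k) A.d 1 : Set (Cochain E F V))
      {δ | A.IsKDifferential k δ} :=
  A.toPair_bijOn_cocycles_of_iff hk (fun _ hδ => hδ.toIsAlmostKDifferential) fun _ hc =>
    (A.d_eq_zero_iff hk hc).trans
      ⟨fun h => ⟨isAlmostKDifferential_toPair hk hc, h.1⟩, fun h => ⟨h.bracket,
        (A.d_apply_one_eq_zero_iff hk hc).1 (A.d_apply_one_eq_zero_of_finrank_ne hk hr hc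
          ((A.d_apply_two_eq_zero_iff hc).2 h.bracket))⟩⟩

end LieAlgebroid

end Geometry

end LieAlgebroidCohomology

end

theorem mainTheorem6
    {E : Type*} [NormedAddCommGroup E] [NormedSpace ℝ E] [FiniteDimensional ℝ E]
    {M : Type*} [TopologicalSpace M] [ChartedSpace E M] [IsManifold 𝓘(ℝ, E) ∞ M]
    [T2Space M] [SigmaCompactSpace M]
    {F : Type*} [NormedAddCommGroup F] [NormedSpace ℝ F] [FiniteDimensional ℝ F]
    {V : M → Type*} [TopologicalSpace (TotalSpace F V)]
    [∀ x, AddCommGroup (V x)] [∀ x, Module ℝ (V x)] [∀ x, TopologicalSpace (V x)]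
    [∀ x, IsTopologicalAddGroup (V x)] [∀ x, ContinuousSMul ℝ (V x)]
    [FiberBundle F V] [VectorBundle ℝ F V] [ContMDiffVectorBundle ∞ F V 𝓘(ℝ, E)]
    (A : LieAlgebroidCohomology.LieAlgebroid E F V) (k : ℕ) (hk : 1 ≤ k) :
    -- the intrinsic complex is a complex, and its differential has the Koszul leading term
    (∀ p, ∀ c ∈ LieAlgebroidCohomology.intrinsic E F V k p,
      A.d c ∈ LieAlgebroidCohomology.intrinsic E F V k (p + 1) ∧ A.d (A.d c) = 0 ∧
      A.d c (p + 1) = A.koszul A.lie c (p + 1)) ∧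
    -- every smooth connection realizes `Λ^k Ad` and compares it with the intrinsic complex
    (∀ (nabla : CovariantDerivative 𝓘(ℝ, E) F V)
        [CovariantDerivative.ContMDiffCovariantDerivative nabla ∞] (p : ℕ),
      (∀ η ∈ LieAlgebroidCohomology.forms E F V k p,
        A.structureOp nabla η ∈ LieAlgebroidCohomology.forms E F V k (p + 1) ∧
        A.structureOp nabla (A.structureOp nabla η) = 0) ∧
      Set.BijOn (LieAlgebroidCohomology.comparison nabla p)
        (LieAlgebroidCohomology.intrinsic E F V k p)
        (LieAlgebroidCohomology.forms E F V k p) ∧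
      ∀ c ∈ LieAlgebroidCohomology.intrinsic E F V k p,
        LieAlgebroidCohomology.comparison nabla (p + 1) (A.d c) =
          A.structureOp nabla (LieAlgebroidCohomology.comparison nabla p c)) ∧
    -- the comparison is compatible with the change of the connection
    (∀ (nabla nabla' : CovariantDerivative 𝓘(ℝ, E) F V)
        [CovariantDerivative.ContMDiffCovariantDerivative nabla ∞]
        [CovariantDerivative.ContMDiffCovariantDerivative nabla' ∞] (p : ℕ),
      Set.BijOn (LieAlgebroidCohomology.transition nabla nabla')
        (LieAlgebroidCohomology.forms E F V k p) (LieAlgebroidCohomology.forms E F V k p) ∧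
      (∀ η ∈ LieAlgebroidCohomology.forms E F V k p,
        LieAlgebroidCohomology.transition nabla nabla' (A.structureOp nabla η) =
          A.structureOp nabla' (LieAlgebroidCohomology.transition nabla nabla' η)) ∧
      ∀ c ∈ LieAlgebroidCohomology.intrinsic E F V k p,
        LieAlgebroidCohomology.transition nabla nabla'
            (LieAlgebroidCohomology.comparison nabla p c) =
          LieAlgebroidCohomology.comparison nabla' p c) ∧
    -- the natural isomorphism of cohomologies
    (∀ (nabla : CovariantDerivative 𝓘(ℝ, E) F V)
        [CovariantDerivative.ContMDiffCovariantDerivative nabla ∞] (p : ℕ),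
      ∃ e : LieAlgebroidCohomology.Cohomology
            (LieAlgebroidCohomology.intrinsic E F V k) A.d p ≃ₗ[ℝ]
          LieAlgebroidCohomology.Cohomology
            (LieAlgebroidCohomology.forms E F V k) (A.structureOp nabla) p,
        ∀ (c : LieAlgebroidCohomology.Cochain E F V)
          (hc : c ∈ LieAlgebroidCohomology.cocycles
            (LieAlgebroidCohomology.intrinsic E F V k) A.d p),
          ∃ hc' : LieAlgebroidCohomology.comparison nabla p c ∈
              LieAlgebroidCohomology.cocycles
                (LieAlgebroidCohomology.forms E F V k) (A.structureOp nabla) p,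
            e (LieAlgebroidCohomology.cohomologyClass _ _ p c hc) =
              LieAlgebroidCohomology.cohomologyClass _ _ p
                (LieAlgebroidCohomology.comparison nabla p c) hc') ∧
    -- degree one: `C^1` is the space of almost `k`-differentials
    Set.BijOn LieAlgebroidCohomology.toPair
      (LieAlgebroidCohomology.intrinsic E F V k 1 : Set (LieAlgebroidCohomology.Cochain E F V))
      {δ | LieAlgebroidCohomology.IsAlmostKDifferential k δ} ∧
    -- the `1`-cocycles are the `k`-differentials
    (Module.finrank ℝ F ≠ k - 1 →
      Set.BijOn LieAlgebroidCohomology.toPair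
        (LieAlgebroidCohomology.cocycles (LieAlgebroidCohomology.intrinsic E F V k) A.d 1)
        {δ | A.IsKDifferential k δ}) ∧
    Set.BijOn LieAlgebroidCohomology.toPair
      (LieAlgebroidCohomology.cocycles (LieAlgebroidCohomology.intrinsic E F V k) A.d 1)
      {δ | A.IsKDifferential k δ ∧ A.FunctionBracketIdentity δ} := by
  refine ⟨fun p c hc => ⟨A.d_mem_intrinsic hc, A.d_d hc, A.d_apply_succ hc⟩,
    fun nabla _ p => ⟨fun η hη => ⟨LieAlgebroidCohomology.structureOp_mem_forms nabla A hη,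
      LieAlgebroidCohomology.structureOp_structureOp nabla A hη⟩,
      LieAlgebroidCohomology.comparison_bijOn nabla k p,
      fun c hc => LieAlgebroidCohomology.comparison_d nabla A hc⟩,
    fun nabla nabla' _ _ p => ⟨LieAlgebroidCohomology.transition_bijOn nabla nabla' k p,
      fun η hη => LieAlgebroidCohomology.transition_structureOp nabla nabla' A hη,
      fun c hc => LieAlgebroidCohomology.transition_comparison nabla nabla' hc⟩,
    fun nabla _ p => LieAlgebroidCohomology.exists_cohomology_equiv
      (fun p c hc => A.d_mem_intrinsic hc)
      (fun p => LieAlgebroidCohomology.comparison_bijOn nabla k p)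
      (fun p c hc => LieAlgebroidCohomology.comparison_d nabla A hc) p,
    LieAlgebroidCohomology.toPair_bijOn hk,
    fun hr => A.toPair_bijOn_cocycles_of_finrank_ne hk hr, A.toPair_bijOn_cocycles hk⟩
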